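/- Let $\mathcal H\cong L^2(\mathbb R)$ be the Hilbert space of one bosonic mode, with Fock basis $(|l\rangle)_{l\ge 0}$, ladder operators $\mathbf a|l\rangle=\sqrt l\,|l-1\rangle$, $\mathbf a^\dagger|l\rangle=\sqrt{l+1}\,|l+1\rangle$, quadratures $\mathbf R=(\mathbf x,\mathbf p)^\top$ where $\mathbf a=(\mathbf x+i\mathbf p)/\sqrt2$, and displacement operators $D_z=\exp(z\mathbf a^\dagger-\bar z\mathbf a)$, $z\in\mathbb C$. Let $\mathcal T(\mathcal H)$ be the space of trace-class operators with the trace norm $\|T\|_1=\mathrm{Tr}\sqrt{T^\dagger T}$. A state is a positive semi-definite $\rho\in\mathcal T(\mathcal H)$ with $\mathrm{Tr}\,\rho=1$; its first-order moments are $\mathrm d(\rho)=\mathrm{Tr}[\rho\mathbf R]$, its covariance matrix is $\gamma(\rho)=\mathrm{Tr}[\rho\{\mathbf R-\mathrm d(\rho),\mathbf R^\top-\mathrm d(\rho)^\top\}]$ (entrywise anticommutator), and it is Gaussian if $z\mapsto \mathrm{Tr}[\rho D_z]$ is the exponential of a polynomial of degree at most two in $z,\bar z$. An operator $T\in\mathcal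 T(\mathcal H)$ has a finite moment of order $\kappa$ if $\mathrm{Tr}[T(\mathbf a^\dagger\mathbf a)^{\kappa/2}]$, computed in the Fock basis, converges absolutely. A channel is a completely positive trace-preserving linear map $\mathcal T(\mathcal H)\to\mathcal T(\mathcal H)$; it is Gaussian if it maps Gaussian states to Gaussian states, and a channel $\mathcal N$ is centered if $\mathrm d(\mathcal N(|0\rangle\langle 0|))=0$. For $n\ge1$ let $U_n$ be a unitary on $\mathcal H^{\otimes n}$ with $U_n(D_{z_1}\otimes\cdots\otimes D_{z_n})U_n^\dagger=D_{w_1}\otimes\cdots\otimes D_{w_n}$ for all $z\in\mathbb C^n$, where $w=V_nz$ and $(V_n)_{jk}=e^{2\pi i(j-1)(k-1)/n}/\sqrt n$, and define the $n$-fold symmetric convolution $$\mathcal N^{\boxplus n}(T)=\mathrm{Tr}_{\neg1}\Big[U_n\,\mathcal N^{\otimes n}\big(U_n^\dagger(T\otimes|0\rangle\langle0|^{\otimes(n-1)})U_n\big)U_n^\dagger\Big],$$ where $\mathrm{Tr}_{\neg1}$ is the partial trace over all modes except the first. **Theorem.** Let $\mathcal N$ be a centered single-mode bosonic channel such that the state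 $\mathcal N(|0\rangle\langle0|)$ has a finite second-order moment and $\mathcal N(|1\rangle\langle0|)$ has a finite first-order moment. Then $\mathcal N^{\boxplus n}$ exists for every $n\ge1$, and there is a Gaussian channel $\mathcal N_G$ such that, for every state $\rho$, $$\lim_{n\to\infty}\big\|\mathcal N^{\boxplus n}(\rho)-\mathcal N_G(\rho)\big\|_1=0.$$ Moreover, for every state $\rho$ with finite second-order moment, $\mathcal N_G(\rho)$ has a finite second-order moment and $$\mathrm d(\mathcal N_G(\rho))=X\,\mathrm d(\rho),\qquad \gamma(\mathcal N_G(\rho))=X\gamma(\rho)X^\top+Y,$$ with the real $2\times2$ matrices $$X=\frac1{\sqrt2}\,\mathrm{Tr}\left[\mathbf R\begin{pmatrix}\mathcal N(|0\rangle\langle1|+|1\rangle\langle0|)\\ \mathcal N(-i|0\rangle\langle1|+i|1\rangle\langle0|)\end{pmatrix}^{\!\top}\right],\qquad Y=V-XX^\top,$$ where $V$ is the covariance matrix of $\mathcal N(|0\rangle\langle0|)$. -/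

import Mathlib

open scoped ComplexOrder ENNReal InnerProductSpace
open ContinuousLinearMap
namespace Bosonic

section Polar
variable {H : Type*} [NormedAddCommGroup H] [InnerProductSpace ℂ H] [CompleteSpace H]

theorem norm_abs_apply (S : H →L[ℂ] H) (x : H) : ‖CFC.abs S x‖ = ‖S x‖ := by
  have h : CFC.abs S * CFC.abs S = star S * S := CFC.abs_mul_abs S
  have hs : star (CFC.abs S) = CFC.abs S := (CFC.abs_nonneg S).star_eq
  have h1 : ⟪CFC.abs S x, CFC.abs S x⟫_ℂ = ⟪S x, S x⟫_ℂ := by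
    rw [← adjoint_inner_right (CFC.abs S), ← star_eq_adjoint, hs, ← mul_apply_eq_comp, h,
      mul_apply_eq_comp, star_eq_adjoint, adjoint_inner_right]
  rw [inner_self_eq_norm_sq_to_K, inner_self_eq_norm_sq_to_K] at h1
  have h2 : ‖CFC.abs S x‖ ^ 2 = ‖S x‖ ^ 2 := by exact_mod_cast h1
  exact (sq_eq_sq₀ (norm_nonneg _) (norm_nonneg _)).1 h2

theorem exists_polar (S : H →L[ℂ] H) :
    ∃ W : H →L[ℂ] H, (∀ x, ‖W x‖ ≤ ‖x‖) ∧ W * CFC.abs S = S ∧ adjoint W * S = CFC.abs S := by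
  set P := CFC.abs S with hP
  have hPs : adjoint P = P := by rw [← star_eq_adjoint]; exact (CFC.abs_nonneg S).star_eq
  let K : Submodule ℂ H := (LinearMap.range P.toLinearMap).topologicalClosure
  have hPK : ∀ x, P x ∈ K := fun x => Submodule.le_topologicalClosure _ ⟨x, rfl⟩
  let e : H →ₗ[ℂ] K := P.toLinearMap.codRestrict K hPK
  have hd : DenseRange e := by
    intro y
    have hy : (y : H) ∈ closure (Set.range P) := y.2
    rw [Metric.mem_closure_iff] at hy ⊢
    intro ε hε
    obtain ⟨_, ⟨x, rfl⟩, hx⟩ := hy ε hε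
    exact ⟨e x, ⟨x, rfl⟩, hx⟩
  have hb : ∀ x, ‖S.toLinearMap x‖ ≤ 1 * ‖e x‖ := fun x => by
    rw [one_mul]; exact (norm_abs_apply S x).symm.le
  have : CompleteSpace K := (Submodule.isClosed_topologicalClosure _).completeSpace_coe
  let W₀ : K →L[ℂ] H := S.toLinearMap.extendOfNorm e
  have hW₀ : ∀ x, W₀ (e x) = S x := fun x => LinearMap.extendOfNorm_eq hd ⟨1, hb⟩ x
  have hW₀n : ∀ x, ‖W₀ x‖ ≤ ‖x‖ := fun x => by
    simpa using LinearMap.norm_extendOfNorm_apply_le (f := S.toLinearMap) hd 1 hb x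
  let W : H →L[ℂ] H := W₀.comp K.orthogonalProjectionOnto
  have hWP : ∀ x, W (P x) = S x := fun x => by
    have : K.orthogonalProjectionOnto (P x) = e x :=
      Submodule.orthogonalProjectionOnto_mem_subspace_eq_self (⟨P x, hPK x⟩ : K)
    simp only [W, comp_apply, this, hW₀]
  refine ⟨W, fun x => (hW₀n _).trans (K.norm_orthogonalProjectionOnto_apply_le x), ?_, ?_⟩
  · ext x; exact hWP x
  · ext x
    refine ext_inner_right ℂ fun y => ?_
    rw [mul_apply_eq_comp, adjoint_inner_left]
    have key : ∀ k : K, ⟪S x, W₀ k⟫_ℂ = ⟪P x, (k : H)⟫_ℂ := by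
      intro k
      refine hd.induction_on (p := fun k => ⟪S x, W₀ k⟫_ℂ = ⟪P x, (k : H)⟫_ℂ) k ?_ ?_
      · exact isClosed_eq (by fun_prop) (by fun_prop)
      · intro z
        rw [hW₀]
        change _ = ⟪P x, P z⟫_ℂ
        rw [← adjoint_inner_left, ← adjoint_inner_left, hPs]
        congr 1
        exact congrArg (fun T : H →L[ℂ] H => T x) (CFC.abs_mul_abs S).symm
    change ⟪S x, W₀ (K.orthogonalProjectionOnto y)⟫_ℂ = _
    rw [key]
    rw [← Submodule.inner_orthogonalProjectionOnto_eq_of_mem_left ⟨P x, hPK x⟩ y]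
    rfl

end Polar

/-- The Hilbert space `ℓ²(ι)`. -/
def L2 (ι : Type) : Type := lp (fun _ : ι => ℂ) 2

noncomputable section

instance (ι : Type) : NormedAddCommGroup (L2 ι) :=
  inferInstanceAs (NormedAddCommGroup (lp (fun _ : ι => ℂ) 2))

instance (ι : Type) : InnerProductSpace ℂ (L2 ι) :=
  inferInstanceAs (InnerProductSpace ℂ (lp (fun _ : ι => ℂ) 2))

instance (ι : Type) : CompleteSpace (L2 ι) :=
  inferInstanceAs (CompleteSpace (lp (fun _ : ι => ℂ) 2))

variable {ι κ : Type}

open Classical in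
/-- The vectors of the standard orthonormal basis of `ℓ²(ι)`. -/
def ket (i : ι) : L2 ι := (lp.single 2 i (1 : ℂ) : lp (fun _ : ι => ℂ) 2)

theorem inner_ket (i : ι) (x : lp (fun _ : ι => ℂ) 2) : ⟪(ket i : L2 ι), (x : L2 ι)⟫_ℂ = x i := by
  classical
  have := lp.inner_single_left (𝕜 := ℂ) i (1 : ℂ) x
  simp only [RCLike.inner_apply, map_one, mul_one] at this
  rw [← this]
  simp only [ket]
  congr!

theorem enorm_sq_eq (x : L2 ι) : ‖x‖ₑ ^ 2 = ∑' i, ‖⟪ket i, x⟫_ℂ‖ₑ ^ 2 := by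
  have h : HasSum (fun i => ‖⟪ket i, x⟫_ℂ‖ ^ 2) (‖x‖ ^ 2) := by
    have := lp.hasSum_norm (p := 2) (by norm_num) (x : lp (fun _ : ι => ℂ) 2)
    have h2 : (2 : ℝ≥0∞).toReal = ((2 : ℕ) : ℝ) := by norm_num
    simp only [h2, Real.rpow_natCast] at this
    have e : ∀ i, ‖⟪ket i, x⟫_ℂ‖ = ‖(show lp (fun _ : ι => ℂ) 2 from x) i‖ :=
      fun i => congrArg _ (inner_ket i x)
    simp only [e]
    exact this
  have h0 : ∀ (E : Type) [NormedAddCommGroup E] (y : E), ‖y‖ₑ ^ 2 = ENNReal.ofReal (‖y‖ ^ 2) := by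
    intro E _ y
    rw [ENNReal.ofReal_pow (norm_nonneg _), ofReal_norm]
  simp only [h0]
  rw [← h.tsum_eq, ENNReal.ofReal_tsum_of_nonneg (fun _ => sq_nonneg _) h.summable]

/-- The trace norm `‖T‖₁ = Tr √(T† T)`. -/
def traceNorm (T : L2 ι →L[ℂ] L2 ι) : ℝ≥0∞ :=
  ∑' i, ENNReal.ofReal (⟪ket i, CFC.abs T (ket i)⟫_ℂ).re

/-- A Bessel family with bound one. -/
def IsBessel (u : κ → L2 ι) : Prop := ∀ x, ∑' k, ‖⟪u k, x⟫_ℂ‖ₑ ^ 2 ≤ ‖x‖ₑ ^ 2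

theorem isBessel_ket : IsBessel (ket : ι → L2 ι) := fun x => (enorm_sq_eq x).symm.le

theorem IsBessel.map {μ : Type} {u : κ → L2 ι} (hu : IsBessel u) (A : L2 ι →L[ℂ] L2 μ)
    (hA : ∀ x, ‖adjoint A x‖ ≤ ‖x‖) : IsBessel fun k => A (u k) := by
  intro x
  simp only [← adjoint_inner_right]
  refine (hu _).trans ?_
  gcongr
  exact enorm_le_iff_norm_le.2 (hA x)

theorem exists_factor (S : L2 ι →L[ℂ] L2 ι) : ∃ W Q : L2 ι →L[ℂ] L2 ι,
    (∀ x, ‖W x‖ ≤ ‖x‖) ∧ adjoint Q = Q ∧ W * (Q * Q) = S ∧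
      ∑' i, ‖Q (ket i)‖ₑ ^ 2 = traceNorm S := by
  obtain ⟨W, hW, h1, -⟩ := exists_polar S
  have h0 := CFC.abs_nonneg S
  have hQ : CFC.sqrt (CFC.abs S) * CFC.sqrt (CFC.abs S) = CFC.abs S :=
    CFC.sqrt_mul_sqrt_self _ h0
  have hQs : adjoint (CFC.sqrt (CFC.abs S)) = CFC.sqrt (CFC.abs S) := by
    rw [← star_eq_adjoint]; exact (CFC.sqrt_nonneg (CFC.abs S)).star_eq
  refine ⟨W, CFC.sqrt (CFC.abs S), hW, hQs, by rw [hQ, h1], ?_⟩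
  rw [traceNorm]
  refine tsum_congr fun i => ?_
  have h2 : ∀ Q : L2 ι →L[ℂ] L2 ι, adjoint Q = Q → ∀ x y, ⟪x, Q y⟫_ℂ = ⟪Q x, y⟫_ℂ := by
    intro Q hQ x y
    rw [← adjoint_inner_left, hQ]
  have h3 : CFC.abs S (ket i) = CFC.sqrt (CFC.abs S) (CFC.sqrt (CFC.abs S) (ket i)) :=
    congrArg (fun T : L2 ι →L[ℂ] L2 ι => T (ket i)) hQ.symm
  rw [h3, h2 _ hQs, inner_self_eq_norm_sq_to_K, ← ofReal_norm,
    ← ENNReal.ofReal_pow (norm_nonneg _)]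
  norm_cast

theorem norm_adjoint_apply_le {E F : Type} [NormedAddCommGroup E] [InnerProductSpace ℂ E]
    [CompleteSpace E] [NormedAddCommGroup F] [InnerProductSpace ℂ F] [CompleteSpace F]
    (W : E →L[ℂ] F) (hW : ∀ x, ‖W x‖ ≤ ‖x‖) (x : F) : ‖adjoint W x‖ ≤ ‖x‖ := by
  have h : ‖W‖ ≤ 1 := W.opNorm_le_bound zero_le_one (by simpa using hW)
  have := (adjoint W).le_of_opNorm_le (c := 1) (by simpa using h) x
  simpa using this

theorem tsum_inner_le (S : L2 ι →L[ℂ] L2 ι) {u v : κ → L2 ι} (hu : IsBessel u)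
    (hv : IsBessel v) : ∑' k, ‖⟪u k, S (v k)⟫_ℂ‖ₑ ≤ traceNorm S := by
  obtain ⟨W, Q, hW, hQ, rfl, hS⟩ := exists_factor S
  set c := traceNorm (W * (Q * Q))
  have key : ∀ w : κ → L2 ι, IsBessel w → ∑' k, ‖Q (w k)‖ₑ ^ 2 ≤ c := by
    intro w hw
    calc ∑' k, ‖Q (w k)‖ₑ ^ 2 = ∑' k, ∑' i, ‖⟪w k, Q (ket i)⟫_ℂ‖ₑ ^ 2 := by
          refine tsum_congr fun k => ?_
          rw [enorm_sq_eq]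
          refine tsum_congr fun i => ?_
          rw [← adjoint_inner_left, hQ]
          simp only [← ofReal_norm, norm_inner_symm]
      _ = ∑' i, ∑' k, ‖⟪w k, Q (ket i)⟫_ℂ‖ₑ ^ 2 := ENNReal.tsum_comm
      _ ≤ ∑' i, ‖Q (ket i)‖ₑ ^ 2 := ENNReal.tsum_le_tsum fun i => hw _
      _ = c := hS
  have hu' := key _ (hu.map (adjoint W) (by simpa using hW))
  have hv' := key v hv
  have h2 : ∀ a b : ℝ≥0∞, a * b ≤ (a ^ 2 + b ^ 2) / 2 := by
    intro a b
    rcases eq_or_ne a ⊤ with rfl | ha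
    · simp [ENNReal.top_div]
    rcases eq_or_ne b ⊤ with rfl | hb
    · simp [ENNReal.top_div]
    lift a to NNReal using ha
    lift b to NNReal using hb
    rw [ENNReal.le_div_iff_mul_le (by simp) (by simp)]
    norm_cast
    rw [← NNReal.coe_le_coe]
    push_cast
    nlinarith [sq_nonneg ((a : ℝ) - b)]
  calc ∑' k, ‖⟪u k, (W * (Q * Q)) (v k)⟫_ℂ‖ₑ
      ≤ ∑' k, (‖Q (adjoint W (u k))‖ₑ ^ 2 + ‖Q (v k)‖ₑ ^ 2) / 2 := by
        refine ENNReal.tsum_le_tsum fun k => ?_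
        refine le_trans ?_ (h2 _ _)
        rw [mul_apply_eq_comp, mul_apply_eq_comp, ← adjoint_inner_left, ← adjoint_inner_left, hQ]
        rw [← enorm_norm (Q _), ← enorm_norm (Q (v k)), ← enorm_mul]
        refine enorm_le_iff_norm_le.2 ?_
        simpa using norm_inner_le_norm (𝕜 := ℂ) (Q (adjoint W (u k))) (Q (v k))
    _ = (∑' k, ‖Q (adjoint W (u k))‖ₑ ^ 2 + ∑' k, ‖Q (v k)‖ₑ ^ 2) / 2 := by
        simp only [div_eq_mul_inv]
        rw [ENNReal.tsum_mul_right, ENNReal.tsum_add]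
    _ ≤ (c + c) / 2 := by gcongr
    _ = c := by
        rw [← two_mul, mul_comm]
        exact ENNReal.mul_div_cancel_right (by simp) (by simp)

/-- Bounding the trace norm from above. -/
theorem exists_traceNorm_le (S : L2 ι →L[ℂ] L2 ι) : ∃ W : L2 ι →L[ℂ] L2 ι, (∀ x, ‖W x‖ ≤ ‖x‖) ∧
    traceNorm S ≤ ∑' i, ‖⟪W (ket i), S (ket i)⟫_ℂ‖ₑ := by
  obtain ⟨W, hW, -, h⟩ := exists_polar S
  refine ⟨W, hW, ENNReal.tsum_le_tsum fun i => ?_⟩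
  rw [← h, mul_apply_eq_comp, adjoint_inner_right, ← ofReal_norm]
  exact ENNReal.ofReal_le_ofReal (Complex.re_le_norm _)

theorem isBessel_polar {W : L2 ι →L[ℂ] L2 ι} (hW : ∀ x, ‖W x‖ ≤ ‖x‖) :
    IsBessel fun i => W (ket i) := isBessel_ket.map W (norm_adjoint_apply_le W hW)

theorem traceNorm_add_le (S T : L2 ι →L[ℂ] L2 ι) :
    traceNorm (S + T) ≤ traceNorm S + traceNorm T := by
  obtain ⟨W, hW, h⟩ := exists_traceNorm_le (S + T)
  refine h.trans ?_
  calc _ ≤ ∑' i, (‖⟪W (ket i), S (ket i)⟫_ℂ‖ₑ + ‖⟪W (ket i), T (ket i)⟫_ℂ‖ₑ) := by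
        refine ENNReal.tsum_le_tsum fun i => ?_
        rw [add_apply, inner_add_right]
        exact enorm_add_le _ _
    _ ≤ _ := by
        rw [ENNReal.tsum_add]
        exact add_le_add (tsum_inner_le S (isBessel_polar hW) isBessel_ket)
          (tsum_inner_le T (isBessel_polar hW) isBessel_ket)

theorem traceNorm_smul (c : ℂ) (T : L2 ι →L[ℂ] L2 ι) :
    traceNorm (c • T) = ‖c‖ₑ * traceNorm T := by
  rw [traceNorm, traceNorm, ← ENNReal.tsum_mul_left]
  refine tsum_congr fun i => ?_
  rw [CFC.abs_smul, ← ofReal_norm c, ← ENNReal.ofReal_mul (norm_nonneg _)]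
  rw [smul_apply, RCLike.real_smul_eq_coe_smul (K := ℂ), inner_smul_right]
  simp

/-- The space `𝒯(ℓ²(ι))` of trace-class operators. -/
def TraceClass (ι : Type) : Submodule ℂ (L2 ι →L[ℂ] L2 ι) where
  carrier := {T | traceNorm T < ⊤}
  add_mem' hS hT := (traceNorm_add_le _ _).trans_lt (ENNReal.add_lt_top.2 ⟨hS, hT⟩)
  zero_mem' := by
    have := traceNorm_smul 0 (0 : L2 ι →L[ℂ] L2 ι)
    simp at this
    simp [this]
  smul_mem' c T hT := by
    change traceNorm (c • T) < ⊤
    rw [traceNorm_smul]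
    exact ENNReal.mul_lt_top enorm_lt_top hT

theorem traceNorm_sandwich_lt_top (A : L2 ι →L[ℂ] L2 κ) (B : L2 κ →L[ℂ] L2 ι)
    (T : L2 ι →L[ℂ] L2 ι) (hT : traceNorm T < ⊤) :
    traceNorm (A.comp (T.comp B)) < ⊤ := by
  obtain ⟨a, ha, hA⟩ : ∃ a : ℝ, 0 < a ∧ ∀ x, ‖adjoint A x‖ ≤ a * ‖x‖ :=
    ⟨‖adjoint A‖ + 1, by positivity, fun x => (adjoint A).le_of_opNorm_le (by linarith) x⟩
  obtain ⟨b, hb, hB⟩ : ∃ b : ℝ, 0 < b ∧ ∀ x, ‖adjoint B x‖ ≤ b * ‖x‖ :=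
    ⟨‖adjoint B‖ + 1, by positivity, fun x => (adjoint B).le_of_opNorm_le (by linarith) x⟩
  have hc : A.comp (T.comp B) =
      ((a * b : ℝ) : ℂ) • ((((a⁻¹ : ℝ) : ℂ) • A).comp (T.comp (((b⁻¹ : ℝ) : ℂ) • B))) := by
    ext1 x
    simp only [comp_apply, smul_apply, map_smul, smul_smul]
    have : (((a * b : ℝ) : ℂ) * (((b⁻¹ : ℝ) : ℂ) * ((a⁻¹ : ℝ) : ℂ))) = 1 := by
      norm_cast; field_simp
    rw [this, one_smul]
  rw [hc, traceNorm_smul]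
  refine ENNReal.mul_lt_top enorm_lt_top ?_
  obtain ⟨W, hW, h⟩ := exists_traceNorm_le ((((a⁻¹ : ℝ) : ℂ) • A).comp (T.comp (((b⁻¹ : ℝ) : ℂ) • B)))
  refine (h.trans ?_).trans_lt hT
  refine le_trans (le_of_eq ?_) (tsum_inner_le T (κ := κ)
    (u := fun i => adjoint (((a⁻¹ : ℝ) : ℂ) • A) (W (ket i)))
    (v := fun i => (((b⁻¹ : ℝ) : ℂ) • B) (ket i))
    ((isBessel_polar hW).map _ ?_) (isBessel_ket.map _ ?_))
  · refine tsum_congr fun i => ?_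
    rw [adjoint_inner_left]; rfl
  · rw [adjoint_adjoint]
    refine fun x => ?_
    have := norm_adjoint_apply_le (adjoint (((a⁻¹ : ℝ) : ℂ) • A)) (fun y => ?_) x
    · simpa using this
    · rw [map_smulₛₗ, smul_apply, norm_smul]
      have h1 := hA y
      simp only [RCLike.norm_conj, Complex.norm_real, norm_inv, Real.norm_eq_abs, abs_of_pos ha]
      rw [inv_mul_le_iff₀ ha]; exact h1
  · intro y
    rw [map_smulₛₗ, smul_apply, norm_smul]
    have h1 := hB y
    simp only [RCLike.norm_conj, Complex.norm_real, norm_inv, Real.norm_eq_abs, abs_of_pos hb]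
    rw [inv_mul_le_iff₀ hb]; exact h1

/-- The map `T ↦ A T B` on trace-class operators. -/
def sandwich (A : L2 ι →L[ℂ] L2 κ) (B : L2 κ →L[ℂ] L2 ι) : TraceClass ι →ₗ[ℂ] TraceClass κ where
  toFun T := ⟨A.comp (T.1.comp B), traceNorm_sandwich_lt_top A B T.1 T.2⟩
  map_add' S T := by ext; simp
  map_smul' c T := by ext; simp

theorem orthonormal_ket : Orthonormal ℂ (ket : ι → L2 ι) := by
  classical
  rw [orthonormal_iff_ite]
  intro i j
  have := inner_ket i (lp.single 2 j (1 : ℂ) : lp (fun _ : ι => ℂ) 2)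
  have h : (ket j : L2 ι) = (lp.single 2 j (1 : ℂ) : lp (fun _ : ι => ℂ) 2) := by
    simp only [ket]; congr!
  rw [h]
  refine this.trans ?_
  rw [lp.single_apply]
  simp [Pi.single_apply]

/-- The isometry `|i⟩ ↦ v i` defined by an orthonormal family `v`. -/
def isometryOf {E : Type} [NormedAddCommGroup E] [InnerProductSpace ℂ E] [CompleteSpace E]
    {v : ι → E} (hv : Orthonormal ℂ v) : L2 ι →L[ℂ] E :=
  (hv.orthogonalFamily.linearIsometry : lp (fun _ : ι => ℂ) 2 →ₗᵢ[ℂ] E).toContinuousLinearMap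

theorem isometryOf_ket {E : Type} [NormedAddCommGroup E] [InnerProductSpace ℂ E] [CompleteSpace E]
    {v : ι → E} (hv : Orthonormal ℂ v) (i : ι) : isometryOf hv (ket i) = v i := by
  classical
  have h : (ket i : L2 ι) = (lp.single 2 i (1 : ℂ) : lp (fun _ : ι => ℂ) 2) := by
    simp only [ket]; congr!
  rw [h]
  refine (hv.orthogonalFamily.linearIsometry_apply_single (1 : ℂ)).trans ?_
  simp

theorem norm_isometryOf {E : Type} [NormedAddCommGroup E] [InnerProductSpace ℂ E]
    [CompleteSpace E] {v : ι → E} (hv : Orthonormal ℂ v) (x : L2 ι) : ‖isometryOf hv x‖ = ‖x‖ :=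
  (hv.orthogonalFamily.linearIsometry : lp (fun _ : ι => ℂ) 2 →ₗᵢ[ℂ] E).norm_map x

/-- The isometry `|i⟩ ↦ |f i⟩` for an injective `f`. -/
def embed {f : ι → κ} (hf : Function.Injective f) : L2 ι →L[ℂ] L2 κ :=
  isometryOf (orthonormal_ket.comp f hf)

theorem embed_ket {f : ι → κ} (hf : Function.Injective f) (i : ι) :
    embed hf (ket i) = ket (f i) := isometryOf_ket _ i

/-- The trace `∑ᵢ ⟨i|T|i⟩`. -/
def trace (T : L2 ι →L[ℂ] L2 ι) : ℂ := ∑' i, ⟪ket i, T (ket i)⟫_ℂ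

theorem enorm_opNorm_le (T : L2 ι →L[ℂ] L2 ι) : ‖T‖ₑ ≤ traceNorm T := by
  rcases eq_or_ne (traceNorm T) ⊤ with h | h
  · simp [h]
  rw [← ofReal_norm, ENNReal.ofReal_le_iff_le_toReal h]
  refine T.opNorm_le_bound ENNReal.toReal_nonneg fun x => ?_
  rcases eq_or_ne (T x) 0 with hy | hy
  · rw [hy, norm_zero]; positivity
  have hx : x ≠ 0 := by rintro rfl; simp at hy
  have hb : ∀ y : L2 ι, y ≠ 0 → IsBessel fun _ : Unit => ((‖y‖⁻¹ : ℝ) : ℂ) • y := by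
    intro y hy z
    rw [tsum_fintype]
    simp only [Finset.univ_unique, Finset.sum_const, Finset.card_singleton, one_smul]
    gcongr
    refine enorm_le_iff_norm_le.2 ((norm_inner_le_norm _ _).trans ?_)
    rw [norm_smul, Complex.norm_real, norm_inv, norm_norm,
      inv_mul_cancel₀ (norm_ne_zero_iff.2 hy), one_mul]
  have := tsum_inner_le T (hb _ hy) (hb _ hx)
  rw [tsum_fintype] at this
  simp only [Finset.univ_unique, Finset.sum_const, Finset.card_singleton, one_smul] at this
  rw [map_smul, inner_smul_left, inner_smul_right, inner_self_eq_norm_sq_to_K, ← ofReal_norm,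
    ENNReal.ofReal_le_iff_le_toReal h] at this
  have hx' : 0 < ‖x‖ := norm_pos_iff.2 hx
  have hy' : 0 < ‖T x‖ := norm_pos_iff.2 hy
  simp only [norm_mul, RCLike.norm_conj, Complex.norm_real, norm_inv, norm_norm, norm_pow,
    RCLike.norm_ofReal, abs_of_pos hy'] at this
  calc ‖T x‖ = (‖T x‖⁻¹ * (‖x‖⁻¹ * ‖T x‖ ^ 2)) * ‖x‖ := by field_simp
    _ ≤ _ := by gcongr

theorem traceNorm_tsum_le {ρ : Type} (A : ρ → L2 ι →L[ℂ] L2 ι) (hA : Summable A) :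
    traceNorm (∑' r, A r) ≤ ∑' r, traceNorm (A r) := by
  obtain ⟨W, hW, h⟩ := exists_traceNorm_le (∑' r, A r)
  refine h.trans ?_
  calc _ ≤ ∑' i, ∑' r, ‖⟪W (ket i), A r (ket i)⟫_ℂ‖ₑ := by
        refine ENNReal.tsum_le_tsum fun i => ?_
        have h1 : HasSum (fun r => ⟪W (ket i), A r (ket i)⟫_ℂ)
            ⟪W (ket i), (∑' r, A r) (ket i)⟫_ℂ :=
          (hA.hasSum.mapL (ContinuousLinearMap.apply ℂ (L2 ι) (ket i))).mapL
            (innerSL ℂ (W (ket i)))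
        rw [← h1.tsum_eq]
        exact enorm_tsum_le_tsum_enorm
    _ = ∑' r, ∑' i, ‖⟪W (ket i), A r (ket i)⟫_ℂ‖ₑ := ENNReal.tsum_comm
    _ ≤ _ := ENNReal.tsum_le_tsum fun r => tsum_inner_le _ (isBessel_polar hW) isBessel_ket

section PartialTrace

variable {ρ : Type} {g : ρ → ι → κ}

theorem tsum_norm_adjoint_le (hg : Function.Injective (Function.uncurry g))
    (J : ρ → L2 ι →L[ℂ] L2 κ) (hJ : ∀ r i, J r (ket i) = ket (g r i)) (x : L2 κ) :
    ∑' r, ‖adjoint (J r) x‖ₑ ^ 2 ≤ ‖x‖ₑ ^ 2 := by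
  calc ∑' r, ‖adjoint (J r) x‖ₑ ^ 2 = ∑' r, ∑' i, ‖⟪ket (g r i), x⟫_ℂ‖ₑ ^ 2 := by
        refine tsum_congr fun r => ?_
        rw [enorm_sq_eq]
        refine tsum_congr fun i => ?_
        rw [adjoint_inner_right, hJ]
    _ = ∑' p : ρ × ι, ‖⟪ket (Function.uncurry g p), x⟫_ℂ‖ₑ ^ 2 := ENNReal.tsum_prod.symm
    _ ≤ ∑' k, ‖⟪ket k, x⟫_ℂ‖ₑ ^ 2 :=
        ENNReal.tsum_comp_le_tsum_of_injective hg fun k => ‖⟪ket k, x⟫_ℂ‖ₑ ^ 2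
    _ = _ := (enorm_sq_eq x).symm

theorem tsum_traceNorm_le (hg : Function.Injective (Function.uncurry g))
    (J : ρ → L2 ι →L[ℂ] L2 κ) (hJ : ∀ r i, J r (ket i) = ket (g r i))
    (S : L2 κ →L[ℂ] L2 κ) :
    ∑' r, traceNorm ((adjoint (J r)).comp (S.comp (J r))) ≤ traceNorm S := by
  choose W hW h using fun r => exists_traceNorm_le ((adjoint (J r)).comp (S.comp (J r)))
  refine (ENNReal.tsum_le_tsum h).trans ?_
  rw [← ENNReal.tsum_prod (f := fun r i =>
    ‖⟪W r (ket i), ((adjoint (J r)).comp (S.comp (J r))) (ket i)⟫_ℂ‖ₑ)]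
  have key : ∀ W : ρ → L2 ι →L[ℂ] L2 ι, (∀ r x, ‖W r x‖ ≤ ‖x‖) →
      IsBessel fun p : ρ × ι => J p.1 (W p.1 (ket p.2)) := by
    intro W hW x
    rw [ENNReal.tsum_prod (f := fun r i => ‖⟪J r (W r (ket i)), x⟫_ℂ‖ₑ ^ 2)]
    refine le_trans (ENNReal.tsum_le_tsum fun r => ?_) (tsum_norm_adjoint_le hg J hJ x)
    simp only [← adjoint_inner_right (J r)]
    exact isBessel_polar (hW r) _
  refine le_trans (le_of_eq ?_) (tsum_inner_le S (key W hW)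
    (key (fun _ => ContinuousLinearMap.id ℂ _) fun _ _ => le_rfl))
  refine tsum_congr fun p => ?_
  rw [comp_apply, adjoint_inner_right]
  rfl

theorem summable_partialTrace (hg : Function.Injective (Function.uncurry g))
    (J : ρ → L2 ι →L[ℂ] L2 κ) (hJ : ∀ r i, J r (ket i) = ket (g r i)) (S : TraceClass κ) :
    Summable fun r => (adjoint (J r)).comp (S.1.comp (J r)) := by
  have h : ∑' r, ‖(adjoint (J r)).comp (S.1.comp (J r))‖ₑ < ⊤ :=
    (ENNReal.tsum_le_tsum fun r => enorm_opNorm_le _).trans_lt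
      ((tsum_traceNorm_le hg J hJ S.1).trans_lt S.2)
  refine Summable.of_norm ?_
  have := ENNReal.summable_toReal h.ne
  simpa using this

end PartialTrace

theorem cons_injective (n : ℕ) : Function.Injective
    (Function.uncurry fun (r : Fin n → ℕ) (m : ℕ) => (Fin.cons m r : Fin (n + 1) → ℕ)) := by
  rintro ⟨r, m⟩ ⟨r', m'⟩ h
  have h' : (Fin.cons m r : Fin (n + 1) → ℕ) = Fin.cons m' r' := h
  rw [Fin.cons_inj] at h'
  simp [h'.1, h'.2]

/-- The isometry `|m⟩ ↦ |m⟩ ⊗ |r⟩` from one mode to `n + 1` modes. -/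
def attach {n : ℕ} (r : Fin n → ℕ) : L2 ℕ →L[ℂ] L2 (Fin (n + 1) → ℕ) :=
  embed (f := fun m : ℕ => (Fin.cons m r : Fin (n + 1) → ℕ))
    fun m m' h => (Prod.mk.inj (cons_injective n (a₁ := (r, m)) (a₂ := (r, m')) h)).2

theorem attach_ket {n : ℕ} (r : Fin n → ℕ) (m : ℕ) :
    attach r (ket m) = ket (Fin.cons m r : Fin (n + 1) → ℕ) := embed_ket _ m

/-- The partial trace over all modes except the first one. -/
def partialTrace {n : ℕ} (S : TraceClass (Fin (n + 1) → ℕ)) : TraceClass ℕ :=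
  ⟨∑' r : Fin n → ℕ, (adjoint (attach r)).comp (S.1.comp (attach r)),
    (traceNorm_tsum_le _ (summable_partialTrace (cons_injective n) attach attach_ket S)).trans_lt
      ((tsum_traceNorm_le (cons_injective n) attach attach_ket S.1).trans_lt S.2)⟩

/-- The operator `|i⟩⟨j|`. -/
def ketbra (i j : ι) : TraceClass ι :=
  ⟨(innerSL ℂ (ket j)).smulRight (ket i), by
    obtain ⟨W, hW, h⟩ := exists_traceNorm_le ((innerSL ℂ (ket j)).smulRight (ket i : L2 ι))
    refine h.trans_lt ?_
    rw [tsum_eq_single j]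
    · exact enorm_lt_top
    · intro k hk
      rw [smulRight_apply, innerSL_apply_apply, orthonormal_ket.2 hk.symm]
      simp⟩

/-! ### Ladder operators, displacement operators -/

/-- Polynomials in the ladder operators act on the space `ℕ →₀ ℂ` of finite superpositions of Fock
states. -/
abbrev FockOp : Type := Module.End ℂ (ℕ →₀ ℂ)

/-- The inclusion of finite superpositions of Fock states in `ℓ²(ℕ)`. -/
def toL2 : (ℕ →₀ ℂ) →ₗ[ℂ] L2 ℕ := Finsupp.linearCombination ℂ ket

/-- The annihilation operator, `a|l⟩ = √l |l - 1⟩`. -/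
def annihilation : FockOp :=
  Finsupp.linearCombination ℂ fun l => Finsupp.single (l - 1) ((Real.sqrt l : ℝ) : ℂ)

/-- The creation operator, `a†|l⟩ = √(l + 1) |l + 1⟩`. -/
def creation : FockOp :=
  Finsupp.linearCombination ℂ fun l => Finsupp.single (l + 1) ((Real.sqrt (l + 1) : ℝ) : ℂ)

/-- The exponent `z a† - z̄ a` of the displacement operator. -/
def displacementGen (z : ℂ) : FockOp := z • creation - (starRingEnd ℂ) z • annihilation

theorem toL2_single (n : ℕ) (c : ℂ) : toL2 (Finsupp.single n c) = c • ket n := by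
  simp [toL2]

theorem annihilation_single (n : ℕ) : annihilation (Finsupp.single n 1) =
    ((Real.sqrt n : ℝ) : ℂ) • Finsupp.single (n - 1) 1 := by simp [annihilation]

theorem creation_single (n : ℕ) : creation (Finsupp.single n 1) =
    ((Real.sqrt (n + 1) : ℝ) : ℂ) • Finsupp.single (n + 1) 1 := by simp [creation]

theorem norm_pow_gen_le (z : ℂ) (k n : ℕ) :
    ‖toL2 ((displacementGen z ^ k) (Finsupp.single n 1))‖ ≤
      ∏ j ∈ Finset.range k, (2 * ‖z‖ * Real.sqrt (n + j + 1)) := by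
  induction k generalizing n with
  | zero => simp [toL2_single, orthonormal_ket.1]
  | succ k ih =>
    have hmono : ∀ m m' : ℕ, m ≤ m' →
        ∏ j ∈ Finset.range k, (2 * ‖z‖ * Real.sqrt (m + j + 1)) ≤
          ∏ j ∈ Finset.range k, (2 * ‖z‖ * Real.sqrt (m' + j + 1)) := by
      intro m m' h
      refine Finset.prod_le_prod (fun _ _ => by positivity) fun j _ => ?_
      gcongr
    rw [pow_succ, Module.End.mul_apply]
    have h1 : displacementGen z (Finsupp.single n 1) =
        (z * ((Real.sqrt (n + 1) : ℝ) : ℂ)) • Finsupp.single (n + 1) 1 -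
          ((starRingEnd ℂ) z * ((Real.sqrt n : ℝ) : ℂ)) • Finsupp.single (n - 1) 1 := by
      rw [displacementGen, LinearMap.sub_apply, LinearMap.smul_apply, LinearMap.smul_apply,
        annihilation_single, creation_single, smul_smul, smul_smul]
    rw [h1, map_sub, map_sub, map_smul, map_smul, map_smul, map_smul]
    refine (norm_sub_le _ _).trans ?_
    rw [norm_smul, norm_smul, norm_mul, norm_mul, RCLike.norm_conj, Complex.norm_real,
      Complex.norm_real, Real.norm_of_nonneg (Real.sqrt_nonneg _),
      Real.norm_of_nonneg (Real.sqrt_nonneg _), Finset.prod_range_succ']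
    have h2 := ih (n + 1)
    have h3 := (ih (n - 1)).trans (hmono (n - 1) (n + 1) (by omega))
    have h4 : Real.sqrt n ≤ Real.sqrt (n + 1) := Real.sqrt_le_sqrt (by linarith)
    have h5 : ∏ j ∈ Finset.range k, (2 * ‖z‖ * Real.sqrt (((n + 1 : ℕ) : ℝ) + j + 1)) =
        ∏ j ∈ Finset.range k, (2 * ‖z‖ * Real.sqrt ((n : ℝ) + ((j + 1 : ℕ) : ℝ) + 1)) := by
      refine Finset.prod_congr rfl fun j _ => ?_
      push_cast
      ring_nf
    rw [← h5]
    set p := ∏ j ∈ Finset.range k, (2 * ‖z‖ * Real.sqrt (((n + 1 : ℕ) : ℝ) + j + 1))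
    have hp : 0 ≤ p := (norm_nonneg _).trans h2
    calc _ ≤ ‖z‖ * Real.sqrt (n + 1) * p + ‖z‖ * Real.sqrt (n + 1) * p := by gcongr
      _ = _ := by simp; ring

/-- The terms of the exponential series of `z a† - z̄ a` applied to `|n⟩`. -/
def displacementTerm (z : ℂ) (n k : ℕ) : L2 ℕ :=
  ((k.factorial : ℂ)⁻¹) • toL2 ((displacementGen z ^ k) (Finsupp.single n 1))

theorem summable_norm_displacementTerm (z : ℂ) (n : ℕ) :
    Summable fun k => ‖displacementTerm z n k‖ := by
  let b : ℕ → ℝ := fun k => (k.factorial : ℝ)⁻¹ *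
    ∏ j ∈ Finset.range k, (2 * ‖z‖ * Real.sqrt (n + j + 1))
  have hb0 : ∀ k, 0 ≤ b k := fun k => by positivity
  have hb : Summable b := by
    have hlim : Filter.Tendsto (fun k : ℕ => 2 * ‖z‖ * Real.sqrt (n + 1) *
        (Real.sqrt ((k : ℝ) + 1))⁻¹) Filter.atTop (nhds 0) := by
      have h1 : Filter.Tendsto (fun k : ℕ => Real.sqrt ((k : ℝ) + 1)) Filter.atTop Filter.atTop :=
        Real.tendsto_sqrt_atTop.comp
          (Filter.tendsto_atTop_add_const_right _ _ tendsto_natCast_atTop_atTop)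
      simpa using (h1.inv_tendsto_atTop).const_mul (2 * ‖z‖ * Real.sqrt (n + 1))
    refine summable_of_ratio_norm_eventually_le (r := 1 / 2) (by norm_num) ?_
    filter_upwards [hlim.eventually (ge_mem_nhds (show (0 : ℝ) < 1 / 2 by norm_num))] with k hk
    rw [Real.norm_of_nonneg (hb0 _), Real.norm_of_nonneg (hb0 _)]
    have h2 : b (k + 1) = (2 * ‖z‖ * Real.sqrt (n + k + 1) / (k + 1)) * b k := by
      simp only [b, Nat.factorial_succ, Finset.prod_range_succ]
      push_cast
      field_simp
    rw [h2]
    refine mul_le_mul_of_nonneg_right (le_trans ?_ hk) (hb0 k)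
    have h3 : Real.sqrt (n + k + 1) ≤ Real.sqrt (n + 1) * Real.sqrt (k + 1) := by
      rw [← Real.sqrt_mul (by positivity)]
      refine Real.sqrt_le_sqrt ?_
      nlinarith [mul_nonneg (Nat.cast_nonneg (α := ℝ) n) (Nat.cast_nonneg (α := ℝ) k)]
    have h4 : ((k : ℝ) + 1) = Real.sqrt (k + 1) * Real.sqrt (k + 1) :=
      (Real.mul_self_sqrt (by positivity)).symm
    have h5 : 0 < Real.sqrt ((k : ℝ) + 1) := Real.sqrt_pos.2 (by positivity)
    rw [div_le_iff₀ (by positivity)]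
    calc 2 * ‖z‖ * Real.sqrt (n + k + 1) ≤ 2 * ‖z‖ * (Real.sqrt (n + 1) * Real.sqrt (k + 1)) := by
          gcongr
      _ = 2 * ‖z‖ * Real.sqrt (n + 1) * (Real.sqrt (k + 1))⁻¹ *
          (Real.sqrt (k + 1) * Real.sqrt (k + 1)) := by field_simp
      _ = _ := by rw [← h4]
  refine Summable.of_nonneg_of_le (fun _ => norm_nonneg _) (fun k => ?_) hb
  rw [displacementTerm, norm_smul, norm_inv, Complex.norm_natCast]
  exact mul_le_mul_of_nonneg_left (norm_pow_gen_le z k n) (by positivity)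

theorem inner_creation (u v : ℕ →₀ ℂ) :
    ⟪toL2 (creation u), toL2 v⟫_ℂ = ⟪toL2 u, toL2 (annihilation v)⟫_ℂ := by
  induction u using Finsupp.induction_linear with
  | zero => simp
  | add f g hf hg => simp only [map_add, inner_add_left, hf, hg]
  | single m c =>
    induction v using Finsupp.induction_linear with
    | zero => simp
    | add f g hf hg => simp only [map_add, inner_add_right, hf, hg]
    | single n d =>
      have hc : Finsupp.single m c = c • Finsupp.single m (1 : ℂ) := by simp
      have hd : Finsupp.single n d = d • Finsupp.single n (1 : ℂ) := by simp
      rw [hc, hd]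
      simp only [map_smul, inner_smul_left, inner_smul_right, creation_single,
        annihilation_single, toL2_single, one_smul, Complex.conj_ofReal]
      have key : ((Real.sqrt (m + 1) : ℝ) : ℂ) * ⟪ket (m + 1), (ket n : L2 ℕ)⟫_ℂ =
          ((Real.sqrt n : ℝ) : ℂ) * ⟪ket m, (ket (n - 1) : L2 ℕ)⟫_ℂ := by
        rw [orthonormal_iff_ite.1 orthonormal_ket, orthonormal_iff_ite.1 orthonormal_ket]
        rcases n with _ | n
        · simp
        · by_cases h : m = n
          · simp [h]
          · simp [h]
      linear_combination (d * (starRingEnd ℂ) c) * key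

theorem inner_gen (z : ℂ) (u v : ℕ →₀ ℂ) :
    ⟪toL2 (displacementGen z u), toL2 v⟫_ℂ = -⟪toL2 u, toL2 (displacementGen z v)⟫_ℂ := by
  have h : ⟪toL2 (annihilation u), toL2 v⟫_ℂ = ⟪toL2 u, toL2 (creation v)⟫_ℂ := by
    rw [← inner_conj_symm, ← inner_creation, inner_conj_symm]
  simp only [displacementGen, LinearMap.sub_apply, LinearMap.smul_apply, map_sub, map_smul,
    inner_sub_left, inner_sub_right, inner_smul_left, inner_smul_right, inner_creation, h,
    Complex.conj_conj]
  ring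

theorem inner_gen_pow (z : ℂ) (j : ℕ) (u v : ℕ →₀ ℂ) :
    ⟪toL2 ((displacementGen z ^ j) u), toL2 v⟫_ℂ =
      (-1) ^ j * ⟪toL2 u, toL2 ((displacementGen z ^ j) v)⟫_ℂ := by
  induction j generalizing v with
  | zero => simp
  | succ j ih =>
    rw [pow_succ', Module.End.mul_apply, inner_gen, ih, ← Module.End.mul_apply, ← pow_succ,
      pow_succ (-1 : ℂ)]
    rw [← pow_succ']
    ring

/-- The vectors `D_z|n⟩ = ∑ₖ (z a† - z̄ a)ᵏ|n⟩ / k!`. -/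
def displacedKet (z : ℂ) (n : ℕ) : L2 ℕ := ∑' k, displacementTerm z n k

theorem orthonormal_displacedKet (z : ℂ) : Orthonormal ℂ (displacedKet z) := by
  rw [orthonormal_iff_ite]
  intro m n
  have hm := summable_norm_displacementTerm z m
  have hn := summable_norm_displacementTerm z n
  let F : ℕ × ℕ → ℂ := fun p => ⟪displacementTerm z m p.1, displacementTerm z n p.2⟫_ℂ
  have hF : Summable F := Summable.of_norm_bounded
    (hm.mul_of_nonneg hn (fun _ => norm_nonneg _) fun _ => norm_nonneg _)
    fun p => norm_inner_le_norm _ _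
  have h1 : ⟪displacedKet z m, displacedKet z n⟫_ℂ = ∑' p, F p := by
    rw [hF.tsum_prod]
    have hs : ∀ x : L2 ℕ, HasSum (fun k => ⟪x, displacementTerm z n k⟫_ℂ)
        ⟪x, displacedKet z n⟫_ℂ := fun x => hn.of_norm.hasSum.mapL (innerSL ℂ x)
    have hs' : HasSum (fun j => ⟪displacementTerm z m j, displacedKet z n⟫_ℂ)
        ⟪displacedKet z m, displacedKet z n⟫_ℂ := by
      have : HasSum (fun j => displacementTerm z m j) (displacedKet z m) := hm.of_norm.hasSum
      have := (this.mapL (innerSL ℂ (displacedKet z n))).map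
        (starRingEnd ℂ) Complex.continuous_conj
      simpa only [Function.comp_def, innerSL_apply_apply, inner_conj_symm] using this
    rw [← hs'.tsum_eq]
    exact tsum_congr fun j => ((hs _).tsum_eq).symm
  have h2 : ∑' p, F p = ∑' N : ℕ, ∑ p ∈ Finset.HasAntidiagonal.antidiagonal N, F p := by
    rw [← Finset.HasAntidiagonal.sigmaAntidiagonalEquivProd.tsum_eq F]
    rw [Summable.tsum_sigma'
      (f := fun c => F (Finset.HasAntidiagonal.sigmaAntidiagonalEquivProd c))
      (fun N => (hasSum_fintype _).summable) (Finset.HasAntidiagonal.sigmaAntidiagonalEquivProd.summable_iff.2 hF)]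
    refine tsum_congr fun N => ?_
    rw [tsum_fintype]
    exact Finset.sum_coe_sort (Finset.HasAntidiagonal.antidiagonal N) F
  have h3 : ∀ N, ∑ p ∈ Finset.HasAntidiagonal.antidiagonal N, F p = if N = 0 then (if m = n then 1 else 0) else 0 := by
    intro N
    have h4 : ∀ p ∈ Finset.HasAntidiagonal.antidiagonal N, F p = ((N.factorial : ℂ)⁻¹ *
        ⟪toL2 (Finsupp.single m 1), toL2 ((displacementGen z ^ N) (Finsupp.single n 1))⟫_ℂ) *
          ((-1) ^ p.1 * 1 ^ p.2 * (N.choose p.1 : ℂ)) := by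
      intro p hp
      rw [Finset.HasAntidiagonal.mem_antidiagonal] at hp
      subst hp
      simp only [F, displacementTerm, inner_smul_left, inner_smul_right, inner_gen_pow]
      rw [← Module.End.mul_apply, ← pow_add, Nat.choose_symm_add, Nat.add_choose, Nat.cast_div
        (Nat.factorial_mul_factorial_dvd_factorial_add _ _)
        (by exact_mod_cast (by positivity : p.1.factorial * p.2.factorial ≠ 0))]
      have : ((p.1 + p.2).factorial : ℂ) ≠ 0 := by exact_mod_cast Nat.factorial_ne_zero _
      push_cast
      simp only [map_inv₀, map_natCast]
      field_simp
      simp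
    rw [Finset.sum_congr rfl h4, ← Finset.mul_sum]
    have h5 : ∑ p ∈ Finset.HasAntidiagonal.antidiagonal N, ((-1 : ℂ) ^ p.1 * 1 ^ p.2 * (N.choose p.1 : ℂ)) =
        0 ^ N := by
      have := (Commute.all (-1 : ℂ) 1).add_pow' N
      rw [neg_add_cancel] at this
      rw [this]
      refine Finset.sum_congr rfl fun p _ => ?_
      rw [nsmul_eq_mul]; ring
    rw [h5]
    rcases eq_or_ne N 0 with rfl | hN
    · simp [toL2_single, orthonormal_iff_ite.1 (orthonormal_ket (ι := ℕ))]
    · simp [hN]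
  rw [h1, h2, tsum_congr h3, tsum_ite_eq]

/-- The displacement operator `D_z = exp(z a† - z̄ a)`: the bounded operator which is given by the
exponential series on Fock states. -/
def displacement (z : ℂ) : L2 ℕ →L[ℂ] L2 ℕ := isometryOf (orthonormal_displacedKet z)

theorem displacement_ket (z : ℂ) (n : ℕ) : HasSum (displacementTerm z n) (displacement z (ket n)) := by
  rw [displacement, isometryOf_ket]
  exact (summable_norm_displacementTerm z n).of_norm.hasSum

/-! ### States and characteristic functions -/

/-- The characteristic function `χ_T(z) = Tr[T D_z]`. -/
def charFun (T : TraceClass ℕ) (z : ℂ) : ℂ := trace (T.1.comp (displacement z))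

/-- Quantum states: positive semi-definite operators of trace one. -/
def IsState (ρ : TraceClass ι) : Prop := ρ.1.IsPositive ∧ trace ρ.1 = 1

/-- Gaussian states: the characteristic function is the exponential of a polynomial of degree at
most two in `z` and `z̄`. -/
def IsGaussianState (σ : TraceClass ℕ) : Prop :=
  IsState σ ∧ ∃ c₀ c₁ c₂ c₃ c₄ c₅ : ℂ, ∀ z : ℂ, charFun σ z =
    Complex.exp (c₀ + c₁ * z + c₂ * (starRingEnd ℂ) z + c₃ * z ^ 2 +
      c₄ * (z * (starRingEnd ℂ) z) + c₅ * (starRingEnd ℂ) z ^ 2)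

/-! ### Moments -/

/-- The position quadrature `x = (a + a†)/√2`, so that `a = (x + i p)/√2`. -/
def position : FockOp := ((Real.sqrt 2 : ℝ) : ℂ)⁻¹ • (annihilation + creation)

/-- The momentum quadrature `p = (a - a†)/(i √2)`, so that `a = (x + i p)/√2`. -/
def momentum : FockOp :=
  (Complex.I * ((Real.sqrt 2 : ℝ) : ℂ))⁻¹ • (annihilation - creation)

/-- The vector `R = (x, p)` of quadrature operators. -/
def quadrature : Fin 2 → FockOp := ![position, momentum]

/-- `Tr[T A] = c` for a polynomial `A` in the ladder operators. The trace is taken in the Fock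
basis, and the series `∑ₗ ⟨l|T A|l⟩` is required to converge absolutely. -/
def HasMoment (T : TraceClass ℕ) (A : FockOp) (c : ℂ) : Prop :=
  HasSum (fun l : ℕ => ⟪ket l, T.1 (toL2 (A (Finsupp.single l 1)))⟫_ℂ) c

/-- `T` has a finite moment of order `κ`: the trace `Tr[T (a†a)^(κ/2)] = ∑ₗ l^(κ/2) ⟨l|T|l⟩`, taken
in the eigenbasis of the photon number operator `a†a`, converges absolutely. -/
def FiniteMoment (κ : ℝ) (T : TraceClass ℕ) : Prop :=
  Summable fun l : ℕ => (l : ℝ) ^ (κ / 2) * ‖⟪ket l, T.1 (ket l)⟫_ℂ‖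

/-- `d = Tr[ρ R]` is the vector of first-order moments of `ρ`. -/
def HasFirstMoments (ρ : TraceClass ℕ) (d : Fin 2 → ℝ) : Prop :=
  ∀ i, HasMoment ρ (quadrature i) (d i : ℂ)

/-- `γ = Tr[ρ {R - d, Rᵀ - dᵀ}]` is the covariance matrix of `ρ`, where `d` is the vector of
first-order moments of `ρ` and `{A, B} = A B + B A`. -/
def HasCovariance (ρ : TraceClass ℕ) (γ : Matrix (Fin 2) (Fin 2) ℝ) : Prop :=
  ∃ d : Fin 2 → ℝ, HasFirstMoments ρ d ∧ ∀ i j, HasMoment ρ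
    ((quadrature i - (d i : ℂ) • 1) * (quadrature j - (d j : ℂ) • 1) +
      (quadrature j - (d j : ℂ) • 1) * (quadrature i - (d i : ℂ) • 1)) (γ i j : ℂ)

/-! ### Channels -/

/-- A block matrix of trace-class operators is positive semi-definite. -/
def BlockPositive {k : ℕ} (T : Fin k → Fin k → TraceClass ι) : Prop :=
  ∀ v : Fin k → L2 ι, 0 ≤ ∑ i, ∑ j, ⟪v i, (T i j).1 (v j)⟫_ℂ

/-- Complete positivity: `id ⊗ N` is positive on `Mₖ ⊗ 𝒯(ℓ²(ι))` for every `k`. -/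
def IsCompletelyPositive (N : TraceClass ι →ₗ[ℂ] TraceClass ι) : Prop :=
  ∀ (k : ℕ) (T : Fin k → Fin k → TraceClass ι), BlockPositive T →
    BlockPositive fun i j => N (T i j)

/-- Quantum channels: completely positive trace-preserving linear maps. -/
def IsChannel (N : TraceClass ι →ₗ[ℂ] TraceClass ι) : Prop :=
  IsCompletelyPositive N ∧ ∀ T, trace (N T).1 = trace T.1

/-- Centered channels: `N(|0⟩⟨0|)` has vanishing first-order moments. -/
def IsCentered (N : TraceClass ℕ →ₗ[ℂ] TraceClass ℕ) : Prop :=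
  HasFirstMoments (N (ketbra 0 0)) 0

/-- Gaussian channels: channels that map Gaussian states to Gaussian states. -/
def IsGaussianChannel (N : TraceClass ℕ →ₗ[ℂ] TraceClass ℕ) : Prop :=
  IsChannel N ∧ ∀ σ, IsGaussianState σ → IsGaussianState (N σ)

/-- `X` and `Y` are the matrices of the (centered) Gaussian channel `N`: it acts on moments by
`d(N(ρ)) = X d(ρ)` and `γ(N(ρ)) = X γ(ρ) Xᵀ + Y`. -/
def HasChannelMatrices (N : TraceClass ℕ →ₗ[ℂ] TraceClass ℕ)
    (X Y : Matrix (Fin 2) (Fin 2) ℝ) : Prop :=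
  ∀ ρ, IsState ρ → FiniteMoment 2 ρ → FiniteMoment 2 (N ρ) ∧
    ∃ (d : Fin 2 → ℝ) (γ : Matrix (Fin 2) (Fin 2) ℝ),
      HasFirstMoments ρ d ∧ HasCovariance ρ γ ∧
      HasFirstMoments (N ρ) (X.mulVec d) ∧ HasCovariance (N ρ) (X * γ * X.transpose + Y)

/-! ### Symmetric convolution

The Hilbert space of `n` modes is `ℓ²(ℕⁿ)`, where `ket m` is `|m₁⟩ ⊗ ⋯ ⊗ |mₙ⟩`. -/

/-- `S = T₁ ⊗ ⋯ ⊗ Tₙ`, expressed through the matrix elements in the Fock basis. -/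
def IsTensor {n : ℕ} (T : Fin n → L2 ℕ →L[ℂ] L2 ℕ)
    (S : L2 (Fin n → ℕ) →L[ℂ] L2 (Fin n → ℕ)) : Prop :=
  ∀ k l : Fin n → ℕ, ⟪ket k, S (ket l)⟫_ℂ = ∏ j, ⟪ket (k j), T j (ket (l j))⟫_ℂ

/-- `M = N^{⊗ n}`: the channel with `M(T₁ ⊗ ⋯ ⊗ Tₙ) = N(T₁) ⊗ ⋯ ⊗ N(Tₙ)`. -/
def IsTensorPower {n : ℕ} (N : TraceClass ℕ →ₗ[ℂ] TraceClass ℕ)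
    (M : TraceClass (Fin n → ℕ) →ₗ[ℂ] TraceClass (Fin n → ℕ)) : Prop :=
  IsChannel M ∧ ∀ (T : Fin n → TraceClass ℕ) (S : TraceClass (Fin n → ℕ)),
    IsTensor (fun j => (T j).1) S.1 → IsTensor (fun j => (N (T j)).1) (M S).1

/-- The matrix `(Vₙ)ⱼₖ = exp(2πi j k / n) / √n`, with indices starting from `0`. -/
def beamSplitterMatrix (n : ℕ) : Matrix (Fin n) (Fin n) ℂ := fun j k =>
  Complex.exp (2 * Real.pi * Complex.I / n * (j : ℕ) * (k : ℕ)) / ((Real.sqrt n : ℝ) : ℂ)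

/-- `U` is an `n`-beam splitter unitary:
`U (D_{z₁} ⊗ ⋯ ⊗ D_{zₙ}) U† = D_{w₁} ⊗ ⋯ ⊗ D_{wₙ}` with `w = Vₙ z`. -/
def IsBeamSplitter {n : ℕ} (U : L2 (Fin n → ℕ) →L[ℂ] L2 (Fin n → ℕ)) : Prop :=
  U ∈ unitary (L2 (Fin n → ℕ) →L[ℂ] L2 (Fin n → ℕ)) ∧
    ∀ z : Fin n → ℂ, ∃ A B : L2 (Fin n → ℕ) →L[ℂ] L2 (Fin n → ℕ),
      IsTensor (fun j => displacement (z j)) A ∧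
      IsTensor (fun j => displacement ((beamSplitterMatrix n).mulVec z j)) B ∧
      U * A * star U = B

/-- The operator `T ⊗ |0⟩⟨0|^{⊗ n}` on `n + 1` modes. -/
def tensorVacuum (n : ℕ) : TraceClass ℕ →ₗ[ℂ] TraceClass (Fin (n + 1) → ℕ) :=
  sandwich (attach (0 : Fin n → ℕ)) (adjoint (attach (0 : Fin n → ℕ)))

/-- `C` is the symmetric convolution `N^{⊞(n+1)}` of `n + 1` copies of `N`,
`C(T) = Tr_{¬1}[U N^{⊗(n+1)}(U† (T ⊗ |0⟩⟨0|^{⊗n}) U) U†]`. -/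
def IsSymmetricConvolution (N : TraceClass ℕ →ₗ[ℂ] TraceClass ℕ) (n : ℕ)
    (C : TraceClass ℕ →ₗ[ℂ] TraceClass ℕ) : Prop :=
  ∃ (U : L2 (Fin (n + 1) → ℕ) →L[ℂ] L2 (Fin (n + 1) → ℕ))
    (M : TraceClass (Fin (n + 1) → ℕ) →ₗ[ℂ] TraceClass (Fin (n + 1) → ℕ)),
    IsBeamSplitter U ∧ IsTensorPower N M ∧
    ∀ T, C T = partialTrace (sandwich U (star U) (M (sandwich (star U) U (tensorVacuum n T))))

end

end Bosonic

open Bosonic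

/-!
# The central limit theorem for bosonic channels

The proof works with characteristic functions `χ_T(z) = Tr[T D_z]` of operators `T = N(|e_α⟩⟨e_β|)`, where
`e_α = ∑ₖ αᵏ/√k! |k⟩` are the exponential vectors. An `n`-beam splitter maps the vacuum to itself up to a
phase (`eq_vacuum`) and hence exponential vectors to exponential vectors. Since the first row of `Vₙ` is
constant, the characteristic function of the convolution is an exact power
(`IsSymmetricConvolution.charFun_eq`),
`χ_{N^{⊞n}(|e_α⟩⟨e_β|)}(z) = χ_{N(|e_{α/√n}⟩⟨e_{β/√n}|)}(z/√n)ⁿ`.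

As in the classical central limit theorem it remains to expand the right-hand side to second order. The
finite second moment of `N(|0⟩⟨0|)` gives the second order of `χ_{N(|0⟩⟨0|)}` (`exists_moments`), without
first order, because `N` is centered. The Kraus decomposition of `N` shows that `N(|0⟩⟨1|)` inherits half
of this regularity, so that `χ_{N(|0⟩⟨1|)}(tz) = t w + o(t)` with `w = μz + νz̄` (`exists_offDiagonal`). All
other terms are trivial in the limit. Hence the characteristic functions converge to
`exp(αβ̄ - αw̄ + β̄w - ξᵀVξ/4)`, where `ξ` are the phase space coordinates of `z`
(`tendsto_charFun_expVec`, `tendsto_charFun_convolution`). This is `χ_{|e_α⟩⟨e_β|}(w) exp(-ξᵀYξ/4)`.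

Pointwise convergence of characteristic functions of positive operators to a function continuous at the
origin implies convergence in trace norm (`exists_tendsto_of_charFun`). Coherent matrix elements are
Gaussian averages of `χ`, so they converge; a Gaussian average close to the origin bounds the weight at
high photon numbers, so that no mass is lost. By polarization and contractivity of channels, the
convolutions converge on all trace-class operators, and the limit is a channel (`exists_limit_channel`).

The limit satisfies `χ_{N_G(T)}(z) = χ_T(μz + νz̄) exp(-ξᵀYξ/4)`. Thus it is Gaussian, and its action on the
moments follows by comparing second order expansions (`hasChannelMatrices_of_charFun`). Here one needs
that a quadratic lower bound for `Re χ` at the origin implies a finite second moment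
(`finiteMoment_of_charFun`).

The analysis of unbounded operators is avoided by working with `(a†a + 1)^(-1/2)` (`resolvent`), whose range
consists of the vectors of finite energy.
-/

namespace Bosonic
noncomputable section
variable {ι κ μ : Type}


/-! ### Vectors and operators in the standard basis -/

/-- The standard orthonormal basis of `ℓ²(ι)` as a Hilbert basis. -/
def ketBasis (ι : Type) : HilbertBasis ι ℂ (L2 ι) :=
  HilbertBasis.ofRepr (LinearIsometryEquiv.refl ℂ (L2 ι))

theorem ketBasis_apply (i : ι) : ketBasis ι i = ket i := by
  classical
  have h := HilbertBasis.repr_symm_single (ketBasis ι) i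
  rw [← h]
  simp only [ket]
  change (lp.single 2 i (1 : ℂ) : lp (fun _ : ι => ℂ) 2) = lp.single 2 i (1 : ℂ)
  congr!

theorem inner_ket_ket [DecidableEq ι] (i j : ι) :
    ⟪(ket i : L2 ι), ket j⟫_ℂ = if i = j then 1 else 0 :=
  orthonormal_iff_ite.1 orthonormal_ket i j

theorem norm_ket (i : ι) : ‖(ket i : L2 ι)‖ = 1 := orthonormal_ket.1 i

theorem hasSum_inner (x y : L2 ι) :
    HasSum (fun i => ⟪x, ket i⟫_ℂ * ⟪ket i, y⟫_ℂ) ⟪x, y⟫_ℂ := by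
  simpa only [ketBasis_apply] using (ketBasis ι).hasSum_inner_mul_inner x y

theorem hasSum_norm_sq (x : L2 ι) : HasSum (fun i => ‖⟪ket i, x⟫_ℂ‖ ^ 2) (‖x‖ ^ 2) := by
  have h := hasSum_inner x x
  have h2 : ∀ i, ⟪x, ket i⟫_ℂ * ⟪ket i, x⟫_ℂ = ((‖⟪ket i, x⟫_ℂ‖ ^ 2 : ℝ) : ℂ) := fun i => by
    rw [← inner_conj_symm, mul_comm, Complex.mul_conj, Complex.normSq_eq_norm_sq]
  rw [inner_self_eq_norm_sq_to_K] at h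
  simp only [h2] at h
  rw [← Complex.hasSum_ofReal]
  convert h using 1
  push_cast; rfl

theorem hasSum_ket (x : L2 ι) : HasSum (fun i => ⟪ket i, x⟫_ℂ • (ket i : L2 ι)) x := by
  have := (ketBasis ι).hasSum_repr x
  simpa only [ketBasis_apply, HilbertBasis.repr_apply_apply] using this

theorem ext_ket {x y : L2 ι} (h : ∀ i, ⟪ket i, x⟫_ℂ = ⟪ket i, y⟫_ℂ) : x = y := by
  rw [← (hasSum_ket x).tsum_eq, ← (hasSum_ket y).tsum_eq]
  simp only [h]

theorem ext_op {E : Type} [NormedAddCommGroup E] [InnerProductSpace ℂ E] {A B : L2 ι →L[ℂ] E}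
    (h : ∀ i, A (ket i) = B (ket i)) : A = B := by
  ext1 x
  have hA := (hasSum_ket x).mapL A
  have hB := (hasSum_ket x).mapL B
  simp only [map_smul] at hA hB
  simp only [h] at hA
  exact hA.unique hB

theorem ext_matrix {A B : L2 ι →L[ℂ] L2 κ}
    (h : ∀ i j, ⟪ket i, A (ket j)⟫_ℂ = ⟪ket i, B (ket j)⟫_ℂ) : A = B :=
  ext_op fun j => ext_ket fun i => h i j

/-- The vector with given square-summable coordinates. -/
def ofCoord (f : ι → ℂ) (hf : Summable fun i => ‖f i‖ ^ 2) : L2 ι :=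
  (⟨f, memℓp_gen (by simpa using hf)⟩ : lp (fun _ : ι => ℂ) 2)

theorem inner_ket_ofCoord (f : ι → ℂ) (hf : Summable fun i => ‖f i‖ ^ 2) (i : ι) :
    ⟪ket i, ofCoord f hf⟫_ℂ = f i := inner_ket i _

theorem span_ket_closure : (Submodule.span ℂ (Set.range (ket : ι → L2 ι))).topologicalClosure = ⊤ := by
  have := (ketBasis ι).dense_span
  have h : ((ketBasis ι : HilbertBasis ι ℂ (L2 ι)) : ι → L2 ι) = ket := funext ketBasis_apply
  rwa [h] at this

/-- A property of vectors which is closed under linear combinations and limits holds everywhere if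
it holds on a set with dense span. -/
theorem dense_induction {E : Type} [NormedAddCommGroup E] [NormedSpace ℂ E] {D : Set E}
    (hD : (Submodule.span ℂ D).topologicalClosure = ⊤) {p : E → Prop} (hc : IsClosed {x | p x})
    (h0 : ∀ x ∈ D, p x) (ha : ∀ x y, p x → p y → p (x + y)) (hs : ∀ (c : ℂ) x, p x → p (c • x))
    (hz : p 0) (x : E) : p x := by
  let S : Submodule ℂ E :=
    { carrier := {x | p x}, add_mem' := fun {a b} => ha a b, zero_mem' := hz,
      smul_mem' := fun c x => hs c x }
  have h1 : Submodule.span ℂ D ≤ S := Submodule.span_le.2 h0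
  have h2 := Submodule.topologicalClosure_minimal _ h1 hc
  rw [hD] at h2
  exact h2 (Submodule.mem_top (x := x))

theorem ext_op_dense {E F : Type} [NormedAddCommGroup E] [NormedSpace ℂ E] [NormedAddCommGroup F]
    [NormedSpace ℂ F] {D : Set E} (hD : (Submodule.span ℂ D).topologicalClosure = ⊤)
    {A B : E →L[ℂ] F} (h : ∀ x ∈ D, A x = B x) : A = B := by
  ext1 x
  refine dense_induction hD (p := fun x => A x = B x) (isClosed_eq A.continuous B.continuous) h
    ?_ ?_ (by simp) x
  · intro x y hx hy; simp [hx, hy]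
  · intro c x hx; simp [hx]

theorem ext_inner_dense {E F : Type} [NormedAddCommGroup E] [InnerProductSpace ℂ E]
    [NormedAddCommGroup F] [InnerProductSpace ℂ F]
    {D : Set E} (hD : (Submodule.span ℂ D).topologicalClosure = ⊤) {D' : Set F}
    (hD' : (Submodule.span ℂ D').topologicalClosure = ⊤)
    {A B : E →L[ℂ] F} (h : ∀ x ∈ D, ∀ y ∈ D', ⟪y, A x⟫_ℂ = ⟪y, B x⟫_ℂ) : A = B := by
  refine ext_op_dense hD fun x hx => ?_
  have : innerSL ℂ (A x) = innerSL ℂ (B x) := by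
    refine ext_op_dense hD' fun y hy => ?_
    rw [innerSL_apply_apply, innerSL_apply_apply, ← inner_conj_symm, h x hx y hy, inner_conj_symm]
  refine ext_inner_right ℂ fun v => ?_
  exact congrArg (fun T => T v) this

/-! ### Trace norm -/

theorem traceNorm_neg (T : L2 ι →L[ℂ] L2 ι) : traceNorm (-T) = traceNorm T := by
  have := traceNorm_smul (-1) T
  simpa using this

theorem traceNorm_sub_le (S T : L2 ι →L[ℂ] L2 ι) :
    traceNorm (S - T) ≤ traceNorm S + traceNorm T := by
  rw [sub_eq_add_neg, ← traceNorm_neg T]; exact traceNorm_add_le _ _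

theorem traceNorm_sub_comm (S T : L2 ι →L[ℂ] L2 ι) : traceNorm (S - T) = traceNorm (T - S) := by
  rw [← traceNorm_neg, neg_sub]

theorem traceNorm_sub_le_add (R S T : L2 ι →L[ℂ] L2 ι) :
    traceNorm (R - T) ≤ traceNorm (R - S) + traceNorm (S - T) := by
  have : R - T = (R - S) + (S - T) := by abel
  rw [this]; exact traceNorm_add_le _ _

theorem traceNorm_zero : traceNorm (0 : L2 ι →L[ℂ] L2 ι) = 0 := by
  have := traceNorm_smul 0 (0 : L2 ι →L[ℂ] L2 ι)
  simpa using this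

theorem eq_of_traceNorm_le {S T : L2 ι →L[ℂ] L2 ι}
    (h : ∀ ε : ℝ≥0∞, 0 < ε → traceNorm (S - T) ≤ ε) : S = T := by
  have h1 : ‖S - T‖ₑ = 0 := by
    refine le_antisymm (le_of_forall_pos_le_add fun ε hε => ?_) (zero_le)
    rw [zero_add]; exact (enorm_opNorm_le _).trans (h ε hε)
  exact sub_eq_zero.1 (enorm_eq_zero.1 h1)

theorem traceNorm_sum_le {α : Type} (s : Finset α) (A : α → L2 ι →L[ℂ] L2 ι) :
    traceNorm (∑ r ∈ s, A r) ≤ ∑ r ∈ s, traceNorm (A r) := by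
  classical
  induction s using Finset.induction_on with
  | empty => simp [traceNorm_zero]
  | insert a s ha ih =>
    rw [Finset.sum_insert ha, Finset.sum_insert ha]
    exact (traceNorm_add_le _ _).trans (by gcongr)

/-- The trace norm is lower semicontinuous for the weak operator topology. -/
theorem traceNorm_le_of_tendsto {A : ℕ → L2 ι →L[ℂ] L2 ι} {B : L2 ι →L[ℂ] L2 ι} {c : ℝ≥0∞}
    (h : ∀ u v, Filter.Tendsto (fun n => ⟪u, A n v⟫_ℂ) Filter.atTop (nhds ⟪u, B v⟫_ℂ))
    (hc : ∀ᶠ n in Filter.atTop, traceNorm (A n) ≤ c) : traceNorm B ≤ c := by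
  obtain ⟨W, hW, hB⟩ := exists_traceNorm_le B
  refine hB.trans (ENNReal.summable.tsum_le_of_sum_le fun s => ?_)
  have h1 : Filter.Tendsto (fun n => ∑ i ∈ s, ‖⟪W (ket i), A n (ket i)⟫_ℂ‖ₑ) Filter.atTop
      (nhds (∑ i ∈ s, ‖⟪W (ket i), B (ket i)⟫_ℂ‖ₑ)) :=
    tendsto_finsetSum _ fun i _ => (h _ _).enorm
  refine le_of_tendsto h1 ?_
  filter_upwards [hc] with n hn
  exact (ENNReal.sum_le_tsum s).trans
    ((tsum_inner_le (A n) (isBessel_polar hW) isBessel_ket).trans hn)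

/-- The space of trace-class operators is complete for the trace norm. -/
theorem exists_tendsto_traceNorm (A : ℕ → TraceClass ι)
    (hA : ∀ ε : ℝ≥0∞, 0 < ε → ∃ n₀, ∀ m ≥ n₀, ∀ n ≥ n₀, traceNorm ((A m).1 - (A n).1) ≤ ε) :
    ∃ B : TraceClass ι, Filter.Tendsto (fun n => traceNorm ((A n).1 - B.1)) Filter.atTop (nhds 0) := by
  -- The operator norm is dominated by the trace norm, so there is a limit in operator norm; lower
  -- semicontinuity upgrades the convergence.
  have hC : CauchySeq fun n => (A n).1 := by
    rw [EMetric.cauchySeq_iff]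
    intro ε hε
    obtain ⟨δ, hδ, hδε⟩ := exists_between hε
    obtain ⟨n₀, h⟩ := hA δ hδ
    refine ⟨n₀, fun m hm n hn => ?_⟩
    rw [edist_eq_enorm_sub]
    exact ((enorm_opNorm_le _).trans (h m hm n hn)).trans_lt hδε
  obtain ⟨B, hB⟩ := cauchySeq_tendsto_of_complete hC
  have key : ∀ ε : ℝ≥0∞, 0 < ε → ∃ n₀, ∀ m ≥ n₀, traceNorm ((A m).1 - B) ≤ ε := by
    intro ε hε
    obtain ⟨n₀, h⟩ := hA ε hε
    refine ⟨n₀, fun m hm => traceNorm_le_of_tendsto (A := fun n => (A m).1 - (A n).1) ?_ ?_⟩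
    · intro u v
      have : Filter.Tendsto (fun n => (A m).1 - (A n).1) Filter.atTop (nhds ((A m).1 - B)) :=
        tendsto_const_nhds.sub hB
      have h2 := ((ContinuousLinearMap.apply ℂ (L2 ι) v).continuous.tendsto _).comp this
      exact ((innerSL ℂ u).continuous.tendsto _).comp h2
    · filter_upwards [Filter.eventually_ge_atTop n₀] with n hn using h m hm n hn
  have hBt : traceNorm B < ⊤ := by
    obtain ⟨n₀, h⟩ := key 1 one_pos
    have h1 := traceNorm_sub_le (A n₀).1 ((A n₀).1 - B)
    rw [sub_sub_cancel] at h1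
    exact h1.trans_lt (ENNReal.add_lt_top.2 ⟨(A n₀).2, (h n₀ le_rfl).trans_lt ENNReal.one_lt_top⟩)
  refine ⟨⟨B, hBt⟩, ENNReal.tendsto_nhds_zero.2 fun ε hε => ?_⟩
  obtain ⟨n₀, h⟩ := key ε hε
  filter_upwards [Filter.eventually_ge_atTop n₀] with n hn using h n hn

/-- Contractions do not increase the trace norm. -/
theorem traceNorm_comp_comp_le (A : L2 ι →L[ℂ] L2 κ) (B : L2 κ →L[ℂ] L2 ι)
    (hA : ∀ x, ‖A x‖ ≤ ‖x‖) (hB : ∀ x, ‖B x‖ ≤ ‖x‖) (T : L2 ι →L[ℂ] L2 ι) :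
    traceNorm (A.comp (T.comp B)) ≤ traceNorm T := by
  obtain ⟨W, hW, h⟩ := exists_traceNorm_le (A.comp (T.comp B))
  refine h.trans (le_trans (le_of_eq ?_) (tsum_inner_le T (κ := κ)
    (u := fun i => adjoint A (W (ket i))) (v := fun i => B (ket i))
    ((isBessel_polar hW).map _ ?_) (isBessel_ket.map _ (norm_adjoint_apply_le B hB))))
  · refine tsum_congr fun i => ?_
    rw [adjoint_inner_left]; rfl
  · rwa [adjoint_adjoint]

theorem enorm_trace_comp_le (T B : L2 ι →L[ℂ] L2 ι) (hB : ∀ x, ‖B x‖ ≤ ‖x‖) :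
    ‖trace (T.comp B)‖ₑ ≤ traceNorm T :=
  enorm_tsum_le_tsum_enorm.trans
    (tsum_inner_le T isBessel_ket (isBessel_ket.map B (norm_adjoint_apply_le B hB)))

theorem enorm_trace_le (T : L2 ι →L[ℂ] L2 ι) : ‖trace T‖ₑ ≤ traceNorm T :=
  enorm_trace_comp_le T (ContinuousLinearMap.id ℂ _) fun _ => le_rfl

theorem tsum_mul_le {f g : κ → ℝ≥0∞} {a b : ℝ≥0∞} (hf : ∑' k, f k ^ 2 ≤ a ^ 2)
    (hg : ∑' k, g k ^ 2 ≤ b ^ 2) : ∑' k, f k * g k ≤ a * b := by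
  refine ENNReal.summable.tsum_le_of_sum_le fun s => ?_
  have h := ENNReal.inner_le_Lp_mul_Lq s f g (p := 2) (q := 2) (by constructor <;> norm_num)
  refine h.trans ?_
  have e : ∀ (f : κ → ℝ≥0∞) (a : ℝ≥0∞), ∑' k, f k ^ 2 ≤ a ^ 2 →
      (∑ k ∈ s, f k ^ (2 : ℝ)) ^ (1 / 2 : ℝ) ≤ a := by
    intro f a h
    rw [one_div, ENNReal.rpow_inv_le_iff (by norm_num)]
    simp only [ENNReal.rpow_two]
    exact (ENNReal.sum_le_tsum s).trans h
  exact mul_le_mul' (e f a hf) (e g b hg)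

/-! ### Decompositions into rank-one operators -/

/-- `T = ∑ₖ |xₖ⟩⟨yₖ|` weakly, with square-summable families `x` and `y`. -/
structure HasDyads (T : L2 ι →L[ℂ] L2 ι) (x y : κ → L2 ι) : Prop where
  left : Summable fun k => ‖x k‖ ^ 2
  right : Summable fun k => ‖y k‖ ^ 2
  hasSum : ∀ u v, HasSum (fun k => ⟪u, x k⟫_ℂ * ⟪y k, v⟫_ℂ) ⟪u, T v⟫_ℂ

theorem summable_norm_sq_of_enorm {E : Type} [NormedAddCommGroup E] {x : κ → E}
    (h : ∑' k, ‖x k‖ₑ ^ 2 ≠ ⊤) : Summable fun k => ‖x k‖ ^ 2 := by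
  have := ENNReal.summable_toReal h
  simpa using this

theorem tsum_enorm_sq {E : Type} [NormedAddCommGroup E] {x : κ → E}
    (h : Summable fun k => ‖x k‖ ^ 2) :
    ∑' k, ‖x k‖ₑ ^ 2 = ENNReal.ofReal (∑' k, ‖x k‖ ^ 2) := by
  rw [ENNReal.ofReal_tsum_of_nonneg (fun _ => sq_nonneg _) h]
  refine tsum_congr fun k => ?_
  rw [ENNReal.ofReal_pow (norm_nonneg _), ofReal_norm]

theorem exists_hasDyads (T : TraceClass ι) : ∃ x y : ι → L2 ι, HasDyads T.1 x y := by
  obtain ⟨W, Q, hW, hQ, h, hS⟩ := exists_factor T.1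
  have h2 : Summable fun k => ‖Q (ket k)‖ ^ 2 :=
    summable_norm_sq_of_enorm (by rw [hS]; exact T.2.ne)
  refine ⟨fun k => W (Q (ket k)), fun k => Q (ket k), ?_, h2, fun u v => ?_⟩
  · refine Summable.of_nonneg_of_le (fun _ => sq_nonneg _) (fun k => ?_) h2
    gcongr
    exact hW _
  · have := hasSum_inner (adjoint Q (adjoint W u)) (Q v)
    have h3 : ∀ a b, ⟪a, Q b⟫_ℂ = ⟪Q a, b⟫_ℂ := fun a b => by rw [← adjoint_inner_left, hQ]
    have h4 : ⟪u, T.1 v⟫_ℂ = ⟪adjoint Q (adjoint W u), Q v⟫_ℂ := by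
      rw [adjoint_inner_left, adjoint_inner_left, ← h]; rfl
    rw [h4]
    simpa only [adjoint_inner_left, h3 _ v] using this

theorem exists_hasDyads_of_isPositive (T : TraceClass ι) (hT : T.1.IsPositive) :
    ∃ x : ι → L2 ι, HasDyads T.1 x x := by
  have h0 : 0 ≤ T.1 := (nonneg_iff_isPositive _).2 hT
  set Q := CFC.sqrt T.1 with hQd
  have hQ : Q * Q = T.1 := CFC.sqrt_mul_sqrt_self _ h0
  have hQs : adjoint Q = Q := by
    rw [← star_eq_adjoint]; exact (CFC.sqrt_nonneg T.1).star_eq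
  have h1 : ∀ u v, ⟪Q u, Q v⟫_ℂ = ⟪u, T.1 v⟫_ℂ := fun u v => by
    rw [← adjoint_inner_right, hQs, ← hQ]; rfl
  have h2 : Summable fun k => ‖Q (ket k)‖ ^ 2 := by
    refine summable_norm_sq_of_enorm (ne_of_lt (lt_of_le_of_lt ?_ T.2))
    refine le_trans (ENNReal.tsum_le_tsum fun k => ?_) (tsum_inner_le T.1 isBessel_ket isBessel_ket)
    rw [← h1, inner_self_eq_norm_sq_to_K, enorm_pow, ← ofReal_norm, ← ofReal_norm]
    simp
  refine ⟨fun k => Q (ket k), h2, h2, fun u v => ?_⟩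
  have := hasSum_inner (Q u) (Q v)
  have h3 : ∀ a b, ⟪a, Q b⟫_ℂ = ⟪Q a, b⟫_ℂ := fun a b => by rw [← adjoint_inner_left, hQs]
  rw [h1] at this
  simpa only [h3 _ v, ← h3 u] using this

theorem summable_coord_sq {x : κ → L2 ι} (hx : Summable fun k => ‖x k‖ ^ 2) :
    Summable fun p : κ × ι => ‖⟪ket p.2, x p.1⟫_ℂ‖ ^ 2 := by
  rw [summable_prod_of_nonneg fun _ => sq_nonneg _]
  refine ⟨fun k => (hasSum_norm_sq (x k)).summable, ?_⟩
  simpa only [(hasSum_norm_sq _).tsum_eq] using hx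

theorem summable_mul_of_sq {f g : κ → ℂ} (hf : Summable fun k => ‖f k‖ ^ 2)
    (hg : Summable fun k => ‖g k‖ ^ 2) : Summable fun k => f k * g k := by
  refine Summable.of_norm_bounded (hf.add hg) fun k => ?_
  rw [norm_mul]
  nlinarith [sq_nonneg (‖f k‖ - ‖g k‖), sq_nonneg (‖f k‖), sq_nonneg (‖g k‖)]

theorem summable_inner_of_sq {E : Type} [NormedAddCommGroup E] [InnerProductSpace ℂ E]
    {x y : κ → E} (hx : Summable fun k => ‖x k‖ ^ 2) (hy : Summable fun k => ‖y k‖ ^ 2) :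
    Summable fun k => ‖x k‖ * ‖y k‖ := by
  refine Summable.of_norm_bounded (hx.add hy) fun k => ?_
  rw [norm_mul, norm_norm, norm_norm]
  nlinarith [sq_nonneg (‖x k‖ - ‖y k‖), sq_nonneg (‖x k‖), sq_nonneg (‖y k‖)]

/-- Fubini for double series. -/
theorem hasSum_swap {F : κ → ι → ℂ} (hF : Summable fun p : κ × ι => F p.1 p.2) {f : κ → ℂ}
    {g : ι → ℂ} (hf : ∀ k, HasSum (fun i => F k i) (f k)) (hg : ∀ i, HasSum (fun k => F k i) (g i)) :
    Summable g ∧ HasSum f (∑' i, g i) := by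
  have h1 := hF.hasSum.prod_fiberwise hf
  have h2 : HasSum (fun p : ι × κ => F p.2 p.1) (∑' p : κ × ι, F p.1 p.2) :=
    (Equiv.prodComm ι κ).hasSum_iff.2 hF.hasSum
  have h3 := h2.prod_fiberwise hg
  exact ⟨h3.summable, h3.tsum_eq ▸ h1⟩

namespace HasDyads
variable {T : L2 ι →L[ℂ] L2 ι} {x y : κ → L2 ι}

theorem comp_left (h : HasDyads T x y) (B : L2 ι →L[ℂ] L2 μ) (B' : L2 μ →L[ℂ] L2 ι) :
    HasDyads (B.comp (T.comp B')) (fun k => B (x k)) (fun k => adjoint B' (y k)) where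
  left := by
    refine Summable.of_nonneg_of_le (fun _ => sq_nonneg _) (fun k => ?_) (h.left.mul_left (‖B‖ ^ 2))
    rw [← mul_pow]; gcongr; exact B.le_opNorm _
  right := by
    refine Summable.of_nonneg_of_le (fun _ => sq_nonneg _) (fun k => ?_)
      (h.right.mul_left (‖adjoint B'‖ ^ 2))
    rw [← mul_pow]; gcongr; exact (adjoint B').le_opNorm _
  hasSum u v := by
    have := h.hasSum (adjoint B u) (B' v)
    simpa only [adjoint_inner_left, adjoint_inner_right, comp_apply] using this

theorem adj (h : HasDyads T x y) : HasDyads (adjoint T) y x where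
  left := h.right
  right := h.left
  hasSum u v := by
    have := (h.hasSum v u).map (starRingEnd ℂ) Complex.continuous_conj
    rw [adjoint_inner_right]
    simpa only [Function.comp_def, map_mul, inner_conj_symm, mul_comm] using this

theorem summable_trace (h : HasDyads T x y) :
    Summable fun p : κ × ι => ⟪ket p.2, x p.1⟫_ℂ * ⟪y p.1, ket p.2⟫_ℂ := by
  refine summable_mul_of_sq (summable_coord_sq h.left) ?_
  refine (summable_coord_sq h.right).congr fun p => ?_
  rw [norm_inner_symm]

theorem trace_aux (h : HasDyads T x y) : Summable (fun i => ⟪ket i, T (ket i)⟫_ℂ) ∧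
    HasSum (fun k => ⟪y k, x k⟫_ℂ) (trace T) := by
  refine hasSum_swap (F := fun k i => ⟪ket i, x k⟫_ℂ * ⟪y k, ket i⟫_ℂ) h.summable_trace
    (fun k => ?_) (fun i => h.hasSum (ket i) (ket i))
  have := hasSum_inner (y k) (x k)
  simpa only [mul_comm ⟪y k, ket _⟫_ℂ] using this

theorem hasSum_trace (h : HasDyads T x y) : HasSum (fun k => ⟪y k, x k⟫_ℂ) (trace T) :=
  h.trace_aux.2

theorem summable_diag (h : HasDyads T x y) : Summable fun i => ⟪ket i, T (ket i)⟫_ℂ :=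
  h.trace_aux.1

theorem hasSum_trace_comp (h : HasDyads T x y) (B : L2 ι →L[ℂ] L2 ι) :
    HasSum (fun k => ⟪y k, B (x k)⟫_ℂ) (trace (T.comp B)) := by
  have := (h.comp_left (ContinuousLinearMap.id ℂ _) B).hasSum_trace
  simpa only [adjoint_inner_left, id_apply, id_comp] using this

theorem hasSum_trace_comp' (h : HasDyads T x y) (B : L2 ι →L[ℂ] L2 ι) :
    HasSum (fun k => ⟪y k, B (x k)⟫_ℂ) (trace (B.comp T)) := by
  have := (h.comp_left B (ContinuousLinearMap.id ℂ _)).hasSum_trace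
  simpa only [adjoint_inner_left, id_apply, comp_id] using this

theorem traceNorm_le (h : HasDyads T x y) {a b : ℝ≥0∞} (ha : ∑' k, ‖x k‖ₑ ^ 2 ≤ a ^ 2)
    (hb : ∑' k, ‖y k‖ₑ ^ 2 ≤ b ^ 2) : traceNorm T ≤ a * b := by
  obtain ⟨W, hW, hT⟩ := exists_traceNorm_le T
  have key : ∀ (u : ι → L2 ι) (x : κ → L2 ι) (a : ℝ≥0∞), IsBessel u → ∑' k, ‖x k‖ₑ ^ 2 ≤ a ^ 2 →
      ∑' p : ι × κ, ‖⟪u p.1, x p.2⟫_ℂ‖ₑ ^ 2 ≤ a ^ 2 := by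
    intro u x a hu ha
    rw [ENNReal.tsum_prod (f := fun i k => ‖⟪u i, x k⟫_ℂ‖ₑ ^ 2), ENNReal.tsum_comm]
    exact (ENNReal.tsum_le_tsum fun k => hu (x k)).trans ha
  have h1 : ∀ i, ‖⟪W (ket i), T (ket i)⟫_ℂ‖ₑ ≤
      ∑' k, ‖⟪W (ket i), x k⟫_ℂ‖ₑ * ‖⟪(ket i : L2 ι), y k⟫_ℂ‖ₑ := fun i => by
    rw [← (h.hasSum _ _).tsum_eq]
    refine enorm_tsum_le_tsum_enorm.trans (ENNReal.tsum_le_tsum fun k => ?_)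
    rw [enorm_mul, ← ofReal_norm ⟪y k, ket i⟫_ℂ, norm_inner_symm, ofReal_norm]
  refine hT.trans ((ENNReal.tsum_le_tsum h1).trans ?_)
  have h2 := tsum_mul_le (key _ _ _ (isBessel_polar hW) ha) (key _ _ _ isBessel_ket hb)
  rwa [ENNReal.tsum_prod (f := fun i k => ‖⟪W (ket i), x k⟫_ℂ‖ₑ * ‖⟪(ket i : L2 ι), y k⟫_ℂ‖ₑ)] at h2

end HasDyads

/-- The trace is cyclic. -/
theorem trace_comp_comm (T : TraceClass ι) (B : L2 ι →L[ℂ] L2 ι) :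
    trace (T.1.comp B) = trace (B.comp T.1) := by
  obtain ⟨x, y, h⟩ := exists_hasDyads T
  exact (h.hasSum_trace_comp B).unique (h.hasSum_trace_comp' B)

theorem hasSum_trace (T : TraceClass ι) : HasSum (fun i => ⟪ket i, T.1 (ket i)⟫_ℂ) (trace T.1) := by
  obtain ⟨x, y, h⟩ := exists_hasDyads T
  exact h.summable_diag.hasSum

theorem hasSum_trace_comp (T : TraceClass ι) (B : L2 ι →L[ℂ] L2 ι) :
    HasSum (fun i => ⟪ket i, T.1 (B (ket i))⟫_ℂ) (trace (T.1.comp B)) := by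
  obtain ⟨x, y, h⟩ := exists_hasDyads T
  exact (h.comp_left (ContinuousLinearMap.id ℂ _) B).summable_diag.hasSum

theorem trace_smul (c : ℂ) (T : L2 ι →L[ℂ] L2 ι) : trace (c • T) = c * trace T := by
  simp only [trace, smul_apply, inner_smul_right, tsum_mul_left]

theorem trace_sub (S T : TraceClass ι) : trace (S.1 - T.1) = trace S.1 - trace T.1 := by
  refine HasSum.tsum_eq ?_
  simpa only [sub_apply, inner_sub_right] using (hasSum_trace S).sub (hasSum_trace T)

/-! ### Rank-one operators -/

/-- The operator `|x⟩⟨y|`. -/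
def dyad (x y : L2 ι) : L2 ι →L[ℂ] L2 ι := (innerSL ℂ y).smulRight x

theorem dyad_apply (x y v : L2 ι) : dyad x y v = ⟪y, v⟫_ℂ • x := rfl

theorem inner_dyad (x y u v : L2 ι) : ⟪u, dyad x y v⟫_ℂ = ⟪u, x⟫_ℂ * ⟪y, v⟫_ℂ := by
  rw [dyad_apply, inner_smul_right, mul_comm]

theorem hasDyads_dyad (x y : L2 ι) : HasDyads (dyad x y) (fun _ : Unit => x) (fun _ => y) where
  left := (hasSum_fintype _).summable
  right := (hasSum_fintype _).summable
  hasSum u v := by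
    rw [inner_dyad]
    exact hasSum_unique _

theorem traceNorm_dyad_le (x y : L2 ι) : traceNorm (dyad x y) ≤ ‖x‖ₑ * ‖y‖ₑ :=
  (hasDyads_dyad x y).traceNorm_le (by simp) (by simp)

/-- The operator `|x⟩⟨y|` as a trace-class operator. -/
def dyadTC (x y : L2 ι) : TraceClass ι :=
  ⟨dyad x y, (traceNorm_dyad_le x y).trans_lt (ENNReal.mul_lt_top enorm_lt_top enorm_lt_top)⟩

theorem dyadTC_val (x y : L2 ι) : (dyadTC x y).1 = dyad x y := rfl

theorem dyadTC_ket (i j : ι) : dyadTC (ket i) (ket j) = ketbra i j := rfl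

theorem dyadTC_add_left (x x' y : L2 ι) : dyadTC (x + x') y = dyadTC x y + dyadTC x' y := by
  ext v; simp [dyadTC, dyad]

theorem dyadTC_add_right (x y y' : L2 ι) : dyadTC x (y + y') = dyadTC x y + dyadTC x y' := by
  ext v; simp [dyadTC, dyad, add_smul]

theorem dyadTC_smul_left (c : ℂ) (x y : L2 ι) : dyadTC (c • x) y = c • dyadTC x y := by
  ext v; simp [dyadTC, dyad, smul_smul, mul_comm]

theorem dyadTC_smul_right (c : ℂ) (x y : L2 ι) :
    dyadTC x (c • y) = (starRingEnd ℂ) c • dyadTC x y := by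
  ext v; simp [dyadTC, dyad, smul_smul]

theorem trace_dyad (x y : L2 ι) : trace (dyad x y) = ⟪y, x⟫_ℂ :=
  ((hasDyads_dyad x y).hasSum_trace.unique (hasSum_unique _))

theorem isPositive_of_inner {T : L2 ι →L[ℂ] L2 ι} (h : ∀ v, 0 ≤ ⟪v, T v⟫_ℂ) : T.IsPositive := by
  rw [isPositive_iff_complex]
  intro v
  have h1 := h v
  have h2 : ⟪T v, v⟫_ℂ = ⟪v, T v⟫_ℂ := by
    rw [← inner_conj_symm]; exact Complex.conj_eq_iff_im.2 (Complex.nonneg_iff.1 h1).2.symm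
  rw [h2]
  exact ⟨Complex.ext rfl (Complex.nonneg_iff.1 h1).2, (Complex.nonneg_iff.1 h1).1⟩

theorem inner_self_mul_nonneg (x v : L2 ι) : 0 ≤ ⟪v, x⟫_ℂ * ⟪x, v⟫_ℂ := by
  rw [← inner_conj_symm x v, Complex.mul_conj]
  exact Complex.zero_le_real.2 (Complex.normSq_nonneg _)

theorem dyadTC_isPositive (x : L2 ι) : (dyadTC x x).1.IsPositive :=
  isPositive_of_inner fun v => by
    rw [dyadTC_val, inner_dyad]; exact inner_self_mul_nonneg x v

/-! ### Density of finite-rank operators in the trace norm -/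

/-- The closure of a subspace of trace-class operators in the trace norm. -/
def traceClosure (p : Submodule ℂ (TraceClass ι)) : Submodule ℂ (TraceClass ι) where
  carrier := {T | ∀ ε : ℝ≥0∞, 0 < ε → ∃ S ∈ p, traceNorm (T.1 - S.1) ≤ ε}
  zero_mem' := fun ε hε => ⟨0, p.zero_mem, by simp [traceNorm_zero]⟩
  add_mem' := by
    intro T T' hT hT' ε hε
    obtain ⟨S, hS, h⟩ := hT (ε / 2) (ENNReal.half_pos hε.ne')
    obtain ⟨S', hS', h'⟩ := hT' (ε / 2) (ENNReal.half_pos hε.ne')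
    refine ⟨S + S', p.add_mem hS hS', ?_⟩
    have : (T + T').1 - (S + S').1 = (T.1 - S.1) + (T'.1 - S'.1) := by
      simp only [Submodule.coe_add]; abel
    rw [this, ← ENNReal.add_halves ε]
    exact (traceNorm_add_le _ _).trans (add_le_add h h')
  smul_mem' := by
    intro c T hT ε hε
    rcases eq_or_ne c 0 with rfl | hc
    · exact ⟨0, p.zero_mem, by simp [traceNorm_zero]⟩
    have hc' : ‖c‖ₑ ≠ 0 := by simpa using hc
    obtain ⟨S, hS, h⟩ := hT (ε / ‖c‖ₑ) (ENNReal.div_pos hε.ne' enorm_ne_top)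
    refine ⟨c • S, p.smul_mem c hS, ?_⟩
    have : (c • T).1 - (c • S).1 = c • (T.1 - S.1) := by simp [smul_sub]
    rw [this, traceNorm_smul]
    calc ‖c‖ₑ * _ ≤ ‖c‖ₑ * (ε / ‖c‖ₑ) := by gcongr
      _ = ε := ENNReal.mul_div_cancel hc' enorm_ne_top

theorem mem_traceClosure_of_approx {p : Submodule ℂ (TraceClass ι)} {T : TraceClass ι}
    (h : ∀ ε : ℝ≥0∞, 0 < ε → ∃ S ∈ traceClosure p, traceNorm (T.1 - S.1) ≤ ε) :
    T ∈ traceClosure p := by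
  intro ε hε
  obtain ⟨S, hS, h1⟩ := h (ε / 2) (ENNReal.half_pos hε.ne')
  obtain ⟨R, hR, h2⟩ := hS (ε / 2) (ENNReal.half_pos hε.ne')
  refine ⟨R, hR, (traceNorm_sub_le_add _ S.1 _).trans ?_⟩
  rw [← ENNReal.add_halves ε]
  exact add_le_add h1 h2

theorem le_traceClosure (p : Submodule ℂ (TraceClass ι)) : p ≤ traceClosure p := fun T hT ε _ =>
  ⟨T, hT, by simp [traceNorm_zero]⟩

theorem isClosed_dyad_mem (p : Submodule ℂ (TraceClass ι)) {f : L2 ι → TraceClass ι} {c : ℝ≥0∞}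
    (hc : c ≠ ⊤) (hf : ∀ x y, traceNorm ((f x).1 - (f y).1) ≤ ‖x - y‖ₑ * c) :
    IsClosed {x | f x ∈ traceClosure p} := by
  rw [← closure_subset_iff_isClosed]
  intro x hx
  refine mem_traceClosure_of_approx fun ε hε => ?_
  rw [EMetric.mem_closure_iff] at hx
  obtain ⟨y, hy, h⟩ := hx (ε / (c + 1)) (ENNReal.div_pos hε.ne' (by simp [hc]))
  refine ⟨f y, hy, (hf x y).trans ?_⟩
  rw [edist_eq_enorm_sub] at h
  calc ‖x - y‖ₑ * c ≤ (ε / (c + 1)) * (c + 1) := mul_le_mul' h.le (by simp)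
    _ = ε := ENNReal.div_mul_cancel (by simp) (by simp [hc])

/-- Rank-one operators built from a set of vectors with dense span have a dense span. -/
theorem traceClosure_span_dyads {D : Set (L2 ι)}
    (hD : (Submodule.span ℂ D).topologicalClosure = ⊤) (T : TraceClass ι) :
    T ∈ traceClosure (Submodule.span ℂ {T | ∃ x ∈ D, ∃ y ∈ D, T = dyadTC x y}) := by
  classical
  set p := Submodule.span ℂ {T | ∃ x ∈ D, ∃ y ∈ D, T = dyadTC x y}
  have h1 : ∀ y ∈ D, ∀ x, dyadTC x y ∈ traceClosure p := by
    intro y hy x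
    refine dense_induction hD (p := fun x => dyadTC x y ∈ traceClosure p)
      (isClosed_dyad_mem p (c := ‖y‖ₑ) enorm_ne_top fun x x' => ?_) ?_ ?_ ?_ ?_ x
    · have : (dyadTC x y).1 - (dyadTC x' y).1 = dyad (x - x') y := by
        ext v; simp [dyadTC, dyad, smul_sub]
      rw [this]; exact traceNorm_dyad_le _ _
    · exact fun x hx => le_traceClosure p (Submodule.subset_span ⟨x, hx, y, hy, rfl⟩)
    · intro x x' hx hx'; rw [dyadTC_add_left]; exact (traceClosure p).add_mem hx hx'
    · intro c x hx; rw [dyadTC_smul_left]; exact (traceClosure p).smul_mem c hx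
    · have : dyadTC 0 y = 0 := by ext v; simp [dyadTC, dyad]
      rw [this]; exact (traceClosure p).zero_mem
  have h2 : ∀ x y, dyadTC x y ∈ traceClosure p := by
    intro x y
    refine dense_induction hD (p := fun y => dyadTC x y ∈ traceClosure p)
      (isClosed_dyad_mem p (c := ‖x‖ₑ) enorm_ne_top fun y y' => ?_) ?_ ?_ ?_ ?_ y
    · have : (dyadTC x y).1 - (dyadTC x y').1 = dyad x (y - y') := by
        ext v; simp [dyadTC, dyad, sub_smul]
      rw [this, mul_comm]; exact traceNorm_dyad_le _ _
    · exact fun y hy => h1 y hy x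
    · intro x x' hx hx'; rw [dyadTC_add_right]; exact (traceClosure p).add_mem hx hx'
    · intro c x hx; rw [dyadTC_smul_right]; exact (traceClosure p).smul_mem _ hx
    · have : dyadTC x 0 = 0 := by ext v; simp [dyadTC, dyad]
      rw [this]; exact (traceClosure p).zero_mem
  -- The tail of a decomposition into rank-one operators is small in trace norm.
  obtain ⟨x, y, h⟩ := exists_hasDyads T
  refine mem_traceClosure_of_approx fun ε hε => ?_
  have hx : ∑' k, ‖x k‖ₑ ^ 2 ≠ ⊤ := by rw [tsum_enorm_sq h.left]; exact ENNReal.ofReal_ne_top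
  have hy : ∑' k, ‖y k‖ₑ ^ 2 ≠ ⊤ := by rw [tsum_enorm_sq h.right]; exact ENNReal.ofReal_ne_top
  set δ := min ε 1 with hδ
  have hδ0 : 0 < δ := lt_min hε one_pos
  have hδ2 : 0 < δ ^ 2 := pos_iff_ne_zero.2 (pow_ne_zero 2 hδ0.ne')
  have e1 := (ENNReal.tendsto_tsum_compl_atTop_zero hx).eventually_le_const hδ2
  have e2 := (ENNReal.tendsto_tsum_compl_atTop_zero hy).eventually_le_const hδ2
  obtain ⟨F, hF1, hF2⟩ := (e1.and e2).exists
  refine ⟨∑ k ∈ F, dyadTC (x k) (y k), Submodule.sum_mem _ fun k _ => h2 _ _, ?_⟩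
  have hd : HasDyads (T.1 - (∑ k ∈ F, dyadTC (x k) (y k)).1) (fun k : {k // k ∉ F} => x k)
      (fun k => y k) :=
    { left := h.left.subtype _
      right := h.right.subtype _
      hasSum := fun u v => by
        refine (Finset.hasSum_compl_iff F (f := fun k => ⟪u, x k⟫_ℂ * ⟪y k, v⟫_ℂ)).2 ?_
        have e : (∑ k ∈ F, dyadTC (x k) (y k)).1 = ∑ k ∈ F, dyad (x k) (y k) := by
          rw [Submodule.coe_sum]; rfl
        rw [e, sub_apply, sum_apply, inner_sub_right, inner_sum]
        simp only [inner_dyad, sub_add_cancel]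
        exact h.hasSum u v }
  refine (hd.traceNorm_le hF1 hF2).trans ?_
  calc δ * δ ≤ δ * 1 := by gcongr; exact min_le_right _ _
    _ ≤ ε := by rw [mul_one]; exact min_le_left _ _

/-! ### Positive operators -/

theorem traceNorm_of_isPositive (T : TraceClass ι) (hT : T.1.IsPositive) :
    traceNorm T.1 = ENNReal.ofReal (trace T.1).re := by
  have h0 : 0 ≤ T.1 := (nonneg_iff_isPositive _).2 hT
  have h1 := (Complex.reCLM.hasSum (hasSum_trace T))
  simp only [Complex.reCLM_apply] at h1
  have hn : ∀ i, 0 ≤ (⟪ket i, T.1 (ket i)⟫_ℂ).re := fun i => 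
    (Complex.nonneg_iff.1 (hT.inner_nonneg_right (ket i))).1
  rw [traceNorm, CFC.abs_of_nonneg _ h0, ← h1.tsum_eq, ENNReal.ofReal_tsum_of_nonneg hn h1.summable]

theorem blockPositive_one {T : TraceClass ι} : 
    BlockPositive (fun _ _ : Fin 1 => T) ↔ T.1.IsPositive := by
  constructor
  · intro h
    exact isPositive_of_inner fun v => by simpa using h fun _ => v
  · intro h v
    simpa using h.inner_nonneg_right (v 0)

/-- Positive `2 × 2` block matrices are hermitian and satisfy the arithmetic-geometric mean
inequality. -/
theorem blockPositive_two {A T S B : TraceClass ι}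
    (h : BlockPositive ![![A, T], ![S, B]]) : A.1.IsPositive ∧ B.1.IsPositive ∧
      S.1 = adjoint T.1 ∧
      ∀ u v, 2 * ‖⟪u, T.1 v⟫_ℂ‖ ≤ ‖⟪u, A.1 u⟫_ℂ‖ + ‖⟪v, B.1 v⟫_ℂ‖ := by
  have h1 : ∀ u v, 0 ≤ ⟪u, A.1 u⟫_ℂ + ⟪u, T.1 v⟫_ℂ + (⟪v, S.1 u⟫_ℂ + ⟪v, B.1 v⟫_ℂ) := by
    intro u v
    simpa [Fin.sum_univ_two] using h ![u, v]
  have hA : ∀ u, 0 ≤ ⟪u, A.1 u⟫_ℂ := fun u => by simpa using h1 u 0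
  have hB : ∀ u, 0 ≤ ⟪u, B.1 u⟫_ℂ := fun u => by simpa using h1 0 u
  have h2 : ∀ u v, ⟪v, S.1 u⟫_ℂ = (starRingEnd ℂ) ⟪u, T.1 v⟫_ℂ := by
    intro u v
    have a1 := (Complex.nonneg_iff.1 (h1 u v)).2
    have a2 := (Complex.nonneg_iff.1 (h1 (Complex.I • u) v)).2
    have a3 := (Complex.nonneg_iff.1 (hA u)).2
    have a4 := (Complex.nonneg_iff.1 (hB v)).2
    simp only [map_smul, inner_smul_left, inner_smul_right, Complex.conj_I, Complex.add_im,
      Complex.mul_im, Complex.neg_re, Complex.neg_im, Complex.I_re, Complex.I_im, Complex.mul_re] at a1 a2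
    apply Complex.ext
    · rw [Complex.conj_re]; linarith
    · rw [Complex.conj_im]; linarith
  refine ⟨isPositive_of_inner hA, isPositive_of_inner hB, ?_, fun u v => ?_⟩
  · ext1 u
    refine ext_inner_left ℂ fun v => ?_
    rw [h2, adjoint_inner_right, inner_conj_symm]
  -- Rotate `u` by the phase `c` that makes `⟪c u, T v⟫` negative.
  · rcases eq_or_ne ⟪u, T.1 v⟫_ℂ 0 with ht | ht
    · rw [ht, norm_zero, mul_zero]; positivity
    set t := ⟪u, T.1 v⟫_ℂ with htd
    have hn : ‖t‖ ≠ 0 := norm_ne_zero_iff.2 ht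
    let c : ℂ := -(t / (‖t‖ : ℝ))
    have hc : (starRingEnd ℂ) c * c = 1 := by
      rw [mul_comm, Complex.mul_conj, Complex.normSq_eq_norm_sq]; simp [c, hn]
    have hct : (starRingEnd ℂ) c * t = -(‖t‖ : ℝ) := by
      have : (starRingEnd ℂ) t * t = (‖t‖ : ℝ) ^ 2 := by
        rw [mul_comm, Complex.mul_conj, Complex.normSq_eq_norm_sq]; push_cast; rfl
      simp only [c, map_neg, map_div₀, Complex.conj_ofReal, neg_mul, div_mul_eq_mul_div, this]
      have : ((‖t‖ : ℝ) : ℂ) ≠ 0 := by exact_mod_cast hn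
      field_simp
    have h3 := h1 (c • u) v
    rw [h2] at h3
    simp only [map_smul, inner_smul_left, inner_smul_right, map_mul, ← htd] at h3
    rw [← mul_assoc, mul_comm c, hc, hct, one_mul] at h3
    have h5 : (starRingEnd ℂ) (starRingEnd ℂ c) * (starRingEnd ℂ) t = -(‖t‖ : ℝ) := by
      rw [← map_mul, hct]; simp
    rw [h5] at h3
    have h4 := (Complex.nonneg_iff.1 h3).1
    simp only [Complex.add_re, Complex.neg_re, Complex.ofReal_re] at h4
    have h6 := Complex.re_le_norm ⟪u, A.1 u⟫_ℂ
    have h7 := Complex.re_le_norm ⟪v, B.1 v⟫_ℂ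
    linarith

/-! ### Channels between different spaces -/

/-- Completely positive trace-preserving linear maps between trace classes. -/
def IsCPTP (N : TraceClass ι →ₗ[ℂ] TraceClass κ) : Prop :=
  (∀ (k : ℕ) (T : Fin k → Fin k → TraceClass ι), BlockPositive T →
    BlockPositive fun i j => N (T i j)) ∧ ∀ T, trace (N T).1 = trace T.1

theorem isCPTP_iff {N : TraceClass ι →ₗ[ℂ] TraceClass ι} : IsCPTP N ↔ IsChannel N := Iff.rfl

namespace IsCPTP
variable {N : TraceClass ι →ₗ[ℂ] TraceClass κ}

theorem comp {M : TraceClass κ →ₗ[ℂ] TraceClass μ} (hM : IsCPTP M) (hN : IsCPTP N) :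
    IsCPTP (M.comp N) :=
  ⟨fun k T hT => hM.1 k _ (hN.1 k T hT), fun T => (hM.2 _).trans (hN.2 T)⟩

theorem isPositive (hN : IsCPTP N) {T : TraceClass ι} (hT : T.1.IsPositive) : (N T).1.IsPositive :=
  blockPositive_one.1 (hN.1 1 _ (blockPositive_one.2 hT))

theorem isState (hN : IsCPTP N) {T : TraceClass ι} (hT : IsState T) : IsState (N T) :=
  ⟨hN.isPositive hT.1, (hN.2 T).trans hT.2⟩

/-- With the polar decomposition `T = W|T|`, the block matrix `((W|T|W†, T), (T†, |T|))` is positive,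
and its diagonal blocks have trace norm at most `‖T‖₁`. -/
theorem blocks (hN : IsCPTP N) (T : TraceClass ι) : ∃ A S B : TraceClass ι,
    S.1 = adjoint T.1 ∧ traceNorm A.1 ≤ traceNorm T.1 ∧ traceNorm B.1 ≤ traceNorm T.1 ∧
    A.1.IsPositive ∧ B.1.IsPositive ∧
    BlockPositive ![![N A, N T], ![N S, N B]] := by
  obtain ⟨W, hW, h1, h2⟩ := exists_polar T.1
  have hW' := norm_adjoint_apply_le W hW
  have hA : traceNorm (T.1.comp (adjoint W)) ≤ traceNorm T.1 :=
    traceNorm_comp_comp_le (ContinuousLinearMap.id ℂ _) _ (fun _ => le_rfl) hW' _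
  have hB : traceNorm ((adjoint W).comp T.1) ≤ traceNorm T.1 :=
    traceNorm_comp_comp_le _ (ContinuousLinearMap.id ℂ _) hW' (fun _ => le_rfl) _
  have hBa : (adjoint W).comp T.1 = CFC.abs T.1 := h2
  have hP : (CFC.abs T.1).IsPositive := (nonneg_iff_isPositive _).1 (CFC.abs_nonneg _)
  have hPs : adjoint (CFC.abs T.1) = CFC.abs T.1 := by
    rw [← star_eq_adjoint]; exact (CFC.abs_nonneg T.1).star_eq
  have hTa : adjoint T.1 = (CFC.abs T.1).comp (adjoint W) := by
    rw [← h1]; change adjoint (W.comp _) = _; rw [adjoint_comp, hPs, h1]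
  have hTW : T.1 = W.comp (CFC.abs T.1) := h1.symm
  have hS : traceNorm (adjoint T.1) < ⊤ := by
    rw [hTa, ← hBa]
    exact ((traceNorm_comp_comp_le (adjoint W) (adjoint W) hW' hW' T.1)).trans_lt T.2
  let A : TraceClass ι := ⟨T.1.comp (adjoint W), hA.trans_lt T.2⟩
  let B : TraceClass ι := ⟨(adjoint W).comp T.1, hB.trans_lt T.2⟩
  let S : TraceClass ι := ⟨adjoint T.1, hS⟩
  have hb : BlockPositive ![![A, T], ![S, B]] := by
    intro v
    have h0 := hP.inner_nonneg_right (adjoint W (v 0) + v 1)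
    have hT1 : ∀ x, T.1 x = W (CFC.abs T.1 x) := fun x => congrArg (fun R => R x) hTW
    have hT2 : ∀ x, adjoint T.1 x = CFC.abs T.1 (adjoint W x) := fun x => congrArg (fun R => R x) hTa
    have hT3 : ∀ x, adjoint W (T.1 x) = CFC.abs T.1 x := fun x => congrArg (fun R => R x) hBa
    have e1 : (A.1 : L2 ι → L2 ι) = fun x => W (CFC.abs T.1 (adjoint W x)) :=
      funext fun x => hT1 _
    have e2 : (B.1 : L2 ι → L2 ι) = fun x => CFC.abs T.1 x := funext hT3
    have e3 : (S.1 : L2 ι → L2 ι) = fun x => CFC.abs T.1 (adjoint W x) := funext hT2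
    simp only [Fin.sum_univ_two, Matrix.cons_val_zero, Matrix.cons_val_one, e1, e2, e3, hT1]
    rw [map_add, inner_add_left, inner_add_right, inner_add_right] at h0
    simpa only [adjoint_inner_left] using h0
  have hb' := hN.1 2 _ hb
  obtain ⟨hA', hB', -, -⟩ := blockPositive_two hb
  refine ⟨A, S, B, rfl, hA, hB, hA', hB', ?_⟩
  convert hb' using 1
  ext i j
  fin_cases i <;> fin_cases j <;> rfl

/-- Channels are contractive in the trace norm: a channel preserves the trace of the diagonal blocks of
a positive block matrix, and these bound the off-diagonal block. -/
theorem traceNorm_le (hN : IsCPTP N) (T : TraceClass ι) : traceNorm (N T).1 ≤ traceNorm T.1 := by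
  obtain ⟨A, S, B, -, hA, hB, hA', hB', hb⟩ := hN.blocks T
  obtain ⟨hNA, hNB, -, h⟩ := blockPositive_two hb
  have key : ∀ A : TraceClass ι, A.1.IsPositive → (N A).1.IsPositive →
      traceNorm (N A).1 = traceNorm A.1 := by
    intro A h1 h2
    rw [traceNorm_of_isPositive _ h1, traceNorm_of_isPositive _ h2, hN.2]
  obtain ⟨W, hW, hT⟩ := exists_traceNorm_le (N T).1
  have h2 : 2 * ∑' i, ‖⟪W (ket i), (N T).1 (ket i)⟫_ℂ‖ₑ ≤ 2 * traceNorm T.1 := by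
    rw [← ENNReal.tsum_mul_left]
    calc _ ≤ ∑' i, (‖⟪W (ket i), (N A).1 (W (ket i))⟫_ℂ‖ₑ + ‖⟪ket i, (N B).1 (ket i)⟫_ℂ‖ₑ) := by
          refine ENNReal.tsum_le_tsum fun i => ?_
          have := h (W (ket i)) (ket i)
          rw [← ofReal_norm, ← ofReal_norm, ← ofReal_norm, ← ENNReal.ofReal_add (norm_nonneg _)
            (norm_nonneg _), ← ENNReal.ofReal_ofNat 2, ← ENNReal.ofReal_mul (by norm_num)]
          exact ENNReal.ofReal_le_ofReal this
      _ ≤ traceNorm (N A).1 + traceNorm (N B).1 := by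
          rw [ENNReal.tsum_add]
          exact add_le_add (tsum_inner_le _ (isBessel_polar hW) (isBessel_polar hW))
            (tsum_inner_le _ isBessel_ket isBessel_ket)
      _ ≤ traceNorm T.1 + traceNorm T.1 := by
          rw [key A hA' hNA, key B hB' hNB]; exact add_le_add hA hB
      _ = _ := (two_mul _).symm
  refine hT.trans ?_
  exact (ENNReal.mul_le_mul_iff_right (by simp) (by simp)).1 h2

end IsCPTP

/-- Bounded maps on trace-class operators are determined by rank-one operators built from a set of
vectors with dense span. -/
theorem ext_dyads {D : Set (L2 ι)} (hD : (Submodule.span ℂ D).topologicalClosure = ⊤)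
    {M N : TraceClass ι →ₗ[ℂ] TraceClass κ} (hM : ∀ T, traceNorm (M T).1 ≤ traceNorm T.1)
    (hN : ∀ T, traceNorm (N T).1 ≤ traceNorm T.1)
    (h : ∀ x ∈ D, ∀ y ∈ D, M (dyadTC x y) = N (dyadTC x y)) : M = N := by
  ext1 T
  refine Subtype.ext (eq_of_traceNorm_le fun ε hε => ?_)
  obtain ⟨S, hS, h1⟩ := traceClosure_span_dyads hD T (ε / 2) (ENNReal.half_pos hε.ne')
  have h2 : M S = N S := by
    have : Submodule.span ℂ {T | ∃ x ∈ D, ∃ y ∈ D, T = dyadTC x y} ≤ LinearMap.eqLocus M N :=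
      Submodule.span_le.2 (by rintro _ ⟨x, hx, y, hy, rfl⟩; exact h x hx y hy)
    exact this hS
  have h3 : (M T).1 - (N T).1 = (M (T - S)).1 - (N (T - S)).1 := by
    simp [map_sub, h2]
  rw [h3, ← ENNReal.add_halves ε]
  exact (traceNorm_sub_le _ _).trans (add_le_add ((hM _).trans h1) ((hN _).trans h1))

theorem isCPTP_sandwich (A : L2 ι →L[ℂ] L2 κ) (hA : (adjoint A).comp A = ContinuousLinearMap.id ℂ _) :
    IsCPTP (sandwich A (adjoint A)) := by
  refine ⟨fun k T hT v => ?_, fun T => ?_⟩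
  · have := hT fun i => adjoint A (v i)
    simp only [adjoint_inner_left] at this
    exact this
  · obtain ⟨x, y, h⟩ := exists_hasDyads T
    have h1 := (h.comp_left A (adjoint A)).hasSum_trace
    rw [adjoint_adjoint] at h1
    refine h1.unique ?_
    convert h.hasSum_trace using 2 with k
    rw [← adjoint_inner_right]
    exact congrArg _ (congrArg (fun R => R (x k)) hA)

/-! ### Partial traces -/

section BlockTrace
variable {ρ : Type} {g : ρ → ι → κ}

theorem injective_section (hg : Function.Injective (Function.uncurry g)) (r : ρ) :
    Function.Injective (g r) := fun i j h => (Prod.mk.inj (hg (a₁ := (r, i)) (a₂ := (r, j)) h)).2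

/-- The partial trace over `ρ` of operators on `ℓ²(ρ × ι) ≅ ℓ²(κ)`. -/
def blockTrace (hg : Function.Injective (Function.uncurry g)) : TraceClass κ →ₗ[ℂ] TraceClass ι where
  toFun S := ⟨∑' r, (adjoint (embed (injective_section hg r))).comp
      (S.1.comp (embed (injective_section hg r))),
    (traceNorm_tsum_le _ (summable_partialTrace hg _ (fun r i => embed_ket _ i) S)).trans_lt
      ((tsum_traceNorm_le hg _ (fun r i => embed_ket _ i) S.1).trans_lt S.2)⟩
  map_add' S T := by
    apply Subtype.ext
    have hS := summable_partialTrace hg _ (fun r i => embed_ket (injective_section hg r) i) S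
    have hT := summable_partialTrace hg _ (fun r i => embed_ket (injective_section hg r) i) T
    simp only [Submodule.coe_add]
    rw [← hS.tsum_add hT]
    simp only [add_comp, comp_add]
  map_smul' c S := by
    apply Subtype.ext
    simp only [SetLike.val_smul, RingHom.id_apply, smul_comp, comp_smul]
    exact tsum_const_smul'' c

theorem hasSum_blockTrace (hg : Function.Injective (Function.uncurry g)) (S : TraceClass κ)
    (u v : L2 ι) : HasSum (fun r => ⟪embed (injective_section hg r) u,
      S.1 (embed (injective_section hg r) v)⟫_ℂ) ⟪u, (blockTrace hg S).1 v⟫_ℂ := by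
  have hS := (summable_partialTrace hg _ (fun r i => embed_ket (injective_section hg r) i) S).hasSum
  have := (hS.mapL (ContinuousLinearMap.apply ℂ (L2 ι) v)).mapL (innerSL ℂ u)
  simp only [apply_apply, innerSL_apply_apply, comp_apply, adjoint_inner_right] at this
  exact this

theorem isCPTP_blockTrace (hg : Function.Bijective (Function.uncurry g)) :
    IsCPTP (blockTrace hg.1) := by
  refine ⟨fun k T hT v => ?_, fun T => ?_⟩
  · have h1 : HasSum (fun r => ∑ i, ∑ j, ⟪embed (injective_section hg.1 r) (v i),
      (T i j).1 (embed (injective_section hg.1 r) (v j))⟫_ℂ)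
        (∑ i, ∑ j, ⟪v i, (blockTrace hg.1 (T i j)).1 (v j)⟫_ℂ) :=
      hasSum_sum fun i _ => hasSum_sum fun j _ => hasSum_blockTrace hg.1 _ _ _
    exact h1.nonneg fun r => hT _
  · have h1 := (hasSum_trace T)
    have h2 : HasSum (fun p : ρ × ι => ⟪ket (g p.1 p.2), T.1 (ket (g p.1 p.2))⟫_ℂ) (trace T.1) :=
      (Equiv.ofBijective _ hg).hasSum_iff.2 h1
    have h3 := hasSum_swap (F := fun r i => ⟪ket (g r i), T.1 (ket (g r i))⟫_ℂ) h2.summable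
      (fun r => (h2.summable.prod_factor r).hasSum) (fun i => by
        have := hasSum_blockTrace hg.1 T (ket i) (ket i)
        simp only [embed_ket] at this
        exact this)
    exact h3.2.unique (h2.prod_fiberwise fun r => (h2.summable.prod_factor r).hasSum)

end BlockTrace

theorem hasSum_of_eq {f g : κ → ℂ} {a : ℂ} (h : ∀ k, f k = g k) (hf : HasSum f a) :
    HasSum g a := by
  rwa [← funext h]

theorem tendsto_sum_of_hasSum {f : κ → ℂ} {a : ℂ} (h : HasSum f a) :
    Filter.Tendsto (fun s => ∑ k ∈ s, f k) Filter.atTop (nhds a) := by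
  rwa [HasSum, SummationFilter.unconditional_filter] at h

/-! ### Stinespring dilation -/

theorem adjoint_embed_ket {f : ι → κ} (hf : Function.Injective f) (i : ι) :
    adjoint (embed hf) (ket (f i)) = ket i := by
  classical
  refine ext_ket fun j => ?_
  rw [adjoint_inner_right, embed_ket, inner_ket_ket, inner_ket_ket]
  simp [hf.eq_iff]

theorem adjoint_embed_ket_of_notMem {f : ι → κ} (hf : Function.Injective f) {k : κ}
    (hk : ∀ i, f i ≠ k) : adjoint (embed hf) (ket k) = 0 := by
  classical
  refine ext_ket fun j => ?_
  rw [adjoint_inner_right, embed_ket, inner_ket_ket, inner_zero_right, if_neg (hk j)]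

theorem norm_embed {f : ι → κ} (hf : Function.Injective f) (x : L2 ι) : ‖embed hf x‖ = ‖x‖ :=
  norm_isometryOf _ x

theorem adjoint_comp_isometryOf {E : Type} [NormedAddCommGroup E] [InnerProductSpace ℂ E]
    [CompleteSpace E] {v : ι → E} (hv : Orthonormal ℂ v) :
    (adjoint (isometryOf hv)).comp (isometryOf hv) = ContinuousLinearMap.id ℂ _ := by
  classical
  refine ext_matrix fun i j => ?_
  rw [comp_apply, adjoint_inner_right, isometryOf_ket, isometryOf_ket, id_apply, inner_ket_ket]
  exact orthonormal_iff_ite.1 hv i j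

theorem sandwich_dyad (A : L2 ι →L[ℂ] L2 κ) (x y : L2 ι) :
    sandwich A (adjoint A) (dyadTC x y) = dyadTC (A x) (A y) := by
  apply Subtype.ext
  ext1 v
  change A (dyad x y (adjoint A v)) = dyad (A x) (A y) v
  rw [dyad_apply, dyad_apply, map_smul, adjoint_inner_right]

theorem IsCPTP.norm_le_one {N : TraceClass ι →ₗ[ℂ] TraceClass κ} (hN : IsCPTP N) (i j : ι) :
    ‖(N (ketbra i j)).1‖ ≤ 1 := by
  have h := (enorm_opNorm_le _).trans ((hN.traceNorm_le (ketbra i j)).trans (traceNorm_dyad_le _ _))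
  rw [← ofReal_norm, ← ofReal_norm, ← ofReal_norm, norm_ket, norm_ket, ← ENNReal.ofReal_mul
    zero_le_one, ENNReal.ofReal_le_ofReal_iff (by norm_num)] at h
  simpa using h

theorem blockPositive_ketbra (n : ℕ) : BlockPositive fun i j : Fin n => ketbra (i : ℕ) (j : ℕ) := by
  intro v
  have : ∑ i : Fin n, ∑ j : Fin n, ⟪v i, (ketbra (i : ℕ) (j : ℕ)).1 (v j)⟫_ℂ =
      (∑ i : Fin n, ⟪v i, ket (i : ℕ)⟫_ℂ) * (starRingEnd ℂ) (∑ i : Fin n, ⟪v i, ket (i : ℕ)⟫_ℂ) := by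
    rw [map_sum, Finset.sum_mul_sum]
    refine Finset.sum_congr rfl fun i _ => Finset.sum_congr rfl fun j _ => ?_
    rw [inner_conj_symm, ← inner_dyad]; rfl
  rw [this, Complex.mul_conj]
  exact Complex.zero_le_real.2 (Complex.normSq_nonneg _)

theorem prodMk_injective (i : ι) : Function.Injective (fun k : κ => (i, k)) := fun _ _ h =>
  (Prod.mk.inj h).2

theorem swap_bijective : Function.Bijective (Function.uncurry fun (r : κ) (k : ι) => (k, r)) :=
  (Equiv.prodComm κ ι).bijective

/-- The Choi operator of a channel, damped by `2^(-i-j)` to make it bounded, and its square root. -/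
theorem exists_choi_sqrt {N : TraceClass ℕ →ₗ[ℂ] TraceClass ℕ} (hN : IsChannel N) :
    ∃ Q : L2 (ℕ × ℕ) →L[ℂ] L2 (ℕ × ℕ), ∀ i j k l : ℕ, ⟪Q (ket (i, k)), Q (ket (j, l))⟫_ℂ =
      (2⁻¹ : ℂ) ^ i * (2⁻¹ : ℂ) ^ j * ⟪ket k, (N (ketbra i j)).1 (ket l)⟫_ℂ := by
  have hN' : IsCPTP N := hN
  let E : ℕ → L2 ℕ →L[ℂ] L2 (ℕ × ℕ) := fun i => embed (prodMk_injective (κ := ℕ) i)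
  let B : ℕ × ℕ → L2 (ℕ × ℕ) →L[ℂ] L2 (ℕ × ℕ) := fun p =>
    ((2⁻¹ : ℂ) ^ p.1 * (2⁻¹ : ℂ) ^ p.2) • (E p.1).comp ((N (ketbra p.1 p.2)).1.comp (adjoint (E p.2)))
  have hE : ∀ i x, ‖E i x‖ = ‖x‖ := fun i x => norm_embed _ x
  have hE' : ∀ i x, ‖adjoint (E i) x‖ ≤ ‖x‖ := fun i x =>
    norm_adjoint_apply_le _ (fun x => (hE i x).le) x
  have hB : Summable B := by
    have h2 : Summable fun p : ℕ × ℕ => (2⁻¹ : ℝ) ^ p.1 * (2⁻¹ : ℝ) ^ p.2 :=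
      summable_mul_of_summable_norm (by simpa using summable_geometric_two)
        (by simpa using summable_geometric_two)
    refine Summable.of_norm_bounded h2 fun p => ?_
    rw [norm_smul, norm_mul, norm_pow, norm_pow, norm_inv]
    refine (mul_le_of_le_one_right (by positivity) ?_).trans (by simp)
    refine ContinuousLinearMap.opNorm_le_bound _ zero_le_one fun x => ?_
    rw [comp_apply, comp_apply, hE]
    refine (le_opNorm _ _).trans ?_
    gcongr
    · exact hN'.norm_le_one _ _
    · exact hE' _ _
  have hP : ∀ u v, HasSum (fun p : ℕ × ℕ => (2⁻¹ : ℂ) ^ p.1 * (2⁻¹ : ℂ) ^ p.2 *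
      ⟪adjoint (E p.1) u, (N (ketbra p.1 p.2)).1 (adjoint (E p.2) v)⟫_ℂ) ⟪u, (∑' p, B p) v⟫_ℂ := by
    intro u v
    have := (hB.hasSum.mapL (ContinuousLinearMap.apply ℂ (L2 (ℕ × ℕ)) v)).mapL (innerSL ℂ u)
    simpa only [B, apply_apply, innerSL_apply_apply, smul_apply, comp_apply, adjoint_inner_left,
      inner_smul_right] using this
  set P := ∑' p, B p with hPd
  have hPpos : P.IsPositive := by
    refine isPositive_of_inner fun v => ?_
    have h0 := Filter.tendsto_finset_range.prodMk Filter.tendsto_finset_range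
    rw [Filter.prod_atTop_atTop_eq] at h0
    have h1 := (tendsto_sum_of_hasSum (hP v v)).comp (Filter.tendsto_finsetProd_atTop.comp h0)
    refine ge_of_tendsto' h1 fun n => ?_
    -- Partial sums over squares are the values of complete positivity on `∑ᵢⱼ |i⟩⟨j| ⊗ |i⟩⟨j|`.
    have h2 := hN'.1 n _ (blockPositive_ketbra n)
      (fun i => ((2⁻¹ : ℂ) ^ (i : ℕ)) • adjoint (E i) v)
    simp only [map_smul, inner_smul_left, inner_smul_right] at h2
    rw [Function.comp_apply, Function.comp_apply, Finset.sum_product, Finset.sum_range]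
    convert h2 using 2 with i _
    rw [Finset.sum_range]
    refine Finset.sum_congr rfl fun j _ => ?_
    simp only [map_pow, map_inv₀, map_ofNat]
    ring
  have h0 : 0 ≤ P := (nonneg_iff_isPositive _).2 hPpos
  have hQ : CFC.sqrt P * CFC.sqrt P = P := CFC.sqrt_mul_sqrt_self _ h0
  have hQs : adjoint (CFC.sqrt P) = CFC.sqrt P := by
    rw [← star_eq_adjoint]; exact (CFC.sqrt_nonneg P).star_eq
  refine ⟨CFC.sqrt P, fun i j k l => ?_⟩
  rw [← adjoint_inner_right, hQs, ← mul_apply_eq_comp, hQ]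
  refine (hP _ _).unique ?_
  have h3 : ∀ i j k : ℕ, adjoint (E i) (ket (j, k)) = if i = j then ket k else 0 := by
    intro i j k
    split_ifs with h
    · subst h; exact adjoint_embed_ket (prodMk_injective (κ := ℕ) i) k
    · exact adjoint_embed_ket_of_notMem _ fun m hm => h (Prod.mk.inj hm).1
  convert hasSum_single (i, j) ?_ using 1
  · simp [h3]
  · rintro ⟨a, b⟩ hab
    simp only [h3]
    by_cases ha : a = i
    · have hb : b ≠ j := fun hb => hab (by rw [ha, hb])
      simp [hb]
    · simp [ha]

/-- Every channel is an isometry followed by a partial trace. The coordinates of the isometry are the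
matrix elements of the square root of the Choi operator, with the damping undone. -/
theorem exists_stinespring {N : TraceClass ℕ →ₗ[ℂ] TraceClass ℕ} (hN : IsChannel N) :
    ∃ (v : ℕ → L2 (ℕ × ℕ × ℕ)) (hv : Orthonormal ℂ v),
      N = (blockTrace (swap_bijective (ι := ℕ) (κ := ℕ × ℕ)).1).comp
        (sandwich (isometryOf hv) (adjoint (isometryOf hv))) := by
  have hN' : IsCPTP N := hN
  obtain ⟨Q, hQ⟩ := exists_choi_sqrt hN
  have h2 : ∀ i : ℕ, (2 : ℂ) ^ i * (2⁻¹ : ℂ) ^ i = 1 := fun i => by rw [← mul_pow]; norm_num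
  have hQ' : ∀ i j k l : ℕ, (2 : ℂ) ^ i * (2 : ℂ) ^ j * ⟪Q (ket (i, k)), Q (ket (j, l))⟫_ℂ =
      ⟪ket k, (N (ketbra i j)).1 (ket l)⟫_ℂ := by
    intro i j k l
    rw [hQ]
    linear_combination (⟪ket k, (N (ketbra i j)).1 (ket l)⟫_ℂ * (2 : ℂ) ^ j * (2⁻¹ : ℂ) ^ j) * h2 i +
      ⟪ket k, (N (ketbra i j)).1 (ket l)⟫_ℂ * h2 j
  have hsum : ∀ i : ℕ, Summable fun k => ‖Q (ket (i, k))‖ ^ 2 := by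
    intro i
    have h1 := (hasSum_trace (N (ketbra i i))).summable.norm.mul_left (‖(2⁻¹ : ℂ) ^ i * (2⁻¹ : ℂ) ^ i‖)
    refine h1.congr fun k => ?_
    rw [← norm_mul, ← hQ, inner_self_eq_norm_sq_to_K]
    simp
  let f : ℕ → ℕ × ℕ × ℕ → ℂ := fun i p => (2 : ℂ) ^ i * ⟪Q (ket (i, p.1)), ket p.2⟫_ℂ
  have hf : ∀ i, Summable fun p => ‖f i p‖ ^ 2 := by
    intro i
    have := (summable_coord_sq (hsum i)).mul_left (‖(2 : ℂ) ^ i‖ ^ 2)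
    refine this.congr fun p => ?_
    rw [norm_mul, mul_pow, norm_inner_symm]
  let v : ℕ → L2 (ℕ × ℕ × ℕ) := fun i => ofCoord (f i) (hf i)
  have hvc : ∀ i p, ⟪ket p, v i⟫_ℂ = f i p := fun i p => inner_ket_ofCoord _ _ _
  have hvc' : ∀ i p, ⟪v i, ket p⟫_ℂ = (2 : ℂ) ^ i * ⟪ket p.2, Q (ket (i, p.1))⟫_ℂ := fun i p => by
    rw [← inner_conj_symm, hvc]
    simp only [f, map_mul, map_pow, map_ofNat, inner_conj_symm]
  -- Trace preservation is orthonormality of the vectors `v i`.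
  have hv : Orthonormal ℂ v := by
    rw [orthonormal_iff_ite]
    intro i j
    have h1 := hasSum_inner (v i) (v j)
    have h3 := h1.prod_fiberwise (g := fun k => ⟪ket k, (N (ketbra j i)).1 (ket k)⟫_ℂ) (fun k => by
      have := (hasSum_inner (Q (ket (j, k))) (Q (ket (i, k)))).mul_left ((2 : ℂ) ^ j * (2 : ℂ) ^ i)
      rw [hQ'] at this
      refine hasSum_of_eq (fun r => ?_) this
      rw [hvc, hvc']
      simp only [f]
      ring)
    have h4 := hasSum_trace (N (ketbra j i))
    rw [hN.2] at h4
    rw [h3.unique h4]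
    change trace (dyad (ket j) (ket i)) = _
    rw [trace_dyad, inner_ket_ket]
  refine ⟨v, hv, ?_⟩
  have hM : IsCPTP ((blockTrace (swap_bijective (ι := ℕ) (κ := ℕ × ℕ)).1).comp
        (sandwich (isometryOf hv) (adjoint (isometryOf hv)))) :=
    (isCPTP_blockTrace swap_bijective).comp (isCPTP_sandwich _ (adjoint_comp_isometryOf hv))
  refine ext_dyads (D := Set.range ket) span_ket_closure hN'.traceNorm_le hM.traceNorm_le ?_
  rintro _ ⟨i, rfl⟩ _ ⟨j, rfl⟩
  refine Subtype.ext (ext_matrix fun k l => ?_)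
  have h1 := hasSum_blockTrace (swap_bijective (ι := ℕ) (κ := ℕ × ℕ)).1
    (dyadTC (v i) (v j)) (ket k) (ket l)
  rw [LinearMap.comp_apply, sandwich_dyad, isometryOf_ket, isometryOf_ket]
  refine HasSum.unique ?_ h1
  have := (hasSum_inner (Q (ket (i, k))) (Q (ket (j, l)))).mul_left ((2 : ℂ) ^ i * (2 : ℂ) ^ j)
  rw [hQ'] at this
  refine hasSum_of_eq (fun r => ?_) this
  rw [embed_ket, embed_ket, dyadTC_val, inner_dyad, hvc, hvc']
  simp only [f]
  ring

/-- Kraus vectors: `N(|i⟩⟨j|) = ∑ᵣ |xᵢᵣ⟩⟨xⱼᵣ|`. -/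
theorem exists_kraus {N : TraceClass ℕ →ₗ[ℂ] TraceClass ℕ} (hN : IsChannel N) :
    ∃ x : ℕ → ℕ × ℕ → L2 ℕ, ∀ i j, HasDyads (N (ketbra i j)).1 (x i) (x j) := by
  obtain ⟨v, hv, hNv⟩ := exists_stinespring hN
  let J := fun r : ℕ × ℕ => embed (injective_section (swap_bijective (ι := ℕ) (κ := ℕ × ℕ)).1 r)
  have h : ∀ i j u w, HasSum (fun r => ⟪u, adjoint (J r) (v i)⟫_ℂ * ⟪adjoint (J r) (v j), w⟫_ℂ)
      ⟪u, (N (ketbra i j)).1 w⟫_ℂ := by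
    intro i j u w
    have h1 := hasSum_blockTrace (swap_bijective (ι := ℕ) (κ := ℕ × ℕ)).1
      (dyadTC (v i) (v j)) u w
    rw [hNv, LinearMap.comp_apply, ← dyadTC_ket, sandwich_dyad, isometryOf_ket, isometryOf_ket]
    simpa only [dyadTC_val, inner_dyad, adjoint_inner_left, adjoint_inner_right] using h1
  have hs : ∀ i, Summable fun r => ‖adjoint (J r) (v i)‖ ^ 2 := by
    intro i
    refine summable_norm_sq_of_enorm (ne_of_lt ((tsum_norm_adjoint_le
      (swap_bijective (ι := ℕ) (κ := ℕ × ℕ)).1 J (fun r k => embed_ket _ _) (v i)).trans_lt ?_))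
    exact ENNReal.pow_lt_top enorm_lt_top
  exact ⟨fun i r => adjoint (J r) (v i), fun i j => ⟨hs i, hs j, h i j⟩⟩

/-! ### Product vectors -/

theorem hasSum_mul_prod {f : κ → ℂ} {g : μ → ℂ} {a b : ℂ} (hf : HasSum f a) (hg : HasSum g b) :
    HasSum (fun p : κ × μ => f p.1 * g p.2) (a * b) :=
  hf.mul hg (summable_mul_of_summable_norm hf.summable.norm hg.summable.norm)

theorem hasSum_pi_prod {n : ℕ} {f : Fin n → κ → ℂ} {s : Fin n → ℂ} (h : ∀ j, HasSum (f j) (s j)) :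
    HasSum (fun k : Fin n → κ => ∏ j, f j (k j)) (∏ j, s j) := by
  induction n with
  | zero => simp
  | succ n ih =>
    have h1 := ih (f := fun j => f j.succ) (s := fun j => s j.succ) fun j => h _
    have h2 := hasSum_mul_prod (h 0) h1
    rw [← Fin.prod_univ_succ (f := s)] at h2
    rw [← (Fin.consEquiv fun _ => κ).hasSum_iff]
    refine hasSum_of_eq (fun p => ?_) h2
    simp [Fin.prod_univ_succ, Fin.consEquiv]

theorem summable_productVector {n : ℕ} (x : Fin n → L2 κ) :
    Summable fun k : Fin n → κ => ‖∏ j, ⟪ket (k j), x j⟫_ℂ‖ ^ 2 := by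
  have h := hasSum_pi_prod (f := fun j k => ((‖⟪ket k, x j⟫_ℂ‖ ^ 2 : ℝ) : ℂ))
    fun j => Complex.hasSum_ofReal.2 (hasSum_norm_sq (x j))
  refine h.summable.norm.congr fun k => ?_
  rw [norm_prod, norm_prod, ← Finset.prod_pow]
  refine Finset.prod_congr rfl fun j _ => ?_
  rw [Complex.norm_real, norm_pow, norm_norm]

/-- The product vector `x₁ ⊗ ⋯ ⊗ xₙ`. -/
def productVector {n : ℕ} (x : Fin n → L2 κ) : L2 (Fin n → κ) := ofCoord _ (summable_productVector x)

theorem inner_ket_productVector {n : ℕ} (x : Fin n → L2 κ) (k : Fin n → κ) :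
    ⟪ket k, productVector x⟫_ℂ = ∏ j, ⟪ket (k j), x j⟫_ℂ := inner_ket_ofCoord _ _ _

theorem inner_productVector {n : ℕ} (x y : Fin n → L2 κ) :
    ⟪productVector x, productVector y⟫_ℂ = ∏ j, ⟪x j, y j⟫_ℂ := by
  refine (hasSum_inner _ _).unique (hasSum_of_eq (fun k => ?_)
    (hasSum_pi_prod fun j => hasSum_inner (x j) (y j)))
  rw [← inner_conj_symm (productVector x), inner_ket_productVector, inner_ket_productVector, map_prod,
    ← Finset.prod_mul_distrib]
  simp only [inner_conj_symm]

theorem norm_productVector {n : ℕ} (x : Fin n → L2 κ) : ‖productVector x‖ = ∏ j, ‖x j‖ := by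
  have h := inner_productVector x x
  simp only [inner_self_eq_norm_sq_to_K] at h
  have h2 : ‖productVector x‖ ^ 2 = (∏ j, ‖x j‖) ^ 2 := by
    rw [← Finset.prod_pow]; exact_mod_cast h
  exact (sq_eq_sq₀ (norm_nonneg _) (Finset.prod_nonneg fun _ _ => norm_nonneg _)).1 h2

theorem productVector_ket {n : ℕ} (k : Fin n → κ) : productVector (fun j => ket (k j)) = ket k := by
  classical
  refine ext_ket fun l => ?_
  rw [inner_ket_productVector, inner_ket_ket]
  simp only [inner_ket_ket]
  rw [Finset.prod_boole]
  simp [funext_iff]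

theorem prod_update_apply {n : ℕ} {E : Type} (φ : Fin n → E → ℂ) (x : Fin n → E) (j : Fin n) (y : E) :
    ∏ i, φ i (Function.update x j y i) = φ j y * ∏ i ∈ Finset.univ.erase j, φ i (x i) := by
  rw [← Finset.mul_prod_erase _ _ (Finset.mem_univ j), Function.update_self]
  congr 1
  refine Finset.prod_congr rfl fun i hi => ?_
  rw [Function.update_of_ne (Finset.ne_of_mem_erase hi)]

/-- The product vector is linear and continuous in each factor. -/
theorem exists_slot {n : ℕ} (x : Fin n → L2 κ) (j : Fin n) :
    ∃ L : L2 κ →L[ℂ] L2 (Fin n → κ), ∀ y, productVector (Function.update x j y) = L y := by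
  let L₀ : L2 κ →ₗ[ℂ] L2 (Fin n → κ) :=
    { toFun := fun y => productVector (Function.update x j y)
      map_add' := fun y y' => ext_ket fun k => by
        rw [inner_add_right]
        simp only [inner_ket_productVector]
        simp only [prod_update_apply (fun i v => ⟪ket (k i), v⟫_ℂ), inner_add_right, add_mul]
      map_smul' := fun c y => ext_ket fun k => by
        rw [RingHom.id_apply, inner_smul_right]
        simp only [inner_ket_productVector]
        simp only [prod_update_apply (fun i v => ⟪ket (k i), v⟫_ℂ), inner_smul_right, mul_assoc] }
  refine ⟨L₀.mkContinuous (∏ i ∈ Finset.univ.erase j, ‖x i‖) fun y => ?_, fun y => rfl⟩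
  change ‖productVector (Function.update x j y)‖ ≤ _
  have h := prod_update_apply (fun _ v => ((‖v‖ : ℝ) : ℂ)) x j y
  rw [norm_productVector, mul_comm]
  exact le_of_eq (by exact_mod_cast h)

/-- Two functions which are linear and continuous in each of `n` arguments are equal if they agree on
a set with dense span. -/
theorem multilinear_ext {n : ℕ} {E F : Type} [NormedAddCommGroup E] [NormedSpace ℂ E]
    [NormedAddCommGroup F] [NormedSpace ℂ F] {D : Set E}
    (hD : (Submodule.span ℂ D).topologicalClosure = ⊤) {f g : (Fin n → E) → F}
    (hf : ∀ x j, ∃ L : E →L[ℂ] F, ∀ y, f (Function.update x j y) = L y)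
    (hg : ∀ x j, ∃ L : E →L[ℂ] F, ∀ y, g (Function.update x j y) = L y)
    (h : ∀ x, (∀ j, x j ∈ D) → f x = g x) (x : Fin n → E) : f x = g x := by
  have key : ∀ (s : Finset (Fin n)) (x : Fin n → E), (∀ j, j ∉ s → x j ∈ D) → f x = g x := by
    intro s
    induction s using Finset.induction_on with
    | empty => exact fun x hx => h x fun j => hx j (Finset.notMem_empty j)
    | insert a s ha ih =>
      intro x hx
      obtain ⟨L, hL⟩ := hf x a
      obtain ⟨L', hL'⟩ := hg x a
      have : L = L' := by
        refine ext_op_dense hD fun y hy => ?_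
        rw [← hL, ← hL']
        refine ih _ fun j hj => ?_
        by_cases hja : j = a
        · subst hja; rwa [Function.update_self]
        · rw [Function.update_of_ne hja]
          exact hx j (by simp [hja, hj])
      have h1 := hL (x a)
      have h2 := hL' (x a)
      rw [Function.update_eq_self] at h1 h2
      rw [h1, h2, this]
  exact key Finset.univ x fun j hj => absurd (Finset.mem_univ j) hj

theorem ext_productVector {n : ℕ} {E : Type} [NormedAddCommGroup E] [InnerProductSpace ℂ E]
    {D : Set (L2 κ)} (hD : (Submodule.span ℂ D).topologicalClosure = ⊤)
    {A B : L2 (Fin n → κ) →L[ℂ] E}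
    (h : ∀ x : Fin n → L2 κ, (∀ j, x j ∈ D) → A (productVector x) = B (productVector x)) : A = B := by
  refine ext_op fun k => ?_
  rw [← productVector_ket]
  refine multilinear_ext hD (f := fun x => A (productVector x)) (g := fun x => B (productVector x))
    (fun x j => ?_) (fun x j => ?_) h _
  all_goals
    obtain ⟨L, hL⟩ := exists_slot x j
  · exact ⟨A.comp L, fun y => by rw [hL]; rfl⟩
  · exact ⟨B.comp L, fun y => by rw [hL]; rfl⟩

theorem span_productVector {n : ℕ} {D : Set (L2 κ)}
    (hD : (Submodule.span ℂ D).topologicalClosure = ⊤) :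
    (Submodule.span ℂ {v | ∃ x : Fin n → L2 κ, (∀ j, x j ∈ D) ∧ v = productVector x}).topologicalClosure
      = ⊤ := by
  rw [Submodule.topologicalClosure_eq_top_iff, Submodule.eq_bot_iff]
  intro u hu
  have h0 : innerSL ℂ u = 0 := by
    refine ext_productVector hD fun x hx => ?_
    rw [innerSL_apply_apply, zero_apply]
    have := (Submodule.mem_orthogonal _ _).1 hu (productVector x) (Submodule.subset_span ⟨x, hx, rfl⟩)
    rw [← inner_conj_symm, this, map_zero]
  have := congrArg (fun T => T u) h0
  simpa using this

/-! ### Tensor products of operators -/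

namespace IsTensor
variable {n : ℕ} {T : Fin n → L2 ℕ →L[ℂ] L2 ℕ} {S : L2 (Fin n → ℕ) →L[ℂ] L2 (Fin n → ℕ)}

theorem apply_productVector (h : IsTensor T S) (x : Fin n → L2 ℕ) :
    S (productVector x) = productVector fun j => T j (x j) := by
  have key : ∀ k, ⟪ket k, S (productVector x)⟫_ℂ = ∏ j, ⟪ket (k j), T j (x j)⟫_ℂ := by
    intro k
    refine multilinear_ext (span_ket_closure (ι := ℕ)) (f := fun x => ⟪ket k, S (productVector x)⟫_ℂ)
      (g := fun x => ∏ j, ⟪ket (k j), T j (x j)⟫_ℂ) (fun x j => ?_) (fun x j => ?_) ?_ x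
    · obtain ⟨L, hL⟩ := exists_slot x j
      exact ⟨(innerSL ℂ (ket k)).comp (S.comp L), fun y => by rw [hL]; rfl⟩
    · refine ⟨(∏ i ∈ Finset.univ.erase j, ⟪ket (k i), T i (x i)⟫_ℂ) •
        (innerSL ℂ (ket (k j))).comp (T j), fun y => ?_⟩
      rw [prod_update_apply (fun i v => ⟪ket (k i), T i v⟫_ℂ), mul_comm]
      rfl
    · intro x hx
      choose l hl using hx
      have : x = fun j => ket (l j) := funext fun j => (hl j).symm
      subst this
      simp only [productVector_ket]
      exact h k l
  exact ext_ket fun k => by rw [key, inner_ket_productVector]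

theorem of_apply (h : ∀ l : Fin n → ℕ, S (ket l) = productVector fun j => T j (ket (l j))) :
    IsTensor T S := fun k l => by rw [h, inner_ket_productVector]

theorem inner (h : IsTensor T S) (x y : Fin n → L2 ℕ) :
    ⟪productVector x, S (productVector y)⟫_ℂ = ∏ j, ⟪x j, T j (y j)⟫_ℂ := by
  rw [h.apply_productVector, inner_productVector]

theorem comp (h : IsTensor T S) {T' : Fin n → L2 ℕ →L[ℂ] L2 ℕ}
    {S' : L2 (Fin n → ℕ) →L[ℂ] L2 (Fin n → ℕ)} (h' : IsTensor T' S') :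
    IsTensor (fun j => (T j).comp (T' j)) (S.comp S') := by
  refine of_apply fun l => ?_
  rw [comp_apply, ← productVector_ket, h'.apply_productVector, h.apply_productVector]
  rfl

theorem unique (h : IsTensor T S) {S' : L2 (Fin n → ℕ) →L[ℂ] L2 (Fin n → ℕ)} (h' : IsTensor T S') :
    S = S' := ext_matrix fun i j => by rw [h i j, h' i j]

theorem trace_eq (h : IsTensor T S)
    (hT : ∀ j, HasSum (fun i => ⟪ket i, T j (ket i)⟫_ℂ) (trace (T j))) :
    trace S = ∏ j, trace (T j) := by
  have := hasSum_pi_prod hT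
  simp only [← h _ _] at this
  exact this.tsum_eq

end IsTensor

theorem isTensor_dyad {n : ℕ} (x y : Fin n → L2 ℕ) :
    IsTensor (fun j => dyad (x j) (y j)) (dyad (productVector x) (productVector y)) := fun k l => by
  simp only [inner_dyad]
  rw [← productVector_ket k, ← productVector_ket l, inner_productVector, inner_productVector,
    Finset.prod_mul_distrib]

theorem orthonormal_productVector {n : ℕ} {v : Fin n → ι → L2 κ} (hv : ∀ j, Orthonormal ℂ (v j)) :
    Orthonormal ℂ fun k : Fin n → ι => productVector fun j => v j (k j) := by
  classical
  rw [orthonormal_iff_ite]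
  intro k l
  rw [inner_productVector]
  simp only [fun j => orthonormal_iff_ite.1 (hv j)]
  rw [Finset.prod_boole]
  simp [funext_iff]

/-- The tensor product of isometries `|i⟩ ↦ vⱼ i`. -/
def tensorIsometry {n : ℕ} {v : Fin n → ι → L2 κ} (hv : ∀ j, Orthonormal ℂ (v j)) :
    L2 (Fin n → ι) →L[ℂ] L2 (Fin n → κ) := isometryOf (orthonormal_productVector hv)

theorem tensorIsometry_ket {n : ℕ} {v : Fin n → ι → L2 κ} (hv : ∀ j, Orthonormal ℂ (v j))
    (k : Fin n → ι) : tensorIsometry hv (ket k) = productVector fun j => v j (k j) :=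
  isometryOf_ket _ k

theorem adjoint_tensorIsometry_ket {n : ℕ} {v : Fin n → ι → L2 κ} (hv : ∀ j, Orthonormal ℂ (v j))
    (k : Fin n → κ) : adjoint (tensorIsometry hv) (ket k) =
      productVector fun j => adjoint (isometryOf (hv j)) (ket (k j)) := by
  refine ext_ket fun l => ?_
  rw [adjoint_inner_right, tensorIsometry_ket, inner_ket_productVector, ← productVector_ket k,
    inner_productVector]
  simp only [adjoint_inner_right, isometryOf_ket]

/-- Tensor powers of channels exist: tensor the Stinespring isometry with itself and trace out all the
environments. -/
theorem exists_tensorPower {N : TraceClass ℕ →ₗ[ℂ] TraceClass ℕ} (hN : IsChannel N) (n : ℕ) :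
    ∃ M : TraceClass (Fin n → ℕ) →ₗ[ℂ] TraceClass (Fin n → ℕ), IsTensorPower N M := by
  obtain ⟨v, hv, hNv⟩ := exists_stinespring hN
  let g : (Fin n → ℕ × ℕ) → (Fin n → ℕ) → (Fin n → ℕ × ℕ × ℕ) := fun r k j => (k j, r j)
  have hg : Function.Bijective (Function.uncurry g) := by
    constructor
    · rintro ⟨r, k⟩ ⟨r', k'⟩ h
      have h' : ∀ j, (k j, r j) = (k' j, r' j) := fun j => congrFun h j
      exact Prod.ext (funext fun j => (Prod.mk.inj (h' j)).2) (funext fun j => (Prod.mk.inj (h' j)).1)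
    · intro p
      exact ⟨(fun j => (p j).2, fun j => (p j).1), rfl⟩
  have hv' : ∀ _ : Fin n, Orthonormal ℂ v := fun _ => hv
  let W := tensorIsometry hv'
  refine ⟨(blockTrace hg.1).comp (sandwich W (adjoint W)),
    (isCPTP_blockTrace hg).comp (isCPTP_sandwich _ (adjoint_comp_isometryOf _)), ?_⟩
  intro T S hS k l
  have h1 := hasSum_blockTrace hg.1 (sandwich W (adjoint W) S) (ket k) (ket l)
  refine h1.unique ?_
  have h2 := hasSum_pi_prod fun j => hasSum_blockTrace (swap_bijective (ι := ℕ) (κ := ℕ × ℕ)).1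
    (sandwich (isometryOf hv) (adjoint (isometryOf hv)) (T j)) (ket (k j)) (ket (l j))
  rw [hNv]
  refine hasSum_of_eq (fun r => ?_) h2
  have e : ∀ (u w : Fin n → ℕ × ℕ × ℕ), ⟪ket u, (sandwich W (adjoint W) S).1 (ket w)⟫_ℂ =
      ∏ j, ⟪adjoint (isometryOf hv) (ket (u j)), (T j).1 (adjoint (isometryOf hv) (ket (w j)))⟫_ℂ := by
    intro u w
    change ⟪ket u, W (S.1 (adjoint W (ket w)))⟫_ℂ = _
    rw [← adjoint_inner_left, adjoint_tensorIsometry_ket hv', adjoint_tensorIsometry_ket hv', hS.inner]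
  rw [embed_ket, embed_ket, e]
  refine Finset.prod_congr rfl fun j _ => ?_
  rw [embed_ket, embed_ket]
  change ⟪ket _, isometryOf hv ((T j).1 (adjoint (isometryOf hv) (ket _)))⟫_ℂ = _
  rw [← adjoint_inner_left]

/-! ### Power series with values in a Banach space -/

theorem summable_powerSeries {E : Type} [NormedAddCommGroup E] [NormedSpace ℂ E] [CompleteSpace E]
    {c : ℕ → E} (hc : ∀ r : ℝ, 0 ≤ r → Summable fun k => r ^ k * ‖c k‖) (v : ℂ) :
    Summable fun k => v ^ k • c k := by
  refine Summable.of_norm ((hc ‖v‖ (norm_nonneg v)).congr fun k => ?_)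
  rw [norm_smul, norm_pow]

theorem hasDerivAt_powerSeries {E : Type} [NormedAddCommGroup E] [NormedSpace ℂ E] [CompleteSpace E]
    {c : ℕ → E} (hc : ∀ r : ℝ, 0 ≤ r → Summable fun k => r ^ k * ‖c k‖) (v : ℂ) :
    (Summable fun k : ℕ => ((k : ℂ) * v ^ (k - 1)) • c k) ∧
    HasDerivAt (fun v : ℂ => ∑' k, v ^ k • c k) (∑' k : ℕ, ((k : ℂ) * v ^ (k - 1)) • c k) v := by
  set R := ‖v‖ + 1 with hR
  have hR1 : 1 ≤ R := by have := norm_nonneg v; linarith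
  have hu := hc (2 * R) (by linarith)
  have hb : ∀ (k : ℕ) (y : ℂ), y ∈ Metric.ball (0 : ℂ) R →
      ‖((k : ℂ) * y ^ (k - 1)) • c k‖ ≤ (2 * R) ^ k * ‖c k‖ := by
    intro k y hy
    rw [mem_ball_zero_iff] at hy
    rw [norm_smul, norm_mul, norm_pow, Complex.norm_natCast, mul_pow]
    gcongr
    · exact_mod_cast Nat.lt_two_pow_self.le
    · calc ‖y‖ ^ (k - 1) ≤ R ^ (k - 1) := by gcongr
        _ ≤ R ^ k := pow_le_pow_right₀ hR1 (by omega)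
  have hv : v ∈ Metric.ball (0 : ℂ) R := by rw [mem_ball_zero_iff]; linarith
  refine ⟨Summable.of_norm_bounded hu fun k => hb k v hv, ?_⟩
  refine hasDerivAt_tsum_of_isPreconnected (t := Metric.ball (0 : ℂ) R) (y₀ := v) hu Metric.isOpen_ball
    (convex_ball _ _).isPreconnected (fun k y _ => ?_) hb hv (summable_powerSeries hc v) hv
  exact (hasDerivAt_pow k y).smul_const (c k)

/-! ### Exponential vectors -/

theorem summable_exp_coeff (α : ℂ) :
    Summable fun k : ℕ => ‖α ^ k / ((Real.sqrt k.factorial : ℝ) : ℂ)‖ ^ 2 := by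
  refine (Real.summable_pow_div_factorial (‖α‖ ^ 2)).congr fun k => ?_
  rw [norm_div, div_pow, norm_pow, Complex.norm_real, Real.norm_of_nonneg (Real.sqrt_nonneg _),
    Real.sq_sqrt (by positivity)]
  ring

/-- The exponential vector (unnormalized coherent state) `∑ₖ αᵏ/√(k!) |k⟩`. -/
def expVec (α : ℂ) : L2 ℕ := ofCoord _ (summable_exp_coeff α)

theorem inner_ket_expVec (α : ℂ) (k : ℕ) :
    ⟪ket k, expVec α⟫_ℂ = α ^ k / ((Real.sqrt k.factorial : ℝ) : ℂ) := inner_ket_ofCoord _ _ _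

theorem inner_expVec (α β : ℂ) :
    ⟪expVec α, expVec β⟫_ℂ = Complex.exp ((starRingEnd ℂ) α * β) := by
  refine (hasSum_inner _ _).unique ?_
  have h := NormedSpace.expSeries_div_hasSum_exp ((starRingEnd ℂ) α * β)
  rw [← Complex.exp_eq_exp_ℂ] at h
  refine hasSum_of_eq (fun k => ?_) h
  rw [← inner_conj_symm (expVec α), inner_ket_expVec, inner_ket_expVec, map_div₀, map_pow,
    Complex.conj_ofReal, div_mul_div_comm, ← mul_pow, ← Complex.ofReal_mul,
    Real.mul_self_sqrt (by positivity)]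
  norm_cast

theorem expVec_zero : expVec 0 = ket 0 := by
  refine ext_ket fun k => ?_
  rw [inner_ket_expVec, inner_ket_ket]
  rcases k with _ | k <;> simp

/-- The exponential vectors have a dense span. -/
theorem span_expVec : (Submodule.span ℂ (Set.range expVec)).topologicalClosure = ⊤ := by
  rw [Submodule.topologicalClosure_eq_top_iff, Submodule.eq_bot_iff]
  intro u hu
  refine ext_ket fun k => ?_
  rw [inner_zero_right]
  let c : ℕ → ℂ := fun k => ⟪u, ket k⟫_ℂ / ((Real.sqrt k.factorial : ℝ) : ℂ)
  have h0 : HasFPowerSeriesAt (0 : ℂ → ℂ) (FormalMultilinearSeries.ofScalars ℂ c) 0 := by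
    rw [hasFPowerSeriesAt_iff]
    refine Filter.Eventually.of_forall fun α => ?_
    have h1 := hasSum_inner u (expVec α)
    have h2 := (Submodule.mem_orthogonal _ _).1 hu (expVec α) (Submodule.subset_span ⟨α, rfl⟩)
    rw [← inner_conj_symm, h2, map_zero] at h1
    refine hasSum_of_eq (fun k => ?_) h1
    rw [FormalMultilinearSeries.coeff_ofScalars, inner_ket_expVec, smul_eq_mul]
    simp only [c]; ring
  have h3 := congrArg (fun p => FormalMultilinearSeries.coeff p k) h0.eq_zero
  simp only [FormalMultilinearSeries.coeff_ofScalars, c] at h3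
  have h4 : ((Real.sqrt k.factorial : ℝ) : ℂ) ≠ 0 := by
    have : Real.sqrt k.factorial ≠ 0 := Real.sqrt_ne_zero'.2 (by positivity)
    exact_mod_cast this
  have h5 : ⟪u, ket k⟫_ℂ = 0 := by
    have h6 : FormalMultilinearSeries.coeff (0 : FormalMultilinearSeries ℂ ℂ ℂ) k = 0 := rfl
    rw [h6, div_eq_zero_iff] at h3
    exact h3.resolve_right h4
  rw [← inner_conj_symm, h5, map_zero]

/-- The coefficients of the power series `α ↦ expVec α`. -/
def expCoeff (k : ℕ) : L2 ℕ := (((Real.sqrt k.factorial : ℝ) : ℂ)⁻¹) • ket k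

theorem summable_expCoeff (r : ℝ) (hr : 0 ≤ r) : Summable fun k => r ^ k * ‖expCoeff k‖ := by
  have h0 : ∀ k, ‖expCoeff k‖ = (Real.sqrt k.factorial)⁻¹ := fun k => by
    rw [expCoeff, norm_smul, norm_ket, mul_one, norm_inv, Complex.norm_real,
      Real.norm_of_nonneg (Real.sqrt_nonneg _)]
  -- Geometric domination: `r ^ k / √k! = (2r) ^ k / √k! * 2 ^ (-k)`, and both factors are in `ℓ²`.
  have h1 := Real.summable_pow_div_factorial ((2 * r) ^ 2)
  have h2 : Summable fun k : ℕ => ((4 : ℝ)⁻¹) ^ k :=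
    summable_geometric_of_lt_one (by norm_num) (by norm_num)
  refine Summable.of_nonneg_of_le (fun k => by positivity) (fun k => ?_) (h1.add h2)
  rw [h0]
  have h3 : r ^ k * (Real.sqrt k.factorial)⁻¹ =
      ((2 * r) ^ k * (Real.sqrt k.factorial)⁻¹) * (2⁻¹ : ℝ) ^ k := by
    rw [mul_pow]
    have : (2 : ℝ) ^ k * (2⁻¹ : ℝ) ^ k = 1 := by rw [← mul_pow]; norm_num
    linear_combination (-(r ^ k * (Real.sqrt k.factorial)⁻¹)) * this
  have h4 : ((2 * r) ^ 2) ^ k / (k.factorial : ℝ) = ((2 * r) ^ k * (Real.sqrt k.factorial)⁻¹) ^ 2 := by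
    rw [mul_pow _ (Real.sqrt _)⁻¹, inv_pow, Real.sq_sqrt (by positivity), ← pow_mul, mul_comm 2 k,
      pow_mul, div_eq_mul_inv]
  have h5 : ((4 : ℝ)⁻¹) ^ k = ((2⁻¹ : ℝ) ^ k) ^ 2 := by rw [← pow_mul, mul_comm k, pow_mul]; norm_num
  rw [h3, h4, h5]
  nlinarith [sq_nonneg (((2 * r) ^ k * (Real.sqrt k.factorial)⁻¹) - (2⁻¹ : ℝ) ^ k),
    sq_nonneg ((2 * r) ^ k * (Real.sqrt k.factorial)⁻¹), sq_nonneg ((2⁻¹ : ℝ) ^ k)]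

theorem expVec_eq_tsum (α : ℂ) : HasSum (fun k => α ^ k • expCoeff k) (expVec α) := by
  have h := hasSum_ket (expVec α)
  convert h using 2 with k
  rw [inner_ket_expVec, expCoeff, smul_smul, div_eq_mul_inv]

/-- The derivative of `α ↦ expVec α`. -/
def expVecDeriv (α : ℂ) : L2 ℕ := ∑' k : ℕ, ((k : ℂ) * α ^ (k - 1)) • expCoeff k

theorem hasDerivAt_expVec (α : ℂ) : HasDerivAt expVec (expVecDeriv α) α := by
  have h := (hasDerivAt_powerSeries summable_expCoeff α).2
  have h2 : (fun α : ℂ => ∑' k, α ^ k • expCoeff k) = expVec :=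
    funext fun α => (expVec_eq_tsum α).tsum_eq
  rwa [h2] at h

theorem inner_ket_expVecDeriv (α : ℂ) (k : ℕ) : ⟪ket k, expVecDeriv α⟫_ℂ =
    (k : ℂ) * α ^ (k - 1) / ((Real.sqrt k.factorial : ℝ) : ℂ) := by
  have h := ((hasDerivAt_powerSeries summable_expCoeff α).1.hasSum.mapL (innerSL ℂ (ket k)))
  have h2 := hasSum_single (f := fun l : ℕ => innerSL ℂ (ket k) (((l : ℂ) * α ^ (l - 1)) • expCoeff l)) k
    (fun l hl => by
      simp only [innerSL_apply_apply, inner_smul_right, expCoeff, inner_ket_ket, if_neg hl.symm]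
      simp)
  refine (h.unique h2).trans ?_
  simp only [innerSL_apply_apply, inner_smul_right, expCoeff, inner_ket_ket, if_true]
  ring

theorem continuous_expVec : Continuous expVec :=
  continuous_iff_continuousAt.2 fun α => (hasDerivAt_expVec α).continuousAt

/-! ### Displacement operators -/

theorem displacementGen_smul (t : ℝ) (z : ℂ) : displacementGen (t * z) = (t : ℂ) • displacementGen z := by
  refine LinearMap.ext fun x => ?_
  simp [displacementGen, smul_sub, smul_smul]

theorem displacementTerm_smul (t : ℝ) (z : ℂ) (n k : ℕ) :
    displacementTerm (t * z) n k = ((t : ℂ) ^ k) • displacementTerm z n k := by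
  rw [displacementTerm, displacementTerm, displacementGen_smul, smul_pow, LinearMap.smul_apply,
    map_smul, smul_smul, smul_smul, mul_comm]

theorem summable_displacementTerm (z : ℂ) (n : ℕ) (r : ℝ) (hr : 0 ≤ r) :
    Summable fun k => r ^ k * ‖displacementTerm z n k‖ := by
  refine (summable_norm_displacementTerm (r * z) n).congr fun k => ?_
  rw [displacementTerm_smul, norm_smul, norm_pow, Complex.norm_real, Real.norm_of_nonneg hr]

/-- The exponential series of the displacement operator on finite superpositions of Fock states. -/
theorem hasSum_displacement (z : ℂ) (t : ℝ) (u : ℕ →₀ ℂ) :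
    HasSum (fun k => ((t : ℂ) ^ k) • (((k.factorial : ℂ)⁻¹) • toL2 ((displacementGen z ^ k) u)))
      (displacement (t * z) (toL2 u)) := by
  induction u using Finsupp.induction_linear with
  | zero => simp
  | add f g hf hg =>
    simp only [map_add, smul_add]
    exact hf.add hg
  | single n c =>
    have h := (displacement_ket (t * z) n).const_smul c
    have hc : Finsupp.single n c = c • Finsupp.single n (1 : ℂ) := by simp
    rw [hc]
    simp only [map_smul, toL2_single, one_smul]
    convert h using 2 with k
    rw [displacementTerm_smul, displacementTerm, smul_comm c, smul_comm c]

/-- `D_{tz}` solves the differential equation of the exponential on finite superpositions of Fock states.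
The generator is applied first, where it is defined algebraically. -/
theorem hasDerivAt_displacement (z : ℂ) (u : ℕ →₀ ℂ) (t : ℝ) :
    HasDerivAt (fun t : ℝ => displacement (t * z) (toL2 u))
      (displacement (t * z) (toL2 (displacementGen z u))) t := by
  induction u using Finsupp.induction_linear with
  | zero => simpa using hasDerivAt_const t (0 : L2 ℕ)
  | add f g hf hg =>
    simp only [map_add]
    exact hf.add hg
  | single n c =>
    have hc : Finsupp.single n c = c • Finsupp.single n (1 : ℂ) := by simp
    rw [hc]
    simp only [map_smul]
    refine HasDerivAt.const_smul c ?_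
    obtain ⟨h1, h2⟩ := hasDerivAt_powerSeries (summable_displacementTerm z n) (t : ℂ)
    have h3 := h2.scomp t Complex.ofRealCLM.hasDerivAt
    have e1 : (fun t : ℝ => displacement (t * z) (toL2 (Finsupp.single n 1))) =
        (fun v : ℂ => ∑' k, v ^ k • displacementTerm z n k) ∘ Complex.ofReal := by
      ext1 t
      rw [toL2_single, one_smul, Function.comp_apply, ← (displacement_ket _ n).tsum_eq]
      simp only [displacementTerm_smul]
    rw [e1]
    convert h3 using 1
    rw [Complex.ofRealCLM_apply, Complex.ofReal_one, one_smul]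
    refine (hasSum_displacement z t _).unique ?_
    have h4 := (hasSum_nat_add_iff' 1).2 h1.hasSum
    simp only [Finset.sum_range_one, Nat.cast_zero, zero_mul, zero_smul, sub_zero,
      Nat.add_sub_cancel] at h4
    convert h4 using 2 with k
    rw [displacementTerm, pow_succ, Module.End.mul_apply, smul_smul, smul_smul, Nat.factorial_succ]
    congr 1
    have : ((k : ℂ) + 1) ≠ 0 := by exact_mod_cast Nat.succ_ne_zero k
    push_cast
    field_simp

theorem displacementGen_single (z : ℂ) (n : ℕ) : displacementGen z (Finsupp.single n 1) =
    (z * ((Real.sqrt (n + 1) : ℝ) : ℂ)) • Finsupp.single (n + 1) 1 -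
      ((starRingEnd ℂ) z * ((Real.sqrt n : ℝ) : ℂ)) • Finsupp.single (n - 1) 1 := by
  rw [displacementGen, LinearMap.sub_apply, LinearMap.smul_apply, LinearMap.smul_apply,
    annihilation_single, creation_single, smul_smul, smul_smul]

theorem sqrt_factorial_succ (n : ℕ) : Real.sqrt (n + 1).factorial =
    Real.sqrt (n + 1) * Real.sqrt n.factorial := by
  rw [Nat.factorial_succ, Nat.cast_mul, Real.sqrt_mul (by positivity)]
  push_cast; rfl

/-- The adjoint ladder operators act on exponential vectors by `a e_v = v e_v` and `a† e_v = e_v'`. -/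
theorem inner_expVec_gen (v z : ℂ) (u : ℕ →₀ ℂ) : ⟪expVec v, toL2 (displacementGen z u)⟫_ℂ =
    z * (starRingEnd ℂ) v * ⟪expVec v, toL2 u⟫_ℂ - (starRingEnd ℂ) z * ⟪expVecDeriv v, toL2 u⟫_ℂ := by
  induction u using Finsupp.induction_linear with
  | zero => simp
  | add f g hf hg => simp only [map_add, inner_add_right, hf, hg]; ring
  | single n c =>
    have hc : Finsupp.single n c = c • Finsupp.single n (1 : ℂ) := by simp
    rw [hc]
    simp only [map_smul, inner_smul_right, displacementGen_single, map_sub, inner_sub_right,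
      toL2_single, one_smul]
    rw [← inner_conj_symm _ (ket (n + 1)), ← inner_conj_symm _ (ket (n - 1)),
      ← inner_conj_symm _ (ket n), ← inner_conj_symm (expVecDeriv v), inner_ket_expVec,
      inner_ket_expVec, inner_ket_expVec, inner_ket_expVecDeriv]
    simp only [map_div₀, map_mul, map_pow, map_natCast, Complex.conj_ofReal]
    have hn : ∀ n : ℕ, ((Real.sqrt n.factorial : ℝ) : ℂ) ≠ 0 := fun n => by
      have : Real.sqrt n.factorial ≠ 0 := Real.sqrt_ne_zero'.2 (by positivity)
      exact_mod_cast this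
    have hs : ∀ n : ℕ, ((Real.sqrt (n + 1) : ℝ) : ℂ) ≠ 0 := fun n => by
      have : Real.sqrt ((n : ℝ) + 1) ≠ 0 := Real.sqrt_ne_zero'.2 (by positivity)
      exact_mod_cast this
    have hss : ∀ n : ℕ, ((Real.sqrt (n + 1) : ℝ) : ℂ) * ((Real.sqrt (n + 1) : ℝ) : ℂ) = n + 1 :=
      fun n => by rw [← Complex.ofReal_mul, Real.mul_self_sqrt (by positivity)]; simp
    have h1 : ((Real.sqrt (n + 1) : ℝ) : ℂ) * ((starRingEnd ℂ) v ^ (n + 1) /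
        ((Real.sqrt (n + 1).factorial : ℝ) : ℂ)) =
        (starRingEnd ℂ) v * ((starRingEnd ℂ) v ^ n / ((Real.sqrt n.factorial : ℝ) : ℂ)) := by
      rw [sqrt_factorial_succ, Complex.ofReal_mul]
      have := hn n; have := hs n
      field_simp
      ring
    have h2 : ((Real.sqrt n : ℝ) : ℂ) * ((starRingEnd ℂ) v ^ (n - 1) /
        ((Real.sqrt (n - 1).factorial : ℝ) : ℂ)) =
        (n : ℂ) * (starRingEnd ℂ) v ^ (n - 1) / ((Real.sqrt n.factorial : ℝ) : ℂ) := by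
      rcases n with _ | n
      · simp
      · rw [sqrt_factorial_succ, Complex.ofReal_mul]
        have := hn n; have := hs n
        simp only [Nat.add_sub_cancel]
        push_cast
        rw [← hss n]
        field_simp
    linear_combination (c * z) * h1 - c * (starRingEnd ℂ) z * h2

/-- The overlap of a displaced Fock state with a coherent vector that is displaced along with it solves
a scalar linear differential equation in the displacement parameter. -/
theorem inner_expVec_displacement (w z : ℂ) (n : ℕ) : ⟪expVec (w + z), displacement z (ket n)⟫_ℂ =
    Complex.exp (z * (starRingEnd ℂ) w + z * (starRingEnd ℂ) z / 2) * ⟪expVec w, ket n⟫_ℂ := by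
  let f : ℝ → ℂ := fun t => ⟪expVec (w + t * z), displacement (t * z) (ket n)⟫_ℂ
  have hk : toL2 (Finsupp.single n 1) = ket n := by rw [toL2_single, one_smul]
  have hf : ∀ t : ℝ, HasDerivAt f (z * (starRingEnd ℂ) (w + t * z) * f t) t := by
    intro t
    have h1 := hasDerivAt_displacement z (Finsupp.single n 1) t
    have h2 : HasDerivAt (fun t : ℝ => w + (t : ℂ) * z) z t := by
      have := (Complex.ofRealCLM.hasDerivAt (x := t)).mul_const z
      simpa using this.const_add w
    have h3 := (hasDerivAt_expVec (w + t * z)).scomp t h2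
    have h4 := h3.inner ℂ h1
    rw [hk] at h4
    refine HasDerivAt.congr_deriv (f := f) h4 ?_
    have h5 : ⟪expVec (w + t * z), displacement (t * z) (toL2 (displacementGen z (Finsupp.single n 1)))⟫_ℂ
        = z * (starRingEnd ℂ) (w + t * z) * ⟪expVec (w + t * z), displacement (t * z) (ket n)⟫_ℂ -
          (starRingEnd ℂ) z * ⟪expVecDeriv (w + t * z), displacement (t * z) (ket n)⟫_ℂ := by
      have a1 := (hasSum_displacement z t (displacementGen z (Finsupp.single n 1))).mapL
        (innerSL ℂ (expVec (w + t * z)))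
      have a2 := (hasSum_displacement z t (Finsupp.single n 1))
      have a3 := ((a2.mapL (innerSL ℂ (expVec (w + t * z)))).mul_left
        (z * (starRingEnd ℂ) (w + t * z))).sub
          ((a2.mapL (innerSL ℂ (expVecDeriv (w + t * z)))).mul_left ((starRingEnd ℂ) z))
      rw [hk] at a3
      refine a1.unique (hasSum_of_eq (fun k => ?_) a3)
      simp only [innerSL_apply_apply, inner_smul_right]
      rw [← Module.End.mul_apply, ← pow_succ, pow_succ', Module.End.mul_apply, inner_expVec_gen]
      ring
    simp only [Function.comp_apply, inner_smul_left, h5, f]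
    ring
  -- Multiply by the integrating factor: the result is constant, and `t = 0, 1` are compared.
  let g : ℝ → ℂ := fun t => Complex.exp (-(t * (z * (starRingEnd ℂ) w) +
    t ^ 2 * (z * (starRingEnd ℂ) z / 2))) * f t
  have hg : ∀ t : ℝ, HasDerivAt g 0 t := by
    intro t
    have h1 : HasDerivAt (fun t : ℝ => (t : ℂ)) 1 t := Complex.ofRealCLM.hasDerivAt
    have h2 : HasDerivAt (fun t : ℝ => -((t : ℂ) * (z * (starRingEnd ℂ) w) +
        (t : ℂ) ^ 2 * (z * (starRingEnd ℂ) z / 2)))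
        (-(z * (starRingEnd ℂ) w + 2 * t * (z * (starRingEnd ℂ) z / 2))) t := by
      have := ((h1.mul_const (z * (starRingEnd ℂ) w)).add
        ((h1.pow 2).mul_const (z * (starRingEnd ℂ) z / 2))).neg
      refine this.congr_deriv ?_
      push_cast; ring
    refine HasDerivAt.congr_deriv (f := g) (h2.cexp.mul (hf t)) ?_
    simp only [map_add, map_mul, Complex.conj_ofReal]
    ring
  have h := is_const_of_deriv_eq_zero (fun t => (hg t).differentiableAt) (fun t => (hg t).deriv) 1 0
  have d0 : displacement 0 (ket n) = ket n := by
    have h1 := displacement_ket 0 n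
    have h2 := hasSum_single (f := displacementTerm 0 n) 0 (fun k hk' => by
      have : displacementGen 0 = 0 := LinearMap.ext fun x => by simp [displacementGen]
      rw [displacementTerm, this, zero_pow hk', LinearMap.zero_apply, map_zero, smul_zero])
    rw [h1.unique h2, displacementTerm]
    simp [hk]
  simp only [g, f, Complex.ofReal_one, one_mul, one_pow, Complex.ofReal_zero, zero_mul, add_zero, d0,
    ne_eq, OfNat.ofNat_ne_zero, not_false_eq_true, zero_pow, neg_zero, Complex.exp_zero] at h
  rw [← h, ← mul_assoc, ← Complex.exp_add, add_neg_cancel, Complex.exp_zero, one_mul]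

theorem norm_displacement (z : ℂ) (x : L2 ℕ) : ‖displacement z x‖ = ‖x‖ := norm_isometryOf _ x

theorem inner_displacement_displacement (z : ℂ) (x y : L2 ℕ) :
    ⟪displacement z x, displacement z y⟫_ℂ = ⟪x, y⟫_ℂ := by
  have h := adjoint_comp_isometryOf (orthonormal_displacedKet z)
  rw [← adjoint_inner_right]
  exact congrArg (fun v => ⟪x, v⟫_ℂ) (congrArg (fun R => R y) h)

/-- Displacement operators act on exponential vectors by `D_z e_w = exp(-|z|²/2 - z̄ w) e_{w+z}`. -/
theorem displacement_expVec (z w : ℂ) : displacement z (expVec w) =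
    Complex.exp (-(z * (starRingEnd ℂ) z / 2) - (starRingEnd ℂ) z * w) • expVec (w + z) := by
  set c := Complex.exp (-(z * (starRingEnd ℂ) z / 2) - (starRingEnd ℂ) z * w) with hc
  have hcc : (starRingEnd ℂ) c = Complex.exp (-(z * (starRingEnd ℂ) z / 2) - z * (starRingEnd ℂ) w) := by
    rw [hc, ← Complex.exp_conj]
    congr 1
    simp only [map_sub, map_neg, map_mul, map_div₀, Complex.conj_conj, map_ofNat]
    ring
  have h1 : ((innerSL ℂ (c • expVec (w + z))).comp (displacement z)) = innerSL ℂ (expVec w) := by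
    refine ext_op fun n => ?_
    rw [comp_apply, innerSL_apply_apply, innerSL_apply_apply, inner_smul_left,
      inner_expVec_displacement, ← mul_assoc, hcc, ← Complex.exp_add]
    convert one_mul _
    convert Complex.exp_zero using 2
    ring
  have h2 : ⟪c • expVec (w + z), displacement z (expVec w)⟫_ℂ = ⟪expVec w, expVec w⟫_ℂ :=
    congrArg (fun T => T (expVec w)) h1
  have h3 : ⟪c • expVec (w + z), c • expVec (w + z)⟫_ℂ = ⟪expVec w, expVec w⟫_ℂ := by
    rw [inner_smul_left, inner_smul_right, inner_expVec, inner_expVec, hcc, hc, ← Complex.exp_add,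
      ← Complex.exp_add]
    congr 1
    simp only [map_add]
    ring
  have h4 : ⟪displacement z (expVec w), c • expVec (w + z)⟫_ℂ = ⟪expVec w, expVec w⟫_ℂ := by
    rw [← inner_conj_symm, h2, inner_conj_symm]
  rw [← sub_eq_zero, ← inner_self_eq_zero (𝕜 := ℂ), inner_sub_left, inner_sub_right, inner_sub_right,
    h2, h3, h4, inner_displacement_displacement]
  ring

theorem displacement_comp (z w : ℂ) : (displacement z).comp (displacement w) =
    Complex.exp ((z * (starRingEnd ℂ) w - (starRingEnd ℂ) z * w) / 2) • displacement (z + w) := by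
  refine ext_op_dense span_expVec ?_
  rintro _ ⟨v, rfl⟩
  rw [comp_apply, smul_apply, displacement_expVec, displacement_expVec, map_smul, displacement_expVec,
    smul_smul, smul_smul, ← Complex.exp_add, ← Complex.exp_add]
  have : v + w + z = v + (z + w) := by ring
  rw [this]
  congr 2
  simp only [map_add]
  ring

theorem displacement_zero : displacement 0 = ContinuousLinearMap.id ℂ _ := by
  refine ext_op_dense span_expVec ?_
  rintro _ ⟨v, rfl⟩
  rw [displacement_expVec]
  simp

theorem displacement_neg_comp (z : ℂ) :
    (displacement (-z)).comp (displacement z) = ContinuousLinearMap.id ℂ _ := by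
  have : (-z * (starRingEnd ℂ) z - (starRingEnd ℂ) (-z) * z) / 2 = 0 := by
    rw [map_neg]; ring
  rw [displacement_comp, neg_add_cancel, displacement_zero, this, Complex.exp_zero, one_smul]

theorem inner_displacement (z : ℂ) (x y : L2 ℕ) :
    ⟪x, displacement z y⟫_ℂ = ⟪displacement (-z) x, y⟫_ℂ := by
  rw [← inner_displacement_displacement (-z) x]
  congr 1
  exact congrArg (fun R => R y) (displacement_neg_comp z)

theorem continuous_displacement (x : L2 ℕ) : Continuous fun z => displacement z x := by
  refine dense_induction span_expVec (p := fun x => Continuous fun z => displacement z x) ?_ ?_ ?_ ?_ ?_ x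
  · rw [← closure_subset_iff_isClosed]
    intro x hx
    refine continuous_of_uniform_approx_of_continuous (fun u hu => ?_)
    obtain ⟨ε, hε, h⟩ := Metric.mem_uniformity_dist.1 hu
    obtain ⟨y, hy, hxy⟩ := Metric.mem_closure_iff.1 hx ε hε
    refine ⟨fun z => displacement z y, hy, fun z => h ?_⟩
    rwa [dist_eq_norm, ← map_sub, norm_displacement, ← dist_eq_norm]
  · rintro _ ⟨w, rfl⟩
    simp only [displacement_expVec]
    have h1 : Continuous fun z : ℂ => (starRingEnd ℂ) z := Complex.continuous_conj
    exact (by fun_prop : Continuous fun z : ℂ =>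
      Complex.exp (-(z * (starRingEnd ℂ) z / 2) - (starRingEnd ℂ) z * w)).smul
        (continuous_expVec.comp (by fun_prop))
  · intro x y hx hy
    simp only [map_add]; exact hx.add hy
  · intro c x hx
    simp only [map_smul]; exact hx.const_smul c
  · simpa using continuous_const

/-! ### Displacement operators of several modes -/

/-- The displacement operator `D_{z₁} ⊗ ⋯ ⊗ D_{zₙ}`. -/
def multiDisplacement {n : ℕ} (z : Fin n → ℂ) : L2 (Fin n → ℕ) →L[ℂ] L2 (Fin n → ℕ) :=
  tensorIsometry fun j => orthonormal_displacedKet (z j)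

theorem isTensor_multiDisplacement {n : ℕ} (z : Fin n → ℂ) :
    IsTensor (fun j => displacement (z j)) (multiDisplacement z) := by
  refine IsTensor.of_apply fun l => ?_
  rw [multiDisplacement, tensorIsometry_ket]
  simp only [displacement, isometryOf_ket]

theorem norm_multiDisplacement {n : ℕ} (z : Fin n → ℂ) (x : L2 (Fin n → ℕ)) :
    ‖multiDisplacement z x‖ = ‖x‖ :=
  norm_isometryOf (orthonormal_productVector fun j => orthonormal_displacedKet (z j)) x

theorem inner_multiDisplacement {n : ℕ} (z : Fin n → ℂ) (x y : L2 (Fin n → ℕ)) :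
    ⟪x, multiDisplacement z y⟫_ℂ = ⟪multiDisplacement (-z) x, y⟫_ℂ := by
  have h1 : (multiDisplacement (-z)).comp (multiDisplacement z) = ContinuousLinearMap.id ℂ _ := by
    refine ((isTensor_multiDisplacement (-z)).comp (isTensor_multiDisplacement z)).unique ?_
    refine IsTensor.of_apply fun l => ?_
    simp only [Pi.neg_apply, displacement_neg_comp, id_apply, productVector_ket]
  have h2 := adjoint_comp_isometryOf (orthonormal_productVector fun j =>
    orthonormal_displacedKet ((-z) j))
  have h3 : ∀ a b, ⟪multiDisplacement (-z) a, multiDisplacement (-z) b⟫_ℂ = ⟪a, b⟫_ℂ := fun a b => by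
    rw [← adjoint_inner_right]
    exact congrArg (fun v => ⟪a, v⟫_ℂ) (congrArg (fun R => R b) h2)
  rw [← h3 x]
  congr 1
  exact congrArg (fun R => R y) h1

/-- The exponential vectors of several modes. -/
def expProd {n : ℕ} (z : Fin n → ℂ) : L2 (Fin n → ℕ) := productVector fun j => expVec (z j)

theorem span_expProd {n : ℕ} :
    (Submodule.span ℂ (Set.range (expProd : (Fin n → ℂ) → _))).topologicalClosure = ⊤ := by
  convert span_productVector (n := n) span_expVec using 4
  ext v
  constructor
  · rintro ⟨z, rfl⟩
    exact ⟨_, fun j => ⟨z j, rfl⟩, rfl⟩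
  · rintro ⟨x, hx, rfl⟩
    choose z hz using hx
    exact ⟨z, by simp only [expProd, hz]⟩

theorem inner_expProd {n : ℕ} (z w : Fin n → ℂ) :
    ⟪expProd z, expProd w⟫_ℂ = Complex.exp (star z ⬝ᵥ w) := by
  rw [expProd, expProd, inner_productVector]
  simp only [inner_expVec]
  rw [← Complex.exp_sum]
  rfl

theorem productVector_smul {n : ℕ} (c : Fin n → ℂ) (x : Fin n → L2 κ) :
    productVector (fun j => c j • x j) = (∏ j, c j) • productVector x := by
  refine ext_ket fun k => ?_
  rw [inner_smul_right, inner_ket_productVector, inner_ket_productVector, ← Finset.prod_mul_distrib]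
  simp only [inner_smul_right]

theorem multiDisplacement_expProd {n : ℕ} (z w : Fin n → ℂ) : multiDisplacement z (expProd w) =
    Complex.exp (-(star z ⬝ᵥ z / 2) - star z ⬝ᵥ w) • expProd (w + z) := by
  rw [expProd, (isTensor_multiDisplacement z).apply_productVector]
  simp only [displacement_expVec]
  rw [productVector_smul, ← Complex.exp_sum]
  congr 2
  rw [Finset.sum_sub_distrib, Finset.sum_neg_distrib, ← Finset.sum_div]
  simp only [dotProduct, Pi.star_apply, RCLike.star_def, mul_comm (z _)]

theorem expProd_zero {n : ℕ} : expProd (0 : Fin n → ℂ) = ket 0 := by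
  simp only [expProd, Pi.zero_apply, expVec_zero, ← productVector_ket]

theorem attach_eq {n : ℕ} (r : Fin n → ℕ) (x : L2 ℕ) :
    attach r x = productVector (Fin.cons x fun j => ket (r j) : Fin (n + 1) → L2 ℕ) := by
  obtain ⟨L, hL⟩ := exists_slot (Fin.cons 0 (fun j => ket (r j)) : Fin (n + 1) → L2 ℕ) 0
  simp only [Fin.update_cons_zero] at hL
  rw [hL]
  refine congrArg (fun T : L2 ℕ →L[ℂ] L2 (Fin (n + 1) → ℕ) => T x) (ext_op fun m => ?_)
  rw [← hL, attach_ket, ← productVector_ket]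
  congr 1
  ext1 j
  refine Fin.cases ?_ (fun i => ?_) j <;> simp

theorem attach_expVec {n : ℕ} (α : ℂ) : attach (0 : Fin n → ℕ) (expVec α) =
    expProd (Fin.cons α 0 : Fin (n + 1) → ℂ) := by
  rw [attach_eq, expProd]
  congr 1
  ext1 j
  refine Fin.cases ?_ (fun i => ?_) j <;> simp [expVec_zero]

/-! ### Beam splitters -/

/-- Second quantization: an isometry `V` of `ℂⁿ` acts on exponential vectors. -/
theorem exists_secondQuantization {n : ℕ} (V : Matrix (Fin n) (Fin n) ℂ)
    (hV : ∀ z w, star (V.mulVec z) ⬝ᵥ V.mulVec w = star z ⬝ᵥ w) :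
    ∃ U : L2 (Fin n → ℕ) →L[ℂ] L2 (Fin n → ℕ), ∀ z, U (expProd z) = expProd (V.mulVec z) := by
  let e : ((Fin n → ℂ) →₀ ℂ) →ₗ[ℂ] L2 (Fin n → ℕ) := Finsupp.linearCombination ℂ expProd
  let f : ((Fin n → ℂ) →₀ ℂ) →ₗ[ℂ] L2 (Fin n → ℕ) :=
    Finsupp.linearCombination ℂ fun z => expProd (V.mulVec z)
  have hd : DenseRange e := by
    have h1 : (LinearMap.range e) = Submodule.span ℂ (Set.range expProd) :=
      Finsupp.range_linearCombination _
    have h2 := span_expProd (n := n)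
    rw [← h1] at h2
    exact (Submodule.dense_iff_topologicalClosure_eq_top (s := LinearMap.range e)).2 h2
  -- The Gram matrix of exponential vectors depends only on the scalar products, which `V` preserves.
  have hn : ∀ c, ‖f c‖ = ‖e c‖ := by
    intro c
    have h1 : ⟪f c, f c⟫_ℂ = ⟪e c, e c⟫_ℂ := by
      simp only [f, e, Finsupp.linearCombination_apply, Finsupp.sum_inner, Finsupp.inner_sum,
        inner_smul_left, inner_smul_right, inner_expProd, hV]
    rw [inner_self_eq_norm_sq_to_K, inner_self_eq_norm_sq_to_K] at h1
    have h2 : ‖f c‖ ^ 2 = ‖e c‖ ^ 2 := by exact_mod_cast h1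
    exact (sq_eq_sq₀ (norm_nonneg _) (norm_nonneg _)).1 h2
  refine ⟨f.extendOfNorm e, fun z => ?_⟩
  have := LinearMap.extendOfNorm_eq (f := f) hd ⟨1, fun c => by rw [hn, one_mul]⟩ (Finsupp.single z 1)
  simpa [e, f] using this

theorem dotProduct_mulVec_isometry {n : ℕ} {V : Matrix (Fin n) (Fin n) ℂ}
    (hV : V.conjTranspose * V = 1) (z w : Fin n → ℂ) :
    star (V.mulVec z) ⬝ᵥ V.mulVec w = star z ⬝ᵥ w := by
  rw [Matrix.star_mulVec, Matrix.dotProduct_mulVec, Matrix.vecMul_vecMul, hV, Matrix.vecMul_one]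

theorem beamSplitterMatrix_unitary (n : ℕ) :
    (beamSplitterMatrix (n + 1)).conjTranspose * beamSplitterMatrix (n + 1) = 1 := by
  ext k l
  set ζ := Complex.exp (2 * Real.pi * Complex.I / (n + 1 : ℕ)) with hζ
  have hp : IsPrimitiveRoot ζ (n + 1) := Complex.isPrimitiveRoot_exp (n + 1) (Nat.succ_ne_zero n)
  have hζ0 : ζ ≠ 0 := Complex.exp_ne_zero _
  have hζc : (starRingEnd ℂ) ζ = ζ⁻¹ := by
    rw [hζ, ← Complex.exp_conj, ← Complex.exp_neg]
    congr 1
    simp only [map_div₀, map_mul, Complex.conj_I, Complex.conj_ofReal, map_ofNat, map_natCast]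
    ring
  have hB : ∀ j k : Fin (n + 1), beamSplitterMatrix (n + 1) j k =
      ζ ^ ((j : ℕ) * (k : ℕ)) / ((Real.sqrt (n + 1 : ℕ) : ℝ) : ℂ) := by
    intro j k
    rw [beamSplitterMatrix, hζ, ← Complex.exp_nat_mul]
    congr 2
    push_cast
    ring
  have hs : ((Real.sqrt (n + 1 : ℕ) : ℝ) : ℂ) * ((Real.sqrt (n + 1 : ℕ) : ℝ) : ℂ) = (n + 1 : ℕ) := by
    rw [← Complex.ofReal_mul, Real.mul_self_sqrt (by positivity)]; simp
  have hn0 : ((n + 1 : ℕ) : ℂ) ≠ 0 := by exact_mod_cast Nat.succ_ne_zero n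
  set x := ζ ^ (l : ℕ) * (ζ ^ (k : ℕ))⁻¹ with hx
  have hterm : ∀ j : Fin (n + 1), (beamSplitterMatrix (n + 1)).conjTranspose k j *
      beamSplitterMatrix (n + 1) j l = x ^ (j : ℕ) / (n + 1 : ℕ) := by
    intro j
    rw [Matrix.conjTranspose_apply, hB, hB, ← hs, RCLike.star_def, map_div₀, map_pow, hζc,
      Complex.conj_ofReal, div_mul_div_comm, hx]
    congr 1
    rw [mul_pow, ← pow_mul, ← inv_pow, ← pow_mul, inv_pow, inv_pow, mul_comm, mul_comm (j : ℕ),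
      mul_comm (j : ℕ)]
  rw [Matrix.mul_apply, Finset.sum_congr rfl fun j _ => hterm j, ← Finset.sum_div,
    ← Finset.sum_range (fun j => x ^ j)]
  rcases eq_or_ne k l with rfl | hkl
  · have : x = 1 := mul_inv_cancel₀ (pow_ne_zero _ hζ0)
    rw [this, Matrix.one_apply_eq]
    simp only [one_pow, Finset.sum_const, Finset.card_range, nsmul_eq_mul, mul_one]
    exact div_self hn0
  · have hx1 : x ≠ 1 := by
      intro h
      have h2 : ζ ^ (l : ℕ) = ζ ^ (k : ℕ) := by
        rw [hx] at h
        exact eq_of_mul_inv_eq_one h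
      exact hkl (Fin.ext (hp.pow_inj l.2 k.2 h2)).symm
    have hxn : x ^ (n + 1) = 1 := by
      rw [hx, mul_pow, inv_pow, ← pow_mul, ← pow_mul, mul_comm (l : ℕ), mul_comm (k : ℕ), pow_mul,
        pow_mul, hp.pow_eq_one]
      simp
    rw [geom_sum_eq hx1, hxn, sub_self, zero_div, zero_div, Matrix.one_apply_ne hkl]

theorem exists_beamSplitter (n : ℕ) :
    ∃ U : L2 (Fin (n + 1) → ℕ) →L[ℂ] L2 (Fin (n + 1) → ℕ), IsBeamSplitter U := by
  set V := beamSplitterMatrix (n + 1) with hVd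
  have hV := beamSplitterMatrix_unitary n
  have hV' : V * V.conjTranspose = 1 := mul_eq_one_comm.1 hV
  obtain ⟨U, hU⟩ := exists_secondQuantization V (dotProduct_mulVec_isometry hV)
  obtain ⟨U', hU'⟩ := exists_secondQuantization V.conjTranspose
    (dotProduct_mulVec_isometry (by rw [Matrix.conjTranspose_conjTranspose]; exact hV'))
  have hVV : ∀ z, V.mulVec (V.conjTranspose.mulVec z) = z := fun z => by
    rw [Matrix.mulVec_mulVec, hV', Matrix.one_mulVec]
  have hVV' : ∀ z, V.conjTranspose.mulVec (V.mulVec z) = z := fun z => by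
    rw [Matrix.mulVec_mulVec, hV, Matrix.one_mulVec]
  have hadj : star U = U' := by
    rw [star_eq_adjoint]
    refine ext_inner_dense span_expProd span_expProd ?_
    rintro _ ⟨z, rfl⟩ _ ⟨w, rfl⟩
    rw [adjoint_inner_right, hU, hU', inner_expProd, inner_expProd,
      ← dotProduct_mulVec_isometry hV w, hVV]
  have h1 : U * U' = 1 := by
    refine ext_op_dense span_expProd ?_
    rintro _ ⟨z, rfl⟩
    rw [mul_apply_eq_comp, hU', hU, hVV]; rfl
  have h2 : U' * U = 1 := by
    refine ext_op_dense span_expProd ?_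
    rintro _ ⟨z, rfl⟩
    rw [mul_apply_eq_comp, hU, hU', hVV']; rfl
  refine ⟨U, Unitary.mem_iff.2 ⟨by rw [hadj, h2], by rw [hadj, h1]⟩, fun z =>
    ⟨multiDisplacement z, multiDisplacement (V.mulVec z), isTensor_multiDisplacement z,
      isTensor_multiDisplacement _, ?_⟩⟩
  rw [hadj]
  refine ext_op_dense span_expProd ?_
  rintro _ ⟨w, rfl⟩
  rw [mul_apply_eq_comp, mul_apply_eq_comp, hU', multiDisplacement_expProd, map_smul, hU,
    multiDisplacement_expProd, Matrix.mulVec_add, hVV, dotProduct_mulVec_isometry hV,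
    ← dotProduct_mulVec_isometry hV z (V.conjTranspose.mulVec w), hVV]

/-! ### Characterization of the vacuum -/

theorem norm_sub_sq_isometry {E : Type} [NormedAddCommGroup E] [InnerProductSpace ℂ E]
    {A : E →L[ℂ] E} (hA : ∀ x, ‖A x‖ = ‖x‖) (x : E) :
    ‖A x - x‖ ^ 2 = 2 * ‖x‖ ^ 2 - 2 * (⟪x, A x⟫_ℂ).re := by
  have h := norm_sub_sq (𝕜 := ℂ) (A x) x
  rw [hA, ← inner_conj_symm, RCLike.conj_re] at h
  rw [h]
  have : RCLike.re ⟪x, A x⟫_ℂ = (⟪x, A x⟫_ℂ).re := rfl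
  rw [this]; ring

theorem sum_inner_ket_sq_le (x : L2 ι) (F : Finset ι) : ∑ i ∈ F, ‖⟪ket i, x⟫_ℂ‖ ^ 2 ≤ ‖x‖ ^ 2 :=
  sum_le_hasSum F (fun _ _ => sq_nonneg _) (hasSum_norm_sq x)

theorem toL2_gen_single (z : ℂ) (n : ℕ) : toL2 (displacementGen z (Finsupp.single n 1)) =
    (z * ((Real.sqrt (n + 1) : ℝ) : ℂ)) • ket (n + 1) -
      ((starRingEnd ℂ) z * ((Real.sqrt n : ℝ) : ℂ)) • ket (n - 1) := by
  rw [displacementGen_single, map_sub, map_smul, map_smul, toL2_single, toL2_single, one_smul, one_smul]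

/-- The parallelogram law. The generators in the directions `1` and `i` contribute `a - b` and `a + b`,
up to a phase, where `a` comes from raising and `b` from lowering the photon number. -/
theorem sq_le_sum_gen (a b : ℂ) : 2 * ‖b‖ ^ 2 ≤
    ‖a - b‖ ^ 2 + ‖-Complex.I * a - Complex.I * b‖ ^ 2 := by
  have h1 : ‖-Complex.I * a - Complex.I * b‖ = ‖a + b‖ := by
    have : -Complex.I * a - Complex.I * b = -Complex.I * (a + b) := by ring
    rw [this, norm_mul, norm_neg, Complex.norm_I, one_mul]
  have h2 := parallelogram_law_with_norm ℝ a b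
  rw [h1]
  nlinarith [sq_nonneg ‖a‖]

/-- For a vector with the characteristic function of the vacuum, the second order expansion of
`‖D_{tζ} ψ - ψ‖²` bounds the generator in mode `j` by one. Matrix elements are taken with the generator
on the Fock state, since `ψ` need not be in its domain; `L k` inserts a vector into mode `j` of `|k⟩`. -/
theorem sum_gen_le {n : ℕ} {ψ : L2 (Fin n → ℕ)} (h1 : ‖ψ‖ = 1) (j : Fin n) (ζ : ℂ) (hζ : ‖ζ‖ = 1)
    (h : ∀ z : Fin n → ℂ, ⟪ψ, multiDisplacement z ψ⟫_ℂ = Complex.exp (-(star z ⬝ᵥ z / 2)))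
    (L : (Fin n → ℕ) → L2 ℕ →L[ℂ] L2 (Fin n → ℕ))
    (hL : ∀ k y, productVector (Function.update (fun i => ket (k i)) j y) = L k y)
    (F : Finset (Fin n → ℕ)) :
    ∑ k ∈ F, ‖⟪L k (toL2 (displacementGen ζ (Finsupp.single (k j) 1))), ψ⟫_ℂ‖ ^ 2 ≤ 1 := by
  let z : ℝ → Fin n → ℂ := fun t => Pi.single j (t * ζ)
  have hz : ∀ t, star (z t) ⬝ᵥ z t = ((t ^ 2 : ℝ) : ℂ) := by
    intro t
    simp only [z, dotProduct_single, Pi.star_apply, Pi.single_eq_same, RCLike.star_def, map_mul,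
      Complex.conj_ofReal]
    have : (starRingEnd ℂ) ζ * ζ = 1 := by
      rw [mul_comm, Complex.mul_conj, Complex.normSq_eq_norm_sq, hζ]; simp
    push_cast
    linear_combination (t : ℂ) ^ 2 * this
  have hk : ∀ k, ket k = L k (ket (k j)) := fun k => by
    rw [← hL, Function.update_eq_self (f := fun i => ket (k i)) j, productVector_ket]
  have hD : ∀ k t, ⟪ket k, multiDisplacement (z (-t)) ψ⟫_ℂ =
      ⟪L k (displacement (t * ζ) (ket (k j))), ψ⟫_ℂ := by
    intro k t
    rw [inner_multiDisplacement, ← productVector_ket, (isTensor_multiDisplacement _).apply_productVector,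
      ← hL]
    congr 2
    ext1 i
    by_cases hi : i = j
    · subst hi
      simp [z]
    · rw [Function.update_of_ne hi]
      simp [z, hi, displacement_zero]
  -- `‖D_{tζ} ψ - ψ‖² = 2 - 2 exp(-t²/2) ≤ t²`, and the inner products with kets are its coordinates.
  have hbound : ∀ t : ℝ, ∑ k ∈ F, ‖⟪L k (displacement (t * ζ) (ket (k j)) - ket (k j)), ψ⟫_ℂ‖ ^ 2
      ≤ t ^ 2 := by
    intro t
    have e1 : ∀ k, ⟪L k (displacement (t * ζ) (ket (k j)) - ket (k j)), ψ⟫_ℂ =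
        ⟪ket k, multiDisplacement (z (-t)) ψ - ψ⟫_ℂ := by
      intro k
      rw [inner_sub_right, hD, map_sub, inner_sub_left, ← hk]
    simp only [e1]
    refine (sum_inner_ket_sq_le _ F).trans ?_
    rw [norm_sub_sq_isometry (norm_multiDisplacement _), h, hz, h1]
    have e2 : (Complex.exp (-((((-t) ^ 2 : ℝ) : ℂ) / 2))).re = Real.exp (-(t ^ 2 / 2)) := by
      rw [← Complex.exp_ofReal_re]; push_cast; ring_nf
    rw [e2]
    have := Real.add_one_le_exp (-(t ^ 2 / 2))
    linarith
  have hder : ∀ k, Filter.Tendsto (fun t : ℝ => ‖⟪(t⁻¹ : ℝ) •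
      L k (displacement (t * ζ) (ket (k j)) - ket (k j)), ψ⟫_ℂ‖ ^ 2) (nhdsWithin 0 {0}ᶜ)
      (nhds (‖⟪L k (toL2 (displacementGen ζ (Finsupp.single (k j) 1))), ψ⟫_ℂ‖ ^ 2)) := by
    intro k
    have d1 := hasDerivAt_displacement ζ (Finsupp.single (k j) 1) 0
    have d2 := hasDerivAt_iff_tendsto_slope_zero.1 d1
    simp only [zero_add, Complex.ofReal_zero, zero_mul, displacement_zero, id_apply, toL2_single,
      one_smul] at d2
    have d3 := ((L k).continuous.tendsto _).comp d2
    have d4 := (d3.inner (𝕜 := ℂ) (tendsto_const_nhds (x := ψ))).norm.pow 2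
    refine d4.congr fun t => ?_
    simp only [Function.comp_apply]
    congr 3
    exact (L k).map_smul_of_tower t⁻¹ _
  refine le_of_tendsto (tendsto_finsetSum F fun k _ => hder k) ?_
  filter_upwards [self_mem_nhdsWithin] with t ht
  have e3 : ∀ k, ‖⟪(t⁻¹ : ℝ) • L k (displacement (t * ζ) (ket (k j)) - ket (k j)), ψ⟫_ℂ‖ ^ 2 =
      (t ^ 2)⁻¹ * ‖⟪L k (displacement (t * ζ) (ket (k j)) - ket (k j)), ψ⟫_ℂ‖ ^ 2 := by
    intro k
    rw [RCLike.real_smul_eq_coe_smul (K := ℂ), inner_smul_left, norm_mul, mul_pow]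
    congr 1
    simp
  simp only [e3]
  rw [← Finset.mul_sum]
  have ht' : (0 : ℝ) < t ^ 2 := by
    have : t ≠ 0 := ht
    positivity
  rw [inv_mul_le_iff₀ ht', mul_one]
  exact hbound t

/-- A unit vector with the characteristic function of the vacuum is the vacuum up to a phase: the
bound on the generators gives `⟪ψ, (a†a + 1) ψ⟫ ≤ 1` in every mode, so its photon numbers vanish. -/
theorem eq_vacuum {n : ℕ} {ψ : L2 (Fin n → ℕ)} (h1 : ‖ψ‖ = 1)
    (h : ∀ z : Fin n → ℂ, ⟪ψ, multiDisplacement z ψ⟫_ℂ = Complex.exp (-(star z ⬝ᵥ z / 2))) :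
    ∃ c : ℂ, ‖c‖ = 1 ∧ ψ = c • ket 0 := by
  classical
  have key : ∀ k₀ : Fin n → ℕ, k₀ ≠ 0 → ⟪ket k₀, ψ⟫_ℂ = 0 := by
    intro k₀ hk₀
    obtain ⟨j, hj⟩ : ∃ j, k₀ j ≠ 0 := by
      by_contra hcon
      push Not at hcon
      exact hk₀ (funext hcon)
    choose L hL using fun k : Fin n → ℕ => exists_slot (fun i => ket (k i)) j
    have hLk : ∀ k m, L k (ket m) = ket (Function.update k j m) := by
      intro k m
      rw [← hL, ← productVector_ket]
      congr 1
      ext1 i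
      by_cases hi : i = j
      · subst hi; simp
      · simp [hi]
    -- `⟪ψ, (a†a + 1) ψ⟫ ≤ 1`: for a finite set `F` of kets, the generators are tested on the kets with
    -- one more photon in mode `j`, whose lowered images are the kets in `F`.
    have hF : ∀ F : Finset (Fin n → ℕ), ∑ k ∈ F, ((k j : ℝ) + 1) * ‖⟪ket k, ψ⟫_ℂ‖ ^ 2 ≤ 1 := by
      intro F
      let s : (Fin n → ℕ) → (Fin n → ℕ) := fun k => Function.update k j (k j + 1)
      have hs : Set.InjOn s F := by
        intro k _ l _ hkl
        have e1 : k j = l j := by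
          have := congrFun hkl j
          simp only [s, Function.update_self] at this
          omega
        ext1 i
        by_cases hi : i = j
        · rw [hi, e1]
        · have := congrFun hkl i
          simpa only [s, Function.update_of_ne hi] using this
      have b1 := sum_gen_le h1 j 1 (by simp) h L hL (F.image s)
      have b2 := sum_gen_le h1 j Complex.I (by simp) h L hL (F.image s)
      rw [Finset.sum_image hs] at b1 b2
      have b3 : ∀ k, 2 * (((k j : ℝ) + 1) * ‖⟪ket k, ψ⟫_ℂ‖ ^ 2) ≤
          ‖⟪L (s k) (toL2 (displacementGen 1 (Finsupp.single (s k j) 1))), ψ⟫_ℂ‖ ^ 2 +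
          ‖⟪L (s k) (toL2 (displacementGen Complex.I (Finsupp.single (s k j) 1))), ψ⟫_ℂ‖ ^ 2 := by
        intro k
        simp only [toL2_gen_single, map_sub, map_smul, hLk, inner_sub_left, inner_smul_left, map_mul,
          Complex.conj_ofReal, map_one, one_mul, Complex.conj_I, s, Function.update_self,
          Nat.add_sub_cancel, Function.update_idem, Function.update_eq_self, map_neg, neg_neg]
        refine le_trans (le_of_eq ?_) (le_of_le_of_eq (sq_le_sum_gen
          (((Real.sqrt (((k j + 1 : ℕ) : ℝ) + 1) : ℝ) : ℂ) *
            ⟪ket (Function.update k j (k j + 1 + 1)), ψ⟫_ℂ)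
          (((Real.sqrt ((k j + 1 : ℕ) : ℝ) : ℝ) : ℂ) * ⟪ket k, ψ⟫_ℂ)) ?_)
        · rw [norm_mul, mul_pow, Complex.norm_real, Real.norm_of_nonneg (Real.sqrt_nonneg _),
            Real.sq_sqrt (by positivity)]
          push_cast; ring
        · simp only [mul_assoc]
      have b4 := Finset.sum_le_sum fun k (_ : k ∈ F) => b3 k
      rw [← Finset.mul_sum, Finset.sum_add_distrib] at b4
      linarith
    have hs := hasSum_norm_sq ψ
    rw [h1] at hs
    have hlim : Filter.Tendsto (fun F : Finset (Fin n → ℕ) => ∑ k ∈ F, ‖⟪ket k, ψ⟫_ℂ‖ ^ 2)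
        Filter.atTop (nhds (1 ^ 2)) := by
      have := hs
      rwa [HasSum, SummationFilter.unconditional_filter] at this
    have h2 : (1 : ℝ) ^ 2 ≤ 1 - ‖⟪ket k₀, ψ⟫_ℂ‖ ^ 2 := by
      refine le_of_tendsto hlim ?_
      filter_upwards [Filter.eventually_ge_atTop {k₀}] with F hFk
      have h3 := hF F
      have h4 : ∑ k ∈ F, ‖⟪ket k, ψ⟫_ℂ‖ ^ 2 + ∑ k ∈ F, (k j : ℝ) * ‖⟪ket k, ψ⟫_ℂ‖ ^ 2 ≤ 1 := by
        rw [← Finset.sum_add_distrib]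
        refine le_trans (le_of_eq (Finset.sum_congr rfl fun k _ => ?_)) h3
        ring
      have h5 : (k₀ j : ℝ) * ‖⟪ket k₀, ψ⟫_ℂ‖ ^ 2 ≤ ∑ k ∈ F, (k j : ℝ) * ‖⟪ket k, ψ⟫_ℂ‖ ^ 2 :=
        Finset.single_le_sum (f := fun k => (k j : ℝ) * ‖⟪ket k, ψ⟫_ℂ‖ ^ 2)
          (fun k _ => by positivity) (hFk (Finset.mem_singleton_self k₀))
      have h6 : (1 : ℝ) ≤ k₀ j := by exact_mod_cast Nat.one_le_iff_ne_zero.2 hj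
      nlinarith [sq_nonneg ‖⟪ket k₀, ψ⟫_ℂ‖]
    have h7 : ‖⟪ket k₀, ψ⟫_ℂ‖ ^ 2 ≤ 0 := by linarith
    have h8 : ‖⟪ket k₀, ψ⟫_ℂ‖ = 0 := by nlinarith [norm_nonneg ⟪ket k₀, ψ⟫_ℂ]
    exact norm_eq_zero.1 h8
  have hψ : ψ = ⟪ket 0, ψ⟫_ℂ • ket 0 := by
    refine ext_ket fun k => ?_
    rw [inner_smul_right, inner_ket_ket]
    by_cases hk : k = 0
    · subst hk; simp
    · rw [key k hk, if_neg hk, mul_zero]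
  refine ⟨⟪ket 0, ψ⟫_ℂ, ?_, hψ⟩
  rw [hψ, norm_smul, norm_ket, mul_one] at h1
  exact h1

/-! ### The symmetric convolution -/

theorem cons_bijective (n : ℕ) : Function.Bijective
    (Function.uncurry fun (r : Fin n → ℕ) (m : ℕ) => (Fin.cons m r : Fin (n + 1) → ℕ)) :=
  ⟨cons_injective n, fun k => ⟨(Fin.tail k, k 0), Fin.cons_self_tail k⟩⟩

theorem multiDisplacement_attach {n : ℕ} (z : ℂ) (r : Fin n → ℕ) (x : L2 ℕ) :
    multiDisplacement (Fin.cons z 0 : Fin (n + 1) → ℂ) (attach r x) =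
      attach r (displacement z x) := by
  rw [attach_eq, attach_eq, (isTensor_multiDisplacement _).apply_productVector]
  congr 1
  ext1 j
  refine Fin.cases ?_ (fun i => ?_) j <;> simp [displacement_zero]

theorem hasSum_fiberwise_swap {f : κ × ι → ℂ} {F : ι → κ → ℂ} {g : ι → ℂ} {a : ℂ}
    (hf : HasSum f a) (hF : ∀ i k, F i k = f (k, i)) (h : ∀ i, HasSum (F i) (g i)) : HasSum g a := by
  have h1 : HasSum (fun p : ι × κ => f (p.2, p.1)) a := (Equiv.prodComm ι κ).hasSum_iff.2 hf
  have h2 : ∀ i, HasSum (fun k => f (k, i)) (g i) := fun i =>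
    (funext (hF i) : F i = fun k => f (k, i)) ▸ h i
  exact HasSum.prod_fiberwise (f := fun p : ι × κ => f (p.2, p.1)) h1 h2

theorem trace_blockTrace_comp {ρ : Type} {g : ρ → ι → κ}
    (hg : Function.Bijective (Function.uncurry g)) (S : TraceClass κ) {B : L2 ι →L[ℂ] L2 ι}
    {D : L2 κ →L[ℂ] L2 κ}
    (h : ∀ r x, D (embed (injective_section hg.1 r) x) = embed (injective_section hg.1 r) (B x)) :
    trace ((blockTrace hg.1 S).1.comp B) = trace (S.1.comp D) := by
  have h1 : HasSum (fun p : ρ × ι => ⟪ket (Function.uncurry g p), S.1 (D (ket (Function.uncurry g p)))⟫_ℂ)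
      (trace (S.1.comp D)) :=
    (Equiv.ofBijective _ hg).hasSum_iff.2 (hasSum_trace_comp S D)
  refine (hasSum_trace_comp (blockTrace hg.1 S) B).unique (hasSum_fiberwise_swap h1
    (fun i r => ?_) fun m => hasSum_blockTrace hg.1 S (ket m) (B (ket m)))
  rw [← h, embed_ket]
  rfl

/-- The characteristic function of a reduced operator is the restriction of the characteristic
function to displacements of the first mode. -/
theorem charFun_partialTrace {n : ℕ} (S : TraceClass (Fin (n + 1) → ℕ)) (z : ℂ) :
    charFun (partialTrace S) z =
      trace (S.1.comp (multiDisplacement (Fin.cons z 0 : Fin (n + 1) → ℂ))) :=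
  trace_blockTrace_comp (cons_bijective n) S fun r x => multiDisplacement_attach z r x

theorem beamSplitterMatrix_const {n : ℕ} (z : ℂ) :
    (beamSplitterMatrix (n + 1)).mulVec (fun _ => z / ((Real.sqrt (n + 1 : ℕ) : ℝ) : ℂ)) =
      Fin.cons z 0 := by
  -- The first row of `V` is constant `1/√(n+1)`, so `V†(z, 0, …, 0)` is a constant vector.
  have h : (fun _ => z / ((Real.sqrt (n + 1 : ℕ) : ℝ) : ℂ)) =
      (beamSplitterMatrix (n + 1)).conjTranspose.mulVec (Fin.cons z 0 : Fin (n + 1) → ℂ) := by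
    ext1 k
    rw [Matrix.mulVec, dotProduct, Fin.sum_univ_succ]
    simp [beamSplitterMatrix, div_eq_mul_inv, mul_comm]
  rw [h, Matrix.mulVec_mulVec, mul_eq_one_comm.1 (beamSplitterMatrix_unitary n), Matrix.one_mulVec]

namespace IsBeamSplitter

variable {n : ℕ} {U : L2 (Fin (n + 1) → ℕ) →L[ℂ] L2 (Fin (n + 1) → ℕ)}

theorem conj_displacement (hU : IsBeamSplitter U) (z : Fin (n + 1) → ℂ) :
    U * multiDisplacement z * star U =
      multiDisplacement ((beamSplitterMatrix (n + 1)).mulVec z) := by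
  obtain ⟨A, B, hA, hB, h⟩ := hU.2 z
  rwa [hA.unique (isTensor_multiDisplacement z), hB.unique (isTensor_multiDisplacement _)] at h

theorem star_mul (hU : IsBeamSplitter U) : star U * U = 1 := (Unitary.mem_iff.1 hU.1).1

theorem mul_star (hU : IsBeamSplitter U) : U * star U = 1 := (Unitary.mem_iff.1 hU.1).2

theorem star_conj_displacement (hU : IsBeamSplitter U) (z : Fin (n + 1) → ℂ) :
    star U * multiDisplacement ((beamSplitterMatrix (n + 1)).mulVec z) * U =
      multiDisplacement z := by
  rw [← hU.conj_displacement]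
  calc _ = (star U * U) * multiDisplacement z * (star U * U) := by noncomm_ring
    _ = _ := by rw [hU.star_mul, one_mul, mul_one]

/-- A beam splitter preserves the vacuum up to a phase, and hence acts on the coherent vectors as the
matrix `V`, up to a common phase. -/
theorem exists_star_expProd (hU : IsBeamSplitter U) : ∃ c : ℂ, ‖c‖ = 1 ∧ ∀ z : Fin (n + 1) → ℂ,
    star U (expProd ((beamSplitterMatrix (n + 1)).mulVec z)) = c • expProd z := by
  set V := beamSplitterMatrix (n + 1)
  have hn : ∀ x, ‖star U x‖ = ‖x‖ := by
    intro x
    have h1 : ⟪star U x, star U x⟫_ℂ = ⟪x, x⟫_ℂ := by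
      rw [star_eq_adjoint, adjoint_inner_left, ← mul_apply_eq_comp, ← star_eq_adjoint, hU.mul_star]
      rfl
    rw [inner_self_eq_norm_sq_to_K, inner_self_eq_norm_sq_to_K] at h1
    have h2 : ‖star U x‖ ^ 2 = ‖x‖ ^ 2 := by exact_mod_cast h1
    exact (sq_eq_sq₀ (norm_nonneg _) (norm_nonneg _)).1 h2
  obtain ⟨c, hc, h0⟩ := eq_vacuum (n := n + 1) (ψ := star U (ket 0)) (by rw [hn, norm_ket]) fun z => by
    have h1 : ⟪star U (ket 0), multiDisplacement z (star U (ket 0))⟫_ℂ =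
        ⟪ket 0, (U * multiDisplacement z * star U) (ket 0)⟫_ℂ := by
      rw [star_eq_adjoint, adjoint_inner_left]; rfl
    rw [h1, hU.conj_displacement, ← expProd_zero, multiDisplacement_expProd, inner_smul_right,
      inner_expProd, dotProduct_mulVec_isometry (beamSplitterMatrix_unitary n)]
    simp
  refine ⟨c, hc, fun z => ?_⟩
  have h2 : star U (multiDisplacement (V.mulVec z) (ket 0)) =
      multiDisplacement z (star U (ket 0)) := by
    rw [← hU.star_conj_displacement z]
    simp only [mul_apply_eq_comp]
    have : U (star U (ket 0)) = ket 0 :=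
      congrArg (fun T : L2 (Fin (n + 1) → ℕ) →L[ℂ] L2 (Fin (n + 1) → ℕ) => T (ket 0)) hU.mul_star
    rw [this]
  rw [h0, map_smul, ← expProd_zero, multiDisplacement_expProd, multiDisplacement_expProd, map_smul,
    dotProduct_mulVec_isometry (beamSplitterMatrix_unitary n), smul_comm] at h2
  simp only [dotProduct_zero, sub_zero, zero_add] at h2
  exact smul_right_injective _ (Complex.exp_ne_zero _) h2

end IsBeamSplitter

namespace IsSymmetricConvolution

variable {N : TraceClass ℕ →ₗ[ℂ] TraceClass ℕ} {n : ℕ} {C : TraceClass ℕ →ₗ[ℂ] TraceClass ℕ}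

theorem isCPTP (h : IsSymmetricConvolution N n C) : IsCPTP C := by
  obtain ⟨U, M, hU, hM, hC⟩ := h
  have h1 : IsCPTP (sandwich U (adjoint U)) := isCPTP_sandwich U (by
    rw [← star_eq_adjoint]; exact hU.star_mul)
  have h2 : IsCPTP (sandwich (adjoint U) (adjoint (adjoint U))) := isCPTP_sandwich _ (by
    rw [adjoint_adjoint, ← star_eq_adjoint]; exact hU.mul_star)
  have h3 : IsCPTP (tensorVacuum n) := isCPTP_sandwich (attach (0 : Fin n → ℕ)) 
    (adjoint_comp_isometryOf (orthonormal_ket.comp (fun m : ℕ => (Fin.cons m 0 : Fin (n + 1) → ℕ))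
      (injective_section (cons_injective n) 0)))
  have h4 := (isCPTP_blockTrace (cons_bijective n)).comp
    (h1.comp ((isCPTP_iff.2 hM.1).comp (h2.comp h3)))
  rw [adjoint_adjoint] at h4
  convert h4 using 1
  ext1 T
  exact hC T

/-- On coherent dyads the characteristic function of the symmetric convolution is a power of the
characteristic function of the given channel: the beam splitter maps `e_α ⊗ |0…0⟩` to a product of equal
coherent vectors, and the displacement of the first mode to a product of equal displacements. -/
theorem charFun_eq (h : IsSymmetricConvolution N n C) (α β z : ℂ) :
    charFun (C (dyadTC (expVec α) (expVec β))) z =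
      charFun (N (dyadTC (expVec (α / ((Real.sqrt (n + 1 : ℕ) : ℝ) : ℂ)))
        (expVec (β / ((Real.sqrt (n + 1 : ℕ) : ℝ) : ℂ)))))
          (z / ((Real.sqrt (n + 1 : ℕ) : ℝ) : ℂ)) ^ (n + 1) := by
  obtain ⟨U, M, hU, hM, hC⟩ := h
  obtain ⟨c, hc, hcU⟩ := hU.exists_star_expProd
  set s : ℂ := ((Real.sqrt (n + 1 : ℕ) : ℝ) : ℂ) with hs
  have h1 : ∀ α, star U (attach (0 : Fin n → ℕ) (expVec α)) = c • expProd (fun _ => α / s) := by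
    intro α
    rw [attach_expVec, ← hcU, beamSplitterMatrix_const]
  have h2 : sandwich (star U) U (tensorVacuum n (dyadTC (expVec α) (expVec β))) =
      dyadTC (expProd fun _ => α / s) (expProd fun _ => β / s) := by
    have e1 : sandwich (star U) U (tensorVacuum n (dyadTC (expVec α) (expVec β))) =
        sandwich (star U) (adjoint (star U)) (tensorVacuum n (dyadTC (expVec α) (expVec β))) := by
      rw [star_eq_adjoint, adjoint_adjoint]
    have hcc : c * (starRingEnd ℂ) c = 1 := by
      rw [Complex.mul_conj, Complex.normSq_eq_norm_sq, hc]; simp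
    rw [e1, tensorVacuum, sandwich_dyad, sandwich_dyad, h1, h1, dyadTC_smul_left, dyadTC_smul_right,
      smul_smul, hcc, one_smul]
  have h3 : IsTensor (fun _ : Fin (n + 1) => (dyadTC (expVec (α / s)) (expVec (β / s))).1)
      (dyadTC (expProd fun _ : Fin (n + 1) => α / s) (expProd fun _ => β / s)).1 :=
    isTensor_dyad _ _
  have h4 := hM.2 _ _ h3
  rw [hC, charFun_partialTrace, h2]
  set X := M (dyadTC (expProd fun _ => α / s) (expProd fun _ => β / s))
  have h5 : trace ((sandwich U (star U) X).1.comp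
      (multiDisplacement (Fin.cons z 0 : Fin (n + 1) → ℂ))) =
      trace (X.1.comp (multiDisplacement fun _ => z / s)) := by
    rw [← hU.star_conj_displacement (fun _ => z / s), beamSplitterMatrix_const]
    change trace ((U.comp (X.1.comp (star U))).comp _) = _
    have hX : traceNorm (X.1.comp ((star U).comp
        (multiDisplacement (Fin.cons z 0 : Fin (n + 1) → ℂ)))) < ⊤ :=
      traceNorm_sandwich_lt_top (ContinuousLinearMap.id ℂ _) _ X.1 X.2
    exact (trace_comp_comm ⟨_, hX⟩ U).symm
  rw [h5, ((h4.comp (isTensor_multiDisplacement fun _ => z / s))).trace_eq fun j =>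
    hasSum_trace_comp _ _]
  simp only [Finset.prod_const, Finset.card_univ, Fintype.card_fin]
  rfl

end IsSymmetricConvolution

theorem exists_isSymmetricConvolution {N : TraceClass ℕ →ₗ[ℂ] TraceClass ℕ} (hN : IsChannel N)
    (n : ℕ) : ∃ C : TraceClass ℕ →ₗ[ℂ] TraceClass ℕ, IsSymmetricConvolution N n C := by
  obtain ⟨U, hU⟩ := exists_beamSplitter n
  obtain ⟨M, hM⟩ := exists_tensorPower hN (n + 1)
  exact ⟨(blockTrace (cons_injective n)).comp ((sandwich U (star U)).comp (M.comp
    ((sandwich (star U) U).comp (tensorVacuum n)))), U, M, hU, hM, fun T => rfl⟩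

/-! ### Diagonal operators and limits of traces -/

theorem summable_diagonal {d : ι → ℝ} (hd : ∀ i, |d i| ≤ 1) (x : L2 ι) :
    Summable fun i => ‖(d i : ℂ) * ⟪ket i, x⟫_ℂ‖ ^ 2 := by
  refine Summable.of_nonneg_of_le (fun _ => sq_nonneg _) (fun i => ?_) (hasSum_norm_sq x).summable
  rw [norm_mul, Complex.norm_real, Real.norm_eq_abs]
  have := hd i
  gcongr
  exact mul_le_of_le_one_left (norm_nonneg _) this

/-- The diagonal operator `|i⟩ ↦ dᵢ|i⟩`. -/
def diagonal (d : ι → ℝ) (hd : ∀ i, |d i| ≤ 1) : L2 ι →L[ℂ] L2 ι :=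
  LinearMap.mkContinuous
    { toFun := fun x => ofCoord _ (summable_diagonal hd x)
      map_add' := fun x y => ext_ket fun i => by
        rw [inner_add_right, inner_ket_ofCoord, inner_ket_ofCoord, inner_ket_ofCoord,
          inner_add_right, mul_add]
      map_smul' := fun c x => ext_ket fun i => by
        rw [RingHom.id_apply, inner_smul_right, inner_ket_ofCoord, inner_ket_ofCoord,
          inner_smul_right, mul_left_comm] } 1 fun x => by
    have h1 := hasSum_norm_sq (ofCoord _ (summable_diagonal hd x))
    have h2 : ‖ofCoord _ (summable_diagonal hd x)‖ ^ 2 ≤ ‖x‖ ^ 2 := by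
      refine hasSum_le (fun i => ?_) h1 (hasSum_norm_sq x)
      rw [inner_ket_ofCoord, norm_mul, Complex.norm_real, Real.norm_eq_abs]
      have := hd i
      gcongr
      exact mul_le_of_le_one_left (norm_nonneg _) this
    rw [one_mul]
    exact (sq_le_sq₀ (norm_nonneg _) (norm_nonneg _)).1 h2

theorem inner_ket_diagonal {d : ι → ℝ} (hd : ∀ i, |d i| ≤ 1) (i : ι) (x : L2 ι) :
    ⟪ket i, diagonal d hd x⟫_ℂ = d i * ⟪ket i, x⟫_ℂ :=
  inner_ket_ofCoord _ (summable_diagonal hd x) i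

theorem diagonal_ket {d : ι → ℝ} (hd : ∀ i, |d i| ≤ 1) (i : ι) :
    diagonal d hd (ket i) = (d i : ℂ) • ket i := by
  classical
  refine ext_ket fun j => ?_
  rw [inner_ket_diagonal, inner_smul_right, inner_ket_ket]
  by_cases h : j = i
  · rw [h]
  · simp [h]

theorem adjoint_diagonal {d : ι → ℝ} (hd : ∀ i, |d i| ≤ 1) :
    adjoint (diagonal d hd) = diagonal d hd := by
  refine ext_matrix fun i j => ?_
  rw [adjoint_inner_right, diagonal_ket, diagonal_ket, inner_smul_left, inner_smul_right,
    Complex.conj_ofReal]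
  by_cases h : i = j
  · rw [h]
  · rw [orthonormal_ket.2 h, mul_zero, mul_zero]

theorem norm_diagonal_le {d : ι → ℝ} (hd : ∀ i, |d i| ≤ 1) (x : L2 ι) :
    ‖diagonal d hd x‖ ≤ ‖x‖ := by
  have := (diagonal d hd).le_of_opNorm_le (LinearMap.mkContinuous_norm_le _ zero_le_one _) x
  simpa using this

/-- Uniformly bounded operators which converge on a total set converge strongly. -/
theorem tendsto_apply_of_total {α E F : Type} [NormedAddCommGroup E] [NormedSpace ℂ E]
    [NormedAddCommGroup F] [NormedSpace ℂ F] {D : Set E}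
    (hD : (Submodule.span ℂ D).topologicalClosure = ⊤) {l : Filter α} {A : α → E →L[ℂ] F}
    {B : E →L[ℂ] F} {c : ℝ} (hA : ∀ a x, ‖A a x‖ ≤ c * ‖x‖)
    (h : ∀ x ∈ D, Filter.Tendsto (fun a => A a x) l (nhds (B x))) (x : E) :
    Filter.Tendsto (fun a => A a x) l (nhds (B x)) := by
  refine dense_induction hD (p := fun x => Filter.Tendsto (fun a => A a x) l (nhds (B x))) ?_ h
    (fun x y hx hy => by simpa using hx.add hy) (fun c x hx => by simpa using hx.const_smul c)
    (by simpa using tendsto_const_nhds) x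
  rw [← isSeqClosed_iff_isClosed]
  intro u x hu hux
  change Filter.Tendsto (fun a => A a x) l (nhds (B x))
  rw [Metric.tendsto_nhds]
  intro ε hε
  obtain ⟨b, hb0, hb⟩ : ∃ b : ℝ, 0 < b ∧ (∀ a x, ‖A a x‖ ≤ b * ‖x‖) ∧ ∀ x, ‖B x‖ ≤ b * ‖x‖ :=
    ⟨|c| + ‖B‖ + 1, by positivity,
      fun a x => (hA a x).trans (by gcongr; linarith [le_abs_self c, norm_nonneg B]),
      fun x => B.le_of_opNorm_le (by linarith [abs_nonneg c]) x⟩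
  obtain ⟨n, hn⟩ := ((tendsto_iff_norm_sub_tendsto_zero.1 hux).eventually
    (gt_mem_nhds (show 0 < ε / (3 * b) by positivity))).exists
  filter_upwards [Metric.tendsto_nhds.1 (hu n) (ε / 3) (by positivity)] with a ha
  rw [dist_eq_norm] at ha ⊢
  have e : A a x - B x = A a (x - u n) + (A a (u n) - B (u n)) + B (u n - x) := by
    simp only [map_sub]; abel
  have h1 := hb.1 a (x - u n)
  have h2 := hb.2 (u n - x)
  rw [norm_sub_rev x] at h1
  have h3 : b * ‖u n - x‖ < ε / 3 := by
    calc b * ‖u n - x‖ < b * (ε / (3 * b)) := by gcongr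
      _ = ε / 3 := by field_simp
  rw [e]
  calc _ ≤ ‖A a (x - u n)‖ + ‖A a (u n) - B (u n)‖ + ‖B (u n - x)‖ :=
        (norm_add_le _ _).trans (add_le_add_left (norm_add_le _ _) _)
    _ < ε := by linarith

/-- The trace against a trace-class operator is continuous for bounded weak convergence. -/
theorem tendsto_trace_comp {α : Type} {l : Filter α} (T : TraceClass ι)
    {A : α → L2 ι →L[ℂ] L2 ι} {B : L2 ι →L[ℂ] L2 ι} {c : ℝ}
    (hA : ∀ᶠ a in l, ∀ x, ‖A a x‖ ≤ c * ‖x‖)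
    (h : ∀ x y, Filter.Tendsto (fun a => ⟪x, A a y⟫_ℂ) l (nhds ⟪x, B y⟫_ℂ)) :
    Filter.Tendsto (fun a => trace (T.1.comp (A a))) l (nhds (trace (T.1.comp B))) := by
  obtain ⟨x, y, hT⟩ := exists_hasDyads T
  simp only [← (hT.hasSum_trace_comp _).tsum_eq]
  refine tendsto_tsum_of_dominated_convergence (bound := fun k => |c| * (‖x k‖ * ‖y k‖))
    ((summable_inner_of_sq hT.left hT.right).mul_left _) (fun k => h _ _) ?_
  filter_upwards [hA] with a ha k
  refine (norm_inner_le_norm _ _).trans ?_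
  have h1 := ha (x k)
  have h2 := mul_le_mul_of_nonneg_right (le_abs_self c) (norm_nonneg (x k))
  calc ‖y k‖ * ‖A a (x k)‖ ≤ ‖y k‖ * (|c| * ‖x k‖) := by gcongr; linarith
    _ = _ := by ring

theorem trace_adjoint (T : L2 ι →L[ℂ] L2 ι) : trace (adjoint T) = (starRingEnd ℂ) (trace T) := by
  rw [trace, trace, Complex.conj_tsum]
  exact tsum_congr fun i => by rw [adjoint_inner_right, inner_conj_symm]

theorem charFun_zero (T : TraceClass ℕ) : charFun T 0 = trace T.1 := by
  rw [charFun, displacement_zero, comp_id]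

theorem continuous_charFun (T : TraceClass ℕ) : Continuous (charFun T) := by
  refine continuous_iff_continuousAt.2 fun z => ?_
  refine tendsto_trace_comp T (c := 1) (Filter.Eventually.of_forall fun w x => ?_) fun x y => ?_
  · rw [norm_displacement, one_mul]
  · exact tendsto_const_nhds.inner ((continuous_displacement y).tendsto z)

/-- Trace-class operators from square summable families of vectors. -/
theorem exists_traceClass {x y : κ → L2 ι} (hx : Summable fun k => ‖x k‖ ^ 2)
    (hy : Summable fun k => ‖y k‖ ^ 2) : ∃ T : TraceClass ι, HasDyads T.1 x y := by
  have hs : Summable fun k => dyad (x k) (y k) := by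
    refine Summable.of_norm_bounded (summable_inner_of_sq hx hy) fun k => ?_
    refine ContinuousLinearMap.opNorm_le_bound _ (by positivity) fun v => ?_
    rw [dyad_apply, norm_smul]
    calc ‖⟪y k, v⟫_ℂ‖ * ‖x k‖ ≤ (‖y k‖ * ‖v‖) * ‖x k‖ := by
          gcongr; exact norm_inner_le_norm _ _
      _ = _ := by ring
  have hd : HasDyads (∑' k, dyad (x k) (y k)) x y := by
    refine ⟨hx, hy, fun u v => ?_⟩
    have h1 := (hs.hasSum.mapL (ContinuousLinearMap.apply ℂ (L2 ι) v)).mapL (innerSL ℂ u)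
    exact hasSum_of_eq (fun k => inner_dyad _ _ _ _) h1
  refine ⟨⟨∑' k, dyad (x k) (y k), ?_⟩, hd⟩
  change traceNorm _ < ⊤
  have hf : ∀ {x : κ → L2 ι}, (Summable fun k => ‖x k‖ ^ 2) →
      ∑' k, ‖x k‖ₑ ^ 2 ≤ (ENNReal.ofReal (Real.sqrt (∑' k, ‖x k‖ ^ 2))) ^ 2 := by
    intro x hx
    rw [tsum_enorm_sq hx, ← ENNReal.ofReal_pow (Real.sqrt_nonneg _),
      Real.sq_sqrt (tsum_nonneg fun _ => sq_nonneg _)]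
  exact (hd.traceNorm_le (hf hx) (hf hy)).trans_lt
    (ENNReal.mul_lt_top ENNReal.ofReal_lt_top ENNReal.ofReal_lt_top)

/-! ### Regularized generators of the displacements -/

theorem abs_inv_sqrt_succ_le (l : ℕ) : |(Real.sqrt (l + 1))⁻¹| ≤ 1 := by
  rw [abs_of_nonneg (by positivity)]
  refine inv_le_one_of_one_le₀ ?_
  rw [Real.one_le_sqrt]
  linarith [Nat.cast_nonneg (α := ℝ) l]

theorem abs_sqrt_mul_inv_sqrt_succ_le (l : ℕ) : |Real.sqrt l * (Real.sqrt (l + 1))⁻¹| ≤ 1 := by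
  rw [abs_of_nonneg (by positivity), ← div_eq_mul_inv]
  refine div_le_one_of_le₀ (Real.sqrt_le_sqrt (by linarith)) (Real.sqrt_nonneg _)

/-- The operator `(a†a + 1)^(-1/2)`. Its range consists of the vectors of finite energy. -/
def resolvent : L2 ℕ →L[ℂ] L2 ℕ := diagonal (fun l : ℕ => (Real.sqrt (l + 1))⁻¹) abs_inv_sqrt_succ_le

theorem resolvent_ket (l : ℕ) : resolvent (ket l) = (((Real.sqrt (l + 1))⁻¹ : ℝ) : ℂ) • ket l :=
  diagonal_ket _ l

theorem adjoint_resolvent : adjoint resolvent = resolvent := adjoint_diagonal _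

theorem inner_resolvent (x y : L2 ℕ) : ⟪resolvent x, y⟫_ℂ = ⟪x, resolvent y⟫_ℂ := by
  conv_lhs => rw [← adjoint_resolvent]
  rw [adjoint_inner_left]

/-- The bounded operator `(z a† - z̄ a) (a†a + 1)^(-1/2)`. -/
def regGen (z : ℂ) : L2 ℕ →L[ℂ] L2 ℕ :=
  z • embed Nat.succ_injective - (starRingEnd ℂ) z • (adjoint (embed Nat.succ_injective)).comp
    (diagonal (fun l : ℕ => Real.sqrt l * (Real.sqrt (l + 1))⁻¹) abs_sqrt_mul_inv_sqrt_succ_le)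

theorem sqrt_succ_ne_zero (l : ℕ) : Real.sqrt ((l : ℝ) + 1) ≠ 0 :=
  (Real.sqrt_pos.2 (by positivity)).ne'

theorem regGen_ket (z : ℂ) (l : ℕ) : regGen z (ket l) =
    (((Real.sqrt (l + 1))⁻¹ : ℝ) : ℂ) • toL2 (displacementGen z (Finsupp.single l 1)) := by
  have h1 : ((Real.sqrt ((l : ℝ) + 1) : ℝ) : ℂ) ≠ 0 := by exact_mod_cast sqrt_succ_ne_zero l
  rw [toL2_gen_single, regGen, sub_apply, smul_apply, smul_apply, comp_apply, diagonal_ket,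
    embed_ket, map_smul, smul_sub, smul_smul, smul_smul, smul_smul]
  congr 1
  · congr 1
    push_cast
    field_simp
  · rcases l with _ | l
    · simp
    · rw [adjoint_embed_ket Nat.succ_injective l, Nat.add_sub_cancel]
      congr 1
      push_cast
      ring

theorem toL2_gen_ket (z : ℂ) (l : ℕ) : toL2 (displacementGen z (Finsupp.single l 1)) =
    ((Real.sqrt (l + 1) : ℝ) : ℂ) • regGen z (ket l) := by
  have h1 : ((Real.sqrt ((l : ℝ) + 1) : ℝ) : ℂ) ≠ 0 := by exact_mod_cast sqrt_succ_ne_zero l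
  rw [regGen_ket, smul_smul]
  push_cast
  rw [mul_inv_cancel₀ h1, one_smul]

theorem adjoint_regGen_toL2 (z : ℂ) (u : ℕ →₀ ℂ) :
    adjoint (regGen z) (toL2 u) = -resolvent (toL2 (displacementGen z u)) := by
  refine ext_ket fun l => ?_
  rw [adjoint_inner_right, regGen_ket, inner_smul_left, Complex.conj_ofReal, inner_gen,
    inner_neg_right, ← inner_resolvent, resolvent_ket, inner_smul_left, Complex.conj_ofReal,
    toL2_single, one_smul, mul_neg]

theorem resolvent_comp_regGen (z : ℂ) :
    resolvent.comp (regGen z) = -(adjoint (regGen z)).comp resolvent := by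
  refine ext_op fun l => ?_
  have h := adjoint_regGen_toL2 z (Finsupp.single l 1)
  rw [toL2_single, one_smul] at h
  rw [neg_apply, comp_apply, comp_apply, resolvent_ket, map_smul, h, regGen_ket, map_smul, smul_neg,
    neg_neg]

theorem regGen_smul (t : ℝ) (z : ℂ) : regGen (t * z) = (t : ℂ) • regGen z := by
  rw [regGen, regGen, smul_sub, smul_smul, smul_smul, map_mul, Complex.conj_ofReal]

theorem regGen_add (z w : ℂ) : regGen (z + w) = regGen z + regGen w := by
  simp only [regGen, map_add, add_smul]
  abel

/-- Finite superpositions of Fock states are in the range of the resolvent. -/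
theorem exists_resolvent_toL2 (z : ℂ) (u : ℕ →₀ ℂ) : ∃ v : ℕ →₀ ℂ,
    resolvent (toL2 u) = toL2 v ∧ regGen z (toL2 u) = toL2 (displacementGen z v) := by
  induction u using Finsupp.induction_linear with
  | zero => exact ⟨0, by simp⟩
  | add f g hf hg =>
    obtain ⟨v, h1, h2⟩ := hf
    obtain ⟨w, h3, h4⟩ := hg
    exact ⟨v + w, by rw [map_add, map_add, map_add, h1, h3],
      by rw [map_add, map_add, map_add, map_add, h2, h4]⟩
  | single l c =>
    refine ⟨Finsupp.single l (c * (((Real.sqrt (l + 1))⁻¹ : ℝ) : ℂ)), ?_, ?_⟩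
    · rw [toL2_single, toL2_single, map_smul, resolvent_ket, smul_smul]
    · have : Finsupp.single l (c * (((Real.sqrt (l + 1))⁻¹ : ℝ) : ℂ)) =
          (c * (((Real.sqrt (l + 1))⁻¹ : ℝ) : ℂ)) • Finsupp.single l (1 : ℂ) := by simp
      rw [this, toL2_single, map_smul, regGen_ket, map_smul, map_smul, smul_smul]

theorem denseRange_toL2 : DenseRange toL2 := by
  have h1 : LinearMap.range toL2 = Submodule.span ℂ (Set.range ket) :=
    Finsupp.range_linearCombination _
  have h2 := span_ket_closure (ι := ℕ)
  rw [← h1] at h2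
  exact (Submodule.dense_iff_topologicalClosure_eq_top (s := LinearMap.range toL2)).2 h2

/-- The mean value inequality for `t ↦ D_{tz} x`, for vectors `x` of finite energy. -/
theorem norm_displacement_resolvent_sub_le (z : ℂ) (x : L2 ℕ) :
    ‖displacement z (resolvent x) - resolvent x‖ ≤ ‖regGen z x‖ := by
  refine denseRange_toL2.induction_on
    (p := fun x => ‖displacement z (resolvent x) - resolvent x‖ ≤ ‖regGen z x‖) x ?_ fun u => ?_
  · exact isClosed_le (by fun_prop) (by fun_prop)
  · obtain ⟨v, h1, h2⟩ := exists_resolvent_toL2 z u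
    rw [h1, h2]
    have h3 := norm_image_sub_le_of_norm_deriv_le_segment_01'
      (f := fun t : ℝ => displacement (t * z) (toL2 v))
      (f' := fun t : ℝ => displacement (t * z) (toL2 (displacementGen z v)))
      (C := ‖toL2 (displacementGen z v)‖)
      (fun t _ => (hasDerivAt_displacement z v t).hasDerivWithinAt)
      (fun t _ => (norm_displacement _ _).le)
    simpa [displacement_zero] using h3

theorem norm_regGen_le (z : ℂ) : ∃ c : ℝ, 0 ≤ c ∧ ∀ x, ‖regGen z x‖ ≤ c * ‖x‖ :=
  ⟨‖regGen z‖, norm_nonneg _, fun x => (regGen z).le_opNorm x⟩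

theorem norm_displacement_smul_sub_le (z : ℂ) (t : ℝ) (x : L2 ℕ) :
    ‖displacement (t * z) (resolvent x) - resolvent x‖ ≤ |t| * ‖regGen z x‖ := by
  refine (norm_displacement_resolvent_sub_le _ x).trans_eq ?_
  rw [regGen_smul, smul_apply, norm_smul, Complex.norm_real, Real.norm_eq_abs]

theorem hasDerivAt_displacement_resolvent_zero (z : ℂ) (x : L2 ℕ) :
    HasDerivAt (fun t : ℝ => displacement (t * z) (resolvent x)) (regGen z x) 0 := by
  obtain ⟨c, hc0, hc⟩ := norm_regGen_le z
  rw [hasDerivAt_iff_tendsto_slope_zero]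
  simp only [zero_add, Complex.ofReal_zero, zero_mul, displacement_zero, id_apply]
  have h := tendsto_apply_of_total (span_ket_closure (ι := ℕ)) (l := nhdsWithin (0 : ℝ) {0}ᶜ)
    (A := fun t : ℝ => ((t⁻¹ : ℝ) : ℂ) • ((displacement (t * z)).comp resolvent - resolvent))
    (B := regGen z) (c := c) (fun t x => ?_) ?_ x
  · simpa only [smul_apply, sub_apply, comp_apply, ← RCLike.real_smul_eq_coe_smul (K := ℂ),
      Complex.coe_smul] using h
  · rw [smul_apply, norm_smul, sub_apply, comp_apply, Complex.norm_real, norm_inv, Real.norm_eq_abs]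
    rcases eq_or_ne t 0 with rfl | ht
    · simp only [abs_zero, inv_zero, zero_mul]; positivity
    · rw [inv_mul_le_iff₀ (abs_pos.2 ht)]
      exact (norm_displacement_smul_sub_le z t x).trans (by gcongr; exact hc x)
  · rintro _ ⟨l, rfl⟩
    obtain ⟨v, h1, h2⟩ := exists_resolvent_toL2 z (Finsupp.single l 1)
    rw [toL2_single, one_smul] at h1 h2
    have h3 := hasDerivAt_iff_tendsto_slope_zero.1 (hasDerivAt_displacement z v 0)
    simp only [zero_add, Complex.ofReal_zero, zero_mul, displacement_zero, id_apply] at h3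
    rw [h2]
    refine h3.congr fun t => ?_
    rw [smul_apply, sub_apply, comp_apply, h1, Complex.coe_smul]

theorem displacement_add_smul (s t : ℝ) (z : ℂ) (x : L2 ℕ) :
    displacement ((s + t : ℝ) * z) x = displacement (s * z) (displacement (t * z) x) := by
  have h := displacement_comp (s * z) (t * z)
  have e : ((s : ℂ) * z * (starRingEnd ℂ) (t * z) - (starRingEnd ℂ) (s * z) * (t * z)) / 2 = 0 := by
    rw [map_mul, map_mul, Complex.conj_ofReal, Complex.conj_ofReal]
    ring
  rw [e, Complex.exp_zero, one_smul] at h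
  rw [← comp_apply, h, Complex.ofReal_add, add_mul]

theorem hasDerivAt_displacement_resolvent (z : ℂ) (x : L2 ℕ) (t : ℝ) :
    HasDerivAt (fun t : ℝ => displacement (t * z) (resolvent x)) (displacement (t * z) (regGen z x))
      t := by
  have h1 : HasDerivAt (fun s : ℝ => displacement ((s - t : ℝ) * z) (resolvent x)) (regGen z x) t := by
    have h0 := hasDerivAt_displacement_resolvent_zero z x
    rw [← sub_self t] at h0
    exact h0.comp_sub_const t t
  have h2 := ((displacement (t * z)).restrictScalars ℝ).hasFDerivAt.comp_hasDerivAt t h1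
  refine h2.congr_of_eventuallyEq (Filter.Eventually.of_forall fun s => ?_)
  change _ = displacement (t * z) (displacement ((s - t : ℝ) * z) (resolvent x))
  rw [← displacement_add_smul, add_sub_cancel]

/-! ### Expansions of characteristic functions -/

theorem tendsto_slope_displacement (z : ℂ) (x y : L2 ℕ) : Filter.Tendsto
    (fun t : ℝ => ⟪x, ((t : ℂ)⁻¹ • ((displacement (t * z)).comp resolvent - resolvent)) y⟫_ℂ)
    (nhdsWithin 0 (Set.Ioi 0)) (nhds ⟪x, regGen z y⟫_ℂ) := by
  have h3 := hasDerivAt_iff_tendsto_slope_zero.1 (hasDerivAt_displacement_resolvent_zero z y)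
  simp only [zero_add, Complex.ofReal_zero, zero_mul, displacement_zero, id_apply] at h3
  have h4 := h3.mono_left (nhdsWithin_mono _ fun t (ht : 0 < t) => ht.ne')
  refine (tendsto_const_nhds.inner h4).congr fun t => ?_
  rw [smul_apply, sub_apply, comp_apply, ← Complex.coe_smul, Complex.ofReal_inv]

theorem norm_slope_displacement_le (z : ℂ) {t : ℝ} (ht : 0 < t) (x : L2 ℕ) :
    ‖((t : ℂ)⁻¹ • ((displacement (t * z)).comp resolvent - resolvent)) x‖ ≤ ‖regGen z‖ * ‖x‖ := by
  rw [smul_apply, norm_smul, sub_apply, comp_apply, norm_inv, Complex.norm_real, Real.norm_eq_abs,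
    inv_mul_le_iff₀ (abs_pos.2 ht.ne')]
  refine (norm_displacement_smul_sub_le z t x).trans ?_
  gcongr
  exact (regGen z).le_opNorm x

theorem trace_comp_add (S : TraceClass ι) (A B : L2 ι →L[ℂ] L2 ι) :
    trace (S.1.comp (A + B)) = trace (S.1.comp A) + trace (S.1.comp B) := by
  have h := (hasSum_trace_comp S A).add (hasSum_trace_comp S B)
  refine (hasSum_trace_comp S (A + B)).unique (hasSum_of_eq (fun i => ?_) h)
  rw [add_apply, map_add, inner_add_right]

theorem trace_comp_smul (S : L2 ι →L[ℂ] L2 ι) (c : ℂ) (A : L2 ι →L[ℂ] L2 ι) :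
    trace (S.comp (c • A)) = c * trace (S.comp A) := by
  rw [comp_smul, trace_smul]

theorem trace_comp_neg (S : L2 ι →L[ℂ] L2 ι) (A : L2 ι →L[ℂ] L2 ι) :
    trace (S.comp (-A)) = -trace (S.comp A) := by
  rw [← neg_one_smul ℂ A, trace_comp_smul, neg_one_mul]

theorem trace_comp_sub (S : TraceClass ι) (A B : L2 ι →L[ℂ] L2 ι) :
    trace (S.1.comp (A - B)) = trace (S.1.comp A) - trace (S.1.comp B) := by
  rw [sub_eq_add_neg, trace_comp_add, trace_comp_neg, sub_eq_add_neg]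

theorem trace_comp_cycle (S : TraceClass ι) (A B : L2 ι →L[ℂ] L2 ι) :
    trace ((A.comp S.1).comp B) = trace (S.1.comp (B.comp A)) :=
  (trace_comp_comm ⟨S.1.comp B, traceNorm_sandwich_lt_top (ContinuousLinearMap.id ℂ _) B S.1 S.2⟩
    A).symm

/-- The characteristic function of an operator of the form `(a†a + 1)^(-1/2) S`, to first order. -/
theorem tendsto_charFun_left {T S : TraceClass ℕ} (h : T.1 = resolvent.comp S.1) (z : ℂ) :
    Filter.Tendsto (fun t : ℝ => (t : ℂ)⁻¹ * (charFun T (t * z) - trace T.1))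
      (nhdsWithin 0 (Set.Ioi 0)) (nhds (trace (S.1.comp (regGen z)))) := by
  have h1 := tendsto_trace_comp S (c := ‖regGen z‖) (l := nhdsWithin (0 : ℝ) (Set.Ioi 0))
    (A := fun t : ℝ => (t : ℂ)⁻¹ • ((displacement (t * z)).comp resolvent - resolvent))
    (by filter_upwards [self_mem_nhdsWithin] with t ht using norm_slope_displacement_le z ht)
    (tendsto_slope_displacement z)
  refine h1.congr fun t => ?_
  rw [trace_comp_smul, trace_comp_sub, ← trace_comp_cycle, ← h, charFun]
  have h2 := trace_comp_cycle S resolvent (ContinuousLinearMap.id ℂ _)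
  rw [comp_id, id_comp] at h2
  rw [← h2, ← h]

theorem adjoint_displacement (z : ℂ) : adjoint (displacement z) = displacement (-z) :=
  ext_matrix fun i j => by rw [adjoint_inner_right, inner_displacement, neg_neg]

theorem regGen_neg (z : ℂ) : regGen (-z) = -regGen z := by
  simp only [regGen, map_neg, neg_smul]
  abel

/-- The characteristic function of an operator of the form `S (a†a + 1)^(-1/2)`, to first order. -/
theorem tendsto_charFun_right {T S : TraceClass ℕ} (h : T.1 = S.1.comp resolvent) (z : ℂ) :
    Filter.Tendsto (fun t : ℝ => (t : ℂ)⁻¹ * (charFun T (t * z) - trace T.1))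
      (nhdsWithin 0 (Set.Ioi 0)) (nhds (-trace (S.1.comp (adjoint (regGen z))))) := by
  have e : ∀ (t : ℝ) (x y : L2 ℕ),
      ⟪x, ((t : ℂ)⁻¹ • (resolvent.comp (displacement (t * z)) - resolvent)) y⟫_ℂ =
      ⟪((t : ℂ)⁻¹ • ((displacement (t * -z)).comp resolvent - resolvent)) x, y⟫_ℂ := by
    intro t x y
    simp only [smul_apply, sub_apply, comp_apply, inner_smul_left, inner_smul_right, inner_sub_left,
      inner_sub_right, map_inv₀, Complex.conj_ofReal, ← inner_resolvent x]
    rw [inner_displacement, mul_neg]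
  have h1 := tendsto_trace_comp S (c := ‖regGen (-z)‖) (l := nhdsWithin (0 : ℝ) (Set.Ioi 0))
    (A := fun t : ℝ => (t : ℂ)⁻¹ • (resolvent.comp (displacement (t * z)) - resolvent))
    (B := -adjoint (regGen z)) ?_ ?_
  · rw [trace_comp_neg] at h1
    refine h1.congr fun t => ?_
    rw [trace_comp_smul, trace_comp_sub, ← h, charFun, h]
    rfl
  · filter_upwards [self_mem_nhdsWithin] with t ht x
    set A := ((t : ℂ)⁻¹ • (resolvent.comp (displacement (t * z)) - resolvent))
    set B := ((t : ℂ)⁻¹ • ((displacement (t * -z)).comp resolvent - resolvent))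
    have h2 : A = adjoint B := ext_matrix fun i j => by rw [adjoint_inner_right]; exact e t _ _
    have h3 : ‖B‖ ≤ ‖regGen (-z)‖ :=
      B.opNorm_le_bound (norm_nonneg _) (norm_slope_displacement_le (-z) ht)
    refine A.le_of_opNorm_le ?_ x
    rw [h2, LinearIsometryEquiv.norm_map]
    exact h3
  · intro x y
    have h2 := (Complex.continuous_conj.tendsto _).comp (tendsto_slope_displacement (-z) y x)
    simp only [Function.comp_def, inner_conj_symm] at h2
    simp only [e]
    rw [neg_apply, inner_neg_right, adjoint_inner_right, ← inner_neg_left]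
    rw [regGen_neg] at h2
    exact h2

/-- The remainder of the second order expansion of `t ↦ D_{tz}` between vectors of finite energy. -/
theorem norm_remainder_le (z : ℂ) (x y : L2 ℕ) {t K : ℝ} (ht : 0 ≤ t)
    (hK : ∀ s ∈ Set.Icc 0 t,
      ‖displacement (s * -z) (resolvent x) - resolvent x - (s : ℂ) • regGen (-z) x‖ ≤ K * t) :
    ‖⟪resolvent x, displacement (t * z) (resolvent y)⟫_ℂ - ⟪resolvent x, resolvent y⟫_ℂ -
      t * ⟪resolvent x, regGen z y⟫_ℂ + t ^ 2 / 2 * ⟪regGen z x, regGen z y⟫_ℂ‖ ≤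
        K * ‖regGen z y‖ * t ^ 2 := by
  -- The derivative of the remainder is controlled by the first order remainder of `D_{-sz}` on the left.
  let r : ℝ → ℂ := fun s => ⟪resolvent x, displacement (s * z) (resolvent y)⟫_ℂ -
    ⟪resolvent x, resolvent y⟫_ℂ - s * ⟪resolvent x, regGen z y⟫_ℂ +
      s ^ 2 / 2 * ⟪regGen z x, regGen z y⟫_ℂ
  have hr : ∀ s : ℝ, HasDerivAt r ⟪displacement (s * -z) (resolvent x) - resolvent x -
      (s : ℂ) • regGen (-z) x, regGen z y⟫_ℂ s := by
    intro s
    have d1 : HasDerivAt (fun s : ℝ => ⟪resolvent x, displacement (s * z) (resolvent y)⟫_ℂ)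
        ⟪resolvent x, displacement (s * z) (regGen z y)⟫_ℂ s :=
      ((innerSL ℂ (resolvent x)).restrictScalars ℝ).hasFDerivAt.comp_hasDerivAt s
        (hasDerivAt_displacement_resolvent z y s)
    have d2 : HasDerivAt (fun s : ℝ => (s : ℂ)) 1 s := Complex.ofRealCLM.hasDerivAt
    have d3 := (d2.pow 2).div_const 2
    have d4 := ((d1.sub_const ⟪resolvent x, resolvent y⟫_ℂ).sub
      (d2.mul_const ⟪resolvent x, regGen z y⟫_ℂ)).add (d3.mul_const ⟪regGen z x, regGen z y⟫_ℂ)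
    refine d4.congr_deriv ?_
    rw [inner_displacement, inner_sub_left, inner_sub_left, inner_smul_left, regGen_neg, neg_apply,
      inner_neg_left, Complex.conj_ofReal, mul_neg]
    push_cast
    ring
  have h := norm_image_sub_le_of_norm_deriv_le_segment' (f := r) (a := 0) (b := t)
    (C := K * t * ‖regGen z y‖) (fun s _ => (hr s).hasDerivWithinAt) (fun s hs => by
      refine (norm_inner_le_norm _ _).trans ?_
      gcongr
      exact hK s ⟨hs.1, hs.2.le⟩) t ⟨ht, le_rfl⟩
  have h0 : r 0 = 0 := by simp [r, displacement_zero]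
  rw [h0, sub_zero, sub_zero] at h
  exact h.trans_eq (by ring)

/-- The second order remainder of `(a†a + 1)^(-1/2) D_{tz} (a†a + 1)^(-1/2)`. -/
def remainder (z : ℂ) (t : ℝ) : L2 ℕ →L[ℂ] L2 ℕ :=
  resolvent.comp ((displacement (t * z)).comp resolvent) - resolvent.comp resolvent -
    (t : ℂ) • resolvent.comp (regGen z) + ((t : ℂ) ^ 2 / 2) • (adjoint (regGen z)).comp (regGen z)

theorem inner_remainder (z : ℂ) (t : ℝ) (x y : L2 ℕ) : ⟪x, remainder z t y⟫_ℂ =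
    ⟪resolvent x, displacement (t * z) (resolvent y)⟫_ℂ - ⟪resolvent x, resolvent y⟫_ℂ -
      t * ⟪resolvent x, regGen z y⟫_ℂ + t ^ 2 / 2 * ⟪regGen z x, regGen z y⟫_ℂ := by
  simp only [remainder, add_apply, sub_apply, smul_apply, comp_apply, inner_add_right,
    inner_sub_right, inner_smul_right, inner_resolvent, adjoint_inner_right]

theorem norm_displacement_sub_sub_le (z : ℂ) {s t : ℝ} (hs : s ∈ Set.Icc 0 t) (x : L2 ℕ) :
    ‖displacement (s * z) (resolvent x) - resolvent x - (s : ℂ) • regGen z x‖ ≤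
      2 * ‖regGen z x‖ * t := by
  have h1 := norm_displacement_smul_sub_le z s x
  refine (norm_sub_le _ _).trans ?_
  rw [norm_smul, Complex.norm_real, Real.norm_eq_abs]
  rw [abs_of_nonneg hs.1] at h1 ⊢
  have := mul_le_mul_of_nonneg_right hs.2 (norm_nonneg (regGen z x))
  linarith

/-- The second order expansion holds weakly. The left vector absorbs one derivative and the right vector
the other, so that only `(a†a + 1)^(-1/2)` is needed on each side. -/
theorem tendsto_remainder (z : ℂ) (x y : L2 ℕ) :
    Filter.Tendsto (fun t : ℝ => ⟪x, (((t : ℂ) ^ 2)⁻¹ • remainder z t) y⟫_ℂ)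
      (nhdsWithin 0 (Set.Ioi 0)) (nhds 0) := by
  rw [Metric.tendsto_nhds]
  intro ε hε
  obtain ⟨K, hK, hKε⟩ : ∃ K : ℝ, 0 < K ∧ K * ‖regGen z y‖ < ε :=
    ⟨ε / (‖regGen z y‖ + 1), by positivity, by
      rw [div_mul_eq_mul_div, div_lt_iff₀ (by positivity)]
      nlinarith [norm_nonneg (regGen z y)]⟩
  have h1 := (hasDerivAt_iff_isLittleO.1 (hasDerivAt_displacement_resolvent_zero (-z) x)).bound hK
  simp only [Complex.ofReal_zero, zero_mul, displacement_zero, id_apply, sub_zero] at h1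
  obtain ⟨δ, hδ, h2⟩ := Metric.eventually_nhds_iff.1 h1
  filter_upwards [Ioo_mem_nhdsGT hδ] with t ht
  have ht0 : 0 < t := ht.1
  rw [dist_zero_right, smul_apply, inner_smul_right, norm_mul, inner_remainder]
  have h3 := norm_remainder_le z x y (K := K) ht0.le fun s hs => by
    have h4 := h2 (y := s) (by
      rw [dist_zero_right, Real.norm_eq_abs, abs_of_nonneg hs.1]; exact hs.2.trans_lt ht.2)
    rw [← Complex.coe_smul, Real.norm_eq_abs, abs_of_nonneg hs.1] at h4
    exact h4.trans (by gcongr; exact hs.2)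
  refine lt_of_le_of_lt (mul_le_mul_of_nonneg_left h3 (norm_nonneg _)) ?_
  rw [norm_inv, norm_pow, Complex.norm_real, Real.norm_eq_abs, abs_of_pos ht0]
  rw [mul_comm, mul_assoc, mul_inv_cancel₀ (by positivity), mul_one]
  exact hKε

theorem norm_remainder_apply_le (z : ℂ) {t : ℝ} (ht : 0 < t) (y : L2 ℕ) :
    ‖(((t : ℂ) ^ 2)⁻¹ • remainder z t) y‖ ≤ 2 * ‖regGen (-z)‖ * ‖regGen z‖ * ‖y‖ := by
  set A := ((t : ℂ) ^ 2)⁻¹ • remainder z t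
  have h1 : ∀ x, ‖⟪x, A y⟫_ℂ‖ ≤ 2 * ‖regGen (-z)‖ * ‖regGen z‖ * ‖y‖ * ‖x‖ := by
    intro x
    have h3 := norm_remainder_le z x y (K := 2 * ‖regGen (-z) x‖) ht.le fun s hs =>
      norm_displacement_sub_sub_le (-z) hs x
    have h4 := (regGen z).le_opNorm y
    have h5 := (regGen (-z)).le_opNorm x
    rw [← inner_remainder] at h3
    rw [smul_apply, inner_smul_right, norm_mul, norm_inv, norm_pow, Complex.norm_real,
      Real.norm_eq_abs, abs_of_pos ht, inv_mul_le_iff₀ (by positivity)]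
    refine h3.trans ?_
    calc 2 * ‖regGen (-z) x‖ * ‖regGen z y‖ * t ^ 2
        ≤ 2 * (‖regGen (-z)‖ * ‖x‖) * (‖regGen z‖ * ‖y‖) * t ^ 2 := by gcongr
      _ = _ := by ring
  have h2 := h1 (A y)
  rw [inner_self_eq_norm_sq_to_K, norm_pow, RCLike.norm_ofReal, abs_norm, pow_two] at h2
  rcases (norm_nonneg (A y)).eq_or_lt with h0 | h0
  · rw [← h0]; positivity
  · exact le_of_mul_le_mul_right h2 h0

/-- The characteristic function of an operator `(a†a + 1)^(-1/2) S (a†a + 1)^(-1/2)`, to second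
order. -/
theorem tendsto_charFun_both {T S : TraceClass ℕ} (h : T.1 = resolvent.comp (S.1.comp resolvent))
    (z : ℂ) : Filter.Tendsto (fun t : ℝ => ((t : ℂ) ^ 2)⁻¹ * (charFun T (t * z) - trace T.1 -
      t * trace (S.1.comp (resolvent.comp (regGen z))) +
        t ^ 2 / 2 * trace (S.1.comp ((adjoint (regGen z)).comp (regGen z)))))
      (nhdsWithin 0 (Set.Ioi 0)) (nhds 0) := by
  have h1 := tendsto_trace_comp S (l := nhdsWithin (0 : ℝ) (Set.Ioi 0))
    (A := fun t : ℝ => ((t : ℂ) ^ 2)⁻¹ • remainder z t) (B := 0)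
    (by filter_upwards [self_mem_nhdsWithin] with t ht using norm_remainder_apply_le z ht)
    (fun x y => by simpa using tendsto_remainder z x y)
  have h0 : trace (S.1.comp (0 : L2 ℕ →L[ℂ] L2 ℕ)) = 0 := by
    have := trace_comp_smul S.1 0 (0 : L2 ℕ →L[ℂ] L2 ℕ)
    rwa [zero_smul, zero_mul] at this
  rw [h0] at h1
  have hc : ∀ A : L2 ℕ →L[ℂ] L2 ℕ, trace (T.1.comp A) = trace (S.1.comp (resolvent.comp (A.comp resolvent))) := by
    intro A
    let S' : TraceClass ℕ := ⟨S.1.comp resolvent,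
      traceNorm_sandwich_lt_top (ContinuousLinearMap.id ℂ _) resolvent S.1 S.2⟩
    have := trace_comp_cycle S' resolvent A
    rw [h]
    exact this
  refine h1.congr fun t => ?_
  rw [trace_comp_smul, remainder, trace_comp_add, trace_comp_sub, trace_comp_sub, trace_comp_smul,
    trace_comp_smul, charFun, hc]
  have h2 := hc (ContinuousLinearMap.id ℂ _)
  rw [comp_id, id_comp] at h2
  rw [h2]

/-! ### Moments of operators of finite energy -/

theorem hasMoment_right {T S : TraceClass ℕ} (h : T.1 = S.1.comp resolvent) (z : ℂ) :
    HasMoment T (displacementGen z) (-trace (S.1.comp (adjoint (regGen z)))) := by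
  have h1 := (hasSum_trace_comp S (adjoint (regGen z))).neg
  refine hasSum_of_eq (fun l => ?_) h1
  have h2 := adjoint_regGen_toL2 z (Finsupp.single l 1)
  rw [toL2_single, one_smul] at h2
  rw [h, comp_apply, h2, map_neg, inner_neg_right, neg_neg]

theorem hasMoment_left {T S : TraceClass ℕ} (h : T.1 = resolvent.comp S.1) (z : ℂ) :
    HasMoment T (displacementGen z) (trace (S.1.comp (regGen z))) := by
  have h1 := hasSum_trace_comp S (regGen z)
  refine hasSum_of_eq (fun l => ?_) h1
  have h3 : ((Real.sqrt ((l : ℝ) + 1) : ℝ) : ℂ) ≠ 0 := by exact_mod_cast sqrt_succ_ne_zero l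
  rw [h, comp_apply, toL2_gen_ket, map_smul, map_smul, inner_smul_right, ← inner_resolvent,
    resolvent_ket, inner_smul_left, Complex.conj_ofReal, ← mul_assoc]
  push_cast
  rw [mul_inv_cancel₀ h3, one_mul]

theorem hasMoment_both {T S : TraceClass ℕ} (h : T.1 = resolvent.comp (S.1.comp resolvent))
    (z w : ℂ) : HasMoment T (displacementGen z * displacementGen w)
      (-trace (S.1.comp ((adjoint (regGen z)).comp (regGen w)))) := by
  have h1 := (hasSum_trace_comp S ((adjoint (regGen z)).comp (regGen w))).neg
  refine hasSum_of_eq (fun l => ?_) h1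
  have h2 := adjoint_regGen_toL2 z (displacementGen w (Finsupp.single l 1))
  have h3 : ((Real.sqrt ((l : ℝ) + 1) : ℝ) : ℂ) ≠ 0 := by exact_mod_cast sqrt_succ_ne_zero l
  rw [toL2_gen_ket, map_smul, eq_neg_iff_add_eq_zero, add_comm, ← eq_neg_iff_add_eq_zero] at h2
  rw [h]
  simp only [comp_apply, Module.End.mul_apply]
  rw [h2, map_neg, map_smul, map_neg, map_smul, inner_neg_right, inner_smul_right, ← inner_resolvent, resolvent_ket, inner_smul_left,
    Complex.conj_ofReal, ← mul_assoc]
  push_cast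
  rw [mul_inv_cancel₀ h3, one_mul]

theorem HasMoment.smul {T : TraceClass ℕ} {A : FockOp} {m : ℂ} (h : HasMoment T A m) (c : ℂ) :
    HasMoment T (c • A) (c * m) := by
  refine hasSum_of_eq (fun l => ?_) (HasSum.mul_left c h)
  rw [LinearMap.smul_apply, map_smul, map_smul, inner_smul_right]

theorem HasMoment.add {T : TraceClass ℕ} {A B : FockOp} {m n : ℂ} (h : HasMoment T A m)
    (h' : HasMoment T B n) : HasMoment T (A + B) (m + n) := by
  refine hasSum_of_eq (fun l => ?_) (HasSum.add h h')
  rw [LinearMap.add_apply, map_add, map_add, inner_add_right]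

theorem HasMoment.add_left {S T : TraceClass ℕ} {A : FockOp} {m n : ℂ} (h : HasMoment S A m)
    (h' : HasMoment T A n) : HasMoment (S + T) A (m + n) := by
  refine hasSum_of_eq (fun l => ?_) (HasSum.add h h')
  rw [Submodule.coe_add, add_apply, inner_add_right]

theorem HasMoment.smul_left {T : TraceClass ℕ} {A : FockOp} {m : ℂ} (h : HasMoment T A m) (c : ℂ) :
    HasMoment (c • T) A (c * m) := by
  refine hasSum_of_eq (fun l => ?_) (HasSum.mul_left c h)
  rw [Submodule.coe_smul, smul_apply, inner_smul_right]

theorem hasMoment_one (T : TraceClass ℕ) : HasMoment T 1 (trace T.1) := by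
  refine hasSum_of_eq (fun l => ?_) (hasSum_trace T)
  rw [Module.End.one_apply, toL2_single, one_smul]

theorem HasMoment.unique {T : TraceClass ℕ} {A : FockOp} {m n : ℂ} (h : HasMoment T A m)
    (h' : HasMoment T A n) : m = n := HasSum.unique h h'

/-! ### States of finite energy -/

theorem HasDyads.ext {S T : L2 ι →L[ℂ] L2 ι} {x y : κ → L2 ι} (hS : HasDyads S x y)
    (hT : HasDyads T x y) : S = T :=
  ext_matrix fun _ _ => (hS.hasSum _ _).unique (hT.hasSum _ _)

theorem finiteMoment_two_iff {T : TraceClass ℕ} :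
    FiniteMoment 2 T ↔ Summable fun l : ℕ => (l : ℝ) * ‖⟪ket l, T.1 (ket l)⟫_ℂ‖ := by
  simp [FiniteMoment]

theorem summable_prod_curried {F : ι → κ → ℝ} (h : ∀ i k, 0 ≤ F i k) :
    (Summable fun p : ι × κ => F p.1 p.2) ↔
      (∀ i, Summable (F i)) ∧ Summable fun i => ∑' k, F i k :=
  summable_prod_of_nonneg (f := fun p : ι × κ => F p.1 p.2) fun p => h p.1 p.2

theorem summable_prod_swap {F : ι → κ → ℝ} (h : Summable fun p : ι × κ => F p.1 p.2) :
    Summable fun p : κ × ι => F p.2 p.1 := (Equiv.prodComm κ ι).summable_iff.2 h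

/-- If `∑ₖ |xₖ⟩⟨xₖ|` has a finite second moment, then the vectors `xₖ` have finite total energy. -/
theorem exists_resolvent_dyads {T : TraceClass ℕ} {x : κ → L2 ℕ} (h : HasDyads T.1 x x)
    (hT : FiniteMoment 2 T) :
    ∃ φ : κ → L2 ℕ, (Summable fun k => ‖φ k‖ ^ 2) ∧ ∀ k, x k = resolvent (φ k) := by
  have hl : ∀ l, HasSum (fun k => ‖⟪ket l, x k⟫_ℂ‖ ^ 2) ‖⟪ket l, T.1 (ket l)⟫_ℂ‖ := by
    intro l
    have h1 := h.hasSum (ket l) (ket l)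
    have h2 : HasSum (fun k => ((‖⟪ket l, x k⟫_ℂ‖ ^ 2 : ℝ) : ℂ)) ⟪ket l, T.1 (ket l)⟫_ℂ := by
      refine hasSum_of_eq (fun k => ?_) h1
      rw [← inner_conj_symm (x k), Complex.mul_conj, Complex.normSq_eq_norm_sq]
    have h3 := Complex.hasSum_re h2
    have h4 : 0 ≤ (⟪ket l, T.1 (ket l)⟫_ℂ).re := h3.nonneg fun k => sq_nonneg _
    have h5 := h2.unique (Complex.hasSum_ofReal.2 h3)
    rw [h5, Complex.norm_real, Real.norm_of_nonneg (by simpa using h4)]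
    exact h3
  let F : ℕ → κ → ℝ := fun l k => ((l : ℝ) + 1) * ‖⟪ket l, x k⟫_ℂ‖ ^ 2
  have hF : ∀ l k, 0 ≤ F l k := fun l k => by positivity
  have h1 : Summable fun p : ℕ × κ => F p.1 p.2 := by
    refine (summable_prod_curried hF).2 ⟨fun l => (hl l).summable.mul_left _, ?_⟩
    have h2 : Summable fun l : ℕ => (l : ℝ) * ‖⟪ket l, T.1 (ket l)⟫_ℂ‖ + ‖⟪ket l, T.1 (ket l)⟫_ℂ‖ :=
      (finiteMoment_two_iff.1 hT).add (hasSum_trace T).summable.norm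
    refine h2.congr fun l => ?_
    rw [tsum_mul_left, (hl l).tsum_eq]
    ring
  obtain ⟨h3, h4⟩ := (summable_prod_curried fun k l => hF l k).1 (summable_prod_swap h1)
  have e : ∀ k (l : ℕ), ‖((Real.sqrt ((l : ℝ) + 1) : ℝ) : ℂ) * ⟪ket l, x k⟫_ℂ‖ ^ 2 =
      F l k := by
    intro k l
    rw [norm_mul, mul_pow, Complex.norm_real, Real.norm_of_nonneg (Real.sqrt_nonneg _),
      Real.sq_sqrt (by positivity)]
  have h5 : ∀ k, Summable fun l : ℕ => ‖((Real.sqrt ((l : ℝ) + 1) : ℝ) : ℂ) * ⟪ket l, x k⟫_ℂ‖ ^ 2 :=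
    fun k => (h3 k).congr fun l => (e k l).symm
  refine ⟨fun k => ofCoord _ (h5 k), h4.congr fun k => ?_, fun k => ext_ket fun l => ?_⟩
  · rw [← (hasSum_norm_sq (ofCoord _ (h5 k))).tsum_eq]
    refine tsum_congr fun l => ?_
    rw [inner_ket_ofCoord, e]
  · have h6 : ((Real.sqrt ((l : ℝ) + 1) : ℝ) : ℂ) ≠ 0 := by exact_mod_cast sqrt_succ_ne_zero l
    rw [← inner_resolvent, resolvent_ket, inner_smul_left, inner_ket_ofCoord, Complex.conj_ofReal,
      ← mul_assoc]
    push_cast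
    rw [inv_mul_cancel₀ h6, one_mul]

/-- A positive operator with a finite second moment is `(a†a + 1)^(-1/2) S (a†a + 1)^(-1/2)` with `S` in
the trace class. -/
theorem exists_resolvent_sandwich {T : TraceClass ℕ} (hp : T.1.IsPositive) (hT : FiniteMoment 2 T) :
    ∃ S : TraceClass ℕ, adjoint S.1 = S.1 ∧ T.1 = resolvent.comp (S.1.comp resolvent) := by
  obtain ⟨x, hx⟩ := exists_hasDyads_of_isPositive T hp
  obtain ⟨φ, hφ, hxφ⟩ := exists_resolvent_dyads hx hT
  obtain ⟨S, hS⟩ := exists_traceClass hφ hφ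
  refine ⟨S, hS.adj.ext hS, hx.ext ?_⟩
  have h := hS.comp_left resolvent resolvent
  rw [adjoint_resolvent] at h
  simpa only [← hxφ] using h

/-- The displacements whose generators are `i x` and `i p`. -/
def direction : Fin 2 → ℂ := ![Complex.I / ((Real.sqrt 2 : ℝ) : ℂ), -1 / ((Real.sqrt 2 : ℝ) : ℂ)]

/-- The vector `ξ` with `z a† - z̄ a = i ξ · R`. -/
def phase (z : ℂ) : Fin 2 → ℝ := ![Real.sqrt 2 * z.im, -(Real.sqrt 2 * z.re)]

theorem sqrt_two_ne_zero : ((Real.sqrt 2 : ℝ) : ℂ) ≠ 0 := by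
  exact_mod_cast (Real.sqrt_pos.2 zero_lt_two).ne'

theorem sqrt_two_mul_self : ((Real.sqrt 2 : ℝ) : ℂ) * ((Real.sqrt 2 : ℝ) : ℂ) = 2 := by
  rw [← Complex.ofReal_mul, Real.mul_self_sqrt zero_le_two]; simp

theorem quadrature_eq (i : Fin 2) :
    quadrature i = (-Complex.I) • displacementGen (direction i) := by
  have h := sqrt_two_ne_zero
  refine LinearMap.ext fun u => ?_
  fin_cases i
  · change ((Real.sqrt 2 : ℝ) : ℂ)⁻¹ • (annihilation u + creation u) = (-Complex.I) •
      ((Complex.I / ((Real.sqrt 2 : ℝ) : ℂ)) • creation u -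
        (starRingEnd ℂ) (Complex.I / ((Real.sqrt 2 : ℝ) : ℂ)) • annihilation u)
    rw [map_div₀, Complex.conj_I, Complex.conj_ofReal]
    match_scalars
    · linear_combination (((Real.sqrt 2 : ℝ) : ℂ)⁻¹) * Complex.I_mul_I
    · linear_combination (((Real.sqrt 2 : ℝ) : ℂ)⁻¹) * Complex.I_mul_I
  · change (Complex.I * ((Real.sqrt 2 : ℝ) : ℂ))⁻¹ • (annihilation u - creation u) = (-Complex.I) •
      ((-1 / ((Real.sqrt 2 : ℝ) : ℂ)) • creation u -
        (starRingEnd ℂ) (-1 / ((Real.sqrt 2 : ℝ) : ℂ)) • annihilation u)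
    rw [map_div₀, map_neg, map_one, Complex.conj_ofReal, mul_inv, Complex.inv_I]
    module

theorem phase_direction (z : ℂ) : z = ∑ i, (phase z i : ℂ) * direction i := by
  rw [Fin.sum_univ_two]
  simp only [phase, direction, Matrix.cons_val_zero, Matrix.cons_val_one, Matrix.cons_val_fin_one]
  have h := sqrt_two_ne_zero
  push_cast
  field_simp
  conv_lhs => rw [← Complex.re_add_im z]
  ring

theorem regGen_eq_sum (z : ℂ) : regGen z = ∑ i, (phase z i : ℂ) • regGen (direction i) := by
  conv_lhs => rw [phase_direction z]
  rw [Fin.sum_univ_two, Fin.sum_univ_two, regGen_add, regGen_smul, regGen_smul]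

theorem ofReal_of_conj {c : ℂ} (h : (starRingEnd ℂ) c = c) : c = (c.re : ℂ) :=
  (Complex.conj_eq_iff_re.1 h).symm

theorem trace_conj_comp {S : TraceClass ι} (hS : adjoint S.1 = S.1) (A : L2 ι →L[ℂ] L2 ι) :
    (starRingEnd ℂ) (trace (S.1.comp A)) = trace (S.1.comp (adjoint A)) := by
  rw [← trace_adjoint, adjoint_comp, hS, trace_comp_comm]

/-- A state with a finite second moment has first and second moments of the quadratures, and they
give the second order expansion of its characteristic function. -/
theorem exists_moments {ρ : TraceClass ℕ} (h : IsState ρ) (hf : FiniteMoment 2 ρ) :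
    ∃ (d : Fin 2 → ℝ) (M : Matrix (Fin 2) (Fin 2) ℝ), HasFirstMoments ρ d ∧
      (∀ i j, HasMoment ρ (quadrature i * quadrature j + quadrature j * quadrature i) (M i j : ℂ)) ∧
      ∀ z : ℂ, Filter.Tendsto (fun t : ℝ => ((t : ℂ) ^ 2)⁻¹ * (charFun ρ (t * z) - 1 -
        t * (Complex.I * ((phase z ⬝ᵥ d : ℝ) : ℂ)) +
          t ^ 2 / 4 * ((phase z ⬝ᵥ M.mulVec (phase z) : ℝ) : ℂ)))
        (nhdsWithin 0 (Set.Ioi 0)) (nhds 0) := by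
  obtain ⟨S, hS, hρ⟩ := exists_resolvent_sandwich h.1 hf
  let m : ℂ → ℂ := fun z => trace (S.1.comp (resolvent.comp (regGen z)))
  let q : ℂ → ℂ → ℂ := fun z w => trace (S.1.comp ((adjoint (regGen z)).comp (regGen w)))
  -- The generators are skew-adjoint, so first moments are imaginary and second moments hermitian.
  have hm : ∀ z, m z = Complex.I * ((m z).im : ℂ) := by
    intro z
    have h1 := trace_conj_comp hS (resolvent.comp (regGen z))
    have h2 : adjoint (resolvent.comp (regGen z)) = -(resolvent.comp (regGen z)) := by
      rw [adjoint_comp, adjoint_resolvent, resolvent_comp_regGen, neg_neg]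
    rw [h2, trace_comp_neg] at h1
    have h3 : (m z).re = 0 := by
      have := congrArg Complex.re h1
      rw [Complex.conj_re, Complex.neg_re] at this
      change (m z).re = -(m z).re at this
      linarith
    rw [mul_comm]
    apply Complex.ext <;> simp [h3]
  have hq : ∀ z w, (starRingEnd ℂ) (q z w) = q w z := by
    intro z w
    have h1 := trace_conj_comp hS ((adjoint (regGen z)).comp (regGen w))
    rwa [adjoint_comp, adjoint_adjoint] at h1
  have hqr : ∀ z w, q z w + q w z = (((q z w + q w z).re : ℝ) : ℂ) := fun z w =>
    ofReal_of_conj (by rw [map_add, hq, hq, add_comm])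
  refine ⟨fun i => (m (direction i)).im, Matrix.of fun i j =>
    (q (direction i) (direction j) + q (direction j) (direction i)).re, fun i => ?_, fun i j => ?_,
    fun z => ?_⟩
  · let S' : TraceClass ℕ := ⟨S.1.comp resolvent,
      traceNorm_sandwich_lt_top (ContinuousLinearMap.id ℂ _) resolvent S.1 S.2⟩
    have h1 := (hasMoment_left (T := ρ) (S := S') hρ (direction i)).smul (-Complex.I)
    rw [← quadrature_eq] at h1
    have h2 : -Complex.I * trace (S'.1.comp (regGen (direction i))) =
        (((m (direction i)).im : ℝ) : ℂ) := by
      change -Complex.I * m (direction i) = _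
      conv_lhs => rw [hm]
      linear_combination (-((m (direction i)).im : ℂ)) * Complex.I_mul_I
    rwa [h2] at h1
  · have h1 : ∀ i j, HasMoment ρ (quadrature i * quadrature j) (q (direction i) (direction j)) := by
      intro i j
      have h1 := (hasMoment_both hρ (direction i) (direction j)).smul (-Complex.I * -Complex.I)
      rw [quadrature_eq, quadrature_eq, smul_mul_smul_comm]
      convert h1 using 1
      linear_combination (q (direction i) (direction j)) * Complex.I_mul_I
    rw [Matrix.of_apply, ← hqr]
    exact (h1 i j).add (h1 j i)
  · have h1 := tendsto_charFun_both hρ z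
    refine h1.congr fun t => ?_
    rw [h.2]
    have e1 : trace (S.1.comp (resolvent.comp (regGen z))) =
        Complex.I * ((phase z ⬝ᵥ (fun i => (m (direction i)).im) : ℝ) : ℂ) := by
      rw [regGen_eq_sum, Fin.sum_univ_two, comp_add, comp_smul, comp_smul, trace_comp_add,
        trace_comp_smul, trace_comp_smul]
      change _ * m (direction 0) + _ * m (direction 1) = _
      rw [hm (direction 0), hm (direction 1), dotProduct, Fin.sum_univ_two]
      push_cast
      ring
    have e2 : trace (S.1.comp ((adjoint (regGen z)).comp (regGen z))) =
        ((phase z ⬝ᵥ (Matrix.of fun i j => (q (direction i) (direction j) +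
          q (direction j) (direction i)).re).mulVec (phase z) : ℝ) : ℂ) / 2 := by
      have e3 : (adjoint (regGen z)).comp (regGen z) =
          (((phase z 0 : ℂ) * (phase z 0 : ℂ)) •
            (adjoint (regGen (direction 0))).comp (regGen (direction 0)) +
          ((phase z 1 : ℂ) * (phase z 0 : ℂ)) •
            (adjoint (regGen (direction 1))).comp (regGen (direction 0))) +
          (((phase z 0 : ℂ) * (phase z 1 : ℂ)) •
            (adjoint (regGen (direction 0))).comp (regGen (direction 1)) +
          ((phase z 1 : ℂ) * (phase z 1 : ℂ)) •
            (adjoint (regGen (direction 1))).comp (regGen (direction 1))) := by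
        rw [regGen_eq_sum, Fin.sum_univ_two, map_add, map_smulₛₗ, map_smulₛₗ, Complex.conj_ofReal,
          Complex.conj_ofReal]
        simp only [comp_add, add_comp, comp_smul, smul_comp, smul_smul, smul_add]
        simp only [mul_comm (phase z 1 : ℂ) (phase z 0 : ℂ)]
      rw [e3]
      simp only [trace_comp_add, trace_comp_smul]
      change _ * q (direction 0) (direction 0) + _ * q (direction 1) (direction 0) +
        (_ * q (direction 0) (direction 1) + _ * q (direction 1) (direction 1)) = _
      simp only [dotProduct, Matrix.mulVec, Fin.sum_univ_two, Matrix.of_apply]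
      push_cast
      have r : ∀ z w, ((q z w).re : ℂ) + ((q w z).re : ℂ) = q z w + q w z := fun z w => by
        rw [hqr z w]; simp
      simp only [Complex.add_re, Complex.ofReal_add, r]
      ring
    rw [e1, e2]
    ring

theorem hasCovariance_of_moments {ρ : TraceClass ℕ} (h : trace ρ.1 = 1) {d : Fin 2 → ℝ}
    {M : Matrix (Fin 2) (Fin 2) ℝ} (hd : HasFirstMoments ρ d)
    (hM : ∀ i j, HasMoment ρ (quadrature i * quadrature j + quadrature j * quadrature i)
      (M i j : ℂ)) :
    HasCovariance ρ (Matrix.of fun i j => M i j - 2 * d i * d j) := by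
  refine ⟨d, hd, fun i j => ?_⟩
  have h1 := (((hM i j).add ((hd i).smul (-2 * d j))).add ((hd j).smul (-2 * d i))).add
    ((hasMoment_one ρ).smul (2 * d i * d j))
  rw [h] at h1
  convert h1 using 1
  · refine LinearMap.ext fun u => ?_
    simp only [LinearMap.add_apply, LinearMap.sub_apply, LinearMap.smul_apply,
      Module.End.mul_apply, Module.End.one_apply, map_sub, map_smul]
    module
  · rw [Matrix.of_apply]
    push_cast
    ring

/-- A positive operator has a finite second moment if its characteristic function does not decay
faster than quadratically near the origin in the directions `1` and `i`. -/
theorem finiteMoment_of_charFun {σ : TraceClass ℕ} (hσ : σ.1.IsPositive) {C : ℝ}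
    (h : ∀ z ∈ ({1, Complex.I} : Set ℂ), ∀ᶠ t : ℝ in nhdsWithin 0 (Set.Ioi 0),
      (trace σ.1).re - (charFun σ (t * z)).re ≤ C * t ^ 2) : FiniteMoment 2 σ := by
  let Q : L2 ℕ → ℝ := fun v => (⟪v, σ.1 v⟫_ℂ).re
  have hQ0 : ∀ v, 0 ≤ Q v := fun v => hσ.re_inner_nonneg_right v
  have hQc : Continuous Q := by
    simp only [Q]
    exact Complex.continuous_re.comp (continuous_id.inner σ.1.continuous)
  have hQs : ∀ (c : ℂ) v, Q (c • v) = ‖c‖ ^ 2 * Q v := by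
    intro c v
    simp only [Q, map_smul, inner_smul_left, inner_smul_right]
    rw [← mul_assoc, Complex.mul_conj, Complex.re_ofReal_mul,
      Complex.normSq_eq_norm_sq]
  -- Partial sums of `Tr[(D - 1)† σ (D - 1)] = 2 (Tr σ - Re χ(z))`.
  have hsum : ∀ (z : ℂ) (F : Finset ℕ), ∑ l ∈ F, Q (displacement z (ket l) - ket l) ≤
      2 * ((trace σ.1).re - (charFun σ z).re) := by
    intro z F
    let A : L2 ℕ →L[ℂ] L2 ℕ := displacement z - ContinuousLinearMap.id ℂ _
    have h1 := hasSum_trace (sandwich (adjoint A) A σ)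
    have h2 : trace (sandwich (adjoint A) A σ).1 =
        2 * trace σ.1 - charFun σ z - (starRingEnd ℂ) (charFun σ z) := by
      have e1 := trace_comp_cycle σ (adjoint A) A
      have e2 : A.comp (adjoint A) = (2 : ℂ) • ContinuousLinearMap.id ℂ _ - displacement z -
          adjoint (displacement z) := by
        have e3 := displacement_neg_comp (-z)
        rw [neg_neg] at e3
        simp only [A, map_sub, adjoint_displacement, adjoint_id, sub_comp, comp_sub, comp_id, id_comp]
        rw [e3, two_smul]
        abel
      rw [e2, trace_comp_sub, trace_comp_sub, trace_comp_smul, comp_id] at e1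
      refine e1.trans ?_
      rw [charFun, trace_conj_comp hσ.isSelfAdjoint.adjoint_eq]
    rw [h2] at h1
    have h3 := Complex.hasSum_re h1
    have h4 := sum_le_hasSum F (fun l _ => ?_) h3
    · refine le_of_eq_of_le (Finset.sum_congr rfl fun l _ => ?_) (h4.trans_eq ?_)
      · change _ = (⟪ket l, adjoint A (σ.1 (A (ket l)))⟫_ℂ).re
        rw [adjoint_inner_right]
        rfl
      · simp only [Complex.sub_re, Complex.mul_re, Complex.re_ofNat, Complex.im_ofNat,
          Complex.conj_re]
        ring
    · change 0 ≤ (⟪ket l, adjoint A (σ.1 (A (ket l)))⟫_ℂ).re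
      rw [adjoint_inner_right]
      exact hQ0 _
  -- Divide by `t²` and let `t → 0`, one finite set of diagonal elements at a time.
  have hgen : ∀ z ∈ ({1, Complex.I} : Set ℂ), ∀ F : Finset ℕ,
      ∑ l ∈ F, Q (toL2 (displacementGen z (Finsupp.single l 1))) ≤ 2 * C := by
    intro z hz F
    have h1 : ∀ l, Filter.Tendsto
        (fun t : ℝ => Q (((t⁻¹ : ℝ) : ℂ) • (displacement (t * z) (ket l) - ket l)))
        (nhdsWithin 0 (Set.Ioi 0)) (nhds (Q (toL2 (displacementGen z (Finsupp.single l 1))))) := by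
      intro l
      have d2 := hasDerivAt_iff_tendsto_slope_zero.1
        (hasDerivAt_displacement z (Finsupp.single l 1) 0)
      simp only [zero_add, Complex.ofReal_zero, zero_mul, displacement_zero, id_apply, toL2_single,
        one_smul] at d2
      have d3 := (hQc.tendsto _).comp
        (d2.mono_left (nhdsWithin_mono _ fun t (ht : 0 < t) => ht.ne'))
      refine d3.congr fun t => ?_
      simp only [Function.comp_apply, Complex.coe_smul]
    refine le_of_tendsto (tendsto_finsetSum F fun l _ => h1 l) ?_
    filter_upwards [self_mem_nhdsWithin, h z hz] with t ht hC
    have ht0 : 0 < t := ht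
    simp only [hQs]
    rw [← Finset.mul_sum, Complex.norm_real, norm_inv, Real.norm_eq_abs, abs_of_pos ht0, inv_pow,
      inv_mul_le_iff₀ (by positivity)]
    refine (hsum _ F).trans ?_
    linarith
  -- The generators in the directions `1` and `i` isolate the creation part.
  have hpar : ∀ l : ℕ, ((l : ℝ) + 1) * Q (ket (l + 1)) ≤
      (Q (toL2 (displacementGen 1 (Finsupp.single l 1))) +
        Q (toL2 (displacementGen Complex.I (Finsupp.single l 1)))) / 2 := by
    intro l
    set a : L2 ℕ := ((Real.sqrt ((l : ℝ) + 1) : ℝ) : ℂ) • ket (l + 1) with ha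
    set b : L2 ℕ := ((Real.sqrt (l : ℝ) : ℝ) : ℂ) • ket (l - 1)
    have e1 : toL2 (displacementGen 1 (Finsupp.single l 1)) = a - b := by
      rw [toL2_gen_single, map_one, one_mul, one_mul]
    have e2 : toL2 (displacementGen Complex.I (Finsupp.single l 1)) = Complex.I • (a + b) := by
      rw [toL2_gen_single, Complex.conj_I, smul_add, smul_smul, smul_smul, neg_mul, neg_smul,
        sub_neg_eq_add]
    have e3 : Q a = ((l : ℝ) + 1) * Q (ket (l + 1)) := by
      rw [ha, hQs, Complex.norm_real, Real.norm_of_nonneg (Real.sqrt_nonneg _),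
        Real.sq_sqrt (by positivity)]
    rw [e1, e2, hQs, Complex.norm_I, ← e3]
    have e4 : Q (a - b) + Q (a + b) = 2 * Q a + 2 * Q b := by
      simp only [Q, map_sub, map_add, inner_sub_left, inner_add_left, inner_sub_right,
        inner_add_right, Complex.sub_re, Complex.add_re]
      ring
    have := hQ0 b
    linarith
  rw [finiteMoment_two_iff, ← summable_nat_add_iff 1]
  refine summable_of_sum_le (c := 2 * C) (fun l => by positivity) fun F => ?_
  have h1 := Finset.sum_le_sum fun l (_ : l ∈ F) => hpar l
  rw [← Finset.sum_div, Finset.sum_add_distrib] at h1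
  have h2 := hgen 1 (by simp) F
  have h3 := hgen Complex.I (by simp) F
  refine le_trans (le_of_eq (Finset.sum_congr rfl fun l _ => ?_)) (h1.trans (by linarith))
  have h4 : ⟪ket (l + 1), σ.1 (ket (l + 1))⟫_ℂ = ((Q (ket (l + 1)) : ℝ) : ℂ) := by
    have := hσ.inner_nonneg_right (ket (l + 1))
    exact Complex.ext rfl (Complex.nonneg_iff.1 this).2.symm
  rw [h4, Complex.norm_real, Real.norm_of_nonneg (hQ0 _)]
  push_cast
  rfl

/-! ### The central limit theorem for coherent dyads -/

theorem charFun_add (S T : TraceClass ℕ) (z : ℂ) : charFun (S + T) z = charFun S z + charFun T z := by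
  have h := (hasSum_trace_comp S (displacement z)).add (hasSum_trace_comp T (displacement z))
  refine (hasSum_trace_comp (S + T) (displacement z)).unique (hasSum_of_eq (fun i => ?_) h)
  rw [Submodule.coe_add, add_apply, inner_add_right]

theorem charFun_smul (c : ℂ) (T : TraceClass ℕ) (z : ℂ) : charFun (c • T) z = c * charFun T z := by
  rw [charFun, charFun, ← trace_smul, ← smul_comp]
  rfl

theorem enorm_charFun_le (T : TraceClass ℕ) (z : ℂ) : ‖charFun T z‖ₑ ≤ traceNorm T.1 :=
  enorm_trace_comp_le _ _ fun x => (norm_displacement z x).le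

theorem charFun_sub (S T : TraceClass ℕ) (z : ℂ) : charFun (S - T) z = charFun S z - charFun T z := by
  rw [sub_eq_add_neg, ← neg_one_smul ℂ T, charFun_add, charFun_smul, neg_one_mul, sub_eq_add_neg]

theorem IsCPTP.norm_charFun_dyad_le {N : TraceClass ℕ →ₗ[ℂ] TraceClass ℕ} (hN : IsCPTP N)
    (x y : L2 ℕ) (z : ℂ) : ‖charFun (N (dyadTC x y)) z‖ ≤ ‖x‖ * ‖y‖ := by
  have h := (enorm_charFun_le _ z).trans ((hN.traceNorm_le (dyadTC x y)).trans
    (traceNorm_dyad_le x y))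
  rw [← ofReal_norm, ← ofReal_norm, ← ofReal_norm, ← ENNReal.ofReal_mul (norm_nonneg _),
    ENNReal.ofReal_le_ofReal_iff (by positivity)] at h
  exact h

theorem IsCPTP.tendsto_charFun_dyad {N : TraceClass ℕ →ₗ[ℂ] TraceClass ℕ} (hN : IsCPTP N)
    {l : Filter ℝ} {x y : ℝ → L2 ℕ} {x₀ y₀ : L2 ℕ} {z : ℝ → ℂ} (hx : Filter.Tendsto x l (nhds x₀))
    (hy : Filter.Tendsto y l (nhds y₀)) (hz : Filter.Tendsto z l (nhds 0)) :
    Filter.Tendsto (fun t => charFun (N (dyadTC (x t) (y t))) (z t)) l (nhds ⟪y₀, x₀⟫_ℂ) := by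
  have h0 : Filter.Tendsto (fun t => charFun (N (dyadTC x₀ y₀)) (z t)) l (nhds ⟪y₀, x₀⟫_ℂ) := by
    have h := ((continuous_charFun (N (dyadTC x₀ y₀))).tendsto 0).comp hz
    rwa [charFun_zero, hN.2, dyadTC_val, trace_dyad] at h
  have h1 : Filter.Tendsto (fun t => ‖x t - x₀‖ * ‖y t‖ + ‖x₀‖ * ‖y t - y₀‖) l (nhds 0) := by
    have := ((tendsto_iff_norm_sub_tendsto_zero.1 hx).mul hy.norm).add
      ((tendsto_iff_norm_sub_tendsto_zero.1 hy).const_mul ‖x₀‖)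
    simpa using this
  have h2 : Filter.Tendsto (fun t => charFun (N (dyadTC (x t) (y t))) (z t) -
      charFun (N (dyadTC x₀ y₀)) (z t)) l (nhds 0) := by
    refine squeeze_zero_norm (fun t => ?_) h1
    have e : dyadTC (x t) (y t) - dyadTC x₀ y₀ =
        dyadTC (x t - x₀) (y t) + dyadTC x₀ (y t - y₀) := by
      have e1 := dyadTC_add_left (x t - x₀) x₀ (y t)
      have e2 := dyadTC_add_right x₀ (y t - y₀) y₀
      rw [sub_add_cancel] at e1 e2
      rw [e1, e2]
      abel
    rw [← charFun_sub, ← map_sub, e, map_add, charFun_add]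
    exact (norm_add_le _ _).trans (add_le_add (hN.norm_charFun_dyad_le _ _ _)
      (hN.norm_charFun_dyad_le _ _ _))
  simpa using h2.add h0

/-- The second order Taylor expansion of `t ↦ e_{tα}`. -/
theorem expVec_eq_add (α : ℂ) : ∃ r : ℝ → L2 ℕ, Continuous r ∧ r 0 = expCoeff 2 ∧
    ∀ t : ℝ, expVec (t * α) = ket 0 + ((t : ℂ) * α) • ket 1 + ((t : ℂ) ^ 2 * α ^ 2) • r t := by
  have hs : ∀ r : ℝ, 0 ≤ r → Summable fun k => r ^ k * ‖expCoeff (k + 2)‖ := by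
    intro r hr
    rcases hr.eq_or_lt with rfl | hr0
    · refine summable_of_ne_finset_zero (s := {0}) fun k hk => ?_
      rw [zero_pow (by simpa using hk), zero_mul]
    · have h1 := (summable_nat_add_iff 2).2 (summable_expCoeff r hr)
      refine (h1.mul_left (r ^ 2)⁻¹).congr fun k => ?_
      rw [pow_add]
      field_simp
  let g : ℂ → L2 ℕ := fun v => ∑' k, v ^ k • expCoeff (k + 2)
  have hg : Continuous g :=
    continuous_iff_continuousAt.2 fun v => (hasDerivAt_powerSeries hs v).2.continuousAt
  refine ⟨fun t => g (t * α), by fun_prop, ?_, fun t => ?_⟩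
  · simp only [g, Complex.ofReal_zero, zero_mul]
    rw [tsum_eq_single 0 fun k hk => by rw [zero_pow hk, zero_smul]]
    simp
  · have h1 := expVec_eq_tsum (t * α)
    have h2 := (hasSum_nat_add_iff' 2).2 h1
    have h3 := (summable_powerSeries hs (t * α)).hasSum.const_smul ((t * α : ℂ) ^ 2)
    have h4 : HasSum (fun k => (t * α : ℂ) ^ (k + 2) • expCoeff (k + 2)) ((t * α : ℂ) ^ 2 • g (t * α)) := by
      have e : (fun k => (t * α : ℂ) ^ (k + 2) • expCoeff (k + 2)) =
          fun k => (t * α : ℂ) ^ 2 • (t * α : ℂ) ^ k • expCoeff (k + 2) :=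
        funext fun k => by rw [smul_smul, ← pow_add, add_comm]
      rw [e]
      exact h3
    have h5 := h2.unique h4
    rw [Finset.sum_range_succ, Finset.sum_range_one, sub_eq_iff_eq_add'] at h5
    rw [h5]
    simp [expCoeff, mul_pow]

/-- The operators `N(|0⟩⟨1|)` and `N(|1⟩⟨0|)` have first moments, which are real-linear in the displacement
and give the first order of their characteristic functions. Only the second moment of `N(|0⟩⟨0|)` enters:
in the Kraus decomposition `N(|0⟩⟨1|) = ∑ᵣ |x₀ᵣ⟩⟨x₁ᵣ|` the vectors `x₀ᵣ` have finite energy, which makes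
this operator `(a†a + 1)^(-1/2) S` with `S` in the trace class. -/
theorem exists_offDiagonal {N : TraceClass ℕ →ₗ[ℂ] TraceClass ℕ} (hN : IsChannel N)
    (h₀ : FiniteMoment 2 (N (ketbra 0 0))) : ∃ μ ν : ℂ,
      (∀ z, HasMoment (N (ketbra 0 1)) (displacementGen z) (μ * z + ν * (starRingEnd ℂ) z)) ∧
      (∀ z, HasMoment (N (ketbra 1 0)) (displacementGen z)
        (-(starRingEnd ℂ) (μ * z + ν * (starRingEnd ℂ) z))) ∧
      (∀ z, Filter.Tendsto (fun t : ℝ => (t : ℂ)⁻¹ * charFun (N (ketbra 0 1)) (t * z))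
        (nhdsWithin 0 (Set.Ioi 0)) (nhds (μ * z + ν * (starRingEnd ℂ) z))) ∧
      (∀ z, Filter.Tendsto (fun t : ℝ => (t : ℂ)⁻¹ * charFun (N (ketbra 1 0)) (t * z))
        (nhdsWithin 0 (Set.Ioi 0)) (nhds (-(starRingEnd ℂ) (μ * z + ν * (starRingEnd ℂ) z)))) := by
  obtain ⟨x, hx⟩ := exists_kraus hN
  obtain ⟨φ, hφ, hxφ⟩ := exists_resolvent_dyads (hx 0 0) h₀
  obtain ⟨S, hS⟩ := exists_traceClass hφ (hx 0 1).right
  obtain ⟨S', hS'⟩ := exists_traceClass (hx 0 1).right hφ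
  have e01 : (N (ketbra 0 1)).1 = resolvent.comp S.1 := by
    refine (hx 0 1).ext ?_
    have h := hS.comp_left resolvent (ContinuousLinearMap.id ℂ _)
    simpa only [← hxφ, adjoint_id, id_apply, comp_id] using h
  have e10 : (N (ketbra 1 0)).1 = S'.1.comp resolvent := by
    refine (hx 1 0).ext ?_
    have h := hS'.comp_left (ContinuousLinearMap.id ℂ _) resolvent
    simpa only [adjoint_resolvent, ← hxφ, id_apply, id_comp] using h
  have eS : S'.1 = adjoint S.1 := hS'.ext hS.adj
  have t01 : trace (N (ketbra 0 1)).1 = 0 := by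
    rw [hN.2, ← dyadTC_ket, dyadTC_val, trace_dyad, orthonormal_ket.2 (by norm_num)]
  have t10 : trace (N (ketbra 1 0)).1 = 0 := by
    rw [hN.2, ← dyadTC_ket, dyadTC_val, trace_dyad, orthonormal_ket.2 (by norm_num)]
  obtain ⟨μ, ν, hw⟩ : ∃ μ ν : ℂ, ∀ z, trace (S.1.comp (regGen z)) = μ * z + ν * (starRingEnd ℂ) z := by
    refine ⟨trace (S.1.comp (embed Nat.succ_injective)), -trace (S.1.comp
      ((adjoint (embed Nat.succ_injective)).comp (diagonal
        (fun l : ℕ => Real.sqrt l * (Real.sqrt (l + 1))⁻¹) abs_sqrt_mul_inv_sqrt_succ_le))),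
      fun z => ?_⟩
    rw [regGen, trace_comp_sub, trace_comp_smul, trace_comp_smul, sub_eq_add_neg, mul_comm z,
      mul_comm ((starRingEnd ℂ) z), ← neg_mul]
  have hw' : ∀ z, -trace (S'.1.comp (adjoint (regGen z))) =
      -(starRingEnd ℂ) (μ * z + ν * (starRingEnd ℂ) z) := by
    intro z
    rw [← hw, ← trace_adjoint, adjoint_comp, ← eS, trace_comp_comm]
  refine ⟨μ, ν, fun z => hw z ▸ hasMoment_left e01 z, fun z => hw' z ▸ hasMoment_right e10 z,
    fun z => ?_, fun z => ?_⟩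
  · have h := tendsto_charFun_left e01 z
    simpa only [t01, sub_zero, hw] using h
  · have h := tendsto_charFun_right e10 z
    simpa only [t10, sub_zero, hw'] using h

/-- The second order asymptotics of the characteristic functions which enter the symmetric
convolution. With `w` the first moments of `N(|0⟩⟨1|)`, only the dyads of `|0⟩` and `|1⟩` contribute, since
`N` preserves the trace and `⟨0|2⟩ = 0`. -/
theorem tendsto_charFun_expVec {N : TraceClass ℕ →ₗ[ℂ] TraceClass ℕ} (hN : IsChannel N) {z w c : ℂ}
    (h0 : Filter.Tendsto (fun t : ℝ => ((t : ℂ) ^ 2)⁻¹ * (charFun (N (ketbra 0 0)) (t * z) - 1))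
      (nhdsWithin 0 (Set.Ioi 0)) (nhds c))
    (h01 : Filter.Tendsto (fun t : ℝ => (t : ℂ)⁻¹ * charFun (N (ketbra 0 1)) (t * z))
      (nhdsWithin 0 (Set.Ioi 0)) (nhds w))
    (h10 : Filter.Tendsto (fun t : ℝ => (t : ℂ)⁻¹ * charFun (N (ketbra 1 0)) (t * z))
      (nhdsWithin 0 (Set.Ioi 0)) (nhds (-(starRingEnd ℂ) w))) (α β : ℂ) :
    Filter.Tendsto (fun t : ℝ => ((t : ℂ) ^ 2)⁻¹ *
        (charFun (N (dyadTC (expVec (t * α)) (expVec (t * β)))) (t * z) - 1))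
      (nhdsWithin 0 (Set.Ioi 0))
      (nhds (α * (starRingEnd ℂ) β - α * (starRingEnd ℂ) w + (starRingEnd ℂ) β * w + c)) := by
  have hC := isCPTP_iff.2 hN
  obtain ⟨r, hr, hr0, hrα⟩ := expVec_eq_add α
  obtain ⟨s, hs, hs0, hsβ⟩ := expVec_eq_add β
  have ht : Filter.Tendsto (fun t : ℝ => (t : ℂ)) (nhdsWithin 0 (Set.Ioi 0)) (nhds 0) :=
    (Complex.continuous_ofReal.tendsto' 0 0 rfl).mono_left nhdsWithin_le_nhds
  have htz : Filter.Tendsto (fun t : ℝ => (t : ℂ) * z) (nhdsWithin 0 (Set.Ioi 0)) (nhds 0) := by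
    simpa using ht.mul_const z
  have hr' : Filter.Tendsto r (nhdsWithin 0 (Set.Ioi 0)) (nhds (expCoeff 2)) :=
    (hr.tendsto' 0 _ hr0).mono_left nhdsWithin_le_nhds
  have hs' : Filter.Tendsto s (nhdsWithin 0 (Set.Ioi 0)) (nhds (expCoeff 2)) :=
    (hs.tendsto' 0 _ hs0).mono_left nhdsWithin_le_nhds
  have k0 : Filter.Tendsto (fun _ : ℝ => (ket 0 : L2 ℕ)) (nhdsWithin 0 (Set.Ioi 0)) (nhds (ket 0)) :=
    tendsto_const_nhds
  have k1 : Filter.Tendsto (fun _ : ℝ => (ket 1 : L2 ℕ)) (nhdsWithin 0 (Set.Ioi 0)) (nhds (ket 1)) :=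
    tendsto_const_nhds
  have l11 := hC.tendsto_charFun_dyad k1 k1 htz
  have l0s := hC.tendsto_charFun_dyad k0 hs' htz
  have lr0 := hC.tendsto_charFun_dyad hr' k0 htz
  have l1s := hC.tendsto_charFun_dyad k1 hs' htz
  have lr1 := hC.tendsto_charFun_dyad hr' k1 htz
  have lrs := hC.tendsto_charFun_dyad hr' hs' htz
  have i11 : ⟪(ket 1 : L2 ℕ), ket 1⟫_ℂ = 1 := by rw [inner_ket_ket, if_pos rfl]
  have i02 : ⟪(ket 0 : L2 ℕ), expCoeff 2⟫_ℂ = 0 := by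
    rw [expCoeff, inner_smul_right, inner_ket_ket, if_neg (by norm_num), mul_zero]
  have i20 : ⟪expCoeff 2, (ket 0 : L2 ℕ)⟫_ℂ = 0 := by rw [← inner_conj_symm, i02, map_zero]
  rw [i11] at l11
  rw [i20] at l0s
  rw [i02] at lr0
  have hlim := ((((((h0.add (h01.const_mul ((starRingEnd ℂ) β))).add (h10.const_mul α)).add
    (l11.const_mul (α * (starRingEnd ℂ) β))).add (l0s.const_mul ((starRingEnd ℂ) β ^ 2))).add
    (lr0.const_mul (α ^ 2))).add (ht.mul ((l1s.const_mul (α * (starRingEnd ℂ) β ^ 2)).add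
    (lr1.const_mul (α ^ 2 * (starRingEnd ℂ) β))))).add
    ((ht.pow 2).mul (lrs.const_mul (α ^ 2 * (starRingEnd ℂ) β ^ 2)))
  have hval : c + (starRingEnd ℂ) β * w + α * -(starRingEnd ℂ) w + α * (starRingEnd ℂ) β * 1 +
      (starRingEnd ℂ) β ^ 2 * 0 + α ^ 2 * 0 + 0 * (α * (starRingEnd ℂ) β ^ 2 *
        ⟪expCoeff 2, (ket 1 : L2 ℕ)⟫_ℂ + α ^ 2 * (starRingEnd ℂ) β * ⟪ket 1, expCoeff 2⟫_ℂ) +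
      0 ^ 2 * (α ^ 2 * (starRingEnd ℂ) β ^ 2 * ⟪expCoeff 2, expCoeff 2⟫_ℂ) =
      α * (starRingEnd ℂ) β - α * (starRingEnd ℂ) w + (starRingEnd ℂ) β * w + c := by ring
  rw [hval] at hlim
  refine hlim.congr' ?_
  filter_upwards [self_mem_nhdsWithin] with t (ht : 0 < t)
  have ht0 : (t : ℂ) ≠ 0 := by exact_mod_cast ht.ne'
  rw [hrα, hsβ]
  simp only [dyadTC_add_left, dyadTC_add_right, dyadTC_smul_left, dyadTC_smul_right, map_add,
    map_smul, charFun_add, charFun_smul, map_mul, map_pow, Complex.conj_ofReal, ← dyadTC_ket]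
  field_simp
  ring

/-- The characteristic functions of the symmetric convolutions of coherent dyads converge: they are
of the form `(1 + c/n + o(1/n))ⁿ`. -/
theorem tendsto_charFun_convolution {N : TraceClass ℕ →ₗ[ℂ] TraceClass ℕ} {α β z c : ℂ}
    (h : Filter.Tendsto (fun t : ℝ => ((t : ℂ) ^ 2)⁻¹ *
        (charFun (N (dyadTC (expVec (t * α)) (expVec (t * β)))) (t * z) - 1))
      (nhdsWithin 0 (Set.Ioi 0)) (nhds c)) {C : ℕ → TraceClass ℕ →ₗ[ℂ] TraceClass ℕ}
    (hC : ∀ n, IsSymmetricConvolution N n (C n)) :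
    Filter.Tendsto (fun n => charFun (C n (dyadTC (expVec α) (expVec β))) z) Filter.atTop
      (nhds (Complex.exp c)) := by
  let t : ℕ → ℝ := fun n => (Real.sqrt (n : ℝ))⁻¹
  have ht : Filter.Tendsto t Filter.atTop (nhdsWithin 0 (Set.Ioi 0)) := by
    refine tendsto_nhdsWithin_iff.2 ⟨?_, ?_⟩
    · exact tendsto_inv_atTop_zero.comp (Real.tendsto_sqrt_atTop.comp tendsto_natCast_atTop_atTop)
    · filter_upwards [Filter.eventually_gt_atTop 0] with n hn
      have : (0 : ℝ) < n := by exact_mod_cast hn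
      simp only [t, Set.mem_Ioi]
      positivity
  have h1 := h.comp ht
  have h2 := Complex.tendsto_one_add_pow_exp_of_tendsto (t := c)
    (g := fun n => charFun (N (dyadTC (expVec (t n * α)) (expVec (t n * β)))) (t n * z) - 1) (by
      refine h1.congr fun n => ?_
      have e : ((t n : ℂ) ^ 2)⁻¹ = n := by
        simp only [t]
        rw [← Complex.ofReal_pow, inv_pow, Real.sq_sqrt (Nat.cast_nonneg n)]
        push_cast
        rw [inv_inv]
      simp only [Function.comp_apply]
      rw [e])
  have h3 := (Filter.tendsto_add_atTop_iff_nat 1).2 h2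
  refine h3.congr fun n => ?_
  rw [(hC n).charFun_eq, add_sub_cancel]
  simp only [t, Complex.ofReal_inv, div_eq_inv_mul]

/-! ### Gaussian integrals of displacement operators -/

theorem enorm_trace_comp_le_mul (T B : L2 ι →L[ℂ] L2 ι) :
    ‖trace (T.comp B)‖ₑ ≤ ‖B‖ₑ * traceNorm T := by
  rcases eq_or_ne B 0 with rfl | hB
  · have : trace (T.comp (0 : L2 ι →L[ℂ] L2 ι)) = 0 := by
      have := trace_comp_smul T 0 (0 : L2 ι →L[ℂ] L2 ι)
      rwa [zero_smul, zero_mul] at this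
    rw [this]; simp
  have hB0 : (‖B‖ : ℂ) ≠ 0 := by exact_mod_cast norm_ne_zero_iff.2 hB
  have e : B = (‖B‖ : ℂ) • ((‖B‖ : ℂ)⁻¹ • B) := by rw [smul_smul, mul_inv_cancel₀ hB0, one_smul]
  conv_lhs => rw [e, trace_comp_smul, enorm_mul]
  refine mul_le_mul' (le_of_eq ?_) (enorm_trace_comp_le _ _ fun x => ?_)
  · rw [← ofReal_norm, Complex.norm_real, norm_norm, ofReal_norm]
  · rw [smul_apply, norm_smul, norm_inv, Complex.norm_real, norm_norm,
      inv_mul_le_iff₀ (norm_pos_iff.2 hB)]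
    exact B.le_opNorm x

/-- Bounded linear functionals on the trace class are determined by their values on dyads. -/
theorem functional_ext_dyads {D : Set (L2 ι)} (hD : (Submodule.span ℂ D).topologicalClosure = ⊤)
    {f g : TraceClass ι →ₗ[ℂ] ℂ} {c : ℝ≥0∞} (hc : c ≠ ⊤) (hf : ∀ T, ‖f T‖ₑ ≤ c * traceNorm T.1)
    (hg : ∀ T, ‖g T‖ₑ ≤ c * traceNorm T.1)
    (h : ∀ x ∈ D, ∀ y ∈ D, f (dyadTC x y) = g (dyadTC x y)) (T : TraceClass ι) : f T = g T := by
  rw [← sub_eq_zero, ← enorm_eq_zero]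
  refine le_antisymm (ENNReal.le_of_forall_pos_le_add fun ε hε _ => ?_) zero_le
  rw [zero_add]
  have hε' : (0 : ℝ≥0∞) < ε := by exact_mod_cast hε
  obtain ⟨S, hS, h1⟩ := traceClosure_span_dyads hD T (ε / (2 * (c + 1)))
    (ENNReal.div_pos hε'.ne' (ENNReal.mul_ne_top (by simp) (by simp [hc])))
  have h2 : f S = g S := by
    have : Submodule.span ℂ {T | ∃ x ∈ D, ∃ y ∈ D, T = dyadTC x y} ≤ LinearMap.eqLocus f g :=
      Submodule.span_le.2 (by rintro _ ⟨x, hx, y, hy, rfl⟩; exact h x hx y hy)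
    exact this hS
  have h3 : f T - g T = f (T - S) - g (T - S) := by simp [map_sub, h2]
  rw [h3]
  calc ‖f (T - S) - g (T - S)‖ₑ ≤ ‖f (T - S)‖ₑ + ‖g (T - S)‖ₑ := enorm_sub_le
    _ ≤ c * traceNorm (T - S).1 + c * traceNorm (T - S).1 := add_le_add (hf _) (hg _)
    _ = 2 * c * traceNorm (T - S).1 := by rw [mul_assoc, two_mul]
    _ ≤ 2 * (c + 1) * (ε / (2 * (c + 1))) := by
        gcongr
        · exact le_self_add
        · exact h1
    _ = ε := ENNReal.mul_div_cancel (by simp) (ENNReal.mul_ne_top (by simp) (by simp [hc]))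

/-- The Gaussian function `exp (-p|z|² + c z + d z̄)`. -/
def gaussWeight (p : ℝ) (c d z : ℂ) : ℂ :=
  Complex.exp (-p * (z * (starRingEnd ℂ) z) + c * z + d * (starRingEnd ℂ) z)

theorem integral_gaussWeight {q : ℝ} (hq : 0 < q) (a b : ℂ) :
    MeasureTheory.Integrable (gaussWeight q a b) ∧
      ∫ z, gaussWeight q a b z = Real.pi / q * Complex.exp (a * b / q) := by
  have hb : 0 < ((q : ℝ) : ℂ).re := by simpa using hq
  let c : Fin 2 → ℂ := ![a + b, (a - b) * Complex.I]
  let G : (Fin 2 → ℝ) → ℂ := fun v =>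
    Complex.exp (-(q : ℂ) * ∑ i, (v i : ℂ) ^ 2 + ∑ i, c i * v i)
  have e : ∀ z : ℂ, gaussWeight q a b z = G (Complex.measurableEquivPi z) := by
    intro z
    simp only [gaussWeight, G, Fin.sum_univ_two, c, Complex.measurableEquivPi_apply,
      Matrix.cons_val_zero, Matrix.cons_val_one, Matrix.cons_val_fin_one]
    congr 1
    have h1 : (starRingEnd ℂ) z = z.re - z.im * Complex.I := by
      apply Complex.ext <;> simp
    rw [h1]
    conv_lhs => rw [← Complex.re_add_im z]
    simp only [Complex.add_re, Complex.ofReal_re, Complex.mul_re, Complex.I_re, mul_zero,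
      Complex.ofReal_im, Complex.I_im, Complex.add_im, Complex.mul_im]
    push_cast
    linear_combination (q * (z.im : ℂ) ^ 2) * Complex.I_mul_I
  refine ⟨?_, ?_⟩
  · rw [show gaussWeight q a b = G ∘ Complex.measurableEquivPi from funext e,
      Complex.volume_preserving_equiv_pi.integrable_comp_emb
      Complex.measurableEquivPi.measurableEmbedding]
    exact GaussianFourier.integrable_cexp_neg_mul_sum_add hb c
  · simp only [e]
    rw [Complex.volume_preserving_equiv_pi.integral_comp
      Complex.measurableEquivPi.measurableEmbedding G]
    simp only [G]
    rw [GaussianFourier.integral_cexp_neg_mul_sum_add hb c]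
    have hq0 : (q : ℂ) ≠ 0 := by exact_mod_cast hq.ne'
    have h2 : ((Fintype.card (Fin 2) : ℂ) / 2) = 1 := by simp
    rw [h2, Complex.cpow_one]
    congr 2
    simp only [Fin.sum_univ_two, c, Matrix.cons_val_zero, Matrix.cons_val_one,
      Matrix.cons_val_fin_one]
    field_simp
    linear_combination (a - b) ^ 2 * Complex.I_mul_I

theorem charFun_dyad (x y : L2 ℕ) (z : ℂ) : charFun (dyadTC x y) z = ⟪y, displacement z x⟫_ℂ := by
  have h := (hasDyads_dyad x y).hasSum_trace_comp (displacement z)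
  rw [charFun, dyadTC_val]
  exact h.unique (hasSum_unique _)

theorem charFun_dyad_expVec (α β z : ℂ) : charFun (dyadTC (expVec α) (expVec β)) z =
    Complex.exp (-(z * (starRingEnd ℂ) z / 2) - (starRingEnd ℂ) z * α +
      (starRingEnd ℂ) β * (α + z)) := by
  rw [charFun_dyad, displacement_expVec, inner_smul_right, inner_expVec, ← Complex.exp_add]

theorem norm_charFun_le (T : TraceClass ℕ) : ∃ c : ℝ, ∀ z, ‖charFun T z‖ ≤ c := by
  refine ⟨(traceNorm T.1).toReal, fun z => ?_⟩
  have h := enorm_charFun_le T z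
  rw [← ofReal_norm, ENNReal.ofReal_le_iff_le_toReal T.2.ne] at h
  exact h

/-- If a bounded operator `A` has the coherent matrix elements of the Gaussian average
`∫ w(z) D_z dz`, then `Tr[T A] = ∫ w(z) χ_T(z) dz` for all trace-class operators. -/
theorem trace_comp_eq_integral {p : ℝ} (hp : 0 < p) {c d K : ℂ} {A : L2 ℕ →L[ℂ] L2 ℕ}
    (hA : ∀ α β : ℂ, ⟪expVec β, A (expVec α)⟫_ℂ = K * (Real.pi / (p + 1 / 2 : ℝ) * Complex.exp
      ((starRingEnd ℂ) β * α + (c + (starRingEnd ℂ) β) * (d - α) / (p + 1 / 2 : ℝ))))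
    (T : TraceClass ℕ) : trace (T.1.comp A) = ∫ z, K * gaussWeight p c d z * charFun T z := by
  have hw : MeasureTheory.Integrable fun z => K * gaussWeight p c d z :=
    (integral_gaussWeight hp c d).1.const_mul K
  have hi : ∀ T : TraceClass ℕ, MeasureTheory.Integrable
      fun z => K * gaussWeight p c d z * charFun T z := by
    intro T
    obtain ⟨b, hb⟩ := norm_charFun_le T
    exact hw.mul_bdd (continuous_charFun T).aestronglyMeasurable (Filter.Eventually.of_forall hb)
  let f : TraceClass ℕ →ₗ[ℂ] ℂ :=
    { toFun := fun T => trace (T.1.comp A)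
      map_add' := fun S T => by
        have h := (hasSum_trace_comp S A).add (hasSum_trace_comp T A)
        refine (hasSum_trace_comp (S + T) A).unique (hasSum_of_eq (fun i => ?_) h)
        rw [Submodule.coe_add, add_apply, inner_add_right]
      map_smul' := fun a T => by
        rw [RingHom.id_apply, smul_eq_mul, ← trace_smul, ← smul_comp]
        rfl }
  let g : TraceClass ℕ →ₗ[ℂ] ℂ :=
    { toFun := fun T => ∫ z, K * gaussWeight p c d z * charFun T z
      map_add' := fun S T => by
        rw [← MeasureTheory.integral_add (hi S) (hi T)]
        simp only [charFun_add, mul_add]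
      map_smul' := fun a T => by
        rw [RingHom.id_apply, smul_eq_mul, ← MeasureTheory.integral_const_mul]
        simp only [charFun_smul, mul_left_comm] }
  refine functional_ext_dyads span_expVec (f := f) (g := g)
    (c := ‖A‖ₑ + ∫⁻ z, ‖K * gaussWeight p c d z‖ₑ)
    (ENNReal.add_ne_top.2 ⟨enorm_ne_top, hw.2.ne⟩) (fun T => ?_) (fun T => ?_) ?_ T
  · refine (enorm_trace_comp_le_mul T.1 A).trans ?_
    gcongr
    exact le_self_add
  · refine (MeasureTheory.enorm_integral_le_lintegral_enorm _).trans ?_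
    calc ∫⁻ z, ‖K * gaussWeight p c d z * charFun T z‖ₑ
        ≤ ∫⁻ z, ‖K * gaussWeight p c d z‖ₑ * traceNorm T.1 := by
          refine MeasureTheory.lintegral_mono fun z => ?_
          rw [enorm_mul]
          gcongr
          exact enorm_charFun_le T z
      _ = (∫⁻ z, ‖K * gaussWeight p c d z‖ₑ) * traceNorm T.1 :=
          MeasureTheory.lintegral_mul_const' _ _ T.2.ne
      _ ≤ _ := by
          gcongr
          exact le_add_self
  · rintro _ ⟨α, rfl⟩ _ ⟨β, rfl⟩
    change trace ((dyadTC (expVec α) (expVec β)).1.comp A) =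
      ∫ z, K * gaussWeight p c d z * charFun (dyadTC (expVec α) (expVec β)) z
    have h1 := ((hasDyads_dyad (expVec α) (expVec β)).hasSum_trace_comp A).unique (hasSum_unique _)
    rw [dyadTC_val, h1, hA]
    have h2 : ∀ z, K * gaussWeight p c d z * charFun (dyadTC (expVec α) (expVec β)) z =
        K * (Complex.exp ((starRingEnd ℂ) β * α) *
          gaussWeight (p + 1 / 2) (c + (starRingEnd ℂ) β) (d - α) z) := by
      intro z
      rw [charFun_dyad_expVec, gaussWeight, gaussWeight, mul_assoc, ← Complex.exp_add,
        ← Complex.exp_add]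
      congr 2
      push_cast
      ring
    simp only [h2]
    rw [MeasureTheory.integral_const_mul, MeasureTheory.integral_const_mul,
      (integral_gaussWeight (by positivity) _ _).2, mul_left_comm (Complex.exp _),
      ← Complex.exp_add]

/-- The inversion formula: coherent matrix elements are Gaussian averages of the characteristic
function. -/
theorem inner_expVec_eq_integral (T : TraceClass ℕ) (α β : ℂ) :
    ⟪expVec β, T.1 (expVec α)⟫_ℂ = ∫ z, ((Real.pi : ℂ)⁻¹ * Complex.exp ((starRingEnd ℂ) β * α)) *
      gaussWeight (1 / 2) (-(starRingEnd ℂ) β) α z * charFun T z := by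
  have hp : (Real.pi : ℂ) ≠ 0 := by exact_mod_cast Real.pi_ne_zero
  rw [← trace_comp_eq_integral (by norm_num) (A := dyad (expVec α) (expVec β)) fun α' β' => ?_]
  · have h := (hasDyads_dyad (expVec α) (expVec β)).hasSum_trace_comp' T.1
    exact (hasSum_unique _).unique h
  · rw [inner_dyad, inner_expVec, inner_expVec]
    norm_num
    rw [← Complex.exp_add, mul_assoc, mul_left_comm (Complex.exp _), ← mul_assoc, inv_mul_cancel₀ hp,
      one_mul, ← Complex.exp_add]
    congr 1
    ring

/-- Trace-class operators are determined by their characteristic functions. -/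
theorem charFun_injective {S T : TraceClass ℕ} (h : ∀ z, charFun S z = charFun T z) : S = T := by
  refine Subtype.ext (ext_inner_dense span_expVec span_expVec ?_)
  rintro _ ⟨α, rfl⟩ _ ⟨β, rfl⟩
  rw [inner_expVec_eq_integral, inner_expVec_eq_integral]
  simp only [h]

theorem abs_pow_le_one {s : ℝ} (hs : 0 ≤ s) (hs1 : s ≤ 1) (l : ℕ) : |s ^ l| ≤ 1 := by
  rw [abs_of_nonneg (by positivity)]
  exact pow_le_one₀ hs hs1

/-- The operator `s^(a†a)` is a Gaussian average of displacement operators. -/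
theorem trace_comp_pow_eq_integral {q : ℝ} (hq : 1 ≤ q) (T : TraceClass ℕ) :
    trace (T.1.comp (diagonal (fun l : ℕ => (1 - q⁻¹) ^ l)
      (abs_pow_le_one (by linarith [inv_le_one_of_one_le₀ hq]) (by
        linarith [inv_nonneg.2 (zero_le_one.trans hq)])))) =
      ∫ z, (q / Real.pi : ℂ) * gaussWeight (q - 1 / 2) 0 0 z * charFun T z := by
  have hp : (Real.pi : ℂ) ≠ 0 := by exact_mod_cast Real.pi_ne_zero
  have hq0 : (q : ℂ) ≠ 0 := by exact_mod_cast (by linarith : q ≠ 0)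
  refine trace_comp_eq_integral (by linarith) (fun α β => ?_) T
  have h1 : diagonal (fun l : ℕ => (1 - q⁻¹) ^ l)
      (abs_pow_le_one (by linarith [inv_le_one_of_one_le₀ hq]) (by
        linarith [inv_nonneg.2 (zero_le_one.trans hq)])) (expVec α) =
      expVec ((1 - q⁻¹ : ℝ) * α) := by
    refine ext_ket fun l => ?_
    rw [inner_ket_diagonal, inner_ket_expVec, inner_ket_expVec, mul_pow, mul_div_assoc]
    push_cast
    rfl
  rw [h1, inner_expVec, sub_add_cancel, ← mul_assoc (q / Real.pi : ℂ),
    show (q / Real.pi : ℂ) * (Real.pi / q) = 1 by field_simp, one_mul]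
  congr 1
  push_cast
  field_simp
  ring

/-! ### Convergence of states from convergence of characteristic functions -/

/-- Centered Gaussian averages concentrate at the origin when the width shrinks. -/
theorem tendsto_gaussian_average {g : ℂ → ℂ} {τ : ℝ} (hg : MeasureTheory.AEStronglyMeasurable g)
    (hb : ∀ z, ‖g z‖ ≤ τ) (h0 : ContinuousAt g 0) : Filter.Tendsto (fun m : ℕ =>
      ∫ z, ((((m + 1 : ℕ) : ℝ) : ℂ) / Real.pi) *
        gaussWeight (((m + 1 : ℕ) : ℝ) - 1 / 2) 0 0 z * g z) Filter.atTop (nhds (g 0)) := by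
  have hp : (Real.pi : ℂ) ≠ 0 := by exact_mod_cast Real.pi_ne_zero
  let R : ℕ → ℝ := fun m => (Real.sqrt (m + 1 : ℕ))⁻¹
  have hR0 : ∀ m, 0 < R m := fun m => by positivity
  have hR2 : ∀ m, R m ^ 2 = ((m + 1 : ℕ) : ℝ)⁻¹ := fun m => by
    simp only [R]
    rw [inv_pow, Real.sq_sqrt (by positivity)]
  have hR : Filter.Tendsto R Filter.atTop (nhds 0) :=
    tendsto_inv_atTop_zero.comp (Real.tendsto_sqrt_atTop.comp
      (tendsto_natCast_atTop_atTop.comp (Filter.tendsto_add_atTop_nat 1)))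
  -- The substitution `z = R u` with `R = q^(-1/2)`.
  have e1 : ∀ m : ℕ, ∫ z, ((((m + 1 : ℕ) : ℝ) : ℂ) / Real.pi) *
      gaussWeight (((m + 1 : ℕ) : ℝ) - 1 / 2) 0 0 z * g z =
      ∫ u, ((Real.pi : ℂ)⁻¹ * gaussWeight (1 - R m ^ 2 / 2) 0 0 u) * g (R m • u) := by
    intro m
    have hq0 : ((((m + 1 : ℕ) : ℝ)) : ℂ) ≠ 0 := by exact_mod_cast Nat.succ_ne_zero m
    have h1 := MeasureTheory.Measure.integral_comp_smul_of_nonneg MeasureTheory.volume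
      (fun z : ℂ => (Real.pi : ℂ)⁻¹ * gaussWeight (((m + 1 : ℕ) : ℝ) - 1 / 2) 0 0 z * g z) (R m)
      (hR := (hR0 m).le)
    rw [Complex.finrank_real_complex, hR2, inv_inv, Complex.real_smul,
      ← MeasureTheory.integral_const_mul] at h1
    refine Eq.trans ?_ (h1.symm.trans ?_)
    · refine MeasureTheory.integral_congr_ae (Filter.Eventually.of_forall fun z => ?_)
      simp only
      rw [div_eq_mul_inv]
      ring
    · refine MeasureTheory.integral_congr_ae (Filter.Eventually.of_forall fun u => ?_)
      simp only
      congr 2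
      simp only [gaussWeight, Complex.real_smul, map_mul, Complex.conj_ofReal, zero_mul, add_zero]
      congr 1
      have h2 : ((R m : ℝ) : ℂ) ^ 2 = (((m + 1 : ℕ) : ℝ) : ℂ)⁻¹ := by
        rw [← Complex.ofReal_pow, hR2, Complex.ofReal_inv]
      have h3 : (((m + 1 : ℕ) : ℝ) : ℂ) * ((R m : ℝ) : ℂ) ^ 2 = 1 := by
        rw [h2, mul_inv_cancel₀ hq0]
      push_cast at h3 ⊢
      linear_combination (-(u * (starRingEnd ℂ) u)) * h3
  have hτ : 0 ≤ τ := (norm_nonneg _).trans (hb 0)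
  have hbound := ((integral_gaussWeight (q := 1 / 2) (by norm_num) 0 0).1.norm.const_mul
    (Real.pi⁻¹)).mul_const τ
  have hn : ∀ (p : ℝ) (u : ℂ), ‖gaussWeight p 0 0 u‖ = Real.exp (-p * ‖u‖ ^ 2) := by
    intro p u
    rw [gaussWeight, Complex.norm_exp, Complex.mul_conj, Complex.normSq_eq_norm_sq]
    simp only [zero_mul, add_zero]
    norm_cast
  have hmeas : ∀ m, MeasureTheory.AEStronglyMeasurable
      (fun u => ((Real.pi : ℂ)⁻¹ * gaussWeight (1 - R m ^ 2 / 2) 0 0 u) * g (R m • u)) := by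
    intro m
    refine MeasureTheory.AEStronglyMeasurable.mul ?_ ?_
    · refine Continuous.aestronglyMeasurable ?_
      simp only [gaussWeight]
      fun_prop
    · exact hg.comp_quasiMeasurePreserving
        (MeasureTheory.Measure.quasiMeasurePreserving_smul MeasureTheory.volume (hR0 m).ne')
  have hlim := MeasureTheory.tendsto_integral_of_dominated_convergence
    (fun u => Real.pi⁻¹ * ‖gaussWeight (1 / 2) 0 0 u‖ * τ)
    (F := fun m u => ((Real.pi : ℂ)⁻¹ * gaussWeight (1 - R m ^ 2 / 2) 0 0 u) * g (R m • u))
    (f := fun u => ((Real.pi : ℂ)⁻¹ * gaussWeight 1 0 0 u) * g 0) hmeas hbound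
    (fun m => Filter.Eventually.of_forall fun u => ?_) (Filter.Eventually.of_forall fun u => ?_)
  · have h1 : ∫ u, ((Real.pi : ℂ)⁻¹ * gaussWeight 1 0 0 u) * g 0 = g 0 := by
      rw [MeasureTheory.integral_mul_const, MeasureTheory.integral_const_mul,
        (integral_gaussWeight one_pos 0 0).2]
      simp [hp]
    rw [h1] at hlim
    simpa only [e1] using hlim
  · rw [norm_mul, norm_mul, norm_inv, Complex.norm_real, Real.norm_of_nonneg Real.pi_pos.le, hn, hn]
    have h1 : R m ^ 2 ≤ 1 := by
      rw [hR2]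
      exact inv_le_one_of_one_le₀ (by exact_mod_cast Nat.succ_le_succ (Nat.zero_le m))
    have h2 : Real.exp (-(1 - R m ^ 2 / 2) * ‖u‖ ^ 2) ≤ Real.exp (-(1 / 2) * ‖u‖ ^ 2) := by
      refine Real.exp_le_exp.2 ?_
      have := sq_nonneg ‖u‖
      nlinarith
    have := hb (R m • u)
    gcongr
  · have h1 : Filter.Tendsto (fun m => gaussWeight (1 - R m ^ 2 / 2) 0 0 u) Filter.atTop
        (nhds (gaussWeight 1 0 0 u)) := by
      have hc : Continuous fun r : ℝ => gaussWeight (1 - r ^ 2 / 2) 0 0 u := by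
        simp only [gaussWeight]
        fun_prop
      have := (hc.tendsto 0).comp hR
      simpa [Function.comp_def] using this
    have h2 : Filter.Tendsto (fun m => g (R m • u)) Filter.atTop (nhds (g 0)) := by
      refine h0.tendsto.comp ?_
      simpa using hR.smul_const u
    exact (h1.const_mul _).mul h2

/-- Uniformly bounded operators which are pointwise Cauchy on a total set are so everywhere. -/
theorem cauchySeq_apply_of_total {E F : Type} [NormedAddCommGroup E] [NormedSpace ℂ E]
    [NormedAddCommGroup F] [NormedSpace ℂ F] {D : Set E}
    (hD : (Submodule.span ℂ D).topologicalClosure = ⊤) {f : ℕ → E →L[ℂ] F} {c : ℝ}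
    (hf : ∀ n x, ‖f n x‖ ≤ c * ‖x‖) (h : ∀ x ∈ D, CauchySeq fun n => f n x) (x : E) :
    CauchySeq fun n => f n x := by
  refine dense_induction hD (p := fun x => CauchySeq fun n => f n x) ?_ h
    (fun x y hx hy => by simp only [map_add]; exact hx.add hy)
    (fun a x hx => by
      simp only [map_smul]; exact (uniformContinuous_const_smul a).comp_cauchySeq hx) (by simpa using cauchySeq_const 0) x
  rw [← isSeqClosed_iff_isClosed]
  intro u x hu hux
  change CauchySeq fun n => f n x
  rw [Metric.cauchySeq_iff]
  intro ε hε
  have hb : ∀ n x, ‖f n x‖ ≤ (|c| + 1) * ‖x‖ := fun n x =>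
    (hf n x).trans (by gcongr; linarith [le_abs_self c])
  obtain ⟨k, hk⟩ := ((tendsto_iff_norm_sub_tendsto_zero.1 hux).eventually
    (gt_mem_nhds (show 0 < ε / (3 * (|c| + 1)) by positivity))).exists
  obtain ⟨n₀, hn₀⟩ := Metric.cauchySeq_iff.1 (hu k) (ε / 3) (by positivity)
  have h3 : (|c| + 1) * ‖u k - x‖ < ε / 3 := by
    calc (|c| + 1) * ‖u k - x‖ < (|c| + 1) * (ε / (3 * (|c| + 1))) := by gcongr
      _ = ε / 3 := by field_simp
  refine ⟨n₀, fun m hm n hn => ?_⟩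
  have h4 := hn₀ m hm n hn
  have h1 := hb m (u k - x)
  have h2 := hb n (u k - x)
  rw [dist_eq_norm] at h4 ⊢
  have e : f m x - f n x = -f m (u k - x) + (f m (u k) - f n (u k)) + f n (u k - x) := by
    simp only [map_sub]; abel
  rw [e]
  calc _ ≤ ‖-f m (u k - x)‖ + ‖f m (u k) - f n (u k)‖ + ‖f n (u k - x)‖ :=
        (norm_add_le _ _).trans (add_le_add_left (norm_add_le _ _) _)
    _ < ε := by rw [norm_neg]; linarith

/-- Uniformly bounded operators whose matrix elements on a total set are Cauchy sequences. -/
theorem cauchySeq_inner_of_total {D : Set (L2 ι)}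
    (hD : (Submodule.span ℂ D).topologicalClosure = ⊤) {A : ℕ → L2 ι →L[ℂ] L2 ι} {c : ℝ}
    (hA : ∀ n x, ‖A n x‖ ≤ c * ‖x‖) (h : ∀ x ∈ D, ∀ y ∈ D, CauchySeq fun n => ⟪y, A n x⟫_ℂ)
    (x y : L2 ι) : CauchySeq fun n => ⟪y, A n x⟫_ℂ := by
  have h1 : ∀ y ∈ D, ∀ x, CauchySeq fun n => ⟪y, A n x⟫_ℂ := by
    intro y hy x
    refine cauchySeq_apply_of_total hD (f := fun n => (innerSL ℂ y).comp (A n)) (c := ‖y‖ * c)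
      (fun n x => ?_) (fun x hx => h x hx y hy) x
    refine (norm_inner_le_norm (𝕜 := ℂ) y (A n x)).trans ?_
    rw [mul_assoc]
    gcongr
    exact hA n x
  have hconj : ∀ u v : L2 ι, CauchySeq (fun n => ⟪v, A n u⟫_ℂ) ↔
      CauchySeq fun n => ⟪A n u, v⟫_ℂ := by
    intro u v
    constructor
    · intro h
      have := Complex.isometry_conj.uniformContinuous.comp_cauchySeq h
      simpa only [Function.comp_def, inner_conj_symm] using this
    · intro h
      have := Complex.isometry_conj.uniformContinuous.comp_cauchySeq h
      simpa only [Function.comp_def, inner_conj_symm] using this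
  refine (hconj x y).2 (cauchySeq_apply_of_total hD (f := fun n => innerSL ℂ (A n x))
    (c := c * ‖x‖) (fun n y => ?_) (fun y hy => (hconj x y).1 (h1 y hy x)) y)
  exact (norm_inner_le_norm (𝕜 := ℂ) (A n x) y).trans
    (mul_le_mul_of_nonneg_right (hA n x) (norm_nonneg _))

/-- The projection onto the span of `|0⟩, …, |L - 1⟩`. -/
def truncation (L : ℕ) : L2 ℕ →L[ℂ] L2 ℕ :=
  diagonal (fun l => if l < L then 1 else 0) fun l => by split_ifs <;> simp

theorem inner_ket_truncation (L i : ℕ) (x : L2 ℕ) :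
    ⟪ket i, truncation L x⟫_ℂ = (if i < L then 1 else 0) * ⟪ket i, x⟫_ℂ := by
  rw [truncation, inner_ket_diagonal]
  split_ifs <;> simp

theorem adjoint_truncation (L : ℕ) : adjoint (truncation L) = truncation L := adjoint_diagonal _

theorem norm_truncation_le (L : ℕ) (x : L2 ℕ) : ‖truncation L x‖ ≤ ‖x‖ := norm_diagonal_le _ x

/-- The weight of a vector above photon number `L`, bounded by the damping `s^(a†a)`. -/
theorem norm_sq_sub_truncation_le {s : ℝ} (h0 : 0 ≤ s) (h1 : s ≤ 1) (L : ℕ)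
    (hd : ∀ l : ℕ, |s ^ l| ≤ 1) (x : L2 ℕ) : (1 - s ^ L) * ‖x - truncation L x‖ ^ 2 ≤
      ‖x‖ ^ 2 - (⟪x, diagonal (fun l : ℕ => s ^ l) hd x⟫_ℂ).re := by
  have e1 := hasSum_norm_sq x
  have e2 := Complex.reCLM.hasSum (hasSum_inner x (diagonal (fun l : ℕ => s ^ l) hd x))
  have e3 : HasSum (fun l : ℕ => s ^ l * ‖⟪ket l, x⟫_ℂ‖ ^ 2)
      (⟪x, diagonal (fun l : ℕ => s ^ l) hd x⟫_ℂ).re := by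
    refine e2.congr_fun fun l => ?_
    simp only [Complex.reCLM_apply]
    rw [inner_ket_diagonal, mul_left_comm, ← inner_conj_symm (ket l) x, RCLike.norm_conj,
      Complex.mul_conj, Complex.normSq_eq_norm_sq]
    norm_cast
  refine hasSum_le (fun l => ?_) ((hasSum_norm_sq (x - truncation L x)).mul_left (1 - s ^ L))
    (e1.sub e3)
  rw [inner_sub_right, inner_ket_truncation]
  have h2 : 0 ≤ ‖⟪ket l, x⟫_ℂ‖ ^ 2 := sq_nonneg _
  split_ifs with h
  · rw [one_mul, sub_self, norm_zero]
    have := pow_le_one₀ (n := l) h0 h1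
    nlinarith
  · rw [zero_mul, sub_zero]
    have := pow_le_pow_of_le_one h0 h1 (not_lt.1 h)
    nlinarith

/-- The gentle truncation bound: a positive operator with little weight above photon number `L` is
close in trace norm to its truncation. -/
theorem traceNorm_sub_truncation_le {T : TraceClass ℕ} (hT : T.1.IsPositive) {s η : ℝ}
    (h0 : 0 ≤ s) (h1 : s ≤ 1) (L : ℕ) (hs : s ^ L < 1) (hd : ∀ l : ℕ, |s ^ l| ≤ 1)
    (h : (trace T.1).re - (trace (T.1.comp (diagonal (fun l : ℕ => s ^ l) hd))).re ≤
      (1 - s ^ L) * η) :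
    traceNorm (T.1 - (truncation L).comp (T.1.comp (truncation L))) ≤
      2 * (ENNReal.ofReal (Real.sqrt η) * ENNReal.ofReal (Real.sqrt (trace T.1).re)) := by
  obtain ⟨x, hx⟩ := exists_hasDyads_of_isPositive T hT
  let Q : L2 ℕ →L[ℂ] L2 ℕ := ContinuousLinearMap.id ℂ _ - truncation L
  have hQ : adjoint Q = Q := by
    simp only [Q, map_sub, adjoint_truncation]
    congr 1
    exact adjoint_id
  have htr : HasSum (fun k => ‖x k‖ ^ 2) (trace T.1).re := by
    refine (Complex.reCLM.hasSum hx.hasSum_trace).congr_fun fun k => ?_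
    simp only [Complex.reCLM_apply]
    rw [inner_self_eq_norm_sq_to_K]
    norm_cast
  have hS := Complex.reCLM.hasSum (hx.hasSum_trace_comp (diagonal (fun l : ℕ => s ^ l) hd))
  have hQx : ∀ k, Q (x k) = x k - truncation L (x k) := fun k => rfl
  have hpt : ∀ k, (1 - s ^ L) * ‖Q (x k)‖ ^ 2 ≤
      ‖x k‖ ^ 2 - (⟪x k, diagonal (fun l : ℕ => s ^ l) hd (x k)⟫_ℂ).re := fun k =>
    norm_sq_sub_truncation_le h0 h1 L hd (x k)
  have hs' : 0 < 1 - s ^ L := by linarith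
  have hsum : Summable fun k => ‖Q (x k)‖ ^ 2 := by
    refine (summable_mul_left_iff hs'.ne').1 (Summable.of_nonneg_of_le
      (fun k => by positivity) hpt (htr.sub hS).summable)
  have hle : ∑' k, ‖Q (x k)‖ ^ 2 ≤ η := by
    have := hasSum_le hpt (hsum.hasSum.mul_left (1 - s ^ L)) (htr.sub hS)
    exact le_of_mul_le_mul_left (this.trans h) hs'
  have hη : 0 ≤ η := (tsum_nonneg fun k => sq_nonneg _).trans hle
  have hτ : 0 ≤ (trace T.1).re := htr.nonneg fun k => sq_nonneg _
  have sq : ∀ {a : ℝ}, 0 ≤ a → ENNReal.ofReal (Real.sqrt a) ^ 2 = ENNReal.ofReal a := fun ha => by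
    rw [← ENNReal.ofReal_pow (Real.sqrt_nonneg _), Real.sq_sqrt ha]
  have b1 : ∑' k, ‖Q (x k)‖ₑ ^ 2 ≤ ENNReal.ofReal (Real.sqrt η) ^ 2 := by
    rw [tsum_enorm_sq hsum, sq hη]
    exact ENNReal.ofReal_le_ofReal hle
  have b2 : ∑' k, ‖x k‖ₑ ^ 2 ≤ ENNReal.ofReal (Real.sqrt (trace T.1).re) ^ 2 := by
    rw [tsum_enorm_sq htr.summable, sq hτ, htr.tsum_eq]
  have b3 : ∑' k, ‖truncation L (x k)‖ₑ ^ 2 ≤ ENNReal.ofReal (Real.sqrt (trace T.1).re) ^ 2 := by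
    refine (ENNReal.tsum_le_tsum fun k => ?_).trans b2
    gcongr
    exact enorm_le_iff_norm_le.2 (norm_truncation_le L (x k))
  -- `T - P T P = (1 - P) T + P T (1 - P)`, each bounded by the Cauchy-Schwarz inequality.
  have e : T.1 - (truncation L).comp (T.1.comp (truncation L)) =
      Q.comp (T.1.comp (ContinuousLinearMap.id ℂ _)) + (truncation L).comp (T.1.comp Q) := by
    ext1 v
    simp only [Q, sub_apply, comp_apply, add_apply, id_apply, map_sub]
    abel
  rw [e]
  refine (traceNorm_add_le _ _).trans ?_
  rw [two_mul]
  refine add_le_add ?_ ?_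
  · refine (hx.comp_left Q (ContinuousLinearMap.id ℂ _)).traceNorm_le b1 ?_
    rw [adjoint_id]
    exact b2
  · rw [mul_comm]
    refine (hx.comp_left (truncation L) Q).traceNorm_le b3 ?_
    rw [hQ]
    exact b1

theorem traceNorm_truncation_le (L : ℕ) (A : L2 ℕ →L[ℂ] L2 ℕ) :
    traceNorm ((truncation L).comp (A.comp (truncation L))) ≤
      ∑ i ∈ Finset.range L, ∑ j ∈ Finset.range L, ‖⟪ket i, A (ket j)⟫_ℂ‖ₑ := by
  have e : (truncation L).comp (A.comp (truncation L)) =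
      ∑ i ∈ Finset.range L, ∑ j ∈ Finset.range L, ⟪ket i, A (ket j)⟫_ℂ • dyad (ket i) (ket j) := by
    refine ext_matrix fun k l => ?_
    have hl : truncation L (ket l) = (if l < L then (1 : ℂ) else 0) • ket l := by
      rw [truncation, diagonal_ket]
      split_ifs <;> simp
    rw [comp_apply, comp_apply, inner_ket_truncation, hl, map_smul, inner_smul_right]
    simp only [sum_apply, inner_sum, smul_apply, inner_smul_right, inner_dyad, inner_ket_ket]
    by_cases hk : k < L <;> by_cases hl : l < L <;>
      simp [hk, hl, Finset.sum_ite_eq, Finset.sum_ite_eq']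
  rw [e]
  refine (traceNorm_sum_le _ _).trans (Finset.sum_le_sum fun i _ =>
    (traceNorm_sum_le _ _).trans (Finset.sum_le_sum fun j _ => ?_))
  rw [traceNorm_smul]
  refine mul_le_of_le_one_right' ((traceNorm_dyad_le _ _).trans ?_)
  rw [← ofReal_norm, ← ofReal_norm, norm_ket, norm_ket]
  simp

theorem norm_charFun_le_of_isPositive {T : TraceClass ℕ} (hT : T.1.IsPositive) {τ : ℝ}
    (hτ : trace T.1 = τ) (z : ℂ) : ‖charFun T z‖ ≤ τ := by
  have h := enorm_charFun_le T z
  have h0 : 0 ≤ τ := by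
    have := (Complex.reCLM.hasSum (hasSum_trace T)).nonneg fun i => hT.re_inner_nonneg_right (ket i)
    simpa [hτ] using this
  rw [traceNorm_of_isPositive T hT, hτ, Complex.ofReal_re, ← ofReal_norm] at h
  exact (ENNReal.ofReal_le_ofReal_iff h0).1 h

theorem tendsto_integral_charFun {T : ℕ → TraceClass ℕ} {τ : ℝ} (hτ : ∀ n z, ‖charFun (T n) z‖ ≤ τ)
    {g : ℂ → ℂ} (hg : ∀ z, Filter.Tendsto (fun n => charFun (T n) z) Filter.atTop (nhds (g z)))
    {p : ℝ} (hp : 0 < p) (K c d : ℂ) :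
    Filter.Tendsto (fun n => ∫ z, K * gaussWeight p c d z * charFun (T n) z) Filter.atTop
      (nhds (∫ z, K * gaussWeight p c d z * g z)) := by
  have hi := (integral_gaussWeight hp c d).1.const_mul K
  refine MeasureTheory.tendsto_integral_of_dominated_convergence
    (fun z => ‖K * gaussWeight p c d z‖ * τ)
    (fun n => hi.aestronglyMeasurable.mul (continuous_charFun (T n)).aestronglyMeasurable)
    (hi.norm.mul_const τ) (fun n => Filter.Eventually.of_forall fun z => ?_)
    (Filter.Eventually.of_forall fun z => (hg z).const_mul _)
  rw [norm_mul]
  exact mul_le_mul_of_nonneg_left (hτ n z) (norm_nonneg _)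

/-- The quantum continuity theorem: positive operators with constant trace whose characteristic
functions converge pointwise to a function that is continuous at the origin converge in trace
norm. -/
theorem exists_tendsto_of_charFun {T : ℕ → TraceClass ℕ} (hT : ∀ n, (T n).1.IsPositive) {τ : ℝ}
    (hτ : ∀ n, trace (T n).1 = τ) {g : ℂ → ℂ}
    (hg : ∀ z, Filter.Tendsto (fun n => charFun (T n) z) Filter.atTop (nhds (g z)))
    (h0 : ContinuousAt g 0) :
    ∃ S : TraceClass ℕ, Filter.Tendsto (fun n => traceNorm ((T n).1 - S.1)) Filter.atTop
      (nhds 0) := by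
  have hb : ∀ n z, ‖charFun (T n) z‖ ≤ τ := fun n z => norm_charFun_le_of_isPositive (hT n) (hτ n) z
  have hgb : ∀ z, ‖g z‖ ≤ τ := fun z => le_of_tendsto' (hg z).norm fun n => hb n z
  have hτ0 : 0 ≤ τ := (norm_nonneg _).trans (hgb 0)
  have hg0 : g 0 = τ := tendsto_nhds_unique (hg 0) (by simp only [charFun_zero, hτ]; exact tendsto_const_nhds)
  have hgm : MeasureTheory.AEStronglyMeasurable g :=
    aestronglyMeasurable_of_tendsto_ae Filter.atTop
      (fun n => (continuous_charFun (T n)).aestronglyMeasurable)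
      (Filter.Eventually.of_forall hg)
  have hnorm : ∀ n x, ‖(T n).1 x‖ ≤ τ * ‖x‖ := by
    intro n x
    have h1 := enorm_opNorm_le (T n).1
    rw [traceNorm_of_isPositive _ (hT n), hτ, Complex.ofReal_re, ← ofReal_norm] at h1
    exact (T n).1.le_of_opNorm_le ((ENNReal.ofReal_le_ofReal_iff hτ0).1 h1) x
  -- Coherent matrix elements are Gaussian averages of `χ`, hence they converge.
  have hmat : ∀ i j : ℕ, CauchySeq fun n => ⟪ket i, (T n).1 (ket j)⟫_ℂ := by
    intro i j
    refine cauchySeq_inner_of_total span_expVec hnorm ?_ (ket j) (ket i)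
    rintro _ ⟨α, rfl⟩ _ ⟨β, rfl⟩
    simp only [inner_expVec_eq_integral]
    exact (tendsto_integral_charFun hb hg (by norm_num) _ _ _).cauchySeq
  refine exists_tendsto_traceNorm T fun ε hε => ?_
  obtain ⟨δ, hδ0, hδ⟩ := ENNReal.lt_iff_exists_nnreal_btwn.1 hε
  have hδ0' : (0 : ℝ) < δ := by exact_mod_cast hδ0
  -- Tightness: `r² = η` is chosen such that the truncation error `2 √η √τ` is at most `δ / 4`.
  set r : ℝ := δ / (8 * (Real.sqrt τ + 1)) with hr
  have hr0 : 0 < r := by positivity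
  have hη : 0 < r ^ 2 := by positivity
  obtain ⟨m, hm⟩ := ((tendsto_iff_norm_sub_tendsto_zero.1
    (tendsto_gaussian_average hgm hgb h0)).eventually
      (gt_mem_nhds (show 0 < r ^ 2 / 4 by positivity))).exists
  -- `Tr[Tₙ s^(a†a)]` converges to the average of `g`, which is close to `g 0 = τ`.
  have hq : (1 : ℝ) ≤ ((m + 1 : ℕ) : ℝ) := by exact_mod_cast Nat.succ_le_succ (Nat.zero_le m)
  set s : ℝ := 1 - ((m + 1 : ℕ) : ℝ)⁻¹ with hs
  have hs0 : 0 ≤ s := by linarith [inv_le_one_of_one_le₀ hq]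
  have hs1 : s < 1 := by
    have : 0 < ((m + 1 : ℕ) : ℝ)⁻¹ := by positivity
    linarith
  obtain ⟨L, hL⟩ := exists_pow_lt_of_lt_one (show (0 : ℝ) < 1 / 2 by norm_num) hs1
  have hlim := tendsto_integral_charFun hb hg
    (show 0 < ((m + 1 : ℕ) : ℝ) - 1 / 2 by linarith) ((((m + 1 : ℕ) : ℝ) : ℂ) / Real.pi) 0 0
  simp only [← trace_comp_pow_eq_integral hq] at hlim
  have htail : ∀ᶠ n in Filter.atTop,
      traceNorm ((T n).1 - (truncation L).comp ((T n).1.comp (truncation L))) ≤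
        ENNReal.ofReal (δ / 4) := by
    filter_upwards [(tendsto_iff_norm_sub_tendsto_zero.1 hlim).eventually
      (gt_mem_nhds (show 0 < r ^ 2 / 4 by positivity))] with n hn
    refine (traceNorm_sub_truncation_le (η := r ^ 2) (hT n) hs0 hs1.le L (by linarith)
      (abs_pow_le_one hs0 hs1.le) ?_).trans ?_
    · have h1 := (Complex.abs_re_le_norm _).trans_lt hm
      have h2 := (Complex.abs_re_le_norm _).trans_lt hn
      rw [Complex.sub_re, abs_lt] at h1 h2
      rw [hg0, Complex.ofReal_re] at h1
      rw [hτ, Complex.ofReal_re]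
      nlinarith [h1.1, h2.1]
    · rw [hτ, Complex.ofReal_re, Real.sqrt_sq hr0.le, ← ENNReal.ofReal_mul hr0.le,
        show (2 : ℝ≥0∞) = ENNReal.ofReal 2 by simp, ← ENNReal.ofReal_mul zero_le_two]
      refine ENNReal.ofReal_le_ofReal ?_
      have h3 : r * (8 * (Real.sqrt τ + 1)) = δ := by rw [hr]; field_simp
      nlinarith [Real.sqrt_nonneg τ]
  have hfin : ∀ᶠ p : ℕ × ℕ in Filter.atTop, ∑ i ∈ Finset.range L, ∑ j ∈ Finset.range L,
      ‖⟪ket i, ((T p.1).1 - (T p.2).1) (ket j)⟫_ℂ‖ₑ ≤ ENNReal.ofReal (δ / 4) := by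
    have h1 : Filter.Tendsto (fun p : ℕ × ℕ => ∑ i ∈ Finset.range L, ∑ j ∈ Finset.range L,
        ‖⟪ket i, ((T p.1).1 - (T p.2).1) (ket j)⟫_ℂ‖ₑ) Filter.atTop (nhds 0) := by
      have : Filter.Tendsto (fun p : ℕ × ℕ => ∑ i ∈ Finset.range L, ∑ j ∈ Finset.range L,
          ‖⟪ket i, ((T p.1).1 - (T p.2).1) (ket j)⟫_ℂ‖ₑ) Filter.atTop
          (nhds (∑ i ∈ Finset.range L, ∑ j ∈ Finset.range L, 0)) := by
        refine tendsto_finsetSum _ fun i _ => tendsto_finsetSum _ fun j _ => ?_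
        have h2 := cauchySeq_iff_tendsto_dist_atTop_0.1 (hmat i j)
        have h3 := ENNReal.tendsto_ofReal h2
        rw [ENNReal.ofReal_zero] at h3
        refine h3.congr fun p => ?_
        rw [dist_eq_norm, ofReal_norm, sub_apply, inner_sub_right]
      simpa using this
    exact h1.eventually (ge_mem_nhds (by simpa using hδ0'))
  obtain ⟨n₁, h₁⟩ := Filter.eventually_atTop.1 htail
  obtain ⟨n₂, h₂⟩ := Filter.eventually_atTop.1 hfin
  refine ⟨max n₁ (max n₂.1 n₂.2), fun k hk n hn => ?_⟩
  have hk1 := h₁ k ((le_max_left _ _).trans hk)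
  have hn1 := h₁ n ((le_max_left _ _).trans hn)
  have hkn := h₂ (k, n) ⟨((le_max_left _ _).trans (le_max_right _ _)).trans hk,
    ((le_max_right _ _).trans (le_max_right _ _)).trans hn⟩
  have hmid := (traceNorm_truncation_le L ((T k).1 - (T n).1)).trans hkn
  have e : (truncation L).comp (((T k).1 - (T n).1).comp (truncation L)) =
      (truncation L).comp ((T k).1.comp (truncation L)) -
        (truncation L).comp ((T n).1.comp (truncation L)) := by
    ext1 v
    simp
  rw [e] at hmid
  rw [traceNorm_sub_comm] at hn1
  calc traceNorm ((T k).1 - (T n).1) ≤ _ + _ := traceNorm_sub_le_add _ _ _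
    _ ≤ _ + (_ + _) := add_le_add_right (traceNorm_sub_le_add _ _ _) _
    _ ≤ ENNReal.ofReal (δ / 4) + (ENNReal.ofReal (δ / 4) + ENNReal.ofReal (δ / 4)) :=
        add_le_add hk1 (add_le_add hmid hn1)
    _ = ENNReal.ofReal (3 / 4 * δ) := by
        rw [← ENNReal.ofReal_add (by positivity) (by positivity),
          ← ENNReal.ofReal_add (by positivity) (by positivity)]
        congr 1; ring
    _ ≤ ENNReal.ofReal δ := ENNReal.ofReal_le_ofReal (by linarith)
    _ ≤ ε := by rw [ENNReal.ofReal_coe_nnreal]; exact hδ.le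

/-! ### Limits of channels -/

theorem tendsto_enorm_of_le {E : Type} [NormedAddCommGroup E] {f : ℕ → E} {a : E} {b : ℕ → ℝ≥0∞}
    (h : ∀ n, ‖f n - a‖ₑ ≤ b n) (hb : Filter.Tendsto b Filter.atTop (nhds 0)) :
    Filter.Tendsto f Filter.atTop (nhds a) := by
  rw [tendsto_iff_edist_tendsto_0]
  refine tendsto_of_tendsto_of_tendsto_of_le_of_le tendsto_const_nhds hb (fun _ => zero_le)
    fun n => ?_
  rw [edist_eq_enorm_sub]
  exact h n

theorem tendsto_of_traceNorm {A : ℕ → TraceClass ι} {S : TraceClass ι}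
    (h : Filter.Tendsto (fun n => traceNorm ((A n).1 - S.1)) Filter.atTop (nhds 0)) :
    Filter.Tendsto (fun n => (A n).1) Filter.atTop (nhds S.1) :=
  tendsto_enorm_of_le (fun _ => enorm_opNorm_le _) h

theorem tendsto_trace_of_traceNorm {A : ℕ → TraceClass ι} {S : TraceClass ι}
    (h : Filter.Tendsto (fun n => traceNorm ((A n).1 - S.1)) Filter.atTop (nhds 0)) :
    Filter.Tendsto (fun n => trace (A n).1) Filter.atTop (nhds (trace S.1)) :=
  tendsto_enorm_of_le (fun n => by rw [← trace_sub]; exact enorm_trace_le _) h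

theorem tendsto_traceNorm_add {A B : ℕ → TraceClass ι} {S T : TraceClass ι}
    (hA : Filter.Tendsto (fun n => traceNorm ((A n).1 - S.1)) Filter.atTop (nhds 0))
    (hB : Filter.Tendsto (fun n => traceNorm ((B n).1 - T.1)) Filter.atTop (nhds 0)) :
    Filter.Tendsto (fun n => traceNorm ((A n + B n).1 - (S + T).1)) Filter.atTop (nhds 0) := by
  refine tendsto_of_tendsto_of_tendsto_of_le_of_le tendsto_const_nhds
    (by simpa using hA.add hB) (fun _ => zero_le) fun n => ?_
  have e : (A n + B n).1 - (S + T).1 = ((A n).1 - S.1) + ((B n).1 - T.1) := by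
    simp only [Submodule.coe_add]; abel
  change traceNorm _ ≤ traceNorm _ + traceNorm _
  rw [e]
  exact traceNorm_add_le _ _

theorem tendsto_traceNorm_smul (c : ℂ) {A : ℕ → TraceClass ι} {S : TraceClass ι}
    (h : Filter.Tendsto (fun n => traceNorm ((A n).1 - S.1)) Filter.atTop (nhds 0)) :
    Filter.Tendsto (fun n => traceNorm ((c • A n).1 - (c • S).1)) Filter.atTop (nhds 0) := by
  have e : ∀ n, traceNorm ((c • A n).1 - (c • S).1) = ‖c‖ₑ * traceNorm ((A n).1 - S.1) := by
    intro n
    rw [Submodule.coe_smul, Submodule.coe_smul, ← smul_sub, traceNorm_smul]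
  simp only [e]
  simpa using ENNReal.Tendsto.const_mul h (Or.inr enorm_ne_top)

theorem tendsto_charFun_of_traceNorm {A : ℕ → TraceClass ℕ} {S : TraceClass ℕ}
    (h : Filter.Tendsto (fun n => traceNorm ((A n).1 - S.1)) Filter.atTop (nhds 0)) (z : ℂ) :
    Filter.Tendsto (fun n => charFun (A n) z) Filter.atTop (nhds (charFun S z)) :=
  tendsto_enorm_of_le (fun n => by rw [← charFun_sub]; exact enorm_charFun_le _ _) h

/-- The operators on which a sequence of maps converges in trace norm. -/
def convergenceDomain (C : ℕ → TraceClass ι →ₗ[ℂ] TraceClass κ) :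
    Submodule ℂ (TraceClass ι) where
  carrier := {T | ∃ S : TraceClass κ,
    Filter.Tendsto (fun n => traceNorm ((C n T).1 - S.1)) Filter.atTop (nhds 0)}
  zero_mem' := ⟨0, by simp [traceNorm_zero]⟩
  add_mem' := by
    rintro T T' ⟨S, hS⟩ ⟨S', hS'⟩
    exact ⟨S + S', by simpa only [map_add] using tendsto_traceNorm_add hS hS'⟩
  smul_mem' := by
    rintro c T ⟨S, hS⟩
    exact ⟨c • S, by simpa only [map_smul] using tendsto_traceNorm_smul c hS⟩

theorem traceClosure_convergenceDomain {C : ℕ → TraceClass ι →ₗ[ℂ] TraceClass κ}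
    (hC : ∀ n T, traceNorm (C n T).1 ≤ traceNorm T.1) {T : TraceClass ι}
    (hT : T ∈ traceClosure (convergenceDomain C)) : T ∈ convergenceDomain C := by
  refine exists_tendsto_traceNorm (fun n => C n T) fun ε hε => ?_
  have hε4 : 0 < ε / 4 := ENNReal.div_pos hε.ne' (by simp)
  obtain ⟨R, ⟨S, hS⟩, hR⟩ := hT (ε / 4) hε4
  obtain ⟨n₀, hn₀⟩ := Filter.eventually_atTop.1 (hS.eventually (ge_mem_nhds hε4))
  have h1 : ∀ n ≥ n₀, traceNorm ((C n T).1 - S.1) ≤ ε / 4 + ε / 4 := by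
    intro n hn
    refine (traceNorm_sub_le_add _ (C n R).1 _).trans (add_le_add ?_ (hn₀ n hn))
    have e : (C n T).1 - (C n R).1 = (C n (T - R)).1 := by rw [map_sub]; rfl
    rw [e]
    exact (hC n _).trans hR
  refine ⟨n₀, fun m hm n hn => (traceNorm_sub_le_add _ S.1 _).trans ?_⟩
  rw [traceNorm_sub_comm S.1]
  refine (add_le_add (h1 m hm) (h1 n hn)).trans (le_of_eq ?_)
  rw [← two_mul, ← two_mul, ← mul_assoc, show (2 : ℝ≥0∞) * 2 = 4 by norm_num]
  exact ENNReal.mul_div_cancel (by simp) (by simp)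

theorem dyadTC_add_smul (c : ℂ) (x y : L2 ι) : dyadTC (x + c • y) (x + c • y) =
    dyadTC x x + (starRingEnd ℂ) c • dyadTC x y + c • dyadTC y x +
      (c * (starRingEnd ℂ) c) • dyadTC y y := by
  simp only [dyadTC_add_left, dyadTC_add_right, dyadTC_smul_left, dyadTC_smul_right, smul_add,
    smul_smul, mul_comm c]
  abel

/-- Polarization. -/
theorem four_smul_dyadTC (x y : L2 ι) : (4 : ℂ) • dyadTC x y =
    (dyadTC (x + (1 : ℂ) • y) (x + (1 : ℂ) • y) - dyadTC (x + (-1 : ℂ) • y) (x + (-1 : ℂ) • y)) +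
      Complex.I • (dyadTC (x + Complex.I • y) (x + Complex.I • y) -
        dyadTC (x + (-Complex.I) • y) (x + (-Complex.I) • y)) := by
  simp only [dyadTC_add_smul, map_neg, map_one, Complex.conj_I, smul_sub, smul_add, smul_smul,
    mul_neg, neg_mul, Complex.I_mul_I, neg_neg]
  module

/-- Trace-norm convergence of channels from convergence of the characteristic functions on
coherent dyads. -/
theorem exists_limit_channel {C : ℕ → TraceClass ℕ →ₗ[ℂ] TraceClass ℕ} (hC : ∀ n, IsCPTP (C n))
    {g : ℂ → ℂ → ℂ → ℂ}
    (hg : ∀ α β z, Filter.Tendsto (fun n => charFun (C n (dyadTC (expVec α) (expVec β))) z)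
      Filter.atTop (nhds (g α β z))) (hcont : ∀ α β, ContinuousAt (g α β) 0) :
    ∃ N : TraceClass ℕ →ₗ[ℂ] TraceClass ℕ, IsCPTP N ∧ ∀ T,
      Filter.Tendsto (fun n => traceNorm ((C n T).1 - (N T).1)) Filter.atTop (nhds 0) := by
  -- The continuity theorem applies to pure states, from which coherent dyads arise by polarization.
  have hpure : ∀ (α β c : ℂ), dyadTC (expVec α + c • expVec β) (expVec α + c • expVec β) ∈
      convergenceDomain C := by
    intro α β c
    set v := expVec α + c • expVec β with hv
    refine exists_tendsto_of_charFun (τ := ‖v‖ ^ 2)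
      (g := fun z => g α α z + (starRingEnd ℂ) c * g α β z + c * g β α z +
        (c * (starRingEnd ℂ) c) * g β β z)
      (fun n => (hC n).isPositive (dyadTC_isPositive v)) (fun n => ?_) (fun z => ?_) ?_
    · rw [(hC n).2, dyadTC_val, trace_dyad, inner_self_eq_norm_sq_to_K]
      norm_cast
    · simp only [hv, dyadTC_add_smul, map_add, map_smul, charFun_add, charFun_smul]
      exact (((hg α α z).add ((hg α β z).const_mul _)).add ((hg β α z).const_mul _)).add
        ((hg β β z).const_mul _)
    · exact (((hcont α α).add ((hcont α β).const_mul _)).add ((hcont β α).const_mul _)).add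
        ((hcont β β).const_mul _)
  have hdyad : ∀ α β : ℂ, dyadTC (expVec α) (expVec β) ∈ convergenceDomain C := by
    intro α β
    have h4 : dyadTC (expVec α) (expVec β) =
        (4 : ℂ)⁻¹ • ((4 : ℂ) • dyadTC (expVec α) (expVec β)) := by
      rw [smul_smul, inv_mul_cancel₀ (by norm_num), one_smul]
    rw [h4, four_smul_dyadTC]
    exact Submodule.smul_mem _ _ (Submodule.add_mem _
      (Submodule.sub_mem _ (hpure _ _ _) (hpure _ _ _))
      (Submodule.smul_mem _ _ (Submodule.sub_mem _ (hpure _ _ _) (hpure _ _ _))))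
  have hall : ∀ T, T ∈ convergenceDomain C := by
    intro T
    refine traceClosure_convergenceDomain (fun n => (hC n).traceNorm_le) fun ε hε => ?_
    obtain ⟨S, hS, h⟩ := traceClosure_span_dyads span_expVec T ε hε
    refine ⟨S, Submodule.span_le.2 ?_ hS, h⟩
    rintro _ ⟨_, ⟨α, rfl⟩, _, ⟨β, rfl⟩, rfl⟩
    exact hdyad α β
  choose F hF using hall
  have huniq : ∀ T S, Filter.Tendsto (fun n => traceNorm ((C n T).1 - S.1)) Filter.atTop (nhds 0) →
      F T = S := fun T S h =>
    Subtype.ext (tendsto_nhds_unique (tendsto_of_traceNorm (hF T)) (tendsto_of_traceNorm h))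
  refine ⟨{ toFun := F, map_add' := fun S T => huniq _ _ ?_, map_smul' := fun c T => huniq _ _ ?_ },
    ⟨fun k T hT v => ?_, fun T => ?_⟩, hF⟩
  · simpa only [map_add] using tendsto_traceNorm_add (hF S) (hF T)
  · simpa only [map_smul, RingHom.id_apply] using tendsto_traceNorm_smul c (hF T)
  · have h1 : Filter.Tendsto (fun n => ∑ i, ∑ j, ⟪v i, (C n (T i j)).1 (v j)⟫_ℂ) Filter.atTop
        (nhds (∑ i, ∑ j, ⟪v i, (F (T i j)).1 (v j)⟫_ℂ)) := by
      refine tendsto_finsetSum _ fun i _ => tendsto_finsetSum _ fun j _ => ?_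
      have hc : Continuous fun A : L2 ℕ →L[ℂ] L2 ℕ => ⟪v i, A (v j)⟫_ℂ := by fun_prop
      exact (hc.tendsto _).comp (tendsto_of_traceNorm (hF (T i j)))
    exact ge_of_tendsto' h1 fun n => (hC n).1 k T hT v
  · have h1 := tendsto_trace_of_traceNorm (hF T)
    simp only [(hC _).2] at h1
    exact tendsto_nhds_unique h1 tendsto_const_nhds

/-! ### Gaussian channels -/

theorem phase_add (z w : ℂ) : phase (z + w) = phase z + phase w := by
  ext i
  fin_cases i <;> simp [phase] <;> ring

theorem phase_mul_ofReal (r : ℝ) (z : ℂ) : phase (r * z) = r • phase z := by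
  ext i
  fin_cases i <;> simp [phase] <;> ring

theorem exists_phase_eq (v : Fin 2 → ℝ) : ∃ z, phase z = v := by
  have h : Real.sqrt 2 ≠ 0 := by positivity
  refine ⟨⟨-(v 1 / Real.sqrt 2), v 0 / Real.sqrt 2⟩, ?_⟩
  ext i
  fin_cases i <;> simp [phase] <;> field_simp

theorem phase_dotProduct_phase (z : ℂ) :
    ((phase z ⬝ᵥ phase z : ℝ) : ℂ) = 2 * (z * (starRingEnd ℂ) z) := by
  have h : Real.sqrt 2 * Real.sqrt 2 = 2 := Real.mul_self_sqrt zero_le_two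
  rw [Complex.mul_conj, Complex.normSq_apply]
  norm_cast
  simp only [phase, dotProduct, Fin.sum_univ_two, Matrix.cons_val_zero, Matrix.cons_val_one,
    Matrix.cons_val_fin_one]
  linear_combination (z.im * z.im + z.re * z.re) * h

/-- Quadratic forms in the phase space coordinates are polynomials in `z` and `z̄`. -/
theorem phase_quadratic (Y : Matrix (Fin 2) (Fin 2) ℝ) (z : ℂ) :
    ((phase z ⬝ᵥ Y.mulVec (phase z) : ℝ) : ℂ) =
      ((Y 1 1 - Y 0 0) / 2 + Complex.I * (Y 0 1 + Y 1 0) / 2) * z ^ 2 +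
        (Y 0 0 + Y 1 1) * (z * (starRingEnd ℂ) z) +
        ((Y 1 1 - Y 0 0) / 2 - Complex.I * (Y 0 1 + Y 1 0) / 2) * (starRingEnd ℂ) z ^ 2 := by
  have h1 : (starRingEnd ℂ) z = z.re - z.im * Complex.I := by
    apply Complex.ext <;> simp
  have h2 : z = z.re + z.im * Complex.I := (Complex.re_add_im z).symm
  rw [h1]
  simp only [phase, Matrix.mulVec, dotProduct, Fin.sum_univ_two, Matrix.cons_val_zero,
    Matrix.cons_val_one, Matrix.cons_val_fin_one]
  push_cast
  generalize (z.re : ℂ) = a at *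
  generalize (z.im : ℂ) = b at *
  rw [h2]
  linear_combination ((Y 0 0 : ℂ) * b ^ 2 - (Y 0 1 + Y 1 0) * a * b + Y 1 1 * a ^ 2) *
    sqrt_two_mul_self - (2 * (Y 0 1 + Y 1 0) * a * b - 2 * Y 0 0 * b ^ 2) * Complex.I_mul_I

/-- The second order expansion
`χ(t z) = 1 + i a t - b t² / 4 + o(t²)` of a characteristic function along a ray. -/
def HasExpansion (χ : ℂ → ℂ) (z : ℂ) (a b : ℝ) : Prop :=
  Filter.Tendsto (fun t : ℝ => ((t : ℂ) ^ 2)⁻¹ * (χ (t * z) - 1 - t * (Complex.I * (a : ℂ)) +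
    t ^ 2 / 4 * (b : ℂ))) (nhdsWithin 0 (Set.Ioi 0)) (nhds 0)

theorem tendsto_ofReal_zero :
    Filter.Tendsto (fun t : ℝ => (t : ℂ)) (nhdsWithin 0 (Set.Ioi 0)) (nhds 0) := by
  have := (Complex.continuous_ofReal.tendsto 0).mono_left
    (nhdsWithin_le_nhds (s := Set.Ioi (0 : ℝ)))
  rwa [Complex.ofReal_zero] at this

theorem HasExpansion.unique {χ : ℂ → ℂ} {z : ℂ} {a b a' b' : ℝ} (h : HasExpansion χ z a b)
    (h' : HasExpansion χ z a' b') : a = a' ∧ b = b' := by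
  have h1 := h.sub h'
  have h2 := tendsto_ofReal_zero.mul h1
  have e2 : ∀ᶠ t : ℝ in nhdsWithin 0 (Set.Ioi 0), Complex.I * ((a' : ℂ) - a) =
      (t : ℂ) * (((t : ℂ) ^ 2)⁻¹ * (χ (t * z) - 1 - t * (Complex.I * (a : ℂ)) +
        t ^ 2 / 4 * (b : ℂ)) - ((t : ℂ) ^ 2)⁻¹ * (χ (t * z) - 1 - t * (Complex.I * (a' : ℂ)) +
        t ^ 2 / 4 * (b' : ℂ))) + t * ((b' - b : ℂ) / 4) := by
    filter_upwards [self_mem_nhdsWithin] with t ht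
    have ht0 : (t : ℂ) ≠ 0 := by exact_mod_cast (ne_of_gt ht)
    field_simp
    ring
  have h3 : Complex.I * ((a' : ℂ) - a) = 0 := by
    refine tendsto_nhds_unique (tendsto_const_nhds.congr' e2) ?_
    simpa using h2.add (tendsto_ofReal_zero.mul_const ((b' - b : ℂ) / 4))
  have ha : a = a' := by
    have h4 := (mul_eq_zero.1 h3).resolve_left Complex.I_ne_zero
    exact_mod_cast (sub_eq_zero.1 h4).symm
  refine ⟨ha, ?_⟩
  subst ha
  have e4 : ∀ᶠ t : ℝ in nhdsWithin 0 (Set.Ioi 0), ((t : ℂ) ^ 2)⁻¹ * (χ (t * z) - 1 -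
      t * (Complex.I * (a : ℂ)) + t ^ 2 / 4 * (b : ℂ)) - ((t : ℂ) ^ 2)⁻¹ * (χ (t * z) - 1 -
      t * (Complex.I * (a : ℂ)) + t ^ 2 / 4 * (b' : ℂ)) = ((b : ℂ) - b') / 4 := by
    filter_upwards [self_mem_nhdsWithin] with t ht
    have ht0 : (t : ℂ) ≠ 0 := by exact_mod_cast (ne_of_gt ht)
    field_simp
    ring
  have h5 : ((b : ℂ) - b') / 4 = 0 := by
    refine tendsto_nhds_unique (tendsto_const_nhds.congr' ?_) (by simpa using h1)
    filter_upwards [e4] with t ht using ht.symm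
  have h6 : (b : ℂ) - b' = 0 := by simpa using h5
  exact_mod_cast sub_eq_zero.1 h6

/-- Multiplication by the Gaussian function `exp(-y t²/4)` shifts the second order coefficient. -/
theorem HasExpansion.mul_gaussian {χ : ℂ → ℂ} {w z : ℂ} {a b y : ℝ} (h : HasExpansion χ w a b)
    {η : ℂ → ℂ} (hη : ∀ t : ℝ, η (t * z) = χ (t * w) * Complex.exp (-(t ^ 2 / 4 * (y : ℂ)))) :
    HasExpansion η z a (b + y) := by
  have ht := tendsto_ofReal_zero
  have hsq : Filter.Tendsto (fun t : ℝ => (t : ℂ) ^ 2) (nhdsWithin 0 (Set.Ioi 0))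
      (nhdsWithin 0 {0}ᶜ) := by
    refine tendsto_nhdsWithin_iff.2 ⟨by simpa using ht.pow 2, ?_⟩
    filter_upwards [self_mem_nhdsWithin] with t ht
    have ht0 : (t : ℂ) ≠ 0 := by exact_mod_cast (ne_of_gt ht)
    simpa using ht0
  have hder : HasDerivAt (fun s : ℂ => Complex.exp (-(s / 4 * (y : ℂ)))) (-(y / 4 : ℂ)) 0 := by
    have h1 : HasDerivAt (fun s : ℂ => -(s / 4 * (y : ℂ))) (-(y / 4 : ℂ)) 0 := by
      refine (((hasDerivAt_id (0 : ℂ)).div_const 4).mul_const (y : ℂ)).neg.congr_deriv ?_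
      ring
    simpa using h1.cexp
  have hE : Filter.Tendsto (fun t : ℝ => ((t : ℂ) ^ 2)⁻¹ *
      (Complex.exp (-(t ^ 2 / 4 * (y : ℂ))) - 1)) (nhdsWithin 0 (Set.Ioi 0))
      (nhds (-(y / 4 : ℂ))) := by
    have := (hasDerivAt_iff_tendsto_slope.1 hder).comp hsq
    refine this.congr fun t => ?_
    simp [slope, Function.comp_apply]
  have hE1 : Filter.Tendsto (fun t : ℝ => Complex.exp (-((t : ℂ) ^ 2 / 4 * (y : ℂ))))
      (nhdsWithin 0 (Set.Ioi 0)) (nhds 1) := by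
    have h1 := (hder.continuousAt.tendsto).comp (hsq.mono_right nhdsWithin_le_nhds)
    simpa [Function.comp_def] using h1
  have h2 : Filter.Tendsto (fun t : ℝ => (t : ℂ) * (Complex.I * (a : ℂ)) - t ^ 2 / 4 * (b : ℂ))
      (nhdsWithin 0 (Set.Ioi 0)) (nhds 0) := by
    simpa using (ht.mul_const (Complex.I * (a : ℂ))).sub (((ht.pow 2).div_const 4).mul_const (b : ℂ))
  have h3 := ((hE1.mul h).add (hE.add_const (y / 4 : ℂ))).add (hE.mul h2)
  unfold HasExpansion
  rw [mul_zero, neg_add_cancel, mul_zero, add_zero, add_zero] at h3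
  refine h3.congr' ?_
  filter_upwards [self_mem_nhdsWithin] with t ht
  have ht0 : (t : ℂ) ≠ 0 := by exact_mod_cast (ne_of_gt ht)
  rw [hη]
  push_cast
  field_simp
  ring

theorem HasExpansion.eventually_le {χ : ℂ → ℂ} {z : ℂ} {a b : ℝ} (h : HasExpansion χ z a b) :
    ∀ᶠ t : ℝ in nhdsWithin 0 (Set.Ioi 0), 1 - (χ (t * z)).re ≤ (|b| / 4 + 1) * t ^ 2 := by
  filter_upwards [self_mem_nhdsWithin, h.norm.eventually
    (gt_mem_nhds (show ‖(0 : ℂ)‖ < 1 by simp))] with t ht h1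
  have ht0 : (t : ℂ) ≠ 0 := by exact_mod_cast (ne_of_gt ht)
  have h2 : ‖χ (t * z) - 1 - t * (Complex.I * (a : ℂ)) + t ^ 2 / 4 * (b : ℂ)‖ ≤ t ^ 2 := by
    rw [norm_mul, norm_inv, norm_pow, Complex.norm_real, Real.norm_eq_abs, sq_abs,
      inv_mul_lt_iff₀ (by have := Set.mem_Ioi.1 ht; positivity), mul_one] at h1
    exact h1.le
  have h3 := (Complex.abs_re_le_norm _).trans h2
  have e : (χ (t * z) - 1 - t * (Complex.I * (a : ℂ)) + t ^ 2 / 4 * (b : ℂ)).re =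
      (χ (t * z)).re - 1 + t ^ 2 / 4 * b := by
    have e1 : (t : ℂ) * (Complex.I * (a : ℂ)) = ((t * a : ℝ) : ℂ) * Complex.I := by push_cast; ring
    have e2 : (t : ℂ) ^ 2 / 4 * (b : ℂ) = ((t ^ 2 / 4 * b : ℝ) : ℂ) := by push_cast; ring
    rw [e1, e2, Complex.add_re, Complex.sub_re, Complex.sub_re, Complex.ofReal_re,
      Complex.re_ofReal_mul]
    simp
  rw [e, abs_le] at h3
  have := le_abs_self b
  nlinarith [sq_nonneg t, h3.1, mul_le_mul_of_nonneg_left this (sq_nonneg t)]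

section GaussianChannel
variable {N : TraceClass ℕ →ₗ[ℂ] TraceClass ℕ} {μ ν : ℂ} {X Y : Matrix (Fin 2) (Fin 2) ℝ}

/-- A linear substitution and a Gaussian factor preserve exponentials of quadratic polynomials. -/
theorem isGaussianChannel_of_charFun (hN : IsChannel N)
    (hχ : ∀ T z, charFun (N T) z = charFun T (μ * z + ν * (starRingEnd ℂ) z) *
      Complex.exp (-(((phase z ⬝ᵥ Y.mulVec (phase z) : ℝ) : ℂ) / 4))) : IsGaussianChannel N := by
  refine ⟨hN, fun σ ⟨hσ, c₀, c₁, c₂, c₃, c₄, c₅, h⟩ => ⟨(isCPTP_iff.2 hN).isState hσ, ?_⟩⟩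
  refine ⟨c₀, c₁ * μ + c₂ * (starRingEnd ℂ) ν, c₁ * ν + c₂ * (starRingEnd ℂ) μ,
    c₃ * μ ^ 2 + c₄ * (μ * (starRingEnd ℂ) ν) + c₅ * (starRingEnd ℂ) ν ^ 2 -
      ((Y 1 1 - Y 0 0) / 2 + Complex.I * (Y 0 1 + Y 1 0) / 2) / 4,
    2 * c₃ * μ * ν + c₄ * (μ * (starRingEnd ℂ) μ + ν * (starRingEnd ℂ) ν) +
      2 * c₅ * (starRingEnd ℂ) μ * (starRingEnd ℂ) ν - (Y 0 0 + Y 1 1) / 4,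
    c₃ * ν ^ 2 + c₄ * (ν * (starRingEnd ℂ) μ) + c₅ * (starRingEnd ℂ) μ ^ 2 -
      ((Y 1 1 - Y 0 0) / 2 - Complex.I * (Y 0 1 + Y 1 0) / 2) / 4, fun z => ?_⟩
  rw [hχ, h, ← Complex.exp_add, phase_quadratic]
  congr 1
  simp only [map_add, map_mul, Complex.conj_conj]
  ring

/-- The moments of `N ρ` are read off from the second order expansion of its characteristic function. -/
theorem hasChannelMatrices_of_charFun (hN : IsChannel N) (hY : Y.transpose = Y)
    (hX : ∀ z, phase (μ * z + ν * (starRingEnd ℂ) z) = X.transpose.mulVec (phase z))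
    (hχ : ∀ T z, charFun (N T) z = charFun T (μ * z + ν * (starRingEnd ℂ) z) *
      Complex.exp (-(((phase z ⬝ᵥ Y.mulVec (phase z) : ℝ) : ℂ) / 4))) :
    HasChannelMatrices N X Y := by
  intro ρ hρ hf
  obtain ⟨d, M, hd, hM, hexp⟩ := exists_moments hρ hf
  have hσ : IsState (N ρ) := (isCPTP_iff.2 hN).isState hρ
  have hlin : ∀ v : Fin 2 → ℝ, v ⬝ᵥ X.mulVec d = X.transpose.mulVec v ⬝ᵥ d := fun v => by
    rw [Matrix.mulVec_transpose, Matrix.dotProduct_mulVec]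
  have hquad : ∀ v : Fin 2 → ℝ, v ⬝ᵥ (X * M * X.transpose + Y).mulVec v =
      X.transpose.mulVec v ⬝ᵥ M.mulVec (X.transpose.mulVec v) + v ⬝ᵥ Y.mulVec v := fun v => by
    rw [Matrix.add_mulVec, dotProduct_add, ← Matrix.mulVec_mulVec, ← Matrix.mulVec_mulVec,
      Matrix.dotProduct_mulVec v X, ← Matrix.mulVec_transpose]
  have hexpσ : ∀ z, HasExpansion (charFun (N ρ)) z (phase z ⬝ᵥ X.mulVec d)
      (phase z ⬝ᵥ (X * M * X.transpose + Y).mulVec (phase z)) := by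
    intro z
    rw [hlin, hquad, ← hX]
    refine HasExpansion.mul_gaussian (hexp _) fun t => ?_
    rw [hχ, phase_mul_ofReal]
    congr 2
    · rw [map_mul, Complex.conj_ofReal]; ring
    · rw [Matrix.mulVec_smul, smul_dotProduct, dotProduct_smul, smul_eq_mul, smul_eq_mul]
      push_cast
      ring
  have hfσ : FiniteMoment 2 (N ρ) := by
    refine finiteMoment_of_charFun hσ.1
      (C := |phase 1 ⬝ᵥ (X * M * X.transpose + Y).mulVec (phase 1)| / 4 +
        |phase Complex.I ⬝ᵥ (X * M * X.transpose + Y).mulVec (phase Complex.I)| / 4 + 1)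
      fun z hz => ?_
    filter_upwards [(hexpσ z).eventually_le] with t ht
    rw [hσ.2, Complex.one_re]
    refine ht.trans (mul_le_mul_of_nonneg_right ?_ (sq_nonneg t))
    rcases hz with rfl | hz
    · have := abs_nonneg (phase Complex.I ⬝ᵥ (X * M * X.transpose + Y).mulVec (phase Complex.I))
      linarith
    · rw [Set.mem_singleton_iff] at hz
      subst hz
      have := abs_nonneg (phase 1 ⬝ᵥ (X * M * X.transpose + Y).mulVec (phase 1))
      linarith
  obtain ⟨d', M', hd', hM', hexp'⟩ := exists_moments hσ hfσ
  -- Compare the two second order expansions of the characteristic function of `N ρ`.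
  have hu : ∀ v : Fin 2 → ℝ, v ⬝ᵥ d' = v ⬝ᵥ X.mulVec d ∧
      v ⬝ᵥ M'.mulVec v = v ⬝ᵥ (X * M * X.transpose + Y).mulVec v := by
    intro v
    obtain ⟨z, rfl⟩ := exists_phase_eq v
    exact HasExpansion.unique (hexp' z) (hexpσ z)
  have hsymm : ∀ {σ : TraceClass ℕ} {A : Matrix (Fin 2) (Fin 2) ℝ}, (∀ i j, HasMoment σ
      (quadrature i * quadrature j + quadrature j * quadrature i) (A i j : ℂ)) →
      A.transpose = A := by
    intro σ A hA
    ext i j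
    have h1 := hA j i
    rw [add_comm] at h1
    exact_mod_cast h1.unique (hA i j)
  have hd'X : d' = X.mulVec d := by
    ext i
    have := (hu (Pi.single i 1)).1
    simpa using this
  have hMX : M' = X * M * X.transpose + Y := by
    have h1 : M'.transpose = M' := hsymm hM'
    have h2 : (X * M * X.transpose + Y).transpose = X * M * X.transpose + Y := by
      rw [Matrix.transpose_add, Matrix.transpose_mul, Matrix.transpose_mul,
        Matrix.transpose_transpose, hsymm hM, hY, Matrix.mul_assoc]
    have h3 := fun v => (hu v).2
    generalize X * M * X.transpose + Y = Z at h2 h3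
    have h00 := h3 ![1, 0]
    have h11 := h3 ![0, 1]
    have h01 := h3 ![1, 1]
    have s1 := congrFun (congrFun h1 0) 1
    have s2 := congrFun (congrFun h2 0) 1
    simp [Matrix.mulVec, dotProduct, Fin.sum_univ_two] at h00 h11 h01 s1 s2
    ext i j
    fin_cases i <;> fin_cases j <;> simp <;> linarith
  refine ⟨hfσ, d, _, hd, hasCovariance_of_moments hρ.2 hd hM, hd'X ▸ hd', ?_⟩
  have h := hasCovariance_of_moments hσ.2 hd' hM'
  convert h using 1
  have e : ∀ (A : Matrix (Fin 2) (Fin 2) ℝ) (v : Fin 2 → ℝ),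
      (Matrix.of fun i j => A i j - 2 * v i * v j) = A - (2 : ℝ) • Matrix.vecMulVec v v := by
    intro A v
    ext i j
    simp [Matrix.vecMulVec]
    ring
  rw [e, e, hMX, hd'X, Matrix.mul_sub, Matrix.sub_mul, Matrix.mul_smul, Matrix.smul_mul,
    Matrix.mul_vecMulVec, Matrix.vecMulVec_mul, Matrix.vecMul_transpose]
  abel

end GaussianChannel

/-! ### The central limit theorem -/

/-- The convolution does not depend on the choice of the beam splitter. -/
theorem IsSymmetricConvolution.unique {N C C' : TraceClass ℕ →ₗ[ℂ] TraceClass ℕ} {n : ℕ}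
    (h : IsSymmetricConvolution N n C) (h' : IsSymmetricConvolution N n C') : C = C' := by
  refine ext_dyads span_expVec h.isCPTP.traceNorm_le h'.isCPTP.traceNorm_le ?_
  rintro _ ⟨α, rfl⟩ _ ⟨β, rfl⟩
  exact charFun_injective fun z => by rw [h.charFun_eq, h'.charFun_eq]

/-- A characteristic function which is a Gaussian multiple of a displaced one on coherent dyads is
so on all operators. -/
theorem charFun_eq_of_expVec {N : TraceClass ℕ →ₗ[ℂ] TraceClass ℕ} (hN : IsCPTP N) {z w c : ℂ}
    (h : ∀ α β, charFun (N (dyadTC (expVec α) (expVec β))) z =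
      charFun (dyadTC (expVec α) (expVec β)) w * c) (T : TraceClass ℕ) :
    charFun (N T) z = charFun T w * c := by
  let f : TraceClass ℕ →ₗ[ℂ] ℂ :=
    { toFun := fun T => charFun (N T) z
      map_add' := fun S T => by rw [map_add, charFun_add]
      map_smul' := fun a T => by rw [map_smul, charFun_smul, RingHom.id_apply, smul_eq_mul] }
  let g : TraceClass ℕ →ₗ[ℂ] ℂ :=
    { toFun := fun T => charFun T w * c
      map_add' := fun S T => by rw [charFun_add, add_mul]
      map_smul' := fun a T => by rw [charFun_smul, RingHom.id_apply, smul_eq_mul, mul_assoc] }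
  refine functional_ext_dyads span_expVec (f := f) (g := g) (c := 1 + ‖c‖ₑ)
    (ENNReal.add_ne_top.2 ⟨ENNReal.one_ne_top, enorm_ne_top⟩) (fun T => ?_) (fun T => ?_) ?_ T
  · refine ((enorm_charFun_le _ z).trans (hN.traceNorm_le T)).trans ?_
    exact le_mul_of_one_le_left' le_self_add
  · change ‖charFun T w * c‖ₑ ≤ _
    rw [enorm_mul, mul_comm]
    exact mul_le_mul' le_add_self (enorm_charFun_le _ w)
  · rintro _ ⟨α, rfl⟩ _ ⟨β, rfl⟩
    exact h α β

/-- The covariance matrix of the centered state `N(|0⟩⟨0|)` is the second order coefficient of its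
characteristic function. -/
theorem exists_vacuum_moments {N : TraceClass ℕ →ₗ[ℂ] TraceClass ℕ} (hN : IsChannel N)
    (hc : IsCentered N) (h₀ : FiniteMoment 2 (N (ketbra 0 0))) :
    ∃ V : Matrix (Fin 2) (Fin 2) ℝ, V.transpose = V ∧ HasCovariance (N (ketbra 0 0)) V ∧
      ∀ z, Filter.Tendsto (fun t : ℝ => ((t : ℂ) ^ 2)⁻¹ * (charFun (N (ketbra 0 0)) (t * z) - 1))
        (nhdsWithin 0 (Set.Ioi 0)) (nhds (-(((phase z ⬝ᵥ V.mulVec (phase z) : ℝ) : ℂ) / 4))) := by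
  have h00 : IsState (ketbra 0 0 : TraceClass ℕ) := by
    rw [← dyadTC_ket]
    refine ⟨dyadTC_isPositive _, ?_⟩
    rw [dyadTC_val, trace_dyad, inner_ket_ket, if_pos rfl]
  have hs := (isCPTP_iff.2 hN).isState h00
  obtain ⟨d, V, hd, hV, hexp⟩ := exists_moments hs h₀
  have hd0 : d = 0 := by
    ext i
    exact_mod_cast (hd i).unique (hc i)
  subst hd0
  refine ⟨V, ?_, ?_, fun z => ?_⟩
  · ext i j
    have h1 := hV j i
    rw [add_comm] at h1
    exact_mod_cast h1.unique (hV i j)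
  · have h := hasCovariance_of_moments hs.2 hd hV
    simp only [Pi.zero_apply, mul_zero, sub_zero] at h
    exact h
  · have h := (hexp z).sub_const (((phase z ⬝ᵥ V.mulVec (phase z) : ℝ) : ℂ) / 4)
    rw [zero_sub] at h
    refine h.congr' ?_
    filter_upwards [self_mem_nhdsWithin] with t ht
    have ht0 : (t : ℂ) ≠ 0 := by exact_mod_cast (ne_of_gt ht)
    rw [dotProduct_zero]
    push_cast
    field_simp
    ring

/-- The real matrix of the map `z ↦ μ z + ν z̄`, transposed, in phase space coordinates. -/
def phaseMatrix (μ ν : ℂ) : Matrix (Fin 2) (Fin 2) ℝ :=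
  Matrix.of fun i j => phase (μ * direction i + ν * (starRingEnd ℂ) (direction i)) j

theorem phase_eq_mulVec (μ ν z : ℂ) : phase (μ * z + ν * (starRingEnd ℂ) z) =
    (phaseMatrix μ ν).transpose.mulVec (phase z) := by
  have e : μ * z + ν * (starRingEnd ℂ) z =
      phase z 0 * (μ * direction 0 + ν * (starRingEnd ℂ) (direction 0)) +
        phase z 1 * (μ * direction 1 + ν * (starRingEnd ℂ) (direction 1)) := by
    conv_lhs => rw [phase_direction z]
    simp only [Fin.sum_univ_two, map_add, map_mul, Complex.conj_ofReal]
    ring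
  rw [e, phase_add, phase_mul_ofReal, phase_mul_ofReal]
  ext j
  simp only [phaseMatrix, Matrix.mulVec, dotProduct, Fin.sum_univ_two, Matrix.transpose_apply,
    Matrix.of_apply, Pi.add_apply, Pi.smul_apply, smul_eq_mul]
  ring

/-- The quadratic form of `X Xᵀ`, which accounts for the vacuum noise of the displaced coherent dyads. -/
theorem norm_sq_eq_phase (μ ν z : ℂ) :
    (μ * z + ν * (starRingEnd ℂ) z) * (starRingEnd ℂ) (μ * z + ν * (starRingEnd ℂ) z) / 2 =
      ((phase z ⬝ᵥ (phaseMatrix μ ν * (phaseMatrix μ ν).transpose).mulVec (phase z) : ℝ) : ℂ)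
        / 4 := by
  have h := phase_dotProduct_phase (μ * z + ν * (starRingEnd ℂ) z)
  have e : phase z ⬝ᵥ (phaseMatrix μ ν * (phaseMatrix μ ν).transpose).mulVec (phase z) =
      phase (μ * z + ν * (starRingEnd ℂ) z) ⬝ᵥ phase (μ * z + ν * (starRingEnd ℂ) z) := by
    rw [phase_eq_mulVec, ← Matrix.mulVec_mulVec, Matrix.dotProduct_mulVec, ← Matrix.mulVec_transpose]
  rw [e, h]
  ring

/-- The first moments of `N(|0⟩⟨1|)` and `N(|1⟩⟨0|)`, combined into the real matrix `√2 X`. -/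
theorem hasMoment_quadrature_sum {S T : TraceClass ℕ} {μ ν : ℂ}
    (hS : ∀ z, HasMoment S (displacementGen z) (μ * z + ν * (starRingEnd ℂ) z))
    (hT : ∀ z, HasMoment T (displacementGen z) (-(starRingEnd ℂ) (μ * z + ν * (starRingEnd ℂ) z)))
    (i : Fin 2) :
    HasMoment (S + T) (quadrature i) ((Real.sqrt 2 * phaseMatrix μ ν i 0 : ℝ) : ℂ) ∧
      HasMoment (-Complex.I • S + Complex.I • T) (quadrature i)
        ((Real.sqrt 2 * phaseMatrix μ ν i 1 : ℝ) : ℂ) := by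
  have h2 := Real.mul_self_sqrt (zero_le_two (α := ℝ))
  have h1 := (hS (direction i)).smul (-Complex.I)
  have h1' := (hT (direction i)).smul (-Complex.I)
  rw [← quadrature_eq] at h1 h1'
  simp only [phaseMatrix, Matrix.of_apply]
  generalize μ * direction i + ν * (starRingEnd ℂ) (direction i) = w at *
  constructor
  · convert h1.add_left h1' using 1
    apply Complex.ext
    · simp [phase]; linear_combination w.im * h2
    · simp [phase]
  · convert (h1.smul_left (-Complex.I)).add_left (h1'.smul_left Complex.I) using 1
    apply Complex.ext
    · simp [phase]; linear_combination -w.re * h2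
    · simp [phase]

end

end Bosonic

theorem theorem1 (N : TraceClass ℕ →ₗ[ℂ] TraceClass ℕ) (hN : IsChannel N) (hc : IsCentered N)
    (h₀ : FiniteMoment 2 (N (ketbra 0 0))) (h₁ : FiniteMoment 1 (N (ketbra 1 0))) :
    (∀ n : ℕ, ∃ C : TraceClass ℕ →ₗ[ℂ] TraceClass ℕ, IsSymmetricConvolution N n C) ∧
    ∃ (NG : TraceClass ℕ →ₗ[ℂ] TraceClass ℕ) (m X Y V : Matrix (Fin 2) (Fin 2) ℝ),
      IsGaussianChannel NG ∧ HasChannelMatrices NG X Y ∧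
      (∀ i, HasMoment (N (ketbra 0 1 + ketbra 1 0)) (quadrature i) (m i 0 : ℂ)) ∧
      (∀ i, HasMoment (N (-Complex.I • ketbra 0 1 + Complex.I • ketbra 1 0)) (quadrature i)
        (m i 1 : ℂ)) ∧
      X = (1 / Real.sqrt 2) • m ∧
      HasCovariance (N (ketbra 0 0)) V ∧
      Y = V - X * X.transpose ∧
      ∀ C : ℕ → TraceClass ℕ →ₗ[ℂ] TraceClass ℕ, (∀ n, IsSymmetricConvolution N n (C n)) →
        ∀ ρ : TraceClass ℕ, IsState ρ →
          Filter.Tendsto (fun n => traceNorm ((C n ρ).1 - (NG ρ).1)) Filter.atTop (nhds 0) := by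
  refine ⟨exists_isSymmetricConvolution hN, ?_⟩
  choose C₀ hC₀ using exists_isSymmetricConvolution hN
  obtain ⟨V, hVs, hV, h00⟩ := exists_vacuum_moments hN hc h₀
  obtain ⟨μ, ν, m01, m10, h01, h10⟩ := exists_offDiagonal hN h₀
  have hlim := fun α β z =>
    tendsto_charFun_convolution (tendsto_charFun_expVec hN (h00 z) (h01 z) (h10 z) α β) hC₀
  obtain ⟨NG, hNG, hconv⟩ := exists_limit_channel (fun n => (hC₀ n).isCPTP) hlim fun α β => by
    refine Continuous.continuousAt ?_
    simp only [phase_quadratic]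
    have := Complex.continuous_conj
    fun_prop
  -- `exp(αβ̄ - αw̄ + β̄w - ξᵀVξ/4)` is the characteristic function of the coherent dyad at
  -- `w = μz + νz̄`, multiplied by `exp(|w|²/2 - ξᵀVξ/4)`, and `|w|²/2 = ξᵀXXᵀξ/4`.
  set X := phaseMatrix μ ν
  have hχ : ∀ T z, charFun (NG T) z = charFun T (μ * z + ν * (starRingEnd ℂ) z) *
      Complex.exp (-(((phase z ⬝ᵥ (V - X * X.transpose).mulVec (phase z) : ℝ) : ℂ) / 4)) := by
    intro T z
    refine charFun_eq_of_expVec hNG (fun α β => ?_) T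
    rw [tendsto_nhds_unique (tendsto_charFun_of_traceNorm (hconv _) z) (hlim α β z),
      charFun_dyad_expVec, ← Complex.exp_add, Matrix.sub_mulVec, dotProduct_sub,
      Complex.ofReal_sub, sub_div, ← norm_sq_eq_phase]
    congr 1
    ring
  have hYs : (V - X * X.transpose).transpose = V - X * X.transpose := by
    rw [Matrix.transpose_sub, Matrix.transpose_mul, Matrix.transpose_transpose, hVs]
  refine ⟨NG, Real.sqrt 2 • X, X, V - X * X.transpose, V,
    isGaussianChannel_of_charFun (isCPTP_iff.1 hNG) hχ,
    hasChannelMatrices_of_charFun (isCPTP_iff.1 hNG) hYs (phase_eq_mulVec μ ν) hχ,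
    fun i => ?_, fun i => ?_, ?_, hV, rfl, fun C hC ρ _ => ?_⟩
  · rw [map_add]
    exact (hasMoment_quadrature_sum m01 m10 i).1
  · rw [map_add, map_smul, map_smul]
    exact (hasMoment_quadrature_sum m01 m10 i).2
  · rw [smul_smul, one_div, inv_mul_cancel₀ (by positivity), one_smul]
  · have e : ∀ n, C n = C₀ n := fun n => (hC n).unique (hC₀ n)
    simp only [e]
    exact hconv ρ
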